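/- **Setting.** Let $\mathbb T^3=\mathbb R^3/(2\pi\mathbb Z)^3$ with normalized Lebesgue measure, $\widehat f(n)=\int_{\mathbb T^3} f(x)e^{-in\cdot x}\,dx$, $\langle a\rangle=(1+|a|^2)^{1/2}$, $n_{12}=n_1+n_2$, $n_{123}=n_1+n_2+n_3$. The letters $N,N_1,N_2,N_3$ denote dyadic integers $1,2,4,\dots$. *Potential and truncations.* Let $0<\beta<1/2$ and let $V$ be a real, even potential on $\mathbb T^3$, smooth away from the origin, bounded below by a positive constant, with $V(x)=c_\beta|x|^{-(3-\beta)}$ for $0<|x|\le 1/10$ and some $c_\beta>0$. Let $\rho_N(n)=\rho(|n|/\langle N\rangle)$, where $\rho$ is smooth, non-increasing on $[0,\infty)$, equal to $1$ near $0$ and to $0$ for large arguments. Let $P_{\le N}$ be the Fourier multiplier with symbol $\rho_N$, let $\chi_1=\rho_1$, $\chi_N=\rho_N-\rho_{N/2}$ for $N\ge2$, and let $P_N$ be the multiplier with symbol $\chi_N$. *Norms.* $\|f\|_{\mathcal C^s_x}=\sup_N N^s\|P_Nf\|_{L^\infty_x}$, and $\mathcal C^s_x$ is the space of $f$ of finite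 norm with $N^s\|P_Nf\|_{L^\infty_x}\to0$; $C^0_t\mathcal C^s_x([0,T]\times\mathbb T^3)$ carries the supremum over $t\in[0,T]$ of this norm. With the space-time Fourier transform $\widehat u(\lambda,n)$, $$\|u\|_{X^{s,b}}=\big\|\langle n\rangle^s\langle|\lambda|-\langle n\rangle\rangle^b\,\widehat u(\lambda,n)\big\|_{L^2_\lambda\ell^2_n},\qquad \|u\|_{X^{s,b}(J)}=\inf\{\|v\|_{X^{s,b}}: v|_J=u\}.$$ *Random objects.* Let $W^{\cos},W^{\sin}$ be two independent real Gaussian free fields on $\mathbb T^3$ with covariance $(1-\Delta)^{-1}$, and let $z(t)=\cos(t\langle\nabla\rangle)W^{\cos}+\sin(t\langle\nabla\rangle)W^{\sin}$. Put $a_N=\sum_n\rho_N(n)^2\langle n\rangle^{-2}$, let $\mathcal M_N$ be the multiplier with symbol $\sum_k\widehat V(n+k)\rho_N(k)^2\langle k\rangle^{-2}$, and define $$\mathcal Z_N=P_{\le N}\Big[(V*(P_{\le N}z)^2)\,P_{\le N}z-a_N\widehat V(0)P_{\le N}z-2\mathcal M_NP_{\le N}z\Big],$$ $$\mathrm{Duh}[F](t)=\int_0^t\frac{\sin((t-t')\langle\nabla\rangle)}{\langle\nabla\rangle}F(t')\,dt'.$$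 For signs $\pm_1,\pm_2,\pm_3\in\{+,-\}$ and dyadic $N_1,N_2,N_3$, let $\widehat W^{\pm}=\widehat W^{\cos}\mp i\,\widehat W^{\sin}$, let $\mathcal I_3[\pm_j,n_j]$ be the triple stochastic integral, i.e. the Wick product of $\widehat W^{\pm_1}(n_1),\widehat W^{\pm_2}(n_2),\widehat W^{\pm_3}(n_3)$, and define the frequency-localized piece $$\mathcal Z_N[\pm_j,N_j](t,x)=\sum_{n_1,n_2,n_3\in\mathbb Z^3}\rho_N(n_{123})\Big(\prod_{j=1}^3\rho_N(n_j)\chi_{N_j}(n_j)\Big)\widehat V(n_{12})\,e^{in_{123}\cdot x}\Big(\prod_{j=1}^3e^{\pm_jit\langle n_j\rangle}\Big)\mathcal I_3[\pm_j,n_j].$$ **Proposition (cubic stochastic objects).** Let $0<\beta<1/2$ and $\eta>0$. Then for all sufficiently small $\eta'>0$ (depending on $\beta,\eta$) and all $b_+>1/2$ sufficiently close to $1/2$ (depending on $\beta,\eta,\eta'$), and for all $V$ and $\rho$ as above, there is a constant $C=C(\beta,\eta,\eta',b_+,V,\rho)$ such that for all $s<\beta-\eta$, $T\ge1$ and $p\ge1$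 the following hold. 1. $\displaystyle\Big\|\sup_N\|\mathcal Z_N\|_{X^{s-1,b_+-1}([0,T])}\Big\|_{L^p_\omega}\le C\,T^2p^{3/2}.$ 2. $\mathrm{Duh}[\mathcal Z_N]\in C^0_t\mathcal C^s_x([0,T]\times\mathbb T^3)$ for every $N$, and $\displaystyle\Big\|\sup_N\|\mathrm{Duh}[\mathcal Z_N]\|_{C^0_t\mathcal C^s_x([0,T]\times\mathbb T^3)}\Big\|_{L^p_\omega}\le C\,T^2p^{3/2}.$ 3. For every $\tau\ge0$, (2) holds, with the same $C$, for $\mathrm{Duh}[1_{[0,\tau]}\mathcal Z_N]$ in place of $\mathrm{Duh}[\mathcal Z_N]$. 4. For all signs $\pm_j$ and all dyadic $N_1,N_2,N_3$, the statements (1), (2), (3) hold with $\mathcal Z_N[\pm_j,N_j]$ in place of $\mathcal Z_N$ and with the bound $C\,T^2p^{3/2}\max(N_1,N_2,N_3)^{-\eta'}$. -/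

import Mathlib

open MeasureTheory ProbabilityTheory Filter Topology
open scoped ENNReal

noncomputable section

namespace CubicStochastic

/-! ### The torus `ℝ³ / (2πℤ)³`, through `2π`-periodic functions on `ℝ³` -/

/-- Frequencies `n ∈ ℤ³`. -/
abbrev Freq := Fin 3 → ℤ

/-- Points of `ℝ³`; functions on the torus are `2π`-periodic functions on `ℝ³`. -/
abbrev Pt := Fin 3 → ℝ

/-- Euclidean length. -/
def euclid (x : Pt) : ℝ := √(∑ i, x i ^ 2)

/-- Japanese bracket `⟨r⟩ = (1 + r²)^{1/2}` of a real number. -/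
def bracket (r : ℝ) : ℝ := √(1 + r ^ 2)

/-- Euclidean length of a frequency. -/
def freqLen (n : Freq) : ℝ := euclid (fun i => (n i : ℝ))

/-- `⟨n⟩ = (1 + |n|²)^{1/2}`, the symbol of `⟨∇⟩`. -/
def jap (n : Freq) : ℝ := bracket (freqLen n)

/-- The character `e^{i n·x}`. -/
def character (n : Freq) (x : Pt) : ℂ :=
  Complex.exp (Complex.I * ((∑ i, (n i : ℝ) * x i : ℝ) : ℂ))

/-- The fundamental domain `[-π, π]³`. -/
def cube : Set Pt := Set.Icc (fun _ => -Real.pi) (fun _ => Real.pi)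

/-- Integral over the torus with respect to normalized Lebesgue measure. -/
def torusMean (f : Pt → ℂ) : ℂ :=
  (((2 * Real.pi) ^ 3 : ℝ) : ℂ)⁻¹ * ∫ x in cube, f x

/-- Fourier coefficient `f̂(n) = ∫ f(x) e^{-i n·x} dx`. -/
def fourierCoef (f : Pt → ℂ) (n : Freq) : ℂ :=
  torusMean (fun x => f x * character (-n) x)

/-- The Fourier multiplier with symbol `m`. -/
def multiplier (m : Freq → ℂ) (f : Pt → ℂ) (x : Pt) : ℂ :=
  ∑' n, m n * fourierCoef f n * character n x

/-- Convolution on the torus. -/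
def torusConv (V : Pt → ℝ) (f : Pt → ℂ) (x : Pt) : ℂ :=
  torusMean (fun y => (V (x - y) : ℂ) * f y)

/-! ### Interaction potential and frequency truncations -/

/-- The lattice `(2πℤ)³`, that is, the origin of the torus. -/
def lattice : Set Pt := Set.range (fun (k : Freq) (i : Fin 3) => 2 * Real.pi * (k i : ℝ))

/-- The interaction potential: on the torus, equal to `c |x|^{-(3-β)}` for `|x| ≤ 1/10`, bounded
below by a positive constant, even, and smooth away from the origin. The value at the origin is
irrelevant. -/
structure IsInteractionPotential (β : ℝ) (V : Pt → ℝ) : Prop where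
  periodic : ∀ (x : Pt) (k : Freq), V (fun i => x i + 2 * Real.pi * (k i : ℝ)) = V x
  singular : ∃ c : ℝ, 0 < c ∧
    ∀ x, 0 < euclid x → euclid x ≤ 1 / 10 → V x = c * euclid x ^ (-(3 - β))
  lower : ∃ c : ℝ, 0 < c ∧ ∀ x, x ∉ lattice → c ≤ V x
  even : ∀ x, V (-x) = V x
  smooth : ContDiffOn ℝ (⊤ : ℕ∞) V latticeᶜ

/-- The Fourier coefficients of the potential. -/
def potentialHat (V : Pt → ℝ) (n : Freq) : ℂ := fourierCoef (fun x => (V x : ℂ)) n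

/-- The radial profile of the frequency truncations: smooth, non-increasing on `[0,∞)`, equal to
`1` near `0` and to `0` far away. -/
structure IsCutoffProfile (ρ : ℝ → ℝ) : Prop where
  smooth : ContDiff ℝ (⊤ : ℕ∞) ρ
  antitone : AntitoneOn ρ (Set.Ici 0)
  eq_one : ∃ r : ℝ, 0 < r ∧ ∀ y, 0 ≤ y → y ≤ r → ρ y = 1
  eq_zero : ∃ R : ℝ, ∀ y, R ≤ y → ρ y = 0

/-- `ρ_N(n) = ρ(|n| / ⟨N⟩)`, the symbol of `P_{≤N}`. -/
def trunc (ρ : ℝ → ℝ) (N : ℝ) (n : Freq) : ℝ := ρ (freqLen n / bracket N)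

/-- The dyadic number `2^k`. -/
def dyad (k : ℕ) : ℝ := 2 ^ k

/-- The symbol `χ_N` of the Littlewood-Paley operator `P_N`, for `N = 2^k`:
`χ_1 = ρ_1` and `χ_N = ρ_N - ρ_{N/2}` for `N ≥ 2`. -/
def lpSymbol (ρ : ℝ → ℝ) : ℕ → Freq → ℝ
  | 0, n => trunc ρ (dyad 0) n
  | k + 1, n => trunc ρ (dyad (k + 1)) n - trunc ρ (dyad k) n

/-! ### Function spaces -/

/-- `N^s ‖P_N f‖_{L^∞}` for `N = 2^k`. Here `P_N f` is a trigonometric polynomial, so that the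
essential supremum is a supremum. -/
def csPiece (ρ : ℝ → ℝ) (s : ℝ) (f : Pt → ℂ) (k : ℕ) : ℝ≥0∞ :=
  ENNReal.ofReal (dyad k ^ s) * ⨆ x, ‖multiplier (fun n => (lpSymbol ρ k n : ℂ)) f x‖ₑ

/-- The norm of `𝒞_x^s`. -/
def csNorm (ρ : ℝ → ℝ) (s : ℝ) (f : Pt → ℂ) : ℝ≥0∞ := ⨆ k : ℕ, csPiece ρ s f k

/-- The norm of `C_t^0 𝒞_x^s([0,T] × 𝕋³)`. -/
def ctcsNorm (ρ : ℝ → ℝ) (s T : ℝ) (u : ℝ → Pt → ℂ) : ℝ≥0∞ :=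
  ⨆ t ∈ Set.Icc (0 : ℝ) T, csNorm ρ s (u t)

/-- Membership in `C_t^0 𝒞_x^s([0,T] × 𝕋³)`: all time slices lie in `𝒞_x^s` (finite norm and
`N^s ‖P_N f‖_{L^∞} → 0`) and depend continuously on time. -/
structure MemCtCs (ρ : ℝ → ℝ) (s T : ℝ) (u : ℝ → Pt → ℂ) : Prop where
  finite : ∀ t ∈ Set.Icc (0 : ℝ) T, csNorm ρ s (u t) < ⊤
  vanish : ∀ t ∈ Set.Icc (0 : ℝ) T, Tendsto (csPiece ρ s (u t)) atTop (𝓝 0)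
  continuous : ∀ t₀ ∈ Set.Icc (0 : ℝ) T,
    Tendsto (fun t => csNorm ρ s (fun x => u t x - u t₀ x)) (𝓝[Set.Icc 0 T] t₀) (𝓝 0)

/-- The `X^{s,b}`-norm of the space-time distribution whose space-time Fourier transform is
`w n lam` (space frequency `n`, angular time frequency `lam`):
`‖⟨n⟩^s ⟨|lam| - ⟨n⟩⟩^b w‖_{L²_lam ℓ²_n}`. -/
def xsbNorm (s b : ℝ) (w : Freq → ℝ → ℂ) : ℝ≥0∞ :=
  (∑' n, ∫⁻ lam : ℝ,
    ENNReal.ofReal (jap n ^ (2 * s) * bracket (|lam| - jap n) ^ (2 * b)) * ‖w n lam‖ₑ ^ 2)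
      ^ (1 / 2 : ℝ)

/-- `(2π)^{-1} ∫ ψ(t) e^{i lam t} dt`. -/
def invFourierTime (ψ : ℝ → ℂ) (lam : ℝ) : ℂ :=
  (((2 * Real.pi : ℝ)) : ℂ)⁻¹ * ∫ t : ℝ, ψ t * Complex.exp (Complex.I * ((lam * t : ℝ) : ℂ))

/-- The space-time distribution with space-time Fourier transform
`w n lam = ∫ e^{-i lam t} v̂(t,n) dt` agrees with the function `u` on the interior of `J`: for every
`n`, the two distributions in time agree on all test functions supported there. -/
def ExtendsFrom (J : Set ℝ) (u : ℝ → Pt → ℂ) (w : Freq → ℝ → ℂ) : Prop :=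
  ∀ (n : Freq) (ψ : ℝ → ℂ), ContDiff ℝ (⊤ : ℕ∞) ψ → HasCompactSupport ψ → tsupport ψ ⊆ interior J →
    ∫ t : ℝ, ψ t * fourierCoef (u t) n = ∫ lam : ℝ, w n lam * invFourierTime ψ lam

/-- The restricted norm `‖u‖_{X^{s,b}(J)} = inf {‖v‖_{X^{s,b}} : v|_J = u}`. -/
def xsbRestrict (J : Set ℝ) (s b : ℝ) (u : ℝ → Pt → ℂ) : ℝ≥0∞ :=
  ⨅ (w : Freq → ℝ → ℂ) (_ : ∀ n, Measurable (w n)) (_ : ExtendsFrom J u w), xsbNorm s b w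

/-- The Duhamel integral `∫_0^t ⟨∇⟩⁻¹ sin((t - t')⟨∇⟩) F(t') dt'`. -/
def duhamel (F : ℝ → Pt → ℂ) (t : ℝ) (x : Pt) : ℂ :=
  ∫ t' in (0 : ℝ)..t,
    multiplier (fun n => ((Real.sin ((t - t') * jap n) / jap n : ℝ) : ℂ)) (F t') x

/-- `1_{[0,τ]}(t) F(t,x)`. -/
def timeCut (τ : ℝ) (F : ℝ → Pt → ℂ) (t : ℝ) (x : Pt) : ℂ :=
  (Set.Icc (0 : ℝ) τ).indicator (fun t' => F t' x) t

/-! ### Moments -/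

/-- The `L^p`-norm of a `[0,∞]`-valued function on a probability space, defined through measurable
majorants so that it makes sense without measurability; for measurable functions it is the usual
norm, by `lpOmega_eq`. -/
def lpOmega {Ω : Type*} [MeasurableSpace Ω] (P : Measure Ω) (p : ℝ) (X : Ω → ℝ≥0∞) : ℝ≥0∞ :=
  ⨅ (Y : Ω → ℝ≥0∞) (_ : Measurable Y) (_ : ∀ᵐ ω ∂P, X ω ≤ Y ω), (∫⁻ ω, Y ω ^ p ∂P) ^ (1 / p)

theorem lpOmega_eq {Ω : Type*} [MeasurableSpace Ω] (P : Measure Ω) {p : ℝ} (hp : 0 < p)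
    {X : Ω → ℝ≥0∞} (hX : AEMeasurable X P) :
    lpOmega P p X = (∫⁻ ω, X ω ^ p ∂P) ^ (1 / p) := by
  apply le_antisymm
  · refine (iInf₂_le (hX.mk X) hX.measurable_mk).trans
      ((iInf_le _ (hX.ae_eq_mk.mono fun ω h => h.le)).trans (le_of_eq ?_))
    congr 1
    exact lintegral_congr_ae (hX.ae_eq_mk.mono fun ω h => by simp only [h])
  · refine le_iInf fun Y => le_iInf fun _ => le_iInf fun h => ?_
    refine ENNReal.rpow_le_rpow (lintegral_mono_ae (h.mono fun ω hω => ?_)) (by positivity)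
    exact ENNReal.rpow_le_rpow hω hp.le

/-! ### Gaussian data and the cubic stochastic objects -/

section Random

variable {Ω : Type*} [MeasurableSpace Ω]

/-- `W 0 n = Ŵ^{cos}(n)` and `W 1 n = Ŵ^{sin}(n)` are the Fourier coefficients of two independent
Gaussian free fields with covariance `(1 - Δ)⁻¹`: `W i (-n)` is the complex conjugate of `W i n`;
`W i 0` is a standard real Gaussian; for `n ≠ 0`, `⟨n⟩ W i n` is a standard complex Gaussian (real
and imaginary part independent with variance `1/2`); and the variables are independent, up to the
conjugation symmetry. The Gaussian initial data is `(W^{cos}, ⟨∇⟩ W^{sin})`. -/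
structure IsGaussianData (P : Measure Ω) (W : Fin 2 → Freq → Ω → ℂ) : Prop where
  measurable : ∀ i n, Measurable (W i n)
  conj : ∀ i n, ∀ᵐ ω ∂P, W i (-n) ω = star (W i n ω)
  law_zero : ∀ i, P.map (W i 0) = (gaussianReal 0 1).map (fun a : ℝ => (a : ℂ))
  law : ∀ i n, n ≠ 0 → P.map (W i n) =
    ((gaussianReal 0 (1 / (2 * jap n ^ 2)).toNNReal).prod
      (gaussianReal 0 (1 / (2 * jap n ^ 2)).toNNReal)).map
        (fun q : ℝ × ℝ => (q.1 : ℂ) + Complex.I * (q.2 : ℂ))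
  indep : ∀ S : Set Freq, (∀ n ∈ S, -n ∈ S → n = 0) →
    iIndepFun (fun (q : Fin 2 × S) => W q.1 q.2) P

/-- Fourier coefficients `cos(t⟨n⟩) Ŵ^{cos}(n) + sin(t⟨n⟩) Ŵ^{sin}(n)` of the linear evolution of
the Gaussian data. -/
def linCoef (W : Fin 2 → Freq → Ω → ℂ) (t : ℝ) (n : Freq) (ω : Ω) : ℂ :=
  (Real.cos (t * jap n) : ℂ) * W 0 n ω + (Real.sin (t * jap n) : ℂ) * W 1 n ω

/-- The truncation `P_{≤N}` of the linear evolution. -/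
def truncLin (ρ : ℝ → ℝ) (W : Fin 2 → Freq → Ω → ℂ) (N : ℝ) (ω : Ω) (t : ℝ) (x : Pt) : ℂ :=
  ∑' n, (trunc ρ N n : ℂ) * linCoef W t n ω * character n x

/-- `a_N = ∑_n ρ_N(n)² / ⟨n⟩²`. -/
def aConst (ρ : ℝ → ℝ) (N : ℝ) : ℝ := ∑' n : Freq, trunc ρ N n ^ 2 / jap n ^ 2

/-- The symbol `∑_k V̂(n+k) ρ_N(k)² / ⟨k⟩²` of the renormalization multiplier `𝓜_N`. -/
def renormSymbol (V : Pt → ℝ) (ρ : ℝ → ℝ) (N : ℝ) (n : Freq) : ℂ :=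
  ∑' k : Freq, potentialHat V (n + k) / ((jap k ^ 2 : ℝ) : ℂ) * ((trunc ρ N k ^ 2 : ℝ) : ℂ)

/-- The renormalized nonlinearity `:(V * f²) f: = (V * f²) f - a_N V̂(0) f - 2 𝓜_N f`, to be
applied to `f = P_{≤N} u`. -/
def wickCubic (V : Pt → ℝ) (ρ : ℝ → ℝ) (N : ℝ) (f : Pt → ℂ) (x : Pt) : ℂ :=
  torusConv V (fun y => f y ^ 2) x * f x - (aConst ρ N : ℂ) * potentialHat V 0 * f x
    - 2 * multiplier (renormSymbol V ρ N) f x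

/-- The renormalized cubic nonlinearity `P_{≤N} :(V * (P_{≤N} z)²) P_{≤N} z:` of the linear
evolution `z` of the Gaussian data. -/
def cubic (V : Pt → ℝ) (ρ : ℝ → ℝ) (W : Fin 2 → Freq → Ω → ℂ) (N : ℝ) (ω : Ω)
    (t : ℝ) (x : Pt) : ℂ :=
  multiplier (fun n => (trunc ρ N n : ℂ)) (wickCubic V ρ N (truncLin ρ W N ω t)) x

/-- Coefficients of the half-wave components: the linear evolution has Fourier coefficients
`1/2 ∑_± e^{± i t ⟨n⟩} Ŵ^±(n)` with `Ŵ^± = Ŵ^{cos} ∓ i Ŵ^{sin}`. -/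
def halfWave (W : Fin 2 → Freq → Ω → ℂ) (ε : ℤˣ) (n : Freq) (ω : Ω) : ℂ :=
  W 0 n ω - ((ε : ℤ) : ℂ) * Complex.I * W 1 n ω

/-- The Wick product `:X Y Z:` of centred jointly Gaussian variables. -/
def wickTriple (P : Measure Ω) (X Y Z : Ω → ℂ) (ω : Ω) : ℂ :=
  X ω * Y ω * Z ω - (∫ ω', X ω' * Y ω' ∂P) * Z ω - (∫ ω', X ω' * Z ω' ∂P) * Y ω
    - (∫ ω', Y ω' * Z ω' ∂P) * X ω

/-- The triple stochastic integral `𝓘₃[±_j, n_j]`. Its integrand does not depend on the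
stochastic times, so that it is the Wick product of the terminal values `Ŵ^{±_j}(n_j)`. -/
def tripleIntegral (P : Measure Ω) (W : Fin 2 → Freq → Ω → ℂ) (ε : Fin 3 → ℤˣ)
    (m : Fin 3 → Freq) (ω : Ω) : ℂ :=
  wickTriple P (halfWave W (ε 0) (m 0)) (halfWave W (ε 1) (m 1)) (halfWave W (ε 2) (m 2)) ω

/-- The frequency-localized cubic nonlinearity with signs `±_j = ε j` and frequency scales
`N_j = 2^(k j)`. The sum runs over `(n₁, n₂, n₃) = (m 0, m 1, m 2)`. -/
def cubicBlock (V : Pt → ℝ) (ρ : ℝ → ℝ) (P : Measure Ω) (W : Fin 2 → Freq → Ω → ℂ)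
    (ε : Fin 3 → ℤˣ) (k : Fin 3 → ℕ) (N : ℝ) (ω : Ω) (t : ℝ) (x : Pt) : ℂ :=
  ∑' m : Fin 3 → Freq,
    (trunc ρ N (m 0 + m 1 + m 2) : ℂ)
      * (∏ j, (trunc ρ N (m j) : ℂ) * (lpSymbol ρ (k j) (m j) : ℂ))
      * potentialHat V (m 0 + m 1)
      * character (m 0 + m 1 + m 2) x
      * (∏ j, Complex.exp (((ε j : ℤ) : ℂ) * Complex.I * ((t * jap (m j) : ℝ) : ℂ)))
      * tripleIntegral P W ε m ω

/-- The maximal frequency scale `max(N₁, N₂, N₃)` for `N_j = 2^(k j)`. -/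
def maxScale (k : Fin 3 → ℕ) : ℝ := max (dyad (k 0)) (max (dyad (k 1)) (dyad (k 2)))

end Random

end CubicStochastic

end

open CubicStochastic

noncomputable section

namespace CubicStochastic

/-! ### Japanese brackets -/

/-! In Fourier variables the nonlinearity is a random sum over triples (n₁,n₂,n₃): a coefficient,
times the Wick product of three Gaussians, times the plane wave e^{iφt}e^{i n₁₂₃·x} with phase φ = Σ
±⟨n_j⟩. Both norms detect the modulation ±⟨n₁₂₃⟩ + φ. The time transform of 1_{[0,T]}e^{iφt} is
concentrated near φ, so the weight of X^{s-1,b-1} contributes ⟨±⟨n₁₂₃⟩+φ⟩^{-(2-2b)} to the squared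
norm (`lintegral_weight_oscInt_le`). The Duhamel integral of such a wave has size
⟨n₁₂₃⟩^{-1}⟨±⟨n₁₂₃⟩+φ⟩^{-1} (`norm_duhCoef_sq_le`). By Gaussian orthogonality both second moments
are controlled by the energy Σ |V̂(n₁₂)|² ∏⟨n_j⟩^{-2} ⟨n₁₂₃⟩^{2s-2} ⟨±⟨n₁₂₃⟩+φ⟩^{-δ} with δ slightly
below 1 (`coefEnergy`).

Deterministic core (`block_coef_sum`). One has |V̂(n)| ≲ ⟨n⟩^{-κ} for every κ < β
(`norm_potentialHat_le`). For fixed a = n₁₂, the number of n with ⟨n⟩ and ⟨n+a⟩ in unit windows at r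
and ρ is ≲ rρ/|a|, because the difference of the two squared lengths is affine in n
(`card_two_shells`). If the modulation exponent exceeds 1, the sum over one of the two window
positions costs a constant, and the sum over n₃ follows (`dispersive_sum`). The powers of ⟨n₁⟩,
⟨n₂⟩, ⟨n₁₂⟩ that remain have total exponent above 6 and sum up (`cubic_sum`). Giving away a small
power of ∏⟨n_j⟩ raises the modulation exponent from below 1 to above 1 and leaves a negative power
of the largest scale M.

Moments (`moment_bound`). No hypercontractivity is used. A Wick product at x is, up to sign, the
average over y of a product of factors evaluated at x + y and y - x. By rotation invariance this
pair has the law of √2 times an independent pair, so Jensen's inequality decouples the chaos, and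
three successive Gaussian moment bounds each cost a factor q in the square. This is the origin of
p^{3/2}. Minkowski's integral inequality carries the bound to the X^{s,b} norm.

Suprema. A block with fixed scales stops depending on N once N is much larger than M, so only
boundedly many times M truncations occur. The supremum over (t,x) is replaced by a maximum over a
grid of polynomial size in M. A maximum of M^{30} variables costs M^{30/q} in the moment bound for
the square, which the decay in M absorbs when q is large; small p are reached by monotonicity of L^p
norms. Finally 𝒵_N is a finite sum of blocks, and the block bounds are summable over all dyadic
scales (`exists_block_majorants`, `exists_tsum_maxScale_le`). -/

theorem one_le_bracket (x : ℝ) : 1 ≤ bracket x := by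
  rw [bracket, Real.one_le_sqrt]; nlinarith [sq_nonneg x]

theorem bracket_pos (x : ℝ) : 0 < bracket x := lt_of_lt_of_le one_pos (one_le_bracket x)

theorem bracket_sq (x : ℝ) : bracket x ^ 2 = 1 + x ^ 2 := Real.sq_sqrt (by positivity)

theorem abs_le_bracket (x : ℝ) : |x| ≤ bracket x := by
  rw [bracket]; apply Real.le_sqrt_of_sq_le; rw [sq_abs]; linarith

theorem bracket_le_one_add_abs (x : ℝ) : bracket x ≤ 1 + |x| := by
  rw [bracket, Real.sqrt_le_left (by positivity)]; nlinarith [abs_nonneg x, sq_abs x]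

theorem bracket_neg (x : ℝ) : bracket (-x) = bracket x := by simp [bracket]

theorem bracket_mono {x y : ℝ} (h : |x| ≤ |y|) : bracket x ≤ bracket y := by
  rw [bracket, bracket]; apply Real.sqrt_le_sqrt; have := sq_le_sq.2 h; linarith

theorem bracket_add_le (x y : ℝ) : bracket (x + y) ≤ 2 * (bracket x * bracket y) := by
  have hx := one_le_bracket x
  have hy := one_le_bracket y
  have h1 := bracket_sq x
  have h2 := bracket_sq y
  have h3 := bracket_sq (x + y)
  refine (pow_le_pow_iff_left₀ (bracket_pos _).le (by positivity) two_ne_zero).1 ?_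
  rw [h3, mul_pow, mul_pow, h1, h2]
  nlinarith [sq_nonneg (x - y), sq_nonneg (x * y)]

theorem continuous_bracket : Continuous bracket := by unfold bracket; fun_prop

/-- Peetre's inequality. -/
theorem bracket_rpow_neg_le {a : ℝ} (ha : 0 ≤ a) (x y : ℝ) :
    bracket (x + y) ^ (-a) ≤ 2 ^ a * bracket x ^ (-a) * bracket y ^ a := by
  have hx := bracket_pos x
  have hy := bracket_pos y
  have hxy := bracket_pos (x + y)
  have h : bracket x ≤ 2 * (bracket (x + y) * bracket y) := by
    have := bracket_add_le (x + y) (-y)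
    rwa [bracket_neg, add_neg_cancel_right] at this
  have h2 := Real.rpow_le_rpow hx.le h ha
  rw [Real.mul_rpow (by norm_num) (by positivity), Real.mul_rpow hxy.le hy.le] at h2
  have e1 : bracket (x + y) ^ (-a) * bracket (x + y) ^ a = 1 := by
    rw [← Real.rpow_add hxy]; simp
  have e2 : bracket x ^ (-a) * bracket x ^ a = 1 := by
    rw [← Real.rpow_add hx]; simp
  have p1 : 0 < bracket (x + y) ^ (-a) := by positivity
  have p2 : 0 < bracket x ^ (-a) := by positivity
  calc bracket (x + y) ^ (-a) = bracket (x + y) ^ (-a) * (bracket x ^ (-a) * bracket x ^ a) := by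
        rw [e2, mul_one]
    _ ≤ bracket (x + y) ^ (-a) * (bracket x ^ (-a) *
          (2 ^ a * (bracket (x + y) ^ a * bracket y ^ a))) := by gcongr
    _ = (bracket (x + y) ^ (-a) * bracket (x + y) ^ a) * (2 ^ a * bracket x ^ (-a) * bracket y ^ a)
        := by ring
    _ = _ := by rw [e1, one_mul]

/-- A frequency as a point of Euclidean space. -/
def toE (n : Freq) : EuclideanSpace ℝ (Fin 3) := WithLp.toLp 2 (fun i => (n i : ℝ))

theorem freqLen_eq_norm (n : Freq) : freqLen n = ‖toE n‖ := by
  simp [freqLen, euclid, toE, EuclideanSpace.norm_eq]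

theorem toE_add (n k : Freq) : toE (n + k) = toE n + toE k := by
  ext i; simp [toE]

theorem toE_neg (n : Freq) : toE (-n) = -toE n := by
  ext i; simp [toE]

theorem freqLen_nonneg (n : Freq) : 0 ≤ freqLen n := Real.sqrt_nonneg _

theorem freqLen_add_le (n k : Freq) : freqLen (n + k) ≤ freqLen n + freqLen k := by
  simp only [freqLen_eq_norm, toE_add]; exact norm_add_le _ _

theorem freqLen_neg (n : Freq) : freqLen (-n) = freqLen n := by
  simp only [freqLen_eq_norm, toE_neg, norm_neg]

theorem freqLen_zero : freqLen 0 = 0 := by simp [freqLen, euclid]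

theorem abs_coord_le_freqLen (n : Freq) (i : Fin 3) : |(n i : ℝ)| ≤ freqLen n := by
  rw [freqLen_eq_norm]; exact PiLp.norm_apply_le (toE n) i

theorem one_le_freqLen {n : Freq} (hn : n ≠ 0) : 1 ≤ freqLen n := by
  obtain ⟨i, hi⟩ := Function.ne_iff.1 hn
  have h1 : (1 : ℝ) ≤ |(n i : ℝ)| := by
    have : 1 ≤ |n i| := Int.one_le_abs hi
    exact_mod_cast this
  exact h1.trans (abs_coord_le_freqLen n i)

theorem one_le_jap (n : Freq) : 1 ≤ jap n := one_le_bracket _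

theorem jap_pos (n : Freq) : 0 < jap n := bracket_pos _

theorem jap_neg (n : Freq) : jap (-n) = jap n := by simp [jap, freqLen_neg]

theorem freqLen_le_jap (n : Freq) : freqLen n ≤ jap n :=
  (le_abs_self _).trans (abs_le_bracket _)

theorem jap_le_one_add (n : Freq) : jap n ≤ 1 + freqLen n := by
  have := bracket_le_one_add_abs (freqLen n)
  rwa [abs_of_nonneg (freqLen_nonneg n)] at this

theorem jap_le_two_mul {n : Freq} (hn : n ≠ 0) : jap n ≤ 2 * freqLen n := by
  linarith [jap_le_one_add n, one_le_freqLen hn]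

/-! ### Sums over lattices -/

theorem tsum_fin_three {α : Type*} (F : (Fin 3 → α) → ℝ≥0∞) :
    ∑' m, F m = ∑' a, ∑' b, ∑' c, F ![a, b, c] := by
  let e' : α × α × α ≃ (Fin 3 → α) :=
    { invFun := fun m => (m 0, m 1, m 2)
      toFun := fun p => ![p.1, p.2.1, p.2.2]
      right_inv := fun m => by ext i; fin_cases i <;> rfl
      left_inv := fun p => rfl }
  rw [← e'.tsum_eq F, ENNReal.tsum_prod']
  congr 1; funext a
  rw [ENNReal.tsum_prod']
  rfl

theorem summable_bracket_int {a : ℝ} (ha : 1 < a) :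
    Summable (fun k : ℤ => bracket (k : ℝ) ^ (-a)) := by
  have h := Real.summable_abs_int_rpow ha
  have h2 : Summable (fun k : ℤ => if k = 0 then (1 : ℝ) else 0) :=
    (hasSum_ite_eq (0 : ℤ) (1 : ℝ)).summable
  refine Summable.of_nonneg_of_le (fun k => by have := bracket_pos (k : ℝ); positivity)
    (fun k => ?_) (h.add h2)
  by_cases hk : k = 0
  · subst hk
    have : bracket ((0 : ℤ) : ℝ) = 1 := by simp [bracket]
    rw [this]; simp only [Real.one_rpow, if_true]
    have : 0 ≤ |(((0 : ℤ)) : ℝ)| ^ (-a) := by positivity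
    linarith
  · simp only [hk, if_false, add_zero]
    exact Real.rpow_le_rpow_of_nonpos (by positivity) (abs_le_bracket _) (by linarith)

theorem tsum_bracket_int_lt_top {a : ℝ} (ha : 1 < a) :
    ∑' k : ℤ, ENNReal.ofReal (bracket (k : ℝ) ^ (-a)) < ⊤ :=
  (summable_bracket_int ha).tsum_ofReal_lt_top

/-- Uniformity in the shift: the integer part of x only relabels the sum, and the fractional part
costs a constant by Peetre's inequality. -/
theorem tsum_bracket_int_shift {a : ℝ} (ha : 1 < a) :
    ∃ C : ℝ≥0∞, C < ⊤ ∧ ∀ x : ℝ, ∑' k : ℤ, ENNReal.ofReal (bracket (k + x) ^ (-a)) ≤ C := by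
  refine ⟨ENNReal.ofReal (2 ^ a * 2 ^ a) * ∑' k : ℤ, ENNReal.ofReal (bracket (k : ℝ) ^ (-a)),
    ENNReal.mul_lt_top (by simp) (tsum_bracket_int_lt_top ha), fun x => ?_⟩
  have key : ∀ k : ℤ, ENNReal.ofReal (bracket (k + x) ^ (-a)) ≤
      ENNReal.ofReal (2 ^ a * 2 ^ a) *
        ENNReal.ofReal (bracket (((k + ⌊x⌋ : ℤ)) : ℝ) ^ (-a)) := by
    intro k
    rw [← ENNReal.ofReal_mul (by positivity)]
    apply ENNReal.ofReal_le_ofReal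
    have h := bracket_rpow_neg_le (a := a) (by linarith) (((k + ⌊x⌋ : ℤ)) : ℝ) (Int.fract x)
    have e : (((k + ⌊x⌋ : ℤ)) : ℝ) + Int.fract x = k + x := by
      push_cast; rw [add_assoc, Int.floor_add_fract]
    rw [e] at h
    have hb : bracket (Int.fract x) ≤ 2 := by
      have := bracket_le_one_add_abs (Int.fract x)
      rw [abs_of_nonneg (Int.fract_nonneg x)] at this
      linarith [Int.fract_lt_one x]
    have hp : 0 < bracket (((k + ⌊x⌋ : ℤ)) : ℝ) ^ (-a) := by
      have := bracket_pos (((k + ⌊x⌋ : ℤ)) : ℝ); positivity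
    have hb2 : bracket (Int.fract x) ^ a ≤ 2 ^ a :=
      Real.rpow_le_rpow (bracket_pos _).le hb (by linarith)
    calc _ ≤ _ := h
      _ ≤ 2 ^ a * bracket (((k + ⌊x⌋ : ℤ)) : ℝ) ^ (-a) * 2 ^ a := by gcongr
      _ = _ := by ring
  calc _ ≤ ∑' k : ℤ, ENNReal.ofReal (2 ^ a * 2 ^ a) *
        ENNReal.ofReal (bracket (((k + ⌊x⌋ : ℤ)) : ℝ) ^ (-a)) := ENNReal.tsum_le_tsum key
    _ = _ := by
      rw [ENNReal.tsum_mul_left]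
      congr 1
      exact (Equiv.addRight ⌊x⌋).tsum_eq (fun k : ℤ => ENNReal.ofReal (bracket (k : ℝ) ^ (-a)))

/-- ⟨n⟩ dominates the bracket of each coordinate, so the sum factors into three one-dimensional sums
with exponent a/3 > 1. -/
theorem tsum_jap_lt_top {a : ℝ} (ha : 3 < a) :
    ∑' n : Freq, ENNReal.ofReal (jap n ^ (-a)) < ⊤ := by
  have h3 : 1 < a / 3 := by linarith
  have hle : ∀ n : Freq, ENNReal.ofReal (jap n ^ (-a)) ≤
      ENNReal.ofReal (bracket (n 0 : ℝ) ^ (-(a / 3))) *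
      (ENNReal.ofReal (bracket (n 1 : ℝ) ^ (-(a / 3))) *
       ENNReal.ofReal (bracket (n 2 : ℝ) ^ (-(a / 3)))) := by
    intro n
    have hb : ∀ i, bracket (n i : ℝ) ≤ jap n := fun i => by
      apply bracket_mono
      rw [abs_of_nonneg (freqLen_nonneg n)]
      exact abs_coord_le_freqLen n i
    have hi : ∀ i, jap n ^ (-(a / 3)) ≤ bracket (n i : ℝ) ^ (-(a / 3)) := fun i =>
      Real.rpow_le_rpow_of_nonpos (bracket_pos _) (hb i) (by linarith)
    have hpos : ∀ i, 0 ≤ bracket (n i : ℝ) ^ (-(a / 3)) := fun i => by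
      have := bracket_pos (n i : ℝ); positivity
    rw [← ENNReal.ofReal_mul (hpos 1), ← ENNReal.ofReal_mul (hpos 0)]
    apply ENNReal.ofReal_le_ofReal
    have e : jap n ^ (-a) = jap n ^ (-(a / 3)) * (jap n ^ (-(a / 3)) * jap n ^ (-(a / 3))) := by
      rw [← Real.rpow_add (jap_pos n), ← Real.rpow_add (jap_pos n)]; ring_nf
    rw [e]
    have hj : 0 ≤ jap n ^ (-(a / 3)) := by have := jap_pos n; positivity
    exact mul_le_mul (hi 0) (mul_le_mul (hi 1) (hi 2) hj (hpos 1)) (by positivity) (hpos 0)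
  refine lt_of_le_of_lt (ENNReal.tsum_le_tsum hle) ?_
  rw [tsum_fin_three]
  simp only [Matrix.cons_val_zero, Matrix.cons_val_one, Matrix.cons_val]
  simp_rw [ENNReal.tsum_mul_left, ENNReal.tsum_mul_right]
  have := tsum_bracket_int_lt_top h3
  exact ENNReal.mul_lt_top this (ENNReal.mul_lt_top this this)

/-! ### Lattice points in the intersection of two shells -/

/-- The area of a planar annulus depends only on the difference of the squared radii. This is why
the shell counts below do not deteriorate with the position of a slice. -/
theorem volume_annulus_le (A L : ℝ) (hL : 0 ≤ L) :
    volume {v : EuclideanSpace ℝ (Fin 2) | A ≤ ‖v‖ ^ 2 ∧ ‖v‖ ^ 2 ≤ A + L} ≤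
      ENNReal.ofReal (Real.pi * L) := by
  have hball : ∀ R : ℝ, 0 ≤ R → volume (Metric.ball (0 : EuclideanSpace ℝ (Fin 2)) (√R)) =
      ENNReal.ofReal (Real.pi * R) := fun R hR => by
    rw [EuclideanSpace.volume_ball_fin_two, ← ENNReal.ofReal_pow (Real.sqrt_nonneg _),
      Real.sq_sqrt hR, ← ENNReal.ofReal_mul hR, mul_comm]
  have hcball : ∀ R : ℝ, 0 ≤ R → volume (Metric.closedBall (0 : EuclideanSpace ℝ (Fin 2)) (√R)) =
      ENNReal.ofReal (Real.pi * R) := fun R hR => by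
    rw [Measure.addHaar_closedBall_eq_addHaar_ball, hball R hR]
  have hsub : ∀ v : EuclideanSpace ℝ (Fin 2), ‖v‖ ^ 2 ≤ A + L → 0 ≤ A + L := fun v hv =>
    (sq_nonneg _).trans hv
  by_cases hAL : 0 ≤ A + L
  swap
  · have : {v : EuclideanSpace ℝ (Fin 2) | A ≤ ‖v‖ ^ 2 ∧ ‖v‖ ^ 2 ≤ A + L} = ∅ := by
      ext v; simp only [Set.mem_ofPred_eq, Set.mem_empty_iff_false, iff_false]
      exact fun h => hAL (hsub v h.2)
    simp [this]
  have h1 : {v : EuclideanSpace ℝ (Fin 2) | A ≤ ‖v‖ ^ 2 ∧ ‖v‖ ^ 2 ≤ A + L} ⊆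
      Metric.closedBall 0 (√(A + L)) := fun v hv => by
    rw [mem_closedBall_zero_iff]; exact Real.le_sqrt_of_sq_le hv.2
  by_cases hA : A ≤ 0
  · refine (measure_mono h1).trans ?_
    rw [hcball _ hAL]
    exact ENNReal.ofReal_le_ofReal (by nlinarith [Real.pi_pos])
  push Not at hA
  have h2 : {v : EuclideanSpace ℝ (Fin 2) | A ≤ ‖v‖ ^ 2 ∧ ‖v‖ ^ 2 ≤ A + L} ⊆
      Metric.closedBall 0 (√(A + L)) \ Metric.ball 0 (√A) := fun v hv => by
    refine ⟨h1 hv, ?_⟩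
    rw [mem_ball_zero_iff, not_lt]
    exact Real.sqrt_le_left (norm_nonneg _) |>.2 hv.1
  refine (measure_mono h2).trans ?_
  rw [measure_sdiff (Metric.ball_subset_closedBall.trans
      (Metric.closedBall_subset_closedBall (Real.sqrt_le_sqrt (by linarith))))
      measurableSet_ball.nullMeasurableSet (by rw [hball _ hA.le]; simp), hcball _ hAL,
    hball _ hA.le, ← ENNReal.ofReal_sub _ (by positivity)]
  exact ENNReal.ofReal_le_ofReal (by linarith)

/-- Archimedes' principle: the slice of the shell by the plane x₀ = u is an annulus whose squared
radii still differ by L, so every slice has area at most πL whatever u is. The slab contributes its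
thickness h. -/
theorem volume_shell_slab_coord (c h α L : ℝ) (hL : 0 ≤ L) :
    volume {x : EuclideanSpace ℝ (Fin 3) | (c ≤ x 0 ∧ x 0 ≤ c + h) ∧
      α ≤ ‖x‖ ^ 2 ∧ ‖x‖ ^ 2 ≤ α + L} ≤ ENNReal.ofReal h * ENNReal.ofReal (Real.pi * L) := by
  set S : Set (EuclideanSpace ℝ (Fin 3)) := {x | (c ≤ x 0 ∧ x 0 ≤ c + h) ∧
      α ≤ ‖x‖ ^ 2 ∧ ‖x‖ ^ 2 ≤ α + L} with hS
  have hSm : MeasurableSet S := by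
    apply IsClosed.measurableSet
    have hc : Continuous fun x : EuclideanSpace ℝ (Fin 3) => x 0 := by fun_prop
    have hn : Continuous fun x : EuclideanSpace ℝ (Fin 3) => ‖x‖ ^ 2 := by fun_prop
    exact ((isClosed_le continuous_const hc).inter (isClosed_le hc continuous_const)).inter
      ((isClosed_le continuous_const hn).inter (isClosed_le hn continuous_const))
  have e1 := (EuclideanSpace.volume_preserving_symm_measurableEquiv_toLp (Fin 3)).symm
  have e2 := (volume_preserving_piFinSuccAbove (fun _ : Fin 3 => ℝ) 0).symm
  have e3 := e1.comp e2
  rw [← e3.measure_preimage hSm.nullMeasurableSet, Measure.volume_eq_prod,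
    Measure.prod_apply (e3.measurable hSm)]
  have hsec : ∀ u : ℝ, volume (Prod.mk u ⁻¹' (((MeasurableEquiv.toLp 2 (Fin 3 → ℝ)).symm.symm ∘
      (MeasurableEquiv.piFinSuccAbove (fun _ : Fin 3 => ℝ) 0).symm) ⁻¹' S)) ≤
      (Set.Icc c (c + h)).indicator (fun _ => ENNReal.ofReal (Real.pi * L)) u := by
    intro u
    have hnorm : ∀ v : Fin 2 → ℝ,
        ‖(WithLp.toLp 2 ((MeasurableEquiv.piFinSuccAbove (fun _ : Fin 3 => ℝ) 0).symm (u, v)) :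
          EuclideanSpace ℝ (Fin 3))‖ ^ 2 = u ^ 2 + ‖(WithLp.toLp 2 v :
          EuclideanSpace ℝ (Fin 2))‖ ^ 2 := by
      intro v
      rw [EuclideanSpace.norm_sq_eq, EuclideanSpace.norm_sq_eq, Fin.sum_univ_succ]
      simp [MeasurableEquiv.piFinSuccAbove, Fin.insertNthEquiv]
    by_cases hu : u ∈ Set.Icc c (c + h)
    · rw [Set.indicator_of_mem hu]
      refine le_trans ?_ (volume_annulus_le (α - u ^ 2) L hL)
      have e4 := (EuclideanSpace.volume_preserving_symm_measurableEquiv_toLp (Fin 2)).symm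
      rw [← e4.measure_preimage_equiv]
      apply measure_mono
      intro v hv
      have hv2 := hv.2
      change α ≤ ‖(WithLp.toLp 2 ((MeasurableEquiv.piFinSuccAbove (fun _ : Fin 3 => ℝ) 0).symm
        (u, v)) : EuclideanSpace ℝ (Fin 3))‖ ^ 2 ∧ _ ≤ _ at hv2
      change _ ∧ ‖(WithLp.toLp 2 ((MeasurableEquiv.piFinSuccAbove (fun _ : Fin 3 => ℝ) 0).symm
        (u, v)) : EuclideanSpace ℝ (Fin 3))‖ ^ 2 ≤ _ at hv2
      rw [hnorm] at hv2
      change α - u ^ 2 ≤ ‖(WithLp.toLp 2 v : EuclideanSpace ℝ (Fin 2))‖ ^ 2 ∧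
        ‖(WithLp.toLp 2 v : EuclideanSpace ℝ (Fin 2))‖ ^ 2 ≤ α - u ^ 2 + L
      constructor <;> linarith [hv2.1, hv2.2]
    · rw [Set.indicator_of_notMem hu]
      have : (Prod.mk u ⁻¹' (((MeasurableEquiv.toLp 2 (Fin 3 → ℝ)).symm.symm ∘
        (MeasurableEquiv.piFinSuccAbove (fun _ : Fin 3 => ℝ) 0).symm) ⁻¹' S)) = ∅ := by
        ext v
        simp only [Set.mem_empty_iff_false, iff_false]
        intro hv
        exact hu hv.1
      rw [this]; simp
  refine (lintegral_mono hsec).trans ?_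
  rw [lintegral_indicator measurableSet_Icc, setLIntegral_const, Real.volume_Icc, mul_comm]
  simp

/-- An isometry taking e to the first basis vector reduces to the coordinate slab. -/
theorem volume_shell_slab {e : EuclideanSpace ℝ (Fin 3)} (he : ‖e‖ = 1) (c h α L : ℝ)
    (hL : 0 ≤ L) :
    volume {x : EuclideanSpace ℝ (Fin 3) | (c ≤ inner ℝ e x ∧ inner ℝ e x ≤ c + h) ∧
      α ≤ ‖x‖ ^ 2 ∧ ‖x‖ ^ 2 ≤ α + L} ≤ ENNReal.ofReal h * ENNReal.ofReal (Real.pi * L) := by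
  obtain ⟨b, hb⟩ := Orthonormal.exists_orthonormalBasis_extension_of_card_eq (𝕜 := ℝ)
    (E := EuclideanSpace ℝ (Fin 3)) (ι := Fin 3) (by simp) (v := fun _ => e) (s := {0}) (by
      constructor
      · rintro ⟨i, hi⟩; simpa using he
      · rintro ⟨i, hi⟩ ⟨j, hj⟩ hij
        exact absurd (Subtype.ext (by
          rw [Set.mem_singleton_iff] at hi hj; simp [hi, hj])) hij)
  have hb0 : b 0 = e := hb 0 rfl
  refine le_trans (le_of_eq ?_) (volume_shell_slab_coord c h α L hL)
  rw [← b.measurePreserving_repr.measure_preimage_equiv (f := b.repr.toMeasurableEquiv)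
    {x : EuclideanSpace ℝ (Fin 3) | (c ≤ x 0 ∧ x 0 ≤ c + h) ∧ α ≤ ‖x‖ ^ 2 ∧ ‖x‖ ^ 2 ≤ α + L}]
  congr 1
  ext x
  have h1 : (b.repr x) 0 = inner ℝ e x := by rw [b.repr_apply_apply, hb0]
  have h2 : ‖b.repr x‖ = ‖x‖ := b.repr.norm_map x
  change _ ↔ ((c ≤ (b.repr x) 0 ∧ (b.repr x) 0 ≤ c + h) ∧
    α ≤ ‖b.repr x‖ ^ 2 ∧ ‖b.repr x‖ ^ 2 ≤ α + L)
  rw [h1, h2]; rfl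

/-- The half-open unit cube with corner `n`. -/
def unitCube (n : Freq) : Set (EuclideanSpace ℝ (Fin 3)) :=
  {x | ∀ i, ⌊x i⌋ = n i}

theorem measurableSet_unitCube (n : Freq) : MeasurableSet (unitCube n) := by
  have : unitCube n = ⋂ i, (fun x : EuclideanSpace ℝ (Fin 3) => ⌊x i⌋) ⁻¹' {n i} := by
    ext x; simp [unitCube]
  rw [this]
  refine MeasurableSet.iInter fun i => ?_
  exact (Int.measurable_floor.comp (by fun_prop)) (measurableSet_singleton _)

theorem volume_unitCube (n : Freq) : volume (unitCube n) = 1 := by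
  have e4 := (EuclideanSpace.volume_preserving_symm_measurableEquiv_toLp (Fin 3)).symm
  rw [← e4.measure_preimage_equiv]
  have : ((MeasurableEquiv.toLp 2 (Fin 3 → ℝ)).symm.symm ⁻¹' unitCube n : Set (Fin 3 → ℝ)) =
      Set.univ.pi fun i => Set.Ico (n i : ℝ) (n i + 1) := by
    ext x
    simp only [Set.mem_preimage, Set.mem_univ_pi, Set.mem_Ico]
    change (∀ i, ⌊x i⌋ = n i) ↔ _
    simp only [Int.floor_eq_iff]
  rw [this, volume_pi_pi]
  simp

theorem norm_sub_toE_le {n : Freq} {x : EuclideanSpace ℝ (Fin 3)} (hx : x ∈ unitCube n) :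
    ‖x - toE n‖ ≤ 2 := by
  have h : ∀ i, |x i - n i| ≤ 1 := fun i => by
    have := hx i
    rw [Int.floor_eq_iff] at this
    rw [abs_of_nonneg (by linarith)]; linarith
  rw [EuclideanSpace.norm_eq, Real.sqrt_le_left (by norm_num)]
  have h2 : ∀ i, ‖(x - toE n) i‖ ^ 2 ≤ 1 := fun i => by
    have : (x - toE n) i = x i - n i := by simp [toE]
    rw [this, Real.norm_eq_abs]
    nlinarith [h i, abs_nonneg (x i - n i)]
  calc ∑ i, ‖(x - toE n) i‖ ^ 2 ≤ ∑ _i : Fin 3, (1 : ℝ) := Finset.sum_le_sum fun i _ => h2 i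
    _ ≤ 2 ^ 2 := by simp; norm_num

/-- Distinct lattice points have disjoint unit cubes of volume 1; this turns counting into a volume
estimate. -/
theorem card_le_of_unitCube_subset (s : Finset Freq) (U : Set (EuclideanSpace ℝ (Fin 3)))
    (h : ∀ n ∈ s, unitCube n ⊆ U) : (s.card : ℝ≥0∞) ≤ volume U := by
  have hd : (s : Set Freq).PairwiseDisjoint unitCube := by
    intro n _ k _ hnk
    refine Set.disjoint_left.2 fun x hx hx' => hnk ?_
    funext i; rw [← hx i, ← hx' i]
  calc (s.card : ℝ≥0∞) = ∑ n ∈ s, volume (unitCube n) := by simp [volume_unitCube]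
    _ = volume (⋃ n ∈ s, unitCube n) :=
      (measure_biUnion_finset hd fun n _ => measurableSet_unitCube n).symm
    _ ≤ volume U := measure_mono (Set.iUnion₂_subset h)

/-- Points of a unit cube attached to a shell have norm between r - 3 and r + 3. For r > 3 this
gives a squared window of length 12r; the larger 16r makes the lower bound nonpositive when 1 ≤ r ≤
3, where r - 3 says nothing. -/
theorem sq_norm_mem_of_jap_mem {n : Freq} {y : EuclideanSpace ℝ (Fin 3)} {r : ℝ} (hr : 1 ≤ r)
    (h1 : r ≤ jap n) (h2 : jap n ≤ r + 1) (hy : ‖y - toE n‖ ≤ 2) :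
    (r + 3) ^ 2 - 16 * r ≤ ‖y‖ ^ 2 ∧ ‖y‖ ^ 2 ≤ (r + 3) ^ 2 := by
  have h3 := freqLen_le_jap n
  have h4 := jap_le_one_add n
  rw [freqLen_eq_norm] at h3 h4
  have h5 : ‖y‖ ≤ ‖toE n‖ + 2 := by
    have := norm_add_le (y - toE n) (toE n); rw [sub_add_cancel] at this; linarith
  have h6 : ‖toE n‖ ≤ ‖y‖ + 2 := by
    have := norm_sub_le y (y - toE n); rw [sub_sub_cancel] at this; linarith
  have h7 := norm_nonneg y
  constructor
  · by_cases h : r ≤ 3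
    · nlinarith
    · push Not at h; nlinarith
  · nlinarith

/-- Subtracting ‖x‖² from ‖x + a‖² removes the quadratic part: inside the first shell, the second
shell becomes a slab orthogonal to a of thickness comparable to (r + ρ)/|a|. The shell-slab volume
then gives the count. -/
theorem card_two_shells_aux (s : Finset Freq) {a : Freq} (ha : a ≠ 0) {r ρ : ℝ} (hr : 1 ≤ r)
    (hρ : 1 ≤ ρ) (hs : ∀ n ∈ s, (r ≤ jap n ∧ jap n ≤ r + 1) ∧
      (ρ ≤ jap (n + a) ∧ jap (n + a) ≤ ρ + 1)) :
    (s.card : ℝ) ≤ 128 * Real.pi * (r * (r + ρ) / freqLen a) := by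
  have hal := one_le_freqLen ha
  have hal' := hal
  rw [freqLen_eq_norm] at hal'
  set A := ‖toE a‖ with hA
  set e : EuclideanSpace ℝ (Fin 3) := (A⁻¹ : ℝ) • toE a with he_def
  have he : ‖e‖ = 1 := by
    rw [he_def, norm_smul, norm_inv, Real.norm_eq_abs, abs_of_pos (by linarith), ← hA]
    exact inv_mul_cancel₀ (by linarith)
  -- The two squared windows have lengths 16r and 16ρ, so 2⟨a,x⟩ lies in an interval of length 16(r
  -- + ρ); dividing by 2|a| gives the thickness h.
  set c : ℝ := ((ρ + 3) ^ 2 - 16 * ρ - (r + 3) ^ 2 - A ^ 2) / (2 * A) with hc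
  set h : ℝ := 8 * (r + ρ) / A with hh
  have key := card_le_of_unitCube_subset s
    {x : EuclideanSpace ℝ (Fin 3) | (c ≤ inner ℝ e x ∧ inner ℝ e x ≤ c + h) ∧
      ((r + 3) ^ 2 - 16 * r) ≤ ‖x‖ ^ 2 ∧ ‖x‖ ^ 2 ≤ ((r + 3) ^ 2 - 16 * r) + 16 * r} (by
      intro n hn x hx
      obtain ⟨⟨h1, h2⟩, h3, h4⟩ := hs n hn
      have b1 := norm_sub_toE_le hx
      have b2 := sq_norm_mem_of_jap_mem hr h1 h2 b1
      have b3 := sq_norm_mem_of_jap_mem (y := x + toE a) hρ h3 h4 (by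
        rw [toE_add]; convert b1 using 2; abel)
      rw [norm_add_sq_real, ← hA, real_inner_comm] at b3
      have hin : inner ℝ e x = inner ℝ (toE a) x / A := by
        rw [he_def, real_inner_smul_left]; field_simp
      refine ⟨⟨?_, ?_⟩, b2.1, by linarith [b2.2]⟩
      · rw [hin, hc, div_le_div_iff₀ (by linarith) (by linarith)]
        nlinarith [b3.1, b2.2]
      · rw [hin, hc, hh, div_add_div _ _ (by linarith) (by linarith),
          div_le_div_iff₀ (by linarith) (by positivity)]
        have : 2 * inner ℝ (toE a) x ≤ (ρ + 3) ^ 2 - ((r + 3) ^ 2 - 16 * r) - A ^ 2 := by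
          linarith [b3.2, b2.1]
        have h9 : 0 < A * A := by positivity
        nlinarith [mul_le_mul_of_nonneg_right this h9.le])
  have key2 := key.trans (volume_shell_slab he c h _ (16 * r) (by linarith))
  rw [← ENNReal.ofReal_mul (by positivity), ← ENNReal.ofReal_natCast] at key2
  have key3 := (ENNReal.ofReal_le_ofReal_iff (by positivity)).1 key2
  refine key3.trans (le_of_eq ?_)
  rw [hh, freqLen_eq_norm, ← hA]; field_simp; ring

/-- The reflection n ↦ -(n + a) exchanges the two shells, so the factor r in r(r + ρ) may be taken
to be the smaller radius, and then r(r + ρ) ≤ 2rρ. -/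
theorem card_two_shells (s : Finset Freq) {a : Freq} (ha : a ≠ 0) {r ρ : ℝ} (hr : 1 ≤ r)
    (hρ : 1 ≤ ρ) (hs : ∀ n ∈ s, (r ≤ jap n ∧ jap n ≤ r + 1) ∧
      (ρ ≤ jap (n + a) ∧ jap (n + a) ≤ ρ + 1)) :
    (s.card : ℝ) ≤ 256 * Real.pi * (r * ρ / freqLen a) := by
  have hal := one_le_freqLen ha
  rcases le_total r ρ with h | h
  · refine (card_two_shells_aux s ha hr hρ hs).trans ?_
    rw [mul_div_assoc', mul_div_assoc']
    gcongr ?_ / _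
    have := Real.pi_pos
    nlinarith [mul_pos (mul_pos this (by linarith : 0 < r)) (by linarith : 0 < ρ),
      mul_le_mul_of_nonneg_left h (mul_pos this (by linarith : 0 < r)).le]
  · classical
    have hinj : Function.Injective fun n : Freq => -(n + a) := fun n k hnk => by
      simpa using hnk
    have := card_two_shells_aux (s.map ⟨_, hinj⟩) ha hρ hr (by
      intro k hk
      obtain ⟨n, hn, rfl⟩ := Finset.mem_map.1 hk
      have e1 : jap (-(n + a)) = jap (n + a) := jap_neg _
      have e2 : jap (-(n + a) + a) = jap n := by rw [← jap_neg]; congr 1; abel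
      have := hs n hn
      simp only [Function.Embedding.coeFn_mk]
      rw [e1, e2]; exact ⟨this.2, this.1⟩)
    rw [Finset.card_map] at this
    refine this.trans ?_
    rw [mul_div_assoc', mul_div_assoc']
    gcongr ?_ / _
    have := Real.pi_pos
    nlinarith [mul_pos (mul_pos this (by linarith : 0 < r)) (by linarith : 0 < ρ),
      mul_le_mul_of_nonneg_left h (mul_pos this (by linarith : 0 < ρ)).le]

/-! ### The dispersive lattice sum -/

theorem rpow_neg_mul_rpow_neg_le {x y p q : ℝ} (hx : 0 < x) (hy : 0 < y) (hp : 0 ≤ p)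
    (hq : 0 ≤ q) : x ^ (-p) * y ^ (-q) ≤ x ^ (-(p + q)) + y ^ (-(p + q)) := by
  have ex : x ^ (-(p + q)) = x ^ (-p) * x ^ (-q) := by rw [← Real.rpow_add hx]; ring_nf
  have ey : y ^ (-(p + q)) = y ^ (-p) * y ^ (-q) := by rw [← Real.rpow_add hy]; ring_nf
  have h1 : 0 < x ^ (-(p + q)) := by positivity
  have h2 : 0 < y ^ (-(p + q)) := by positivity
  rcases le_total x y with h | h
  · have : y ^ (-q) ≤ x ^ (-q) := Real.rpow_le_rpow_of_nonpos hx h (by linarith)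
    have : x ^ (-p) * y ^ (-q) ≤ x ^ (-(p + q)) := by rw [ex]; gcongr
    linarith
  · have : x ^ (-p) ≤ y ^ (-p) := Real.rpow_le_rpow_of_nonpos hy h (by linarith)
    have : x ^ (-p) * y ^ (-q) ≤ y ^ (-(p + q)) := by rw [ey]; gcongr
    linarith

/-- The larger of r and ρ is at least A/4. Taking the power 1 - u - 2θ out of it leaves exponents
adding up to 1 + θ, which are then placed on a single variable. -/
theorem shell_weight_le {u θ r ρ A : ℝ} (hu : 0 < u) (hθ : 0 < θ) (h : u + 2 * θ ≤ 1)
    (hr : 1 ≤ r) (hρ : 1 ≤ ρ) (hA : 0 < A) (hAr : A ≤ r + ρ + 2) :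
    r ^ (-(1 - θ)) * ρ ^ (-(1 - u)) ≤
      (A / 4) ^ (-(1 - u - 2 * θ)) * (r ^ (-(1 + θ)) + ρ ^ (-(1 + θ))) := by
  have hr0 : 0 < r := by linarith
  have hρ0 : 0 < ρ := by linarith
  rcases le_total r ρ with hle | hle
  · have e : ρ ^ (-(1 - u)) = ρ ^ (-(1 - u - 2 * θ)) * ρ ^ (-(2 * θ)) := by
      rw [← Real.rpow_add hρ0]; ring_nf
    have h1 : ρ ^ (-(1 - u - 2 * θ)) ≤ (A / 4) ^ (-(1 - u - 2 * θ)) :=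
      Real.rpow_le_rpow_of_nonpos (by positivity) (by linarith) (by linarith)
    have h2 := rpow_neg_mul_rpow_neg_le hr0 hρ0 (p := 1 - θ) (q := 2 * θ) (by linarith)
      (by linarith)
    have e2 : 1 - θ + 2 * θ = 1 + θ := by ring
    rw [e2] at h2
    calc _ = ρ ^ (-(1 - u - 2 * θ)) * (r ^ (-(1 - θ)) * ρ ^ (-(2 * θ))) := by rw [e]; ring
      _ ≤ _ := by gcongr
  · have e : r ^ (-(1 - θ)) = r ^ (-(1 - u - 2 * θ)) * r ^ (-(u + θ)) := by
      rw [← Real.rpow_add hr0]; ring_nf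
    have h1 : r ^ (-(1 - u - 2 * θ)) ≤ (A / 4) ^ (-(1 - u - 2 * θ)) :=
      Real.rpow_le_rpow_of_nonpos (by positivity) (by linarith) (by linarith)
    have h2 := rpow_neg_mul_rpow_neg_le hr0 hρ0 (p := u + θ) (q := 1 - u) (by linarith)
      (by linarith)
    have e2 : u + θ + (1 - u) = 1 + θ := by ring
    rw [e2] at h2
    calc _ = r ^ (-(1 - u - 2 * θ)) * (r ^ (-(u + θ)) * ρ ^ (-(1 - u))) := by rw [e]; ring
      _ ≤ _ := by gcongr

theorem tsum_nat_bracket_sign {γ : ℝ} (hγ : 1 < γ) :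
    ∃ C : ℝ≥0∞, C < ⊤ ∧ ∀ σ x : ℝ, |σ| = 1 →
      ∑' k : ℕ, ENNReal.ofReal (bracket (σ * k + x) ^ (-γ)) ≤ C := by
  obtain ⟨C, hC, h⟩ := tsum_bracket_int_shift hγ
  refine ⟨C, hC, fun σ x hσ => ?_⟩
  have e : ∀ k : ℕ, bracket (σ * k + x) = bracket ((((k : ℤ)) : ℝ) + σ * x) := fun k => by
    have h2 : σ ^ 2 = 1 := by rw [← sq_abs, hσ]; norm_num
    have : (((k : ℤ)) : ℝ) + σ * x = σ * (σ * k + x) := by push_cast; linear_combination (-(k:ℝ)) * h2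
    rw [this, bracket, bracket]
    congr 2
    linear_combination (-(σ * k + x) ^ 2) * h2
  simp_rw [e]
  exact (ENNReal.tsum_comp_le_tsum_of_injective Nat.cast_injective
    (fun k : ℤ => ENNReal.ofReal (bracket ((k : ℝ) + σ * x) ^ (-γ)))).trans (h (σ * x))

theorem tsum_nat_rpow_lt_top {a : ℝ} (ha : 1 < a) :
    ∑' k : ℕ, ENNReal.ofReal ((k : ℝ) ^ (-a)) < ⊤ := by
  have : Summable fun k : ℕ => (k : ℝ) ^ (-a) := Real.summable_nat_rpow.2 (by linarith)
  exact this.tsum_ofReal_lt_top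

theorem ENNReal_tsum_le_of_card {α : Type*} (F : α → ℝ≥0∞) (B : ℝ≥0∞) (M : ℝ)
    (hF : ∀ x, F x ≤ B) (hcard : ∀ s : Finset α, (s.card : ℝ) ≤ M) :
    ∑' x, F x ≤ ENNReal.ofReal M * B := by
  rw [ENNReal.tsum_eq_iSup_sum]
  refine iSup_le fun s => ?_
  calc ∑ x ∈ s, F x ≤ ∑ _x ∈ s, B := Finset.sum_le_sum fun x _ => hF x
    _ = (s.card : ℝ≥0∞) * B := by simp
    _ ≤ _ := by
      gcongr
      rw [← ENNReal.ofReal_natCast]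
      exact ENNReal.ofReal_le_ofReal (hcard s)

/-- Rounding both arguments moves the modulation by at most 2, so it may be treated as a function of
two integers. -/
theorem bracket_floor_le {γ σ τ x y m : ℝ} (hγ : 0 ≤ γ) (hσ : |σ| = 1) (hτ : |τ| = 1)
    (hx : 0 ≤ x) (hy : 0 ≤ y) :
    bracket (σ * y + τ * x - m) ^ (-γ) ≤
      6 ^ γ * bracket (σ * ⌊y⌋₊ + τ * ⌊x⌋₊ - m) ^ (-γ) := by
  have h := bracket_rpow_neg_le hγ (σ * ⌊y⌋₊ + τ * ⌊x⌋₊ - m) (σ * (y - ⌊y⌋₊) + τ * (x - ⌊x⌋₊))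
  have e : σ * ⌊y⌋₊ + τ * ⌊x⌋₊ - m + (σ * (y - ⌊y⌋₊) + τ * (x - ⌊x⌋₊)) = σ * y + τ * x - m := by
    ring
  rw [e] at h
  have hb : bracket (σ * (y - ⌊y⌋₊) + τ * (x - ⌊x⌋₊)) ≤ 3 := by
    refine (bracket_le_one_add_abs _).trans ?_
    have h1 := abs_add_le (σ * (y - ⌊y⌋₊)) (τ * (x - ⌊x⌋₊))
    rw [abs_mul, abs_mul, hσ, hτ] at h1
    have h2 := Nat.floor_le hy
    have h3 := Nat.floor_le hx
    have h4 := Nat.lt_floor_add_one y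
    have h5 := Nat.lt_floor_add_one x
    rw [abs_of_nonneg (by linarith : 0 ≤ y - ⌊y⌋₊), abs_of_nonneg (by linarith : 0 ≤ x - ⌊x⌋₊)] at h1
    linarith
  have h2 : bracket (σ * (y - ⌊y⌋₊) + τ * (x - ⌊x⌋₊)) ^ γ ≤ 3 ^ γ :=
    Real.rpow_le_rpow (bracket_pos _).le hb hγ
  have hp := bracket_pos (σ * ⌊y⌋₊ + τ * ⌊x⌋₊ - m)
  calc _ ≤ _ := h
    _ ≤ 2 ^ γ * bracket (σ * ⌊y⌋₊ + τ * ⌊x⌋₊ - m) ^ (-γ) * 3 ^ γ := by gcongr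
    _ = _ := by
      rw [show (6 : ℝ) = 2 * 3 by norm_num, Real.mul_rpow (by norm_num) (by norm_num)]; ring

/-- The frequencies are fibred over the integer parts (r, ρ) of ⟨n⟩ and ⟨n+a⟩, and each fibre is
counted by `card_two_shells`. After `shell_weight_le` only one of r, ρ carries the weight with
exponent 1 + θ; the sum over the other one is paid for by the modulation, since γ > 1. -/
theorem dispersive_sum {u θ γ : ℝ} (hu : 0 < u) (hθ : 0 < θ) (h : u + 2 * θ ≤ 1) (hγ : 1 < γ) :
    ∃ C : ℝ≥0∞, C < ⊤ ∧ ∀ (σ τ m : ℝ) (a : Freq), |σ| = 1 → |τ| = 1 →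
      ∑' n : Freq, ENNReal.ofReal (jap n ^ (-(2 - θ)) * jap (n + a) ^ (-(2 - u)) *
        bracket (σ * jap (n + a) + τ * jap n - m) ^ (-γ)) ≤
      C * ENNReal.ofReal (jap a ^ (-(2 - u - 2 * θ))) := by
  obtain ⟨C₁, hC₁, hsum⟩ := tsum_nat_bracket_sign hγ
  set C₂ := ∑' k : ℕ, ENNReal.ofReal ((k : ℝ) ^ (-(1 + θ))) with hC₂d
  have hC₂ : C₂ < ⊤ := tsum_nat_rpow_lt_top (by linarith)
  set C₃ := ∑' n : Freq, ENNReal.ofReal (jap n ^ (-(4 - θ - u))) with hC₃d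
  have hC₃ : C₃ < ⊤ := tsum_jap_lt_top (by linarith)
  set K : ℝ := 256 * Real.pi * 6 ^ γ * 4 * 4 with hK
  refine ⟨C₃ + ENNReal.ofReal K * (C₁ * C₂ + C₁ * C₂), ?_, ?_⟩
  · exact ENNReal.add_lt_top.2 ⟨hC₃, ENNReal.mul_lt_top (by simp)
      (ENNReal.add_lt_top.2 ⟨ENNReal.mul_lt_top hC₁ hC₂, ENNReal.mul_lt_top hC₁ hC₂⟩)⟩
  intro σ τ m a hσ hτ
  rw [add_mul]
  -- For a = 0 the two shells coincide and the count is void, but then the summand is at most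
  -- ⟨n⟩^{-(4-θ-u)}, whose exponent exceeds 3.
  by_cases ha : a = 0
  · subst ha
    refine le_trans ?_ le_self_add
    have : jap 0 = 1 := by simp [jap, freqLen_zero, bracket]
    rw [this]
    simp only [Real.one_rpow, ENNReal.ofReal_one, mul_one, add_zero]
    refine ENNReal.tsum_le_tsum fun n => ENNReal.ofReal_le_ofReal ?_
    have hj := jap_pos n
    rw [← Real.rpow_add hj]
    have : bracket (σ * jap n + τ * jap n - m) ^ (-γ) ≤ 1 :=
      Real.rpow_le_one_of_one_le_of_nonpos (one_le_bracket _) (by linarith)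
    calc _ ≤ jap n ^ (-(2 - θ) + -(2 - u)) * 1 := by gcongr
      _ = _ := by rw [mul_one]; ring_nf
  refine le_trans ?_ le_add_self
  have hA := one_le_freqLen ha
  set A := freqLen a with hAd
  let g : Freq → ℕ × ℕ := fun n => (⌊jap n⌋₊, ⌊jap (n + a)⌋₊)
  rw [← ENNReal.tsum_fiberwise _ g]
  have hfib : ∀ q : ℕ × ℕ, (∑' n : g ⁻¹' {q}, ENNReal.ofReal (jap (n : Freq) ^ (-(2 - θ)) *
      jap (n + a) ^ (-(2 - u)) * bracket (σ * jap (n + a) + τ * jap n - m) ^ (-γ))) ≤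
      ENNReal.ofReal K * ENNReal.ofReal (jap a ^ (-(2 - u - 2 * θ))) *
      ((ENNReal.ofReal ((q.1 : ℝ) ^ (-(1 + θ))) + ENNReal.ofReal ((q.2 : ℝ) ^ (-(1 + θ)))) *
        ENNReal.ofReal (bracket (σ * q.2 + τ * q.1 - m) ^ (-γ))) := by
    rintro ⟨r, ρ⟩
    by_cases hne : (g ⁻¹' {(r, ρ)}).Nonempty
    swap
    · rw [Set.not_nonempty_iff_eq_empty] at hne
      have : IsEmpty (g ⁻¹' {(r, ρ)}) := by rw [hne]; infer_instance
      simp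
    have hmem : ∀ n ∈ g ⁻¹' {(r, ρ)}, ((r : ℝ) ≤ jap n ∧ jap n ≤ r + 1) ∧
        ((ρ : ℝ) ≤ jap (n + a) ∧ jap (n + a) ≤ ρ + 1) := by
      intro n hn
      have hn' : g n = (r, ρ) := hn
      have h1 : ⌊jap n⌋₊ = r := congrArg Prod.fst hn'
      have h2 : ⌊jap (n + a)⌋₊ = ρ := congrArg Prod.snd hn'
      rw [← h1, ← h2]
      exact ⟨⟨Nat.floor_le (jap_pos _).le, (Nat.lt_floor_add_one _).le⟩,
        Nat.floor_le (jap_pos _).le, (Nat.lt_floor_add_one _).le⟩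
    obtain ⟨n₀, hn₀⟩ := hne
    have hn₀' : g n₀ = (r, ρ) := hn₀
    have hr : (1 : ℝ) ≤ r := by
      have h1 : ⌊jap n₀⌋₊ = r := congrArg Prod.fst hn₀'
      rw [← h1]; exact_mod_cast Nat.le_floor (by simpa using one_le_jap n₀)
    have hρ : (1 : ℝ) ≤ ρ := by
      have h1 : ⌊jap (n₀ + a)⌋₊ = ρ := congrArg Prod.snd hn₀'
      rw [← h1]; exact_mod_cast Nat.le_floor (by simpa using one_le_jap (n₀ + a))
    -- Triangle inequality for a = (n₀ + a) - n₀, with n₀ any member of the fibre.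
    have hAr : A ≤ r + ρ + 2 := by
      have h1 := freqLen_add_le (n₀ + a) (-n₀)
      rw [freqLen_neg, show n₀ + a + -n₀ = a by abel] at h1
      have h2 := hmem n₀ hn₀
      linarith [freqLen_le_jap n₀, freqLen_le_jap (n₀ + a), h2.1.2, h2.2.2]
    have hr0 : (0 : ℝ) < r := by linarith
    have hρ0 : (0 : ℝ) < ρ := by linarith
    have hbp := bracket_pos (σ * ρ + τ * r - m)
    refine (ENNReal_tsum_le_of_card _ (ENNReal.ofReal ((r : ℝ) ^ (-(2 - θ)) * (ρ : ℝ) ^ (-(2 - u)) *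
      (6 ^ γ * bracket (σ * ρ + τ * r - m) ^ (-γ)))) (256 * Real.pi * (r * ρ / A)) ?_ ?_).trans ?_
    · rintro ⟨n, hn⟩
      apply ENNReal.ofReal_le_ofReal
      have hb := bracket_floor_le (γ := γ) (σ := σ) (τ := τ) (x := jap n) (y := jap (n + a))
        (m := m) (by linarith) hσ hτ (jap_pos _).le (jap_pos _).le
      have hn' : g n = (r, ρ) := hn
      have h1 : ⌊jap n⌋₊ = r := congrArg Prod.fst hn'
      have h2 : ⌊jap (n + a)⌋₊ = ρ := congrArg Prod.snd hn'
      rw [h1, h2] at hb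
      have hm := hmem n hn
      have i1 : jap n ^ (-(2 - θ)) ≤ (r : ℝ) ^ (-(2 - θ)) :=
        Real.rpow_le_rpow_of_nonpos hr0 hm.1.1 (by linarith)
      have i2 : jap (n + a) ^ (-(2 - u)) ≤ (ρ : ℝ) ^ (-(2 - u)) :=
        Real.rpow_le_rpow_of_nonpos hρ0 hm.2.1 (by linarith)
      have := jap_pos n
      have := jap_pos (n + a)
      have := bracket_pos (σ * jap (n + a) + τ * jap n - m)
      simp only
      gcongr
    · intro s
      have := card_two_shells (s.map (Function.Embedding.subtype _)) ha hr hρ (by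
        intro n hn
        obtain ⟨⟨k, hk⟩, -, rfl⟩ := Finset.mem_map.1 hn
        exact hmem k hk)
      rwa [Finset.card_map] at this
    · rw [← ENNReal.ofReal_mul (by positivity), ← ENNReal.ofReal_add (by positivity) (by positivity),
        ← ENNReal.ofReal_mul (by positivity),
        ← ENNReal.ofReal_mul (by positivity), ← ENNReal.ofReal_mul (by
          have := jap_pos a; positivity)]
      apply ENNReal.ofReal_le_ofReal
      have hw := shell_weight_le hu hθ h hr hρ (by linarith : 0 < A) hAr
      have e1 : (r : ℝ) ^ (-(1 - θ)) = r * (r : ℝ) ^ (-(2 - θ)) := by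
        rw [show -(1 - θ) = 1 + -(2 - θ) by ring, Real.rpow_add hr0, Real.rpow_one]
      have e2 : (ρ : ℝ) ^ (-(1 - u)) = ρ * (ρ : ℝ) ^ (-(2 - u)) := by
        rw [show -(1 - u) = 1 + -(2 - u) by ring, Real.rpow_add hρ0, Real.rpow_one]
      have e3 : A⁻¹ * (A / 4) ^ (-(1 - u - 2 * θ)) ≤ 16 * jap a ^ (-(2 - u - 2 * θ)) := by
        have hj := jap_le_two_mul ha
        have hj0 := jap_pos a
        have i1 : (A / 4) ^ (-(1 - u - 2 * θ)) ≤ (jap a / 8) ^ (-(1 - u - 2 * θ)) :=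
          Real.rpow_le_rpow_of_nonpos (by positivity) (by linarith) (by linarith)
        have i2 : (jap a / 8) ^ (-(1 - u - 2 * θ)) =
            jap a ^ (-(1 - u - 2 * θ)) * 8 ^ (1 - u - 2 * θ) := by
          rw [Real.div_rpow hj0.le (by norm_num), Real.rpow_neg (by norm_num : (0:ℝ) ≤ 8),
            div_inv_eq_mul]
        have i3 : (8 : ℝ) ^ (1 - u - 2 * θ) ≤ 8 := by
          calc (8 : ℝ) ^ (1 - u - 2 * θ) ≤ 8 ^ (1 : ℝ) :=
                Real.rpow_le_rpow_of_exponent_le (by norm_num) (by linarith)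
            _ = 8 := Real.rpow_one 8
        have i4 : A⁻¹ ≤ 2 * (jap a)⁻¹ := by
          rw [← div_eq_mul_inv, inv_eq_one_div, div_le_div_iff₀ (by linarith) hj0]; linarith
        have i5 : jap a ^ (-(2 - u - 2 * θ)) = (jap a)⁻¹ * jap a ^ (-(1 - u - 2 * θ)) := by
          rw [← Real.rpow_neg_one, ← Real.rpow_add hj0]; ring_nf
        calc _ ≤ (2 * (jap a)⁻¹) * (jap a ^ (-(1 - u - 2 * θ)) * 8) := by
              refine mul_le_mul i4 (i1.trans ?_) (by positivity) (by positivity)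
              rw [i2]; gcongr
          _ = _ := by rw [i5]; ring
      calc 256 * Real.pi * (↑r * ↑ρ / A) * (↑r ^ (-(2 - θ)) * ↑ρ ^ (-(2 - u)) *
            (6 ^ γ * bracket (σ * ↑ρ + τ * ↑r - m) ^ (-γ)))
          = 256 * Real.pi * 6 ^ γ * A⁻¹ * ((r : ℝ) ^ (-(1 - θ)) * (ρ : ℝ) ^ (-(1 - u))) *
            bracket (σ * ↑ρ + τ * ↑r - m) ^ (-γ) := by rw [e1, e2]; field_simp
        _ ≤ 256 * Real.pi * 6 ^ γ * A⁻¹ * ((A / 4) ^ (-(1 - u - 2 * θ)) *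
            ((r : ℝ) ^ (-(1 + θ)) + (ρ : ℝ) ^ (-(1 + θ)))) *
            bracket (σ * ↑ρ + τ * ↑r - m) ^ (-γ) := by gcongr
        _ = 256 * Real.pi * 6 ^ γ * (A⁻¹ * (A / 4) ^ (-(1 - u - 2 * θ))) *
            (((r : ℝ) ^ (-(1 + θ)) + (ρ : ℝ) ^ (-(1 + θ))) *
            bracket (σ * ↑ρ + τ * ↑r - m) ^ (-γ)) := by ring
        _ ≤ 256 * Real.pi * 6 ^ γ * (16 * jap a ^ (-(2 - u - 2 * θ))) *
            (((r : ℝ) ^ (-(1 + θ)) + (ρ : ℝ) ^ (-(1 + θ))) *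
            bracket (σ * ↑ρ + τ * ↑r - m) ^ (-γ)) := by gcongr
        _ = _ := by rw [hK]; ring
  refine (ENNReal.tsum_le_tsum hfib).trans ?_
  rw [ENNReal.tsum_mul_left, mul_right_comm]
  gcongr
  simp_rw [add_mul]
  rw [ENNReal.tsum_add]
  have hA1 : ∀ r : ℕ, ∑' ρ : ℕ, ENNReal.ofReal (bracket (σ * ρ + τ * r - m) ^ (-γ)) ≤ C₁ :=
    fun r => by
      have := hsum σ (τ * r - m) hσ
      simpa only [add_sub_assoc] using this
  have hA2 : ∀ ρ : ℕ, ∑' r : ℕ, ENNReal.ofReal (bracket (σ * ρ + τ * r - m) ^ (-γ)) ≤ C₁ :=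
    fun ρ => by
      have := hsum τ (σ * ρ - m) hτ
      refine le_trans (le_of_eq ?_) this
      congr 1; funext r; congr 3; ring
  refine add_le_add ?_ ?_
  · rw [ENNReal.tsum_prod']
    simp only
    simp_rw [ENNReal.tsum_mul_left]
    calc _ ≤ ∑' r : ℕ, ENNReal.ofReal ((r : ℝ) ^ (-(1 + θ))) * C₁ :=
          ENNReal.tsum_le_tsum fun r => by gcongr; exact hA1 r
      _ = _ := by rw [ENNReal.tsum_mul_right, mul_comm]
  · rw [ENNReal.tsum_prod', ENNReal.tsum_comm]
    simp only
    simp_rw [ENNReal.tsum_mul_left]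
    calc _ ≤ ∑' r : ℕ, ENNReal.ofReal ((r : ℝ) ^ (-(1 + θ))) * C₁ :=
          ENNReal.tsum_le_tsum fun r => by gcongr; exact hA2 r
      _ = _ := by rw [ENNReal.tsum_mul_right, mul_comm]

/-- The power of the largest of the three variables is distributed over the other two so that both
end with the exponent (a+b+c)/2. The triangle inequalities among a, b, c say exactly that the shares
are nonnegative. -/
theorem triple_rpow_le {x y z a b c : ℝ} (hx : 0 < x) (hy : 0 < y) (hz : 0 < z)
    (ha : a ≤ b + c) (hb : b ≤ a + c) (hc : c ≤ a + b) :
    x ^ (-a) * y ^ (-b) * z ^ (-c) ≤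
      x ^ (-((a + b + c) / 2)) * y ^ (-((a + b + c) / 2)) +
      x ^ (-((a + b + c) / 2)) * z ^ (-((a + b + c) / 2)) +
      y ^ (-((a + b + c) / 2)) * z ^ (-((a + b + c) / 2)) := by
  have key : ∀ {x y z a b c : ℝ}, 0 < x → 0 < y → 0 < z → a ≤ b + c → b ≤ a + c →
      x ≤ z → y ≤ z → x ^ (-a) * y ^ (-b) * z ^ (-c) ≤
      x ^ (-((a + b + c) / 2)) * y ^ (-((a + b + c) / 2)) := by
    intro x y z a b c hx hy hz ha hb h1 h2
    have e1 : z ^ (-c) = z ^ (-((b + c - a) / 2)) * z ^ (-((a + c - b) / 2)) := by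
      rw [← Real.rpow_add hz]; ring_nf
    have e2 : x ^ (-((a + b + c) / 2)) = x ^ (-a) * x ^ (-((b + c - a) / 2)) := by
      rw [← Real.rpow_add hx]; ring_nf
    have e3 : y ^ (-((a + b + c) / 2)) = y ^ (-b) * y ^ (-((a + c - b) / 2)) := by
      rw [← Real.rpow_add hy]; ring_nf
    have i1 : z ^ (-((b + c - a) / 2)) ≤ x ^ (-((b + c - a) / 2)) :=
      Real.rpow_le_rpow_of_nonpos hx h1 (by linarith)
    have i2 : z ^ (-((a + c - b) / 2)) ≤ y ^ (-((a + c - b) / 2)) :=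
      Real.rpow_le_rpow_of_nonpos hy h2 (by linarith)
    calc _ = x ^ (-a) * y ^ (-b) * (z ^ (-((b + c - a) / 2)) * z ^ (-((a + c - b) / 2))) := by
          rw [e1]
      _ ≤ x ^ (-a) * y ^ (-b) * (x ^ (-((b + c - a) / 2)) * y ^ (-((a + c - b) / 2))) := by
          gcongr
      _ = _ := by rw [e2, e3]; ring
  have p1 : 0 < x ^ (-((a + b + c) / 2)) := by positivity
  have p2 : 0 < y ^ (-((a + b + c) / 2)) := by positivity
  have p3 : 0 < z ^ (-((a + b + c) / 2)) := by positivity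
  have q1 := mul_pos p1 p2
  have q2 := mul_pos p1 p3
  have q3 := mul_pos p2 p3
  by_cases h1 : x ≤ z ∧ y ≤ z
  · have := key hx hy hz ha hb h1.1 h1.2; linarith
  by_cases h2 : x ≤ y ∧ z ≤ y
  · have := key hx hz hy (a := a) (b := c) (c := b) (by linarith) (by linarith) h2.1 h2.2
    rw [show a + c + b = a + b + c by ring] at this
    rw [mul_right_comm]; linarith
  · have h3 : y ≤ x ∧ z ≤ x := by
      rcases le_total x y with h | h <;> rcases le_total y z with h' | h' <;>
        rcases le_total x z with h'' | h'' <;> refine ⟨?_, ?_⟩ <;>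
        first
        | assumption
        | (exfalso; first | exact h1 ⟨by linarith, by linarith⟩ | exact h2 ⟨by linarith, by linarith⟩)
    have := key hy hz hx (a := b) (b := c) (c := a) (by linarith) (by linarith) h3.1 h3.2
    rw [show b + c + a = a + b + c by ring] at this
    have e : x ^ (-a) * y ^ (-b) * z ^ (-c) = y ^ (-b) * z ^ (-c) * x ^ (-a) := by ring
    rw [e]; linarith

/-- The cubic sum estimate behind the multilinear dispersive smoothing. -/
theorem cubic_sum {β η θ γ : ℝ} (hηβ : η < β) (hβ : β < 1 / 2) (hθ : 0 < θ)
    (hθη : 2 * θ < η) (hγ : 1 < γ) :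
    ∃ C : ℝ≥0∞, C < ⊤ ∧ ∀ (σ : ℝ) (ε : Fin 3 → ℝ), |σ| = 1 → (∀ j, |ε j| = 1) →
      ∑' m : Fin 3 → Freq, ENNReal.ofReal ((∏ j, jap (m j) ^ (-(2 - θ))) *
        jap (m 0 + m 1) ^ (-(2 * β)) * jap (m 0 + m 1 + m 2) ^ (-(2 - 2 * (β - η))) *
        bracket (σ * jap (m 0 + m 1 + m 2) + ∑ j, ε j * jap (m j)) ^ (-γ)) ≤ C := by
  obtain ⟨C, hC, hdisp⟩ := dispersive_sum (u := 2 * (β - η)) (θ := θ) (γ := γ) (by linarith) hθ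
    (by linarith) hγ
  -- Half of (2-θ) + (2-θ) + (2+2η-2θ), the exponents left on n₁, n₂, n₁₂ after the sum over n₃. It
  -- exceeds 3 because 2θ < η.
  set d : ℝ := 3 + η - 2 * θ with hd
  set S := ∑' n : Freq, ENNReal.ofReal (jap n ^ (-d)) with hS
  have hSt : S < ⊤ := tsum_jap_lt_top (by linarith)
  refine ⟨C * (S * S + S * S + S * S), ?_, ?_⟩
  · have := ENNReal.mul_lt_top hSt hSt
    exact ENNReal.mul_lt_top hC (ENNReal.add_lt_top.2 ⟨ENNReal.add_lt_top.2 ⟨this, this⟩, this⟩)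
  intro σ ε hσ hε
  rw [tsum_fin_three]
  have hin : ∀ a b : Freq, ∑' c : Freq, ENNReal.ofReal ((∏ j, jap ((![a, b, c] : Fin 3 → Freq) j)
        ^ (-(2 - θ))) *
        jap (![a, b, c] 0 + ![a, b, c] 1) ^ (-(2 * β)) *
        jap (![a, b, c] 0 + ![a, b, c] 1 + ![a, b, c] 2) ^ (-(2 - 2 * (β - η))) *
        bracket (σ * jap (![a, b, c] 0 + ![a, b, c] 1 + ![a, b, c] 2) +
          ∑ j, ε j * jap ((![a, b, c] : Fin 3 → Freq) j)) ^ (-γ)) ≤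
      C * (ENNReal.ofReal (jap a ^ (-d)) * ENNReal.ofReal (jap b ^ (-d)) +
        ENNReal.ofReal (jap a ^ (-d)) * ENNReal.ofReal (jap (a + b) ^ (-d)) +
        ENNReal.ofReal (jap b ^ (-d)) * ENNReal.ofReal (jap (a + b) ^ (-d))) := by
    intro a b
    have ha := jap_pos a
    have hb := jap_pos b
    have hab := jap_pos (a + b)
    -- The sum over n₃ is dispersive with shift a = n₁₂; the phases of n₁ and n₂ are constants here
    -- and enter through the parameter m.
    have h1 := hdisp σ (ε 2) (-(ε 0 * jap a + ε 1 * jap b)) (a + b) hσ (hε 2)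
    calc _ = ENNReal.ofReal (jap a ^ (-(2 - θ)) * jap b ^ (-(2 - θ)) *
          jap (a + b) ^ (-(2 * β))) *
          ∑' n : Freq, ENNReal.ofReal (jap n ^ (-(2 - θ)) *
            jap (n + (a + b)) ^ (-(2 - 2 * (β - η))) *
            bracket (σ * jap (n + (a + b)) + ε 2 * jap n - -(ε 0 * jap a + ε 1 * jap b)) ^ (-γ)) := by
          rw [← ENNReal.tsum_mul_left]
          congr 1; funext n
          rw [← ENNReal.ofReal_mul (by positivity)]
          congr 1
          simp only [Fin.prod_univ_three, Fin.sum_univ_three, Matrix.cons_val_zero,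
            Matrix.cons_val_one, Matrix.cons_val]
          rw [show n + (a + b) = a + b + n by abel,
            show σ * jap (a + b + n) + ε 2 * jap n - -(ε 0 * jap a + ε 1 * jap b) =
              σ * jap (a + b + n) + (ε 0 * jap a + ε 1 * jap b + ε 2 * jap n) by ring]
          ring
      _ ≤ ENNReal.ofReal (jap a ^ (-(2 - θ)) * jap b ^ (-(2 - θ)) *
          jap (a + b) ^ (-(2 * β))) *
          (C * ENNReal.ofReal (jap (a + b) ^ (-(2 - 2 * (β - η) - 2 * θ)))) := by gcongr
      _ = C * ENNReal.ofReal (jap a ^ (-(2 - θ)) * jap b ^ (-(2 - θ)) *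
          jap (a + b) ^ (-(2 + 2 * η - 2 * θ))) := by
          rw [mul_left_comm, ← ENNReal.ofReal_mul (by positivity), mul_assoc _ (jap (a + b) ^ _),
            ← Real.rpow_add hab]
          congr 4; ring
      _ ≤ _ := by
          gcongr
          have := triple_rpow_le ha hb hab (a := 2 - θ) (b := 2 - θ) (c := 2 + 2 * η - 2 * θ)
            (by linarith) (by linarith) (by linarith)
          have ed : (2 - θ + (2 - θ) + (2 + 2 * η - 2 * θ)) / 2 = d := by rw [hd]; ring
          rw [ed] at this
          rw [← ENNReal.ofReal_mul (by positivity), ← ENNReal.ofReal_mul (by positivity),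
            ← ENNReal.ofReal_mul (by positivity), ← ENNReal.ofReal_add (by positivity)
            (by positivity), ← ENNReal.ofReal_add (by positivity) (by positivity)]
          exact ENNReal.ofReal_le_ofReal this
  refine (ENNReal.tsum_le_tsum fun a => ENNReal.tsum_le_tsum fun b => hin a b).trans ?_
  simp_rw [ENNReal.tsum_mul_left, ENNReal.tsum_add, ENNReal.tsum_mul_left]
  have hshift : ∀ a : Freq, ∑' b : Freq, ENNReal.ofReal (jap (a + b) ^ (-d)) = S := fun a =>
    (Equiv.addLeft a).tsum_eq (fun n : Freq => ENNReal.ofReal (jap n ^ (-d)))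
  have hshift' : ∀ b : Freq, ∑' a : Freq, ENNReal.ofReal (jap (a + b) ^ (-d)) = S := fun b =>
    (Equiv.addRight b).tsum_eq (fun n : Freq => ENNReal.ofReal (jap n ^ (-d)))
  have h3 : ∑' a : Freq, ∑' b : Freq, ENNReal.ofReal (jap b ^ (-d)) *
      ENNReal.ofReal (jap (a + b) ^ (-d)) = S * S := by
    rw [ENNReal.tsum_comm]
    simp_rw [ENNReal.tsum_mul_left, hshift', ENNReal.tsum_mul_right]
    rw [← hS]
  rw [h3]
  simp_rw [hshift, ENNReal.tsum_mul_right]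
  rw [← hS]

/-! ### Minkowski's integral inequality -/

/-- Minkowski's inequality with the L^q norms replaced by a majorant g. It follows from Hölder's
inequality applied to F = (F g^{-1/q'}) · g^{1/q'} in x, and then Tonelli. -/
theorem lintegral_rpow_lintegral_le {Ω Λ : Type*} [MeasurableSpace Ω] [MeasurableSpace Λ]
    (P : Measure Ω) (ν : Measure Λ) [SFinite P] [SFinite ν] {F : Ω → Λ → ℝ≥0∞}
    (hF : Measurable (Function.uncurry F)) {g : Λ → ℝ≥0∞} (hg : Measurable g) {q : ℝ}
    (hq : 1 ≤ q) (h : ∀ x, ∫⁻ ω, F ω x ^ q ∂P ≤ g x ^ q) :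
    ∫⁻ ω, (∫⁻ x, F ω x ∂ν) ^ q ∂P ≤ (∫⁻ x, g x ∂ν) ^ q := by
  rcases eq_or_lt_of_le hq with rfl | hq1
  · simp only [ENNReal.rpow_one] at h ⊢
    rw [lintegral_lintegral_swap hF.aemeasurable]
    exact lintegral_mono h
  have hq0 : 0 < q := by linarith
  set G := ∫⁻ x, g x ∂ν with hG
  by_cases hGtop : G = ⊤
  · rw [hGtop, ENNReal.top_rpow_of_pos hq0]; exact le_top
  have hgfin : ∀ᵐ x ∂ν, g x < ⊤ := ae_lt_top hg hGtop
  have hFx : ∀ ω, Measurable (F ω) := fun ω => hF.comp measurable_prodMk_left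
  have hFo : ∀ x, Measurable fun ω => F ω x := fun x => hF.comp measurable_prodMk_right
  have hmem : Measurable (Function.uncurry fun ω x => ({x | g x = 0} : Set Λ).indicator
      (fun x => F ω x ^ q) x) := by
    have : (Function.uncurry fun ω x => ({x | g x = 0} : Set Λ).indicator
      (fun x => F ω x ^ q) x) = ({p : Ω × Λ | g p.2 = 0} : Set (Ω × Λ)).indicator
        (fun p => Function.uncurry F p ^ q) := by
      ext ⟨ω, x⟩; simp [Set.indicator, Function.uncurry]
    rw [this]
    exact (hF.pow_const q).indicator (measurableSet_eq_fun (hg.comp measurable_snd) measurable_const)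
  -- The negative powers of g are infinite where g = 0, so one needs F to vanish there almost
  -- everywhere.
  have hN : ∀ᵐ ω ∂P, ∀ᵐ x ∂ν, g x = 0 → F ω x = 0 := by
    have h0 : ∫⁻ ω, ∫⁻ x, ({x | g x = 0} : Set Λ).indicator (fun x => F ω x ^ q) x ∂ν ∂P = 0 := by
      rw [lintegral_lintegral_swap hmem.aemeasurable]
      refine (lintegral_eq_zero_iff' ?_).2 (Eventually.of_forall fun x => ?_)
      · exact (hmem.lintegral_prod_left').aemeasurable
      · by_cases hx : g x = 0
        · have := h x
          rw [hx, ENNReal.zero_rpow_of_pos hq0] at this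
          simpa [Set.indicator, hx] using this
        · simp [Set.indicator, hx]
    have h1 := (lintegral_eq_zero_iff' (hmem.lintegral_prod_right').aemeasurable).1 h0
    filter_upwards [h1] with ω hω
    have h2 := (lintegral_eq_zero_iff' (hmem.comp measurable_prodMk_left).aemeasurable).1 hω
    filter_upwards [h2] with x hx hgx
    simpa [Function.uncurry, Set.indicator, hgx, hq0.le, hq0, not_lt.2 hq0.le] using hx
  set q' := q / (q - 1) with hq'
  have hconj : q.HolderConjugate q' := Real.HolderConjugate.conjExponent hq1
  have hq'0 : 0 < q' := hconj.symm.pos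
  have step : ∀ᵐ ω ∂P, (∫⁻ x, F ω x ∂ν) ^ q ≤
      G ^ (q - 1) * ∫⁻ x, F ω x ^ q * g x ^ (-(q - 1)) ∂ν := by
    filter_upwards [hN] with ω hω
    have e1 : ∫⁻ x, F ω x ∂ν = ∫⁻ x, ((fun x => F ω x * g x ^ (-(1 / q'))) *
        (fun x => g x ^ (1 / q'))) x ∂ν := by
      refine lintegral_congr_ae ?_
      filter_upwards [hω, hgfin] with x hx hx2
      simp only [Pi.mul_apply]
      by_cases hgx : g x = 0
      · simp [hx hgx]
      · rw [mul_assoc, ← ENNReal.rpow_add _ _ hgx hx2.ne]; simp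
    have e2 := ENNReal.lintegral_mul_le_Lp_mul_Lq ν hconj
      (f := fun x => F ω x * g x ^ (-(1 / q'))) (g := fun x => g x ^ (1 / q'))
      ((hFx ω).mul (hg.pow_const _)).aemeasurable (hg.pow_const _).aemeasurable
    rw [← e1] at e2
    have e3 := ENNReal.rpow_le_rpow e2 hq0.le
    refine e3.trans (le_of_eq ?_)
    rw [ENNReal.mul_rpow_of_nonneg _ _ hq0.le, ← ENNReal.rpow_mul, ← ENNReal.rpow_mul, mul_comm]
    have i1 : 1 / q * q = 1 := by field_simp
    have i2 : 1 / q' * q = q - 1 := by rw [hq']; field_simp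
    have i3 : ∀ x, (g x ^ (1 / q')) ^ q' = g x := fun x => by
      rw [← ENNReal.rpow_mul, one_div, inv_mul_cancel₀ hq'0.ne', ENNReal.rpow_one]
    have i4 : ∀ x, (F ω x * g x ^ (-(1 / q'))) ^ q = F ω x ^ q * g x ^ (-(q - 1)) := fun x => by
      rw [ENNReal.mul_rpow_of_nonneg _ _ hq0.le, ← ENNReal.rpow_mul, neg_mul, i2]
    simp_rw [i3, i4]
    rw [i1, i2, ENNReal.rpow_one]
  have hmeas2 : Measurable (Function.uncurry fun ω x => F ω x ^ q * g x ^ (-(q - 1))) :=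
    (hF.pow_const q).mul ((hg.comp measurable_snd).pow_const _)
  calc ∫⁻ ω, (∫⁻ x, F ω x ∂ν) ^ q ∂P
      ≤ ∫⁻ ω, G ^ (q - 1) * ∫⁻ x, F ω x ^ q * g x ^ (-(q - 1)) ∂ν ∂P := lintegral_mono_ae step
    _ = G ^ (q - 1) * ∫⁻ x, ∫⁻ ω, F ω x ^ q * g x ^ (-(q - 1)) ∂P ∂ν := by
        rw [lintegral_const_mul _ (show Measurable fun ω => ∫⁻ x, F ω x ^ q * g x ^ (-(q - 1)) ∂ν from
            hmeas2.lintegral_prod_right'),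
          lintegral_lintegral_swap hmeas2.aemeasurable]
    _ ≤ G ^ (q - 1) * ∫⁻ x, g x ∂ν := by
        refine mul_le_mul_right (lintegral_mono_ae ?_) _
        filter_upwards [hgfin] with x hx
        rw [lintegral_mul_const _ ((hFo x).pow_const q)]
        by_cases hgx : g x = 0
        · have := h x
          rw [hgx, ENNReal.zero_rpow_of_pos hq0] at this
          rw [le_antisymm this zero_le]; simp
        · calc _ ≤ g x ^ q * g x ^ (-(q - 1)) := by gcongr; exact h x
            _ = g x := by rw [← ENNReal.rpow_add _ _ hgx hx.ne]; simp
    _ = G ^ q := by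
        by_cases hG0 : G = 0
        · rw [← hG, hG0, ENNReal.zero_rpow_of_pos hq0, mul_zero]
        · rw [← hG]
          conv_lhs => rw [← ENNReal.rpow_one G, ← ENNReal.rpow_mul, one_mul]
          rw [← ENNReal.rpow_add _ _ hG0 hGtop]; congr 1; ring

theorem lintegral_rpow_tsum_le {Ω α : Type*} [MeasurableSpace Ω] [Countable α]
    (P : Measure Ω) [SFinite P] {F : α → Ω → ℝ≥0∞} (hF : ∀ a, Measurable (F a)) {g : α → ℝ≥0∞}
    {q : ℝ} (hq : 1 ≤ q) (h : ∀ a, ∫⁻ ω, F a ω ^ q ∂P ≤ g a ^ q) :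
    ∫⁻ ω, (∑' a, F a ω) ^ q ∂P ≤ (∑' a, g a) ^ q := by
  let _ : MeasurableSpace α := ⊤
  have h1 := lintegral_rpow_lintegral_le P (Measure.count : Measure α) (F := fun ω a => F a ω)
    (measurable_from_prod_countable_left fun a => hF a) (g := g) (measurable_from_top) hq h
  simpa [lintegral_count] using h1

theorem lintegral_rpow_sum_le {Ω α : Type*} [MeasurableSpace Ω] (P : Measure Ω) [SFinite P]
    (s : Finset α) {F : α → Ω → ℝ≥0∞} (hF : ∀ a ∈ s, Measurable (F a)) {g : α → ℝ≥0∞}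
    {q : ℝ} (hq : 1 ≤ q) (h : ∀ a ∈ s, ∫⁻ ω, F a ω ^ q ∂P ≤ g a ^ q) :
    ∫⁻ ω, (∑ a ∈ s, F a ω) ^ q ∂P ≤ (∑ a ∈ s, g a) ^ q := by
  have h1 := lintegral_rpow_tsum_le (α := s) P (F := fun a => F a) (fun a => hF a a.2)
    (g := fun a => g a) hq (fun a => h a a.2)
  simp only [tsum_fintype] at h1
  have e1 : ∀ ω, ∑ a : s, F a ω = ∑ a ∈ s, F a ω := fun ω => Finset.sum_coe_sort s (F · ω)
  have e2 : ∑ a : s, g a = ∑ a ∈ s, g a := Finset.sum_coe_sort s g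
  simpa only [e1, e2] using h1

theorem rpow_lintegral_le {Ω : Type*} [MeasurableSpace Ω] (P : Measure Ω) [IsProbabilityMeasure P]
    {f : Ω → ℝ≥0∞} (hf : AEMeasurable f P) {q : ℝ} (hq : 1 ≤ q) :
    (∫⁻ ω, f ω ∂P) ^ q ≤ ∫⁻ ω, f ω ^ q ∂P := by
  rcases eq_or_lt_of_le hq with rfl | hq1
  · simp
  have hq0 : 0 < q := by linarith
  have hconj := Real.HolderConjugate.conjExponent hq1
  have := ENNReal.lintegral_mul_le_Lp_mul_Lq P hconj hf (aemeasurable_const (b := (1 : ℝ≥0∞)))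
  simp only [Pi.mul_apply, mul_one, ENNReal.one_rpow, lintegral_const, measure_univ] at this
  have h2 := ENNReal.rpow_le_rpow this hq0.le
  rwa [← ENNReal.rpow_mul, one_div, inv_mul_cancel₀ hq0.ne', ENNReal.rpow_one] at h2

/-! ### Moments of Gaussian variables -/

/-- The point is the linear growth in q of the constant. The power is dominated by exponentials
through y ≤ e^{y-1}, whose Gaussian integrals are explicit. -/
theorem lintegral_gaussianReal_moment (v : NNReal) {q : ℝ} (hq : 1 ≤ q) :
    ∫⁻ x, (‖x‖ₑ ^ 2) ^ q ∂gaussianReal 0 v ≤ (ENNReal.ofReal (2 * q) * v) ^ q := by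
  have hq0 : 0 < q := by linarith
  by_cases hv : v = 0
  · subst hv
    simp [gaussianReal_zero_var, hq0]
  have hv0 : (0 : ℝ) < v := by positivity
  -- With this l one has v l²/2 = 2q, so the exponential moment cancels the factor e^{-2q}.
  set l : ℝ := √(4 * q / v) with hl
  have hl2 : l ^ 2 = 4 * q / v := Real.sq_sqrt (by positivity)
  have hl0 : 0 < l := Real.sqrt_pos.2 (by positivity)
  have hpt : ∀ x : ℝ, (‖x‖ₑ ^ 2) ^ q ≤ ENNReal.ofReal ((q * v) ^ q * Real.exp (-(2 * q))) *
      (ENNReal.ofReal (Real.exp (l * x)) + ENNReal.ofReal (Real.exp (-l * x))) := by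
    intro x
    rw [← ENNReal.ofReal_add (by positivity) (by positivity), ← ENNReal.ofReal_mul (by positivity),
      Real.enorm_eq_ofReal_abs, ← ENNReal.ofReal_pow (abs_nonneg _),
      ENNReal.ofReal_rpow_of_nonneg (by positivity) hq0.le]
    apply ENNReal.ofReal_le_ofReal
    set y : ℝ := l * |x| / (2 * q) with hy
    have hy0 : 0 ≤ y := by positivity
    have e1 : |x| ^ 2 = (q * v) * y ^ 2 := by
      rw [hy, div_pow, mul_pow, hl2]; field_simp; norm_num
    have e2 : y ≤ Real.exp (y - 1) := by have := Real.add_one_le_exp (y - 1); linarith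
    have e3 : (y ^ 2) ^ q ≤ Real.exp (l * |x| - 2 * q) := by
      calc (y ^ 2) ^ q ≤ (Real.exp (y - 1) ^ 2) ^ q := by gcongr
        _ = Real.exp (l * |x| - 2 * q) := by
          rw [← Real.exp_nat_mul, ← Real.exp_mul]; congr 1; rw [hy]; push_cast; field_simp
    have e4 : Real.exp (l * |x|) ≤ Real.exp (l * x) + Real.exp (-l * x) := by
      rcases abs_cases x with ⟨h, _⟩ | ⟨h, _⟩ <;> rw [h]
      · linarith [Real.exp_pos (-l * x)]
      · rw [mul_neg, ← neg_mul]; linarith [Real.exp_pos (l * x)]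
    rw [e1, Real.mul_rpow (by positivity) (by positivity)]
    calc _ ≤ (q * v) ^ q * Real.exp (l * |x| - 2 * q) := by gcongr
      _ = (q * v) ^ q * Real.exp (-(2 * q)) * Real.exp (l * |x|) := by
        rw [sub_eq_add_neg, Real.exp_add]; ring
      _ ≤ _ := by gcongr
  have hmgf : ∀ t : ℝ, ∫⁻ x, ENNReal.ofReal (Real.exp (t * x)) ∂gaussianReal 0 v =
      ENNReal.ofReal (Real.exp (v * t ^ 2 / 2)) := by
    intro t
    rw [← ofReal_integral_eq_lintegral_ofReal (integrable_exp_mul_gaussianReal t)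
      (Eventually.of_forall fun x => (Real.exp_pos _).le)]
    have := congrFun (mgf_id_gaussianReal (μ := 0) (v := v)) t
    simp only [mgf, id, zero_mul, zero_add] at this
    rw [this]
  refine (lintegral_mono hpt).trans ?_
  rw [lintegral_const_mul _ (by fun_prop), lintegral_add_left (by fun_prop), hmgf, hmgf, neg_sq,
    ← ENNReal.ofReal_add (by positivity) (by positivity), ← ENNReal.ofReal_mul (by positivity)]
  have e5 : (v : ℝ≥0∞) = ENNReal.ofReal (v : ℝ) := by simp
  rw [e5, ← ENNReal.ofReal_mul (by positivity), ENNReal.ofReal_rpow_of_nonneg (by positivity) hq0.le]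
  apply ENNReal.ofReal_le_ofReal
  have e6 : (v : ℝ) * l ^ 2 / 2 = 2 * q := by rw [hl2]; field_simp; norm_num
  have e9 : (2 * (q * v)) ^ q = 2 ^ q * (q * v) ^ q :=
    Real.mul_rpow (by norm_num) (by positivity)
  rw [e6, mul_assoc 2 q, e9]
  have e7 : (2 : ℝ) ≤ 2 ^ q := by
    calc (2 : ℝ) = 2 ^ (1 : ℝ) := (Real.rpow_one 2).symm
      _ ≤ _ := Real.rpow_le_rpow_of_exponent_le (by norm_num) hq
  have e8 : Real.exp (-(2 * q)) * Real.exp (2 * q) = 1 := by rw [← Real.exp_add]; simp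
  calc _ = (q * v) ^ q * (Real.exp (-(2 * q)) * Real.exp (2 * q)) * 2 := by ring
    _ = 2 * (q * v) ^ q := by rw [e8]; ring
    _ ≤ _ := by gcongr

section Gaussian

variable {E : Type*} [NormedAddCommGroup E] [NormedSpace ℝ E] [MeasurableSpace E] [BorelSpace E]
  [CompleteSpace E] [SecondCountableTopology E] (μ : Measure E) [IsGaussian μ]

theorem integral_clm_eq_zero (hμ : ∫ x, id x ∂μ = 0) {F : Type*} [NormedAddCommGroup F]
    [NormedSpace ℝ F] [CompleteSpace F] (L : E →L[ℝ] F) : ∫ x, L x ∂μ = 0 := by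
  have := L.integral_comp_comm (IsGaussian.integrable_id (μ := μ))
  simp only [id] at this hμ
  rw [this, hμ, map_zero]

theorem lintegral_real_moment (hμ : ∫ x, id x ∂μ = 0) (L : E →L[ℝ] ℝ) {q : ℝ} (hq : 1 ≤ q) :
    ∫⁻ x, (‖L x‖ₑ ^ 2) ^ q ∂μ ≤ (ENNReal.ofReal (2 * q) * ∫⁻ x, ‖L x‖ₑ ^ 2 ∂μ) ^ q := by
  have h0 := integral_clm_eq_zero μ hμ L
  have hmap : μ.map L = gaussianReal 0 Var[L; μ].toNNReal := by
    rw [IsGaussian.map_eq_gaussianReal L, h0]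
  have hm : Measurable L := L.continuous.measurable
  have e1 : ∫⁻ x, (‖L x‖ₑ ^ 2) ^ q ∂μ = ∫⁻ y, (‖y‖ₑ ^ 2) ^ q ∂(μ.map L) := by
    rw [lintegral_map (by fun_prop) hm]
  have e2 : ∫⁻ x, ‖L x‖ₑ ^ 2 ∂μ = (Var[L; μ].toNNReal : ℝ≥0∞) := by
    have hv : Var[L; μ] = ∫ x, L x ^ 2 ∂μ := by
      rw [variance_eq_integral hm.aemeasurable, h0]; simp
    have hint : Integrable (fun x => L x ^ 2) μ :=
      (IsGaussian.memLp_dual μ L 2 (by simp)).integrable_sq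
    have h3 : ENNReal.ofReal (∫ x, L x ^ 2 ∂μ) = ∫⁻ x, ENNReal.ofReal (L x ^ 2) ∂μ :=
      ofReal_integral_eq_lintegral_ofReal hint (Eventually.of_forall fun x => sq_nonneg _)
    change _ = ENNReal.ofReal _
    rw [hv, h3]
    congr 1; funext x
    rw [Real.enorm_eq_ofReal_abs, ← ENNReal.ofReal_pow (abs_nonneg _), sq_abs]
  rw [e1, e2, hmap]
  exact lintegral_gaussianReal_moment _ hq

theorem enorm_sq_complex (z : ℂ) : ‖z‖ₑ ^ 2 = ‖z.re‖ₑ ^ 2 + ‖z.im‖ₑ ^ 2 := by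
  have h : ∀ {F : Type} [NormedAddCommGroup F] (w : F), ‖w‖ₑ ^ 2 = ENNReal.ofReal (‖w‖ ^ 2) :=
    fun w => by rw [ENNReal.ofReal_pow (norm_nonneg _), ofReal_norm]
  rw [h, h, h, ← ENNReal.ofReal_add (by positivity) (by positivity), Complex.sq_norm,
    Complex.normSq_apply, Real.norm_eq_abs, Real.norm_eq_abs, sq_abs, sq_abs]
  ring_nf

/-- Minkowski's inequality for the squares of the real and imaginary parts; their variances add up,
so the constant is the real one. -/
theorem lintegral_complex_moment (hμ : ∫ x, id x ∂μ = 0) (L : E →L[ℝ] ℂ) {q : ℝ} (hq : 1 ≤ q) :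
    ∫⁻ x, (‖L x‖ₑ ^ 2) ^ q ∂μ ≤ (ENNReal.ofReal (2 * q) * ∫⁻ x, ‖L x‖ₑ ^ 2 ∂μ) ^ q := by
  let R : Fin 2 → (E →L[ℝ] ℝ) := ![Complex.reCLM.comp L, Complex.imCLM.comp L]
  have e : ∀ x, ‖L x‖ₑ ^ 2 = ∑ i : Fin 2, ‖R i x‖ₑ ^ 2 := fun x => by
    rw [enorm_sq_complex, Fin.sum_univ_two]; rfl
  have hm : ∀ i, Measurable (R i) := fun i => (R i).continuous.measurable
  have h := lintegral_rpow_sum_le μ Finset.univ (F := fun i x => ‖R i x‖ₑ ^ 2)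
    (g := fun i => ENNReal.ofReal (2 * q) * ∫⁻ x, ‖R i x‖ₑ ^ 2 ∂μ)
    (fun i _ => by have := hm i; fun_prop) hq (fun i _ => lintegral_real_moment μ hμ (R i) hq)
  simp_rw [e]
  rw [lintegral_finsetSum _ (fun i _ => by have := hm i; fun_prop), Finset.mul_sum]
  exact h

/-- `X` is a family of Gaussian variables dominated in covariance by an orthogonal family with
variances `v`. -/
def CovDominated {J : Type*} (X : J → E →L[ℝ] ℂ) (v : J → ℝ≥0∞) : Prop :=
  ∀ (s : Finset J) (c : J → ℂ),
    ∫⁻ x, ‖∑ j ∈ s, c j * X j x‖ₑ ^ 2 ∂μ ≤ ∑ j ∈ s, ‖c j‖ₑ ^ 2 * v j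

variable {μ}

theorem CovDominated.lintegral_weighted_le {J I : Type*} {X : J → E →L[ℝ] ℂ} {v : J → ℝ≥0∞}
    (hX : CovDominated μ X v) (hμ : ∫ x, id x ∂μ = 0) (s : Finset J) (t : Finset I)
    (w : I → ℝ≥0∞) (c : I → J → ℂ) {q : ℝ} (hq : 1 ≤ q) :
    ∫⁻ x, (∑ i ∈ t, w i * ‖∑ j ∈ s, c i j * X j x‖ₑ ^ 2) ^ q ∂μ ≤
      (ENNReal.ofReal (2 * q) * ∑ i ∈ t, w i * ∑ j ∈ s, ‖c i j‖ₑ ^ 2 * v j) ^ q := by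
  have hq0 : 0 ≤ q := by linarith
  have hm : ∀ i, Measurable fun x => ‖∑ j ∈ s, c i j * X j x‖ₑ ^ 2 := fun i => by
    have : ∀ j, Measurable (X j) := fun j => (X j).continuous.measurable
    fun_prop
  rw [Finset.mul_sum]
  refine lintegral_rpow_sum_le μ t (F := fun i x => w i * ‖∑ j ∈ s, c i j * X j x‖ₑ ^ 2)
    (fun i _ => (hm i).const_mul _) hq fun i _ => ?_
  have h1 := lintegral_complex_moment μ hμ (∑ j ∈ s, c i j • X j) hq
  simp only [sum_apply, smul_apply, smul_eq_mul] at h1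
  simp_rw [ENNReal.mul_rpow_of_nonneg _ _ hq0]
  rw [lintegral_const_mul _ ((hm i).pow_const q)]
  refine (mul_le_mul_right h1 _).trans ?_
  rw [ENNReal.mul_rpow_of_nonneg _ _ hq0]
  rw [mul_left_comm]
  gcongr
  exact hX s (c i)

/-- The copies z, y, x are integrated out in this order. Each integration leaves a weighted sum of
squared linear forms in the next variable, to which `lintegral_weighted_le` applies again, at the
price of one factor 2q. -/
theorem lintegral_decoupled_triple_le {J₁ J₂ J₃ : Type*} {X : J₁ → E →L[ℝ] ℂ}
    {Y : J₂ → E →L[ℝ] ℂ} {Z : J₃ → E →L[ℝ] ℂ} {v₁ : J₁ → ℝ≥0∞} {v₂ : J₂ → ℝ≥0∞}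
    {v₃ : J₃ → ℝ≥0∞} (hX : CovDominated μ X v₁) (hY : CovDominated μ Y v₂)
    (hZ : CovDominated μ Z v₃) (hμ : ∫ x, id x ∂μ = 0) (s₁ : Finset J₁) (s₂ : Finset J₂)
    (s₃ : Finset J₃) (A : J₁ → J₂ → J₃ → ℂ) {q : ℝ} (hq : 1 ≤ q) :
    ∫⁻ x, ∫⁻ y, ∫⁻ z, (‖∑ k ∈ s₃, (∑ j ∈ s₂, (∑ i ∈ s₁, A i j k * X i x) * Y j y) * Z k z‖ₑ ^ 2) ^ q
      ∂μ ∂μ ∂μ ≤ (ENNReal.ofReal (2 * q) ^ 3 *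
        ∑ k ∈ s₃, ∑ j ∈ s₂, ∑ i ∈ s₁, ‖A i j k‖ₑ ^ 2 * v₁ i * v₂ j * v₃ k) ^ q := by
  have hq0 : 0 ≤ q := by linarith
  set κ := ENNReal.ofReal (2 * q) with hκ
  have mX : ∀ i, Measurable (X i) := fun i => (X i).continuous.measurable
  have mY : ∀ i, Measurable (Y i) := fun i => (Y i).continuous.measurable
  have h1 : ∀ x y, ∫⁻ z, (‖∑ k ∈ s₃, (∑ j ∈ s₂, (∑ i ∈ s₁, A i j k * X i x) * Y j y) * Z k z‖ₑ ^ 2)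
      ^ q ∂μ ≤ κ ^ q * (∑ k ∈ s₃, v₃ k * ‖∑ j ∈ s₂, (∑ i ∈ s₁, A i j k * X i x) * Y j y‖ₑ ^ 2) ^ q := by
    intro x y
    have := hZ.lintegral_weighted_le hμ s₃ ({()} : Finset Unit) (fun _ => 1)
      (fun _ k => ∑ j ∈ s₂, (∑ i ∈ s₁, A i j k * X i x) * Y j y) hq
    simp only [Finset.sum_singleton, one_mul] at this
    rw [← ENNReal.mul_rpow_of_nonneg _ _ hq0]
    refine this.trans (le_of_eq ?_)
    congr 2; exact Finset.sum_congr rfl fun k _ => mul_comm _ _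
  have h2 : ∀ x, ∫⁻ y, (∑ k ∈ s₃, v₃ k * ‖∑ j ∈ s₂, (∑ i ∈ s₁, A i j k * X i x) * Y j y‖ₑ ^ 2) ^ q ∂μ
      ≤ κ ^ q * (∑ p ∈ s₃ ×ˢ s₂, (v₃ p.1 * v₂ p.2) * ‖∑ i ∈ s₁, A i p.2 p.1 * X i x‖ₑ ^ 2) ^ q := by
    intro x
    have := hY.lintegral_weighted_le hμ s₂ s₃ v₃ (fun k j => ∑ i ∈ s₁, A i j k * X i x) hq
    rw [← ENNReal.mul_rpow_of_nonneg _ _ hq0]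
    refine this.trans (le_of_eq ?_)
    congr 2
    rw [Finset.sum_product]
    refine Finset.sum_congr rfl fun k _ => ?_
    rw [Finset.mul_sum]
    exact Finset.sum_congr rfl fun j _ => by ring
  have h3 := hX.lintegral_weighted_le hμ s₁ (s₃ ×ˢ s₂) (fun p => v₃ p.1 * v₂ p.2)
    (fun p i => A i p.2 p.1) hq
  have m2 : Measurable fun x => (∑ p ∈ s₃ ×ˢ s₂, (v₃ p.1 * v₂ p.2) *
      ‖∑ i ∈ s₁, A i p.2 p.1 * X i x‖ₑ ^ 2) ^ q := by fun_prop
  have m1 : ∀ x, Measurable fun y => (∑ k ∈ s₃, v₃ k *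
      ‖∑ j ∈ s₂, (∑ i ∈ s₁, A i j k * X i x) * Y j y‖ₑ ^ 2) ^ q := fun x => by fun_prop
  calc _ ≤ ∫⁻ x, κ ^ q * (κ ^ q * (∑ p ∈ s₃ ×ˢ s₂, (v₃ p.1 * v₂ p.2) *
        ‖∑ i ∈ s₁, A i p.2 p.1 * X i x‖ₑ ^ 2) ^ q) ∂μ := by
        refine lintegral_mono fun x => ?_
        refine (lintegral_mono fun y => h1 x y).trans ?_
        rw [lintegral_const_mul _ (m1 x)]
        exact mul_le_mul_right (h2 x) _
    _ ≤ κ ^ q * (κ ^ q * (κ * ∑ p ∈ s₃ ×ˢ s₂, (v₃ p.1 * v₂ p.2) *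
          ∑ i ∈ s₁, ‖A i p.2 p.1‖ₑ ^ 2 * v₁ i) ^ q) := by
        rw [lintegral_const_mul _ (m2.const_mul _), lintegral_const_mul _ m2]
        gcongr
    _ = _ := by
        rw [← ENNReal.mul_rpow_of_nonneg _ _ hq0, ← ENNReal.mul_rpow_of_nonneg _ _ hq0,
          Finset.sum_product]
        congr 1
        rw [pow_succ, pow_two, mul_assoc, mul_assoc]
        congr 3
        refine Finset.sum_congr rfl fun k _ => Finset.sum_congr rfl fun j _ => ?_
        rw [Finset.mul_sum]
        exact Finset.sum_congr rfl fun i _ => by ring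

/-- Invariance of μ ⊗ μ under the rotation by π/4, rescaled by √2. -/
theorem lintegral_rotation (hμ : ∫ x, id x ∂μ = 0) {f : E × E → ℝ≥0∞} (hf : Measurable f) :
    ∫⁻ x, ∫⁻ y, f (x + y, y - x) ∂μ ∂μ = ∫⁻ x, ∫⁻ y, f (√2 • x, √2 • y) ∂μ ∂μ := by
  have h := IsGaussian.map_rotation_eq_self (μ := μ) hμ (Real.pi / 4)
  have hf2 : Measurable fun p : E × E => f (√2 • p.1, √2 • p.2) := by fun_prop
  have hR : Measurable (ContinuousLinearMap.rotation (E := E) (Real.pi / 4)) :=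
    (ContinuousLinearMap.continuous _).measurable
  have e1 : ∫⁻ x, ∫⁻ y, f (√2 • x, √2 • y) ∂μ ∂μ = ∫⁻ p, f (√2 • p.1, √2 • p.2) ∂(μ.prod μ) :=
    (lintegral_prod _ hf2.aemeasurable).symm
  have hf3 : Measurable fun p : E × E => f (p.1 + p.2, p.2 - p.1) := by fun_prop
  have e2 : ∫⁻ x, ∫⁻ y, f (x + y, y - x) ∂μ ∂μ = ∫⁻ p, f (p.1 + p.2, p.2 - p.1) ∂(μ.prod μ) :=
    (lintegral_prod _ hf3.aemeasurable).symm
  rw [e1, e2, ← h, lintegral_map hf2 hR, h]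
  refine lintegral_congr fun p => ?_
  have hs : √2 * (√2 / 2) = 1 := by
    rw [mul_div_assoc', Real.mul_self_sqrt (by norm_num)]; norm_num
  have e3 : ContinuousLinearMap.rotation (E := E) (Real.pi / 4) p =
      ((√2 / 2) • p.1 + (√2 / 2) • p.2, -(√2 / 2) • p.1 + (√2 / 2) • p.2) := by
    rw [← Real.cos_pi_div_four]
    conv_rhs => rw [Real.cos_pi_div_four, ← Real.sin_pi_div_four]
    simp [ContinuousLinearMap.rotation, Real.cos_pi_div_four, Real.sin_pi_div_four]
  have e4 : ∀ z : E, √2 • (√2 / 2) • z = z := fun z => by rw [smul_smul, hs, one_smul]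
  rw [e3]
  simp only [smul_add, neg_smul, smul_neg, e4]
  congr 2; abel

/-- The rotation by π is the reflection in both variables, so its first marginal gives the symmetry
of μ. -/
theorem integral_odd_eq_zero (hμ : ∫ x, id x ∂μ = 0) {f : E → ℂ} (hf : Measurable f)
    (hodd : ∀ x, f (-x) = -f x) : ∫ x, f x ∂μ = 0 := by
  have h := IsGaussian.map_rotation_eq_self (μ := μ) hμ Real.pi
  have hneg : μ.map (fun x => -x) = μ := by
    have hR : Measurable (ContinuousLinearMap.rotation (E := E) Real.pi) :=
      (ContinuousLinearMap.continuous _).measurable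
    have h2 := congrArg (fun m => m.map Prod.fst) h
    simp only [Measure.map_fst_prod, measure_univ, one_smul] at h2
    rw [Measure.map_map measurable_fst hR] at h2
    have e : (Prod.fst ∘ (ContinuousLinearMap.rotation (E := E) Real.pi)) =
        (fun x : E => -x) ∘ Prod.fst := by
      ext p; simp [ContinuousLinearMap.rotation]
    rw [e, ← Measure.map_map measurable_neg measurable_fst, Measure.map_fst_prod] at h2
    simpa using h2
  have h3 : ∫ x, f x ∂μ = ∫ x, f (-x) ∂μ := by
    conv_lhs => rw [← hneg]
    rw [integral_map measurable_neg.aemeasurable hf.aestronglyMeasurable]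
  simp_rw [hodd, integral_neg] at h3
  have h4 : (2 : ℂ) * ∫ x, f x ∂μ = 0 := by linear_combination h3
  simpa using h4

end Gaussian

/-! ### Decoupling of Wick products by rotation -/

section Chaos

variable {E : Type*} [NormedAddCommGroup E] [NormedSpace ℝ E] [MeasurableSpace E] [BorelSpace E]
  [CompleteSpace E] [SecondCountableTopology E] {μ : Measure E} [IsGaussian μ]

theorem jensen_enorm_sq {Ω : Type*} [MeasurableSpace Ω] (P : Measure Ω) [IsProbabilityMeasure P]
    {f : Ω → ℂ} (hf : Measurable f) {q : ℝ} (hq : 1 ≤ q) :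
    (‖∫ ω, f ω ∂P‖ₑ ^ 2) ^ q ≤ ∫⁻ ω, (‖f ω‖ₑ ^ 2) ^ q ∂P := by
  have e : ∀ x : ℝ≥0∞, (x ^ 2) ^ q = x ^ (2 * q) := fun x => by
    rw [← ENNReal.rpow_natCast, ← ENNReal.rpow_mul]; norm_num
  simp_rw [e]
  exact (ENNReal.rpow_le_rpow (enorm_integral_le_lintegral_enorm f) (by linarith)).trans
    (rpow_lintegral_le P hf.enorm.aemeasurable (by linarith))

/-- Jensen's inequality pulls the average over y out of the power; the rotation then replaces (x +
y, y - x) by two independent variables. -/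
theorem lintegral_decoupling (hμ : ∫ x, id x ∂μ = 0) {S : E × E → ℂ} (hS : Measurable S) {q : ℝ}
    (hq : 1 ≤ q) :
    ∫⁻ x, (‖∫ y, S (x + y, y - x) ∂μ‖ₑ ^ 2) ^ q ∂μ ≤
      ∫⁻ x, ∫⁻ y, (‖S (√2 • x, √2 • y)‖ₑ ^ 2) ^ q ∂μ ∂μ := by
  rw [← lintegral_rotation hμ (f := fun p => (‖S p‖ₑ ^ 2) ^ q) (by fun_prop)]
  exact lintegral_mono fun x => jensen_enorm_sq μ (by fun_prop) hq

theorem integrable_clm_mul (X Y : E →L[ℝ] ℂ) : Integrable (fun x => X x * Y x) μ := by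
  have h := (IsGaussian.memLp_id μ 2 (by simp)).integrable_norm_pow (by norm_num)
  refine (h.const_mul (‖X‖ * ‖Y‖)).mono' (by fun_prop) (Eventually.of_forall fun x => ?_)
  rw [norm_mul]
  calc _ ≤ (‖X‖ * ‖x‖) * (‖Y‖ * ‖x‖) := by gcongr <;> exact ContinuousLinearMap.le_opNorm _ _
    _ = _ := by simp only [id]; ring

theorem integrable_clm_mul_mul (X Y Z : E →L[ℝ] ℂ) :
    Integrable (fun x => X x * Y x * Z x) μ := by
  have h := (IsGaussian.memLp_id μ 3 (by simp)).integrable_norm_pow (by norm_num)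
  refine (h.const_mul (‖X‖ * ‖Y‖ * ‖Z‖)).mono' (by fun_prop) (Eventually.of_forall fun x => ?_)
  rw [norm_mul, norm_mul]
  calc _ ≤ (‖X‖ * ‖x‖) * (‖Y‖ * ‖x‖) * (‖Z‖ * ‖x‖) := by
        gcongr <;> exact ContinuousLinearMap.le_opNorm _ _
    _ = _ := by simp only [id]; ring

theorem integrable_clm (X : E →L[ℝ] ℂ) : Integrable (fun x => X x) μ :=
  X.integrable_comp (IsGaussian.integrable_id (μ := μ))

/-- Terms linear in y average to zero. The sign comes from the -x in the second factor. -/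
theorem wick_two_eq (hμ : ∫ x, id x ∂μ = 0) (Y Z : E →L[ℝ] ℂ) (x : E) :
    Integrable (fun y => Y (x + y) * Z (y - x)) μ ∧
    ∫ y, Y (x + y) * Z (y - x) ∂μ = -(Y x * Z x - ∫ y, Y y * Z y ∂μ) := by
  have hi := integrable_clm_mul (μ := μ) Y Z
  have hY := integrable_clm (μ := μ) Y
  have hZ := integrable_clm (μ := μ) Z
  have e : ∀ y, Y (x + y) * Z (y - x) = Y y * Z y + (Y x * Z y + (-Z x) * Y y + (-(Y x * Z x))) :=
    fun y => by rw [map_add, map_sub]; ring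
  have i1 := hZ.const_mul (Y x)
  have i2 := hY.const_mul (-Z x)
  have i3 : Integrable (fun _ : E => -(Y x * Z x)) μ := integrable_const _
  have i12 : Integrable (fun y => Y x * Z y + (-Z x) * Y y) μ := i1.add i2
  have i123 : Integrable (fun y => Y x * Z y + (-Z x) * Y y + (-(Y x * Z x))) μ := i12.add i3
  simp_rw [e]
  refine ⟨hi.add i123, ?_⟩
  rw [integral_add hi i123, integral_add i12 i3, integral_add i1 i2,
    integral_const_mul, integral_const_mul, integral_clm_eq_zero μ hμ, integral_clm_eq_zero μ hμ]
  simp; ring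

/-- The factor 2 in front of the covariance is needed because y - x, with both entries random, has
twice the covariance of y. Averaging over y then restores one of the two units, and the remaining
contractions come from X(y)Y(y) and X(y)Z(y). -/
theorem wick_three_eq (hμ : ∫ x, id x ∂μ = 0) (X Y Z : E →L[ℝ] ℂ) (x : E) :
    Integrable (fun y => X (x + y) * (Y (y - x) * Z (y - x) - 2 * ∫ w, Y w * Z w ∂μ)) μ ∧
    ∫ y, X (x + y) * (Y (y - x) * Z (y - x) - 2 * ∫ w, Y w * Z w ∂μ) ∂μ =
      wickTriple μ X Y Z x := by
  set κ := ∫ w, Y w * Z w ∂μ with hκ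
  -- The terms of odd degree in y, which average to zero by symmetry of μ.
  let odd : E → ℂ := fun y => X y * Y y * Z y + (Y x * Z x - 2 * κ) * X y + (-(X x * Z x)) * Y y +
    (-(X x * Y x)) * Z y
  have hodd : Integrable odd μ :=
    (((integrable_clm_mul_mul X Y Z).add ((integrable_clm X).const_mul _)).add
      ((integrable_clm Y).const_mul _)).add ((integrable_clm Z).const_mul _)
  have hodd0 : ∫ y, odd y ∂μ = 0 := by
    refine integral_odd_eq_zero hμ ?_ ?_
    · have mX := X.continuous.measurable
      have mY := Y.continuous.measurable
      have mZ := Z.continuous.measurable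
      fun_prop
    · intro y; simp only [odd, map_neg]; ring
  have e : ∀ y, X (x + y) * (Y (y - x) * Z (y - x) - 2 * κ) =
      odd y + (X x * (Y y * Z y) + (-Z x) * (X y * Y y) + (-Y x) * (X y * Z y) +
        (X x * Y x * Z x - 2 * κ * X x)) := fun y => by
    simp only [map_add, map_sub, odd]; ring
  have i1 := (integrable_clm_mul (μ := μ) Y Z).const_mul (X x)
  have i2 := (integrable_clm_mul (μ := μ) X Y).const_mul (-Z x)
  have i3 := (integrable_clm_mul (μ := μ) X Z).const_mul (-Y x)
  have i4 : Integrable (fun _ : E => X x * Y x * Z x - 2 * κ * X x) μ := integrable_const _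
  have i12 : Integrable (fun y => X x * (Y y * Z y) + (-Z x) * (X y * Y y)) μ := i1.add i2
  have i123 : Integrable (fun y => X x * (Y y * Z y) + (-Z x) * (X y * Y y) +
    (-Y x) * (X y * Z y)) μ := i12.add i3
  have i1234 : Integrable (fun y => X x * (Y y * Z y) + (-Z x) * (X y * Y y) +
    (-Y x) * (X y * Z y) + (X x * Y x * Z x - 2 * κ * X x)) μ := i123.add i4
  simp_rw [e]
  refine ⟨hodd.add i1234, ?_⟩
  rw [integral_add hodd i1234, hodd0, integral_add i123 i4, integral_add i12 i3, integral_add i1 i2, integral_const_mul, integral_const_mul,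
    integral_const_mul, ← hκ, wickTriple, ← hκ]
  simp; ring

variable {J₁ J₂ J₃ : Type*} {X : J₁ → E →L[ℝ] ℂ} {Y : J₂ → E →L[ℝ] ℂ} {Z : J₃ → E →L[ℝ] ℂ}
  {v₁ : J₁ → ℝ≥0∞} {v₂ : J₂ → ℝ≥0∞} {v₃ : J₃ → ℝ≥0∞}

/-- The factor 4 is the square of √2 · √2, produced by the rescaling in the rotation identity. -/
theorem lintegral_wick_two_le (hμ : ∫ x, id x ∂μ = 0) (s₂ : Finset J₂) (s₃ : Finset J₃)
    (B : J₂ → J₃ → ℂ) {q : ℝ} (hq : 1 ≤ q) :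
    ∫⁻ y, (‖∑ k ∈ s₃, ∑ j ∈ s₂, B j k * (Y j y * Z k y - ∫ w, Y j w * Z k w ∂μ)‖ₑ ^ 2) ^ q ∂μ ≤
      ENNReal.ofReal 4 ^ q *
        ∫⁻ y, ∫⁻ z, (‖∑ k ∈ s₃, (∑ j ∈ s₂, B j k * Y j y) * Z k z‖ₑ ^ 2) ^ q ∂μ ∂μ := by
  have hq0 : 0 ≤ q := by linarith
  have mY : ∀ i, Measurable (Y i) := fun i => (Y i).continuous.measurable
  have mZ : ∀ i, Measurable (Z i) := fun i => (Z i).continuous.measurable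
  let S : E × E → ℂ := fun p => ∑ k ∈ s₃, ∑ j ∈ s₂, B j k * (Y j p.1 * Z k p.2)
  have hS : Measurable S := by
    have h1 : ∀ j, Measurable fun p : E × E => Y j p.1 := fun j => (mY j).comp measurable_fst
    have h2 : ∀ j, Measurable fun p : E × E => Z j p.2 := fun j => (mZ j).comp measurable_snd
    fun_prop
  have e : ∀ y, ∑ k ∈ s₃, ∑ j ∈ s₂, B j k * (Y j y * Z k y - ∫ w, Y j w * Z k w ∂μ) =
      -∫ z, S (y + z, z - y) ∂μ := by
    intro y
    rw [integral_finsetSum _ (fun k _ => integrable_finsetSum _ fun j _ =>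
      (wick_two_eq hμ (Y j) (Z k) y).1.const_mul _), ← Finset.sum_neg_distrib]
    refine Finset.sum_congr rfl fun k _ => ?_
    rw [integral_finsetSum _ (fun j _ => (wick_two_eq hμ (Y j) (Z k) y).1.const_mul _),
      ← Finset.sum_neg_distrib]
    refine Finset.sum_congr rfl fun j _ => ?_
    rw [integral_const_mul, (wick_two_eq hμ (Y j) (Z k) y).2]; ring
  rw [lintegral_congr fun y => by rw [e y, enorm_neg]]
  refine (lintegral_decoupling hμ hS hq).trans (le_of_eq ?_)
  have e2 : ∀ y z, (‖S (√2 • y, √2 • z)‖ₑ ^ 2) ^ q = ENNReal.ofReal 4 ^ q *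
      (‖∑ k ∈ s₃, (∑ j ∈ s₂, B j k * Y j y) * Z k z‖ₑ ^ 2) ^ q := by
    intro y z
    have h2 : ((√2 : ℝ) : ℂ) * ((√2 : ℝ) : ℂ) = 2 := by
      rw [← Complex.ofReal_mul, Real.mul_self_sqrt (by norm_num)]; norm_num
    have : S (√2 • y, √2 • z) = 2 * ∑ k ∈ s₃, (∑ j ∈ s₂, B j k * Y j y) * Z k z := by
      simp only [S, Finset.mul_sum, Finset.sum_mul, map_smul, Complex.real_smul]
      refine Finset.sum_congr rfl fun k _ => Finset.sum_congr rfl fun j _ => ?_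
      linear_combination (B j k * Y j y * Z k z) * h2
    rw [this, enorm_mul, mul_pow, ENNReal.mul_rpow_of_nonneg _ _ hq0]
    congr 2
    rw [show ‖(2 : ℂ)‖ₑ = ENNReal.ofReal 2 by rw [← ofReal_norm]; norm_num,
      ← ENNReal.ofReal_pow (by norm_num)]
    norm_num
  rw [lintegral_congr fun y => lintegral_congr (e2 y)]
  have h4 : ENNReal.ofReal 4 ^ q ≠ ⊤ := ENNReal.rpow_ne_top_of_nonneg hq0 (by simp)
  rw [lintegral_congr fun y => lintegral_const_mul' _ _ h4, lintegral_const_mul' _ _ h4]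

/-- Moment bound for Wick-ordered cubic forms of Gaussian variables. -/
theorem lintegral_wick_three_le (hX : CovDominated μ X v₁) (hY : CovDominated μ Y v₂)
    (hZ : CovDominated μ Z v₃) (hμ : ∫ x, id x ∂μ = 0) (s₁ : Finset J₁) (s₂ : Finset J₂)
    (s₃ : Finset J₃) (A : J₁ → J₂ → J₃ → ℂ) {q : ℝ} (hq : 1 ≤ q) :
    ∫⁻ x, (‖∑ k ∈ s₃, ∑ j ∈ s₂, ∑ i ∈ s₁, A i j k * wickTriple μ (X i) (Y j) (Z k) x‖ₑ ^ 2) ^ q ∂μ ≤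
      (ENNReal.ofReal (256 * q ^ 3) *
        ∑ k ∈ s₃, ∑ j ∈ s₂, ∑ i ∈ s₁, ‖A i j k‖ₑ ^ 2 * v₁ i * v₂ j * v₃ k) ^ q := by
  have hq0 : 0 ≤ q := by linarith
  have mX : ∀ i, Measurable (X i) := fun i => (X i).continuous.measurable
  have mY : ∀ i, Measurable (Y i) := fun i => (Y i).continuous.measurable
  have mZ : ∀ i, Measurable (Z i) := fun i => (Z i).continuous.measurable
  have p1 : ∀ j, Measurable fun p : E × E => X j p.1 := fun j => (mX j).comp measurable_fst
  have p2 : ∀ j, Measurable fun p : E × E => Y j p.2 := fun j => (mY j).comp measurable_snd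
  have p3 : ∀ j, Measurable fun p : E × E => Z j p.2 := fun j => (mZ j).comp measurable_snd
  let T : E × E → ℂ := fun p => ∑ k ∈ s₃, ∑ j ∈ s₂, ∑ i ∈ s₁,
    A i j k * (X i p.1 * (Y j p.2 * Z k p.2 - 2 * ∫ w, Y j w * Z k w ∂μ))
  have hT : Measurable T := by fun_prop
  have hi : ∀ x i j k, Integrable (fun y => A i j k * (X i (x + y) *
      (Y j (y - x) * Z k (y - x) - 2 * ∫ w, Y j w * Z k w ∂μ))) μ := fun x i j k =>
    (wick_three_eq hμ (X i) (Y j) (Z k) x).1.const_mul _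
  have e : ∀ x, ∑ k ∈ s₃, ∑ j ∈ s₂, ∑ i ∈ s₁, A i j k * wickTriple μ (X i) (Y j) (Z k) x =
      ∫ y, T (x + y, y - x) ∂μ := by
    intro x
    rw [integral_finsetSum _ (fun k _ => integrable_finsetSum _ fun j _ =>
      integrable_finsetSum _ fun i _ => hi x i j k)]
    refine Finset.sum_congr rfl fun k _ => ?_
    rw [integral_finsetSum _ (fun j _ => integrable_finsetSum _ fun i _ => hi x i j k)]
    refine Finset.sum_congr rfl fun j _ => ?_
    rw [integral_finsetSum _ (fun i _ => hi x i j k)]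
    refine Finset.sum_congr rfl fun i _ => ?_
    rw [integral_const_mul, (wick_three_eq hμ (X i) (Y j) (Z k) x).2]
  rw [lintegral_congr fun x => by rw [e x]]
  refine (lintegral_decoupling hμ hT hq).trans ?_
  -- Rescaling a cubic form gives (2√2)² = 8, and the inner covariance 2∫YZ becomes the correct one.
  -- The remaining quadratic Wick product in y is decoupled a second time, with x frozen; altogether
  -- 8 · 4 · (2q)³ = 256 q³.
  have e2 : ∀ x y, (‖T (√2 • x, √2 • y)‖ₑ ^ 2) ^ q = ENNReal.ofReal 8 ^ q *
      (‖∑ k ∈ s₃, ∑ j ∈ s₂, (∑ i ∈ s₁, A i j k * X i x) *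
        (Y j y * Z k y - ∫ w, Y j w * Z k w ∂μ)‖ₑ ^ 2) ^ q := by
    intro x y
    have h2 : ((√2 : ℝ) : ℂ) * ((√2 : ℝ) : ℂ) = 2 := by
      rw [← Complex.ofReal_mul, Real.mul_self_sqrt (by norm_num)]; norm_num
    have : T (√2 • x, √2 • y) = (2 * ((√2 : ℝ) : ℂ)) * ∑ k ∈ s₃, ∑ j ∈ s₂,
        (∑ i ∈ s₁, A i j k * X i x) * (Y j y * Z k y - ∫ w, Y j w * Z k w ∂μ) := by
      simp only [T, Finset.mul_sum, Finset.sum_mul, map_smul, Complex.real_smul]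
      refine Finset.sum_congr rfl fun k _ => Finset.sum_congr rfl fun j _ =>
        Finset.sum_congr rfl fun i _ => ?_
      linear_combination (A i j k * X i x * Y j y * Z k y * ((√2 : ℝ) : ℂ)) * h2
    rw [this, enorm_mul, mul_pow, ENNReal.mul_rpow_of_nonneg _ _ hq0]
    congr 2
    rw [← ofReal_norm, ← ENNReal.ofReal_pow (by positivity), norm_mul, mul_pow, Complex.norm_real,
      Real.norm_eq_abs, sq_abs, Real.sq_sqrt (by norm_num)]
    norm_num
  rw [lintegral_congr fun x => lintegral_congr (e2 x)]
  have h8 : ENNReal.ofReal 8 ^ q ≠ ⊤ := ENNReal.rpow_ne_top_of_nonneg hq0 (by simp)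
  rw [lintegral_congr fun x => lintegral_const_mul' _ _ h8]
  calc _ ≤ ∫⁻ x, ENNReal.ofReal 8 ^ q * (ENNReal.ofReal 4 ^ q * ∫⁻ y, ∫⁻ z,
        (‖∑ k ∈ s₃, (∑ j ∈ s₂, (∑ i ∈ s₁, A i j k * X i x) * Y j y) * Z k z‖ₑ ^ 2) ^ q ∂μ ∂μ) ∂μ := by
        refine lintegral_mono fun x => ?_
        refine mul_le_mul_right ?_ _
        exact lintegral_wick_two_le hμ s₂ s₃ (fun j k => ∑ i ∈ s₁, A i j k * X i x) hq
    _ = ENNReal.ofReal 8 ^ q * (ENNReal.ofReal 4 ^ q * ∫⁻ x, ∫⁻ y, ∫⁻ z,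
        (‖∑ k ∈ s₃, (∑ j ∈ s₂, (∑ i ∈ s₁, A i j k * X i x) * Y j y) * Z k z‖ₑ ^ 2) ^ q ∂μ ∂μ ∂μ) := by
        rw [lintegral_const_mul' _ _ (ENNReal.rpow_ne_top_of_nonneg hq0 (by simp)),
          lintegral_const_mul' _ _ (ENNReal.rpow_ne_top_of_nonneg hq0 (by simp))]
    _ ≤ ENNReal.ofReal 8 ^ q * (ENNReal.ofReal 4 ^ q * (ENNReal.ofReal (2 * q) ^ 3 *
        ∑ k ∈ s₃, ∑ j ∈ s₂, ∑ i ∈ s₁, ‖A i j k‖ₑ ^ 2 * v₁ i * v₂ j * v₃ k) ^ q) := by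
        gcongr
        exact lintegral_decoupled_triple_le hX hY hZ hμ s₁ s₂ s₃ A hq
    _ = _ := by
        rw [← ENNReal.mul_rpow_of_nonneg _ _ hq0, ← ENNReal.mul_rpow_of_nonneg _ _ hq0]
        congr 1
        rw [← mul_assoc, ← mul_assoc, ← ENNReal.ofReal_pow (by positivity),
          ← ENNReal.ofReal_mul (by norm_num), ← ENNReal.ofReal_mul (by norm_num)]
        congr 2; ring

end Chaos

/-! ### Gaussian data on finitely many frequencies -/

/-- A set of representatives of the frequencies modulo sign. -/
def halfSpace : Set Freq :=
  {n | 0 < n 0 ∨ (n 0 = 0 ∧ (0 < n 1 ∨ (n 1 = 0 ∧ 0 ≤ n 2)))}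

theorem neg_mem_halfSpace {n : Freq} (h : n ∉ halfSpace) : -n ∈ halfSpace := by
  simp only [halfSpace, Set.mem_ofPred_eq, Pi.neg_apply] at h ⊢; omega

theorem eq_zero_of_mem_halfSpace {n : Freq} (h : n ∈ halfSpace) (h' : -n ∈ halfSpace) : n = 0 := by
  simp only [halfSpace, Set.mem_ofPred_eq, Pi.neg_apply] at h h'
  funext i; fin_cases i <;> simp <;> omega

/-- `(a, b) ↦ a + i b` as a real-linear map. -/
def toComplexCLM : ℝ × ℝ →L[ℝ] ℂ :=
  Complex.ofRealCLM.comp (ContinuousLinearMap.fst ℝ ℝ ℝ) +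
    Complex.I • Complex.ofRealCLM.comp (ContinuousLinearMap.snd ℝ ℝ ℝ)

theorem toComplexCLM_apply (q : ℝ × ℝ) :
    toComplexCLM q = (q.1 : ℂ) + Complex.I * (q.2 : ℂ) := by
  simp [toComplexCLM]

theorem integral_sq_gaussianReal (v : NNReal) : ∫ x, x ^ 2 ∂gaussianReal 0 v = v := by
  have h := variance_fun_id_gaussianReal (μ := 0) (v := v)
  rw [variance_eq_integral (by fun_prop)] at h
  simpa using h

section Data

variable {Ω : Type*} [MeasurableSpace Ω] {P : Measure Ω}
  {W : Fin 2 → Freq → Ω → ℂ}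

theorem IsGaussianData.law' (hW : IsGaussianData P W) (i : Fin 2) {n : Freq} (hn : n ≠ 0) :
    P.map (W i n) = ((gaussianReal 0 (1 / (2 * jap n ^ 2)).toNNReal).prod
      (gaussianReal 0 (1 / (2 * jap n ^ 2)).toNNReal)).map toComplexCLM := by
  rw [hW.law i n hn]
  simp_rw [← toComplexCLM_apply]

theorem IsGaussianData.hasGaussianLaw (hW : IsGaussianData P W) (i : Fin 2) (n : Freq) :
    HasGaussianLaw (W i n) P := by
  constructor
  by_cases hn : n = 0
  · subst hn
    rw [hW.law_zero i]
    exact isGaussian_map (μ := gaussianReal 0 1) Complex.ofRealCLM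
  · rw [hW.law' i hn]
    infer_instance

theorem IsGaussianData.memLp (hW : IsGaussianData P W) (i : Fin 2) (n : Freq) :
    MemLp (W i n) 2 P := (hW.hasGaussianLaw i n).memLp (by simp)

theorem IsGaussianData.integral_eq_zero [IsProbabilityMeasure P] (hW : IsGaussianData P W) (i : Fin 2) (n : Freq) :
    ∫ ω, W i n ω ∂P = 0 := by
  have h1 : ∫ ω, W i n ω ∂P = ∫ z, z ∂(P.map (W i n)) :=
    by rw [integral_map (hW.measurable i n).aemeasurable (by fun_prop)]
  rw [h1]
  by_cases hn : n = 0
  · subst hn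
    rw [hW.law_zero i, integral_map (by fun_prop) (by fun_prop), integral_complex_ofReal,
      integral_id_gaussianReal]
    simp
  · rw [hW.law' i hn, integral_map toComplexCLM.continuous.measurable.aemeasurable (by fun_prop)]
    apply integral_clm_eq_zero
    set γ := gaussianReal 0 (1 / (2 * jap n ^ 2)).toNNReal
    have hint := IsGaussian.integrable_id (μ := γ.prod γ)
    refine Prod.ext ?_ ?_
    · have := (ContinuousLinearMap.fst ℝ ℝ ℝ).integral_comp_comm hint
      simp only [id] at this
      change (ContinuousLinearMap.fst ℝ ℝ ℝ) (∫ x, x ∂γ.prod γ) = 0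
      rw [← this]
      have h2 := integral_prod_mul (μ := γ) (ν := γ) (fun x : ℝ => x) (fun _ : ℝ => (1 : ℝ))
      simp only [mul_one] at h2
      rw [show γ = gaussianReal 0 _ from rfl] at h2 ⊢
      simpa [integral_id_gaussianReal] using h2
    · have := (ContinuousLinearMap.snd ℝ ℝ ℝ).integral_comp_comm hint
      simp only [id] at this
      change (ContinuousLinearMap.snd ℝ ℝ ℝ) (∫ x, x ∂γ.prod γ) = 0
      rw [← this]
      have h2 := integral_prod_mul (μ := γ) (ν := γ) (fun _ : ℝ => (1 : ℝ)) (fun x : ℝ => x)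
      simp only [one_mul] at h2
      rw [show γ = gaussianReal 0 _ from rfl] at h2 ⊢
      simpa [integral_id_gaussianReal] using h2

theorem integral_prod_sq_gaussian (v : NNReal) :
    Integrable (fun q : ℝ × ℝ => q.1 ^ 2) ((gaussianReal 0 v).prod (gaussianReal 0 v)) ∧
    Integrable (fun q : ℝ × ℝ => q.2 ^ 2) ((gaussianReal 0 v).prod (gaussianReal 0 v)) ∧
    Integrable (fun q : ℝ × ℝ => q.1 * q.2) ((gaussianReal 0 v).prod (gaussianReal 0 v)) ∧
    ∫ q, q.1 ^ 2 ∂((gaussianReal 0 v).prod (gaussianReal 0 v)) = v ∧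
    ∫ q, q.2 ^ 2 ∂((gaussianReal 0 v).prod (gaussianReal 0 v)) = v ∧
    ∫ q, q.1 * q.2 ∂((gaussianReal 0 v).prod (gaussianReal 0 v)) = 0 := by
  have hL := (memLp_id_gaussianReal (μ := 0) (v := v) 2)
  have hsq : Integrable (fun x : ℝ => x ^ 2) (gaussianReal 0 v) := hL.integrable_sq
  have h1 : Integrable (fun x : ℝ => x) (gaussianReal 0 v) := hL.integrable (by simp)
  have a1 := integral_prod_mul (μ := gaussianReal 0 v) (ν := gaussianReal 0 v)
    (fun x : ℝ => x ^ 2) (fun _ : ℝ => (1 : ℝ))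
  have a2 := integral_prod_mul (μ := gaussianReal 0 v) (ν := gaussianReal 0 v)
    (fun _ : ℝ => (1 : ℝ)) (fun x : ℝ => x ^ 2)
  have a3 := integral_prod_mul (μ := gaussianReal 0 v) (ν := gaussianReal 0 v)
    (fun x : ℝ => x) (fun x : ℝ => x)
  rw [integral_sq_gaussianReal] at a1 a2
  rw [integral_id_gaussianReal] at a3
  simp only [mul_one, one_mul, mul_zero, integral_const, smul_eq_mul, probReal_univ] at a1 a2 a3
  refine ⟨hsq.comp_fst _, hsq.comp_snd _, h1.mul_prod h1, a1, a2, a3⟩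

theorem IsGaussianData.integral_sq [IsProbabilityMeasure P] (hW : IsGaussianData P W) (i : Fin 2) {n : Freq} (hn : n ≠ 0) :
    ∫ ω, W i n ω * W i n ω ∂P = 0 := by
  have h1 : ∫ ω, W i n ω * W i n ω ∂P = ∫ z, z * z ∂(P.map (W i n)) :=
    by rw [integral_map (hW.measurable i n).aemeasurable (by fun_prop)]
  rw [h1, hW.law' i hn, integral_map toComplexCLM.continuous.measurable.aemeasurable (by fun_prop)]
  set v := (1 / (2 * jap n ^ 2)).toNNReal
  obtain ⟨i1, i2, i3, e1, e2, e3⟩ := integral_prod_sq_gaussian v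
  have e : ∀ q : ℝ × ℝ, toComplexCLM q * toComplexCLM q =
      ((q.1 ^ 2 - q.2 ^ 2 : ℝ) : ℂ) + (2 * Complex.I) * ((q.1 * q.2 : ℝ) : ℂ) := fun q => by
    rw [toComplexCLM_apply]; push_cast
    linear_combination (q.2 : ℂ) ^ 2 * Complex.I_mul_I
  simp_rw [e]
  have j1 : Integrable (fun q : ℝ × ℝ => ((q.1 ^ 2 - q.2 ^ 2 : ℝ) : ℂ))
    ((gaussianReal 0 v).prod (gaussianReal 0 v)) := (i1.sub i2).ofReal
  have j2 : Integrable (fun q : ℝ × ℝ => (2 * Complex.I) * ((q.1 * q.2 : ℝ) : ℂ))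
    ((gaussianReal 0 v).prod (gaussianReal 0 v)) := i3.ofReal.const_mul _
  rw [integral_add j1 j2, integral_const_mul, integral_complex_ofReal, integral_complex_ofReal, e3,
    integral_sub i1 i2, e1, e2]
  simp

theorem IsGaussianData.integral_mul_conj [IsProbabilityMeasure P] (hW : IsGaussianData P W) (i : Fin 2) (n : Freq) :
    ∫ ω, W i n ω * star (W i n ω) ∂P = ((1 / jap n ^ 2 : ℝ) : ℂ) := by
  have h1 : ∫ ω, W i n ω * star (W i n ω) ∂P = ∫ z, z * star z ∂(P.map (W i n)) :=
    by rw [integral_map (hW.measurable i n).aemeasurable (by fun_prop)]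
  rw [h1]
  by_cases hn : n = 0
  · subst hn
    rw [hW.law_zero i, integral_map (by fun_prop) (by fun_prop)]
    have e : ∀ a : ℝ, (a : ℂ) * star (a : ℂ) = ((a ^ 2 : ℝ) : ℂ) := fun a => by
      simp [pow_two]
    simp_rw [e]
    rw [integral_complex_ofReal, integral_sq_gaussianReal]
    simp [jap, freqLen_zero, bracket]
  · rw [hW.law' i hn, integral_map toComplexCLM.continuous.measurable.aemeasurable (by fun_prop)]
    obtain ⟨i1, i2, -, e1, e2, -⟩ := integral_prod_sq_gaussian (1 / (2 * jap n ^ 2)).toNNReal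
    have e : ∀ q : ℝ × ℝ, toComplexCLM q * star (toComplexCLM q) =
        ((q.1 ^ 2 + q.2 ^ 2 : ℝ) : ℂ) := fun q => by
      rw [toComplexCLM_apply]; simp
      linear_combination (-(q.2 : ℂ) ^ 2) * Complex.I_mul_I
    simp_rw [e]
    rw [integral_complex_ofReal, integral_add i1 i2, e1, e2, Real.coe_toNNReal _ (by positivity)]
    congr 1
    have := jap_pos n
    field_simp; norm_num

/-- The covariance of the Gaussian data. -/
theorem IsGaussianData.covariance [IsProbabilityMeasure P] (hW : IsGaussianData P W) (i j : Fin 2) (n k : Freq) :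
    ∫ ω, W i n ω * W j k ω ∂P = if i = j ∧ n + k = 0 then ((1 / jap n ^ 2 : ℝ) : ℂ) else 0 := by
  by_cases hk : n + k = 0
  · obtain rfl : k = -n := by rw [eq_neg_iff_add_eq_zero, add_comm]; exact hk
    have e : ∫ ω, W i n ω * W j (-n) ω ∂P = ∫ ω, W i n ω * star (W j n ω) ∂P :=
      integral_congr_ae (by filter_upwards [hW.conj j n] with ω hω; rw [hω])
    rw [e]
    by_cases hij : i = j
    · subst hij; rw [if_pos ⟨rfl, hk⟩]; exact hW.integral_mul_conj i n
    · rw [if_neg (fun h => hij h.1)]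
      have hS := hW.indep {n} (by
        intro a ha ha'
        rw [Set.mem_singleton_iff] at ha ha'
        subst ha
        funext l
        have := congrFun ha' l
        simp only [Pi.neg_apply] at this
        simp only [Pi.zero_apply]; omega)
      have h2 : IndepFun (W i n) (W j n) P := hS.indepFun (i := (i, ⟨n, rfl⟩)) (j := (j, ⟨n, rfl⟩))
        (by simp [hij])
      have h3 : IndepFun (W i n) (fun ω => star (W j n ω)) P :=
        h2.comp measurable_id (show Measurable (fun z : ℂ => star z) by fun_prop)
      have h4 := h3.integral_mul_eq_mul_integral (hW.measurable i n).aestronglyMeasurable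
        (by have := hW.measurable j n; fun_prop)
      have h5 : ∫ ω, W i n ω * star (W j n ω) ∂P = (∫ ω, W i n ω ∂P) * ∫ ω, star (W j n ω) ∂P := h4
      rw [h5, hW.integral_eq_zero, zero_mul]
  · rw [if_neg (fun h => hk h.2)]
    by_cases heq : i = j ∧ n = k
    · obtain ⟨rfl, rfl⟩ := heq
      exact hW.integral_sq i (fun h0 => hk (by rw [h0, add_zero]))
    · have hS := hW.indep {n, k} (by
        intro a ha ha'
        simp only [Set.mem_insert_iff, Set.mem_singleton_iff] at ha ha'
        have hself : ∀ b : Freq, -b = b → b = 0 := fun b hb => by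
          funext l
          have := congrFun hb l
          simp only [Pi.neg_apply] at this
          simp only [Pi.zero_apply]; omega
        rcases ha with rfl | rfl <;> rcases ha' with h | h
        · exact hself _ h
        · exact absurd (by rw [← h, add_neg_cancel]) hk
        · exact absurd (by rw [← h, neg_add_cancel]) hk
        · exact hself _ h)
      have h2 : IndepFun (W i n) (W j k) P := hS.indepFun (i := (i, ⟨n, by simp⟩))
        (j := (j, ⟨k, by simp⟩)) (by
          intro h
          simp only [Prod.mk.injEq, Subtype.mk.injEq] at h
          exact heq h)
      have h4 : ∫ ω, W i n ω * W j k ω ∂P = (∫ ω, W i n ω ∂P) * ∫ ω, W j k ω ∂P :=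
        h2.integral_mul_eq_mul_integral (hW.measurable i n).aestronglyMeasurable
          (hW.measurable j k).aestronglyMeasurable
      rw [h4, hW.integral_eq_zero, zero_mul]

/-- The Gaussian data on a finite symmetric set of frequencies is jointly Gaussian. -/
theorem IsGaussianData.hasGaussianLaw_pi (hW : IsGaussianData P W) (F : Finset Freq)
    (hF : ∀ n ∈ F, -n ∈ F) :
    HasGaussianLaw (fun ω (p : Fin 2 × F) => W p.1 p.2 ω) P := by
  classical
  let I := Fin 2 × {n : F // (n : Freq) ∈ halfSpace}
  have hind : iIndepFun (fun q : I => W q.1 q.2.1) P := by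
    have h := hW.indep halfSpace (fun n hn hn' => eq_zero_of_mem_halfSpace hn hn')
    refine h.precomp (g := fun q : I => (q.1, (⟨q.2.1, q.2.2⟩ : halfSpace))) ?_
    rintro ⟨i, ⟨⟨n, h1⟩, h2⟩⟩ ⟨j, ⟨⟨k, h3⟩, h4⟩⟩ h
    simp only [Prod.mk.injEq, Subtype.mk.injEq] at h
    obtain ⟨rfl, rfl⟩ := h; rfl
  have hG : HasGaussianLaw (fun ω (q : I) => W q.1 q.2.1 ω) P :=
    hind.hasGaussianLaw (fun q => hW.hasGaussianLaw q.1 q.2.1)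
  -- The coefficients at representatives modulo sign are independent, hence jointly Gaussian; the
  -- others are complex conjugates of these, so the whole vector is a real-linear image.
  let L : (I → ℂ) →L[ℝ] (Fin 2 × F → ℂ) := ContinuousLinearMap.pi fun p =>
    if h : (p.2 : Freq) ∈ halfSpace then
      ContinuousLinearMap.proj (R := ℝ) (φ := fun _ : I => ℂ) (p.1, ⟨p.2, h⟩)
    else (Complex.conjCLE : ℂ →L[ℝ] ℂ).comp
      (ContinuousLinearMap.proj (R := ℝ) (φ := fun _ : I => ℂ)
        (p.1, ⟨⟨-p.2, hF p.2 p.2.2⟩, neg_mem_halfSpace h⟩))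
  refine (hG.map_fun L).congr ?_
  have hall : ∀ᵐ ω ∂P, ∀ p : Fin 2 × F, W p.1 (-p.2) ω = star (W p.1 p.2 ω) :=
    ae_all_iff.2 fun p => hW.conj p.1 p.2
  filter_upwards [hall] with ω hω
  funext p
  simp only [L, ContinuousLinearMap.coe_pi']
  split_ifs with h
  · simp
  · have := hω p
    simp [this]

theorem IsGaussianData.halfWave_memLp (hW : IsGaussianData P W) (ε : ℤˣ) (n : Freq) :
    MemLp (halfWave W ε n) 2 P := by
  have h := (hW.memLp 0 n).sub ((hW.memLp 1 n).const_mul (((ε : ℤ) : ℂ) * Complex.I))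
  exact h

theorem units_mul_self (ε : ℤˣ) : ((ε : ℤ) : ℂ) * ((ε : ℤ) : ℂ) = 1 := by
  have : ((ε : ℤ) * (ε : ℤ)) = 1 := by
    rcases Int.units_eq_one_or ε with rfl | rfl <;> simp
  exact_mod_cast this

/-- The cosine and sine fields contribute 1/⟨n⟩² each and their cross terms vanish; this is the
source of the variance 2/⟨n⟩². -/
theorem IsGaussianData.halfWave_covariance [IsProbabilityMeasure P] (hW : IsGaussianData P W) (ε : ℤˣ) (n k : Freq) :
    ∫ ω, halfWave W ε n ω * star (halfWave W ε k ω) ∂P =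
      if n = k then ((2 / jap n ^ 2 : ℝ) : ℂ) else 0 := by
  have hint : ∀ i j, Integrable (fun ω => W i n ω * W j (-k) ω) P := fun i j =>
    (hW.memLp i n).integrable_mul (hW.memLp j (-k))
  set e : ℂ := ((ε : ℤ) : ℂ) with he
  have hee : e * e = 1 := units_mul_self ε
  have hes : (starRingEnd ℂ) e = e := by rw [he]; simp
  have e1 : ∫ ω, halfWave W ε n ω * star (halfWave W ε k ω) ∂P =
      ∫ ω, (W 0 n ω * W 0 (-k) ω + (e * Complex.I) * (W 0 n ω * W 1 (-k) ω) +
        (-(e * Complex.I)) * (W 1 n ω * W 0 (-k) ω) + W 1 n ω * W 1 (-k) ω) ∂P := by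
    refine integral_congr_ae ?_
    filter_upwards [hW.conj 0 k, hW.conj 1 k] with ω h0 h1
    simp only [halfWave, ← he, h0, h1, star_sub, star_mul']
    simp only [RCLike.star_def, hes, Complex.conj_I]
    linear_combination (-(W 1 n ω * (starRingEnd ℂ) (W 1 k ω))) * Complex.I_mul_I * (e * e) +
      (W 1 n ω * (starRingEnd ℂ) (W 1 k ω)) * hee
  have i2 := (hint 0 1).const_mul (e * Complex.I)
  have i3 := (hint 1 0).const_mul (-(e * Complex.I))
  have i12 : Integrable (fun ω => W 0 n ω * W 0 (-k) ω +
    (e * Complex.I) * (W 0 n ω * W 1 (-k) ω)) P := (hint 0 0).add i2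
  have i123 : Integrable (fun ω => W 0 n ω * W 0 (-k) ω +
    (e * Complex.I) * (W 0 n ω * W 1 (-k) ω) + (-(e * Complex.I)) * (W 1 n ω * W 0 (-k) ω)) P :=
    i12.add i3
  rw [e1, integral_add i123 (hint 1 1), integral_add i12 i3, integral_add (hint 0 0) i2,
    integral_const_mul, integral_const_mul, hW.covariance, hW.covariance, hW.covariance,
    hW.covariance]
  have hnk : n + -k = 0 ↔ n = k := by rw [← sub_eq_add_neg, sub_eq_zero]
  simp only [hnk]
  by_cases h : n = k
  · simp [h]; ring
  · simp [h]

theorem IsGaussianData.halfWave_lintegral [IsProbabilityMeasure P] (hW : IsGaussianData P W) (ε : ℤˣ) (s : Finset Freq)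
    (c : Freq → ℂ) :
    ∫⁻ ω, ‖∑ n ∈ s, c n * halfWave W ε n ω‖ₑ ^ 2 ∂P =
      ∑ n ∈ s, ‖c n‖ₑ ^ 2 * ENNReal.ofReal (2 / jap n ^ 2) := by
  have hmem : MemLp (fun ω => ∑ n ∈ s, c n * halfWave W ε n ω) 2 P :=
    memLp_finsetSum s fun n _ => (hW.halfWave_memLp ε n).const_mul (c n)
  have hint : ∀ n k, Integrable (fun ω => halfWave W ε n ω * star (halfWave W ε k ω)) P :=
    fun n k => (hW.halfWave_memLp ε n).integrable_mul (hW.halfWave_memLp ε k).star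
  have e1 : ∀ z : ℂ, ‖z‖ₑ ^ 2 = ENNReal.ofReal (‖z‖ ^ 2) := fun z => by
    rw [ENNReal.ofReal_pow (norm_nonneg _), ofReal_norm]
  have e2 : ∫⁻ ω, ‖∑ n ∈ s, c n * halfWave W ε n ω‖ₑ ^ 2 ∂P =
      ENNReal.ofReal (∫ ω, ‖∑ n ∈ s, c n * halfWave W ε n ω‖ ^ 2 ∂P) := by
    rw [ofReal_integral_eq_lintegral_ofReal hmem.integrable_norm_pow'
      (Eventually.of_forall fun ω => by positivity)]
    simp_rw [e1]
  have e3 : ((∫ ω, ‖∑ n ∈ s, c n * halfWave W ε n ω‖ ^ 2 ∂P : ℝ) : ℂ) =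
      ((∑ n ∈ s, ‖c n‖ ^ 2 * (2 / jap n ^ 2) : ℝ) : ℂ) := by
    rw [← integral_complex_ofReal]
    have : ∀ ω, ((‖∑ n ∈ s, c n * halfWave W ε n ω‖ ^ 2 : ℝ) : ℂ) =
        ∑ n ∈ s, ∑ k ∈ s, (c n * star (c k)) * (halfWave W ε n ω * star (halfWave W ε k ω)) := by
      intro ω
      rw [← Complex.normSq_eq_norm_sq, Complex.normSq_eq_conj_mul_self, mul_comm,
        map_sum, Finset.sum_mul_sum]
      refine Finset.sum_congr rfl fun n _ => Finset.sum_congr rfl fun k _ => ?_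
      simp only [map_mul, RCLike.star_def]; ring
    rw [integral_congr_ae (Eventually.of_forall this)]
    rw [integral_finsetSum _ fun n _ => integrable_finsetSum _ fun k _ => (hint n k).const_mul _]
    push_cast
    refine Finset.sum_congr rfl fun n hn => ?_
    rw [integral_finsetSum _ fun k _ => (hint n k).const_mul _]
    simp_rw [integral_const_mul, hW.halfWave_covariance]
    rw [Finset.sum_eq_single n]
    · simp only [if_true]
      have : c n * star (c n) = (‖c n‖ : ℂ) ^ 2 := Complex.mul_conj' (c n)
      rw [this]; push_cast; ring
    · intro k _ hk; rw [if_neg (Ne.symm hk), mul_zero]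
    · exact fun h => absurd hn h
  rw [e2, Complex.ofReal_injective e3, ENNReal.ofReal_sum_of_nonneg (fun n _ => by positivity)]
  refine Finset.sum_congr rfl fun n _ => ?_
  rw [ENNReal.ofReal_mul (by positivity), e1]

theorem sum_triple_eq {M : Type*} [AddCommMonoid M] (F : Finset Freq) (s : Finset (Fin 3 → Freq))
    (hs : ∀ m ∈ s, ∀ j, m j ∈ F) (g : (Fin 3 → Freq) → M) (hg : ∀ m ∉ s, g m = 0) :
    ∑ k ∈ F, ∑ j ∈ F, ∑ i ∈ F, g ![i, j, k] = ∑ m ∈ s, g m := by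
  classical
  have h1 : ∑ m ∈ s, g m = ∑ m ∈ Fintype.piFinset (fun _ : Fin 3 => F), g m :=
    Finset.sum_subset (fun m hm => Fintype.mem_piFinset.2 (hs m hm)) fun m _ hm => hg m hm
  rw [h1]
  simp_rw [← Finset.sum_product']
  symm
  refine Finset.sum_nbij' (fun m => (m 2, m 1, m 0)) (fun p => ![p.2.2, p.2.1, p.1]) ?_ ?_ ?_ ?_ ?_
  · intro m hm
    rw [Fintype.mem_piFinset] at hm
    simp [hm]
  · intro p hp
    simp only [Finset.mem_product] at hp
    rw [Fintype.mem_piFinset]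
    intro j; fin_cases j <;> simp [hp]
  · intro m _; ext j; fin_cases j <;> rfl
  · intro p _; rfl
  · intro m _
    congr 1
    funext j; fin_cases j <;> rfl

theorem measurable_halfWave (hW : IsGaussianData P W) (ε : ℤˣ) (n : Freq) :
    Measurable (halfWave W ε n) := by
  have h0 := hW.measurable 0 n
  have h1 := hW.measurable 1 n
  unfold halfWave
  fun_prop

theorem measurable_tripleIntegral (hW : IsGaussianData P W) (ε : Fin 3 → ℤˣ) (m : Fin 3 → Freq) :
    Measurable (tripleIntegral P W ε m) := by
  have h := fun j => measurable_halfWave hW (ε j) (m j)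
  have h0 := h 0
  have h1 := h 1
  have h2 := h 2
  unfold tripleIntegral wickTriple
  fun_prop

/-- Moment bound for finite linear combinations of triple stochastic integrals. -/
theorem IsGaussianData.moment_bound [IsProbabilityMeasure P] (hW : IsGaussianData P W) (ε : Fin 3 → ℤˣ)
    (s : Finset (Fin 3 → Freq)) (A : (Fin 3 → Freq) → ℂ) {q : ℝ} (hq : 1 ≤ q) :
    ∫⁻ ω, (‖∑ m ∈ s, A m * tripleIntegral P W ε m ω‖ₑ ^ 2) ^ q ∂P ≤
      (ENNReal.ofReal (2048 * q ^ 3) *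
        ∑ m ∈ s, ‖A m‖ₑ ^ 2 * ENNReal.ofReal (∏ j, jap (m j) ^ (-2 : ℝ))) ^ q := by
  classical
  set F₀ : Finset Freq := s.biUnion fun m => Finset.univ.image m with hF₀
  -- Closing the set under n ↦ -n makes the vector of coefficients Gaussian, so the abstract chaos
  -- bound applies to its law μ.
  set F : Finset Freq := F₀ ∪ F₀.image (fun n => -n) with hFd
  have hF : ∀ n ∈ F, -n ∈ F := by
    intro n hn
    rw [hFd, Finset.mem_union, Finset.mem_image] at hn ⊢
    rcases hn with hn | ⟨k, hk, rfl⟩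
    · exact Or.inr ⟨n, hn, rfl⟩
    · left; simpa using hk
  have hsF : ∀ m ∈ s, ∀ j, m j ∈ F := fun m hm j => by
    rw [hFd, Finset.mem_union, hF₀, Finset.mem_biUnion]
    exact Or.inl ⟨m, hm, Finset.mem_image.2 ⟨j, Finset.mem_univ _, rfl⟩⟩
  let Wv : Ω → (Fin 2 × F → ℂ) := fun ω p => W p.1 p.2 ω
  have hWm : Measurable Wv := measurable_pi_lambda _ fun p => hW.measurable p.1 p.2
  have hG := hW.hasGaussianLaw_pi F hF
  set μ := P.map Wv with hμd
  have : IsGaussian μ := hG.isGaussian_map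
  have hμ : ∫ x, id x ∂μ = 0 := by
    funext p
    have h1 := (ContinuousLinearMap.proj (R := ℝ) (φ := fun _ : Fin 2 × F => ℂ) p).integral_comp_comm
      (IsGaussian.integrable_id (μ := μ))
    simp only [id, ContinuousLinearMap.proj_apply] at h1 ⊢
    rw [← h1, hμd, integral_map hWm.aemeasurable
      (show Measurable fun x : Fin 2 × F → ℂ => x p from measurable_pi_apply p).aestronglyMeasurable]
    exact hW.integral_eq_zero p.1 p.2
  let X : ℤˣ → Freq → ((Fin 2 × F → ℂ) →L[ℝ] ℂ) := fun e n =>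
    if h : n ∈ F then ContinuousLinearMap.proj (R := ℝ) (φ := fun _ : Fin 2 × F => ℂ) (0, ⟨n, h⟩) -
      (((e : ℤ) : ℂ) * Complex.I) •
        ContinuousLinearMap.proj (R := ℝ) (φ := fun _ : Fin 2 × F => ℂ) (1, ⟨n, h⟩)
    else 0
  have hX : ∀ e, ∀ n ∈ F, ∀ ω, X e n (Wv ω) = halfWave W e n ω := by
    intro e n hn ω
    simp [X, hn, Wv, halfWave]
  -- Frequencies outside F give zero functionals, so here the covariance bound is only an
  -- inequality; this is why domination is all that is asked for.
  have hcov : ∀ e, CovDominated μ (X e) (fun n => ENNReal.ofReal (2 / jap n ^ 2)) := by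
    intro e t c
    rw [hμd, lintegral_map (by
      have : ∀ n, Measurable (X e n) := fun n => (X e n).continuous.measurable
      fun_prop) hWm]
    have e1 : ∀ ω, ∑ n ∈ t, c n * X e n (Wv ω) = ∑ n ∈ t.filter (· ∈ F), c n * halfWave W e n ω := by
      intro ω
      rw [Finset.sum_filter]
      refine Finset.sum_congr rfl fun n _ => ?_
      split_ifs with h
      · rw [hX e n h]
      · simp [X, h]
    simp_rw [e1, hW.halfWave_lintegral]
    exact Finset.sum_le_sum_of_subset (Finset.filter_subset _ _)
  have htrip : ∀ m ∈ s, ∀ ω, tripleIntegral P W ε m ω =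
      wickTriple μ (X (ε 0) (m 0)) (X (ε 1) (m 1)) (X (ε 2) (m 2)) (Wv ω) := by
    intro m hm ω
    have hint : ∀ (e e' : ℤˣ) (n k : Freq), n ∈ F → k ∈ F →
        ∫ x, X e n x * X e' k x ∂μ = ∫ ω, halfWave W e n ω * halfWave W e' k ω ∂P := by
      intro e e' n k hn hk
      rw [hμd, integral_map hWm.aemeasurable (by fun_prop)]
      exact integral_congr_ae (Eventually.of_forall fun ω => by
        simp only [hX e n hn, hX e' k hk])
    rw [tripleIntegral, wickTriple, wickTriple, hint _ _ _ _ (hsF m hm 0) (hsF m hm 1),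
      hint _ _ _ _ (hsF m hm 0) (hsF m hm 2), hint _ _ _ _ (hsF m hm 1) (hsF m hm 2),
      hX _ _ (hsF m hm 0), hX _ _ (hsF m hm 1), hX _ _ (hsF m hm 2)]
  have key := lintegral_wick_three_le (hcov (ε 0)) (hcov (ε 1)) (hcov (ε 2)) hμ F F F
    (fun i j k => if ![i, j, k] ∈ s then A ![i, j, k] else 0) hq
  have mwick : Measurable fun x => (‖∑ k ∈ F, ∑ j ∈ F, ∑ i ∈ F,
      (if ![i, j, k] ∈ s then A ![i, j, k] else 0) *
        wickTriple μ (X (ε 0) i) (X (ε 1) j) (X (ε 2) k) x‖ₑ ^ 2) ^ q := by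
    have : ∀ e n, Measurable (X e n) := fun e n => (X e n).continuous.measurable
    unfold wickTriple
    fun_prop
  rw [hμd, lintegral_map (hμd ▸ mwick) hWm, ← hμd] at key
  have e1 : ∀ ω, ∑ k ∈ F, ∑ j ∈ F, ∑ i ∈ F, (if ![i, j, k] ∈ s then A ![i, j, k] else 0) *
      wickTriple μ (X (ε 0) i) (X (ε 1) j) (X (ε 2) k) (Wv ω) =
      ∑ m ∈ s, A m * tripleIntegral P W ε m ω := by
    intro ω
    have := sum_triple_eq F s hsF (fun m => (if m ∈ s then A m else 0) *
      wickTriple μ (X (ε 0) (m 0)) (X (ε 1) (m 1)) (X (ε 2) (m 2)) (Wv ω))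
      (fun m hm => by simp [hm])
    refine this.trans (Finset.sum_congr rfl fun m hm => ?_)
    rw [if_pos hm, htrip m hm]
  have e2 : ∑ k ∈ F, ∑ j ∈ F, ∑ i ∈ F, ‖(if ![i, j, k] ∈ s then A ![i, j, k] else 0 : ℂ)‖ₑ ^ 2 *
      ENNReal.ofReal (2 / jap i ^ 2) * ENNReal.ofReal (2 / jap j ^ 2) *
        ENNReal.ofReal (2 / jap k ^ 2) =
      ENNReal.ofReal 8 * ∑ m ∈ s, ‖A m‖ₑ ^ 2 * ENNReal.ofReal (∏ j, jap (m j) ^ (-2 : ℝ)) := by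
    have := sum_triple_eq F s hsF (fun m => ‖(if m ∈ s then A m else 0 : ℂ)‖ₑ ^ 2 *
      ENNReal.ofReal (2 / jap (m 0) ^ 2) * ENNReal.ofReal (2 / jap (m 1) ^ 2) *
        ENNReal.ofReal (2 / jap (m 2) ^ 2)) (fun m hm => by simp [hm])
    refine this.trans ?_
    rw [Finset.mul_sum]
    refine Finset.sum_congr rfl fun m hm => ?_
    have j0 := jap_pos (m 0)
    have j1 := jap_pos (m 1)
    have j2 := jap_pos (m 2)
    rw [if_pos hm, mul_assoc, mul_assoc, ← ENNReal.ofReal_mul (by positivity),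
      ← ENNReal.ofReal_mul (by positivity), mul_left_comm (ENNReal.ofReal 8), ← ENNReal.ofReal_mul (by positivity)]
    congr 2
    rw [Fin.prod_univ_three, Real.rpow_neg j0.le, Real.rpow_neg j1.le, Real.rpow_neg j2.le]
    norm_cast
    field_simp; norm_num
  simp only [e1] at key
  rw [e2, ← mul_assoc, ← ENNReal.ofReal_mul (by positivity)] at key
  refine key.trans (le_of_eq ?_)
  -- 256 from the chaos bound times 2³ from the three variances 2/⟨n_j⟩².
  congr 3; ring

end Data

/-! ### Characters and trigonometric polynomials -/

theorem character_eq (n : Freq) (x : Pt) :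
    character n x = ∏ i, Complex.exp (Complex.I * (((n i : ℝ) * x i : ℝ) : ℂ)) := by
  rw [character, ← Complex.exp_sum, ← Finset.mul_sum]
  push_cast; rfl

theorem character_add (n k : Freq) (x : Pt) :
    character (n + k) x = character n x * character k x := by
  rw [character, character, character, ← Complex.exp_add, ← mul_add, ← Complex.ofReal_add,
    ← Finset.sum_add_distrib]
  refine congrArg (fun r : ℝ => Complex.exp (Complex.I * (r : ℂ)))
    (Finset.sum_congr rfl fun i _ => ?_)
  simp only [Pi.add_apply]; push_cast; ring

theorem character_apply_add (n : Freq) (x y : Pt) :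
    character n (x + y) = character n x * character n y := by
  rw [character, character, character, ← Complex.exp_add, ← mul_add, ← Complex.ofReal_add,
    ← Finset.sum_add_distrib]
  refine congrArg (fun r : ℝ => Complex.exp (Complex.I * (r : ℂ)))
    (Finset.sum_congr rfl fun i _ => ?_)
  simp only [Pi.add_apply]; ring

theorem character_zero (x : Pt) : character 0 x = 1 := by simp [character]

theorem character_apply_neg (n : Freq) (x : Pt) : character n (-x) = character (-n) x := by
  simp [character]

theorem norm_character (n : Freq) (x : Pt) : ‖character n x‖ = 1 := by
  rw [character, mul_comm]; exact Complex.norm_exp_ofReal_mul_I _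

theorem continuous_character (n : Freq) : Continuous (character n) := by
  unfold character; fun_prop

theorem character_periodic (n : Freq) (x : Pt) (k : Freq) :
    character n (fun i => x i + 2 * Real.pi * (k i : ℝ)) = character n x := by
  have : (fun i => x i + 2 * Real.pi * (k i : ℝ)) = x + fun i => 2 * Real.pi * (k i : ℝ) := rfl
  rw [this, character_apply_add]
  convert mul_one _
  rw [character, Complex.exp_eq_one_iff]
  refine ⟨∑ i, n i * k i, ?_⟩
  push_cast
  rw [Finset.mul_sum, Finset.sum_mul]
  exact Finset.sum_congr rfl fun i _ => by ring

theorem volume_restrict_cube : (volume : Measure Pt).restrict cube =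
    Measure.pi fun _ => (volume : Measure ℝ).restrict (Set.Icc (-Real.pi) Real.pi) := by
  rw [cube, ← Set.pi_univ_Icc, volume_pi, Measure.restrict_pi_pi]

theorem integral_exp_int (n : ℤ) :
    ∫ x in Set.Icc (-Real.pi) Real.pi, Complex.exp (Complex.I * (((n : ℝ) * x : ℝ) : ℂ)) =
      if n = 0 then ((2 * Real.pi : ℝ) : ℂ) else 0 := by
  rw [integral_Icc_eq_integral_Ioc, ← intervalIntegral.integral_of_le (by linarith [Real.pi_pos])]
  split_ifs with h
  · subst h
    simp; ring
  · have h1 : ∀ x : ℝ, Complex.exp (Complex.I * (((n : ℝ) * x : ℝ) : ℂ)) =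
        Complex.exp ((Complex.I * n) * x) := fun x => by push_cast; ring_nf
    simp_rw [h1]
    have hn : Complex.I * (n : ℂ) ≠ 0 := mul_ne_zero Complex.I_ne_zero (by exact_mod_cast h)
    rw [integral_exp_mul_complex hn]
    have : Complex.exp (Complex.I * n * (Real.pi : ℝ)) =
        Complex.exp (Complex.I * n * ((-Real.pi : ℝ) : ℂ)) := by
      rw [Complex.exp_eq_exp_iff_exists_int]
      exact ⟨n, by push_cast; ring⟩
    rw [this, sub_self, zero_div]

theorem torusMean_character (n : Freq) :
    torusMean (character n) = if n = 0 then 1 else 0 := by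
  rw [torusMean, volume_restrict_cube]
  simp_rw [character_eq]
  rw [integral_fintype_prod_eq_prod (𝕜 := ℂ)
    (f := fun i (y : ℝ) => Complex.exp (Complex.I * (((n i : ℝ) * y : ℝ) : ℂ)))]
  simp_rw [integral_exp_int]
  have hpi : ((2 * Real.pi : ℝ) : ℂ) ≠ 0 := by exact_mod_cast Real.two_pi_pos.ne'
  split_ifs with h
  · subst h
    simp only [Pi.zero_apply, if_true, Finset.prod_const, Finset.card_univ, Fintype.card_fin]
    push_cast at hpi ⊢
    exact inv_mul_cancel₀ (pow_ne_zero _ hpi)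
  · obtain ⟨i, hi⟩ : ∃ i, n i ≠ 0 := by
      by_contra hcon; push Not at hcon; exact h (funext hcon)
    rw [Finset.prod_eq_zero (Finset.mem_univ i) (if_neg hi), mul_zero]

theorem isCompact_cube : IsCompact cube := isCompact_Icc

theorem integrableOn_cube_of_continuous {f : Pt → ℂ} (hf : Continuous f) :
    IntegrableOn f cube := hf.continuousOn.integrableOn_compact isCompact_cube

theorem torusMean_sum {ι : Type*} (s : Finset ι) (f : ι → Pt → ℂ)
    (hf : ∀ i ∈ s, IntegrableOn (f i) cube) :
    torusMean (fun x => ∑ i ∈ s, f i x) = ∑ i ∈ s, torusMean (f i) := by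
  simp only [torusMean]
  rw [integral_finsetSum s hf, Finset.mul_sum]

theorem torusMean_const_mul (c : ℂ) (f : Pt → ℂ) :
    torusMean (fun x => c * f x) = c * torusMean f := by
  simp only [torusMean]
  rw [integral_const_mul]; ring

section Trig

variable {ι : Type*} (s : Finset ι) (c : ι → ℂ) (ν : ι → Freq)

theorem fourierCoef_sum (n : Freq) :
    fourierCoef (fun x => ∑ i ∈ s, c i * character (ν i) x) n =
      ∑ i ∈ s, if ν i = n then c i else 0 := by
  rw [fourierCoef]
  have h : ∀ x, (∑ i ∈ s, c i * character (ν i) x) * character (-n) x =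
      ∑ i ∈ s, c i * character (ν i + -n) x := fun x => by
    rw [Finset.sum_mul]
    exact Finset.sum_congr rfl fun i _ => by rw [character_add]; ring
  simp_rw [h]
  rw [torusMean_sum]
  · refine Finset.sum_congr rfl fun i _ => ?_
    rw [torusMean_const_mul, torusMean_character]
    simp only [← sub_eq_add_neg, sub_eq_zero]
    split_ifs <;> simp
  · exact fun i _ => integrableOn_cube_of_continuous
      (continuous_const.mul (continuous_character _))

theorem multiplier_sum (μ : Freq → ℂ) (x : Pt) :
    multiplier μ (fun x => ∑ i ∈ s, c i * character (ν i) x) x =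
      ∑ i ∈ s, μ (ν i) * c i * character (ν i) x := by
  classical
  rw [multiplier, tsum_eq_sum (s := s.image ν)]
  · simp_rw [fourierCoef_sum, Finset.mul_sum, Finset.sum_mul]
    rw [Finset.sum_comm]
    refine Finset.sum_congr rfl fun i hi => ?_
    rw [Finset.sum_eq_single (ν i)]
    · simp
    · intro n _ hn; rw [if_neg (Ne.symm hn)]; simp
    · exact fun h => absurd (Finset.mem_image_of_mem ν hi) h
  · intro n hn
    rw [fourierCoef_sum, Finset.sum_eq_zero, mul_zero, zero_mul]
    intro i hi
    rw [if_neg]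
    rintro rfl
    exact hn (Finset.mem_image_of_mem ν hi)

end Trig

/-! ### Periodic functions -/

section Periodic

open scoped Pointwise

/-- Periodicity with respect to `(2πℤ)³`. -/
def TorusPeriodic {α : Type*} (f : Pt → α) : Prop :=
  ∀ (x : Pt) (k : Freq), f (fun i => x i + 2 * Real.pi * (k i : ℝ)) = f x

/-- The basis `2π e_i` of `ℝ³`. -/
def torusBasis : Module.Basis (Fin 3) ℝ Pt :=
  (Pi.basisFun ℝ (Fin 3)).isUnitSMul (w := fun _ => 2 * Real.pi)
    fun _ => (Real.two_pi_pos.ne').isUnit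

theorem torusBasis_apply (i : Fin 3) : torusBasis i = Pi.single i (2 * Real.pi) := by
  rw [torusBasis, Module.Basis.isUnitSMul_apply, Pi.basisFun_apply, ← Pi.single_smul]
  simp

theorem torusBasis_repr (x : Pt) (i : Fin 3) : torusBasis.repr x i = x i / (2 * Real.pi) := by
  have h := torusBasis.sum_repr x
  have h2 := congrFun h i
  simp only [torusBasis_apply, Finset.sum_apply, Pi.smul_apply, smul_eq_mul, Pi.single_apply,
    mul_ite, mul_zero] at h2
  rw [Finset.sum_eq_single i (fun j _ hj => by rw [if_neg (Ne.symm hj)]) (by simp)] at h2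
  rw [if_pos rfl] at h2
  rw [← h2, mul_div_assoc, div_self Real.two_pi_pos.ne', mul_one]

theorem mem_torusLattice {v : Pt} (hv : v ∈ Submodule.span ℤ (Set.range torusBasis)) :
    ∃ k : Freq, v = fun i => 2 * Real.pi * (k i : ℝ) := by
  rw [Module.Basis.mem_span_iff_repr_mem] at hv
  choose k hk using hv
  refine ⟨k, funext fun i => ?_⟩
  have h := hk i
  rw [torusBasis_repr, eq_div_iff Real.two_pi_pos.ne'] at h
  rw [← h, mul_comm]
  simp

instance : VAddInvariantMeasure (Submodule.span ℤ (Set.range torusBasis)) Pt volume :=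
  inferInstanceAs
    (VAddInvariantMeasure (Submodule.span ℤ (Set.range torusBasis)).toAddSubgroup Pt volume)

theorem isAddFundamentalDomain_torus (a : Pt) :
    IsAddFundamentalDomain (Submodule.span ℤ (Set.range torusBasis))
      (a +ᵥ ZSpan.fundamentalDomain torusBasis) (volume : Measure Pt) :=
  (ZSpan.isAddFundamentalDomain torusBasis volume).vadd_of_comm a

theorem vadd_fundamentalDomain_eq (a : Pt) :
    a +ᵥ ZSpan.fundamentalDomain torusBasis =
      Set.pi Set.univ fun i => Set.Ico (a i) (a i + 2 * Real.pi) := by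
  ext x
  rw [Set.mem_vadd_set_iff_neg_vadd_mem, ZSpan.mem_fundamentalDomain, Set.mem_univ_pi]
  refine forall_congr' fun i => ?_
  rw [torusBasis_repr, Set.mem_Ico, Set.mem_Ico, le_div_iff₀ Real.two_pi_pos, zero_mul,
    div_lt_one Real.two_pi_pos]
  simp only [vadd_eq_add, Pi.add_apply, Pi.neg_apply]
  constructor <;> rintro ⟨h1, h2⟩ <;> constructor <;> linarith

theorem vadd_fundamentalDomain_ae_eq (a : Pt) :
    (a +ᵥ ZSpan.fundamentalDomain torusBasis : Set Pt) =ᵐ[volume]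
      Set.Icc a (fun i => a i + 2 * Real.pi) := by
  rw [vadd_fundamentalDomain_eq, volume_pi]
  exact Measure.univ_pi_Ico_ae_eq_Icc

theorem TorusPeriodic.vadd {α : Type*} {f : Pt → α} (hf : TorusPeriodic f)
    (g : Submodule.span ℤ (Set.range torusBasis)) (x : Pt) : f (g +ᵥ x) = f x := by
  obtain ⟨k, hk⟩ := mem_torusLattice g.2
  have : g +ᵥ x = fun i => x i + 2 * Real.pi * (k i : ℝ) := by
    change (g : Pt) + x = _
    rw [hk]; funext i; simp [add_comm]
  rw [this]; exact hf x k

theorem cube_eq_Icc : cube = Set.Icc (fun _ => -Real.pi) (fun i : Fin 3 =>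
    (fun _ => -Real.pi : Pt) i + 2 * Real.pi) := by
  rw [cube]; congr 1; funext i; ring

theorem preimage_add_left_Icc (a : Pt) :
    (fun y => a + y) ⁻¹' Set.Icc (a + fun _ => -Real.pi)
      (fun i => (a + fun _ => -Real.pi : Pt) i + 2 * Real.pi) = cube := by
  ext y
  simp only [cube, Set.mem_preimage, Set.mem_Icc, Pi.le_def, Pi.add_apply]
  constructor <;> rintro ⟨h1, h2⟩ <;>
    exact ⟨fun i => by have := h1 i; linarith, fun i => by have := h2 i; linarith⟩

/-- Up to null sets the cube and its translates are fundamental domains of the same lattice, so a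
periodic function has the same integral over each. -/
theorem TorusPeriodic.setIntegral_add {f : Pt → ℂ} (hf : TorusPeriodic f) (a : Pt) :
    ∫ y in cube, f (a + y) = ∫ y in cube, f y := by
  have h1 := (measurePreserving_add_left (volume : Measure Pt) a).setIntegral_preimage_emb
    (measurableEmbedding_addLeft a) f (Set.Icc (a + fun _ => -Real.pi)
      (fun i => (a + fun _ => -Real.pi : Pt) i + 2 * Real.pi))
  rw [preimage_add_left_Icc] at h1
  rw [h1, cube_eq_Icc, ← setIntegral_congr_set (vadd_fundamentalDomain_ae_eq _),
    ← setIntegral_congr_set (vadd_fundamentalDomain_ae_eq _)]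
  exact (isAddFundamentalDomain_torus _).setIntegral_eq (isAddFundamentalDomain_torus _) hf.vadd

theorem TorusPeriodic.integrableOn_add {f : Pt → ℂ} (hf : TorusPeriodic f) (a : Pt)
    (hi : IntegrableOn f cube) : IntegrableOn (fun y => f (a + y)) cube := by
  have h1 := (measurePreserving_add_left (volume : Measure Pt) a).integrableOn_comp_preimage
    (measurableEmbedding_addLeft a) (f := f) (s := Set.Icc (a + fun _ => -Real.pi)
      (fun i => (a + fun _ => -Real.pi : Pt) i + 2 * Real.pi))
  rw [preimage_add_left_Icc] at h1
  refine h1.2 ?_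
  rw [← integrableOn_congr_set_ae (vadd_fundamentalDomain_ae_eq _),
    (isAddFundamentalDomain_torus _).integrableOn_iff
      (isAddFundamentalDomain_torus (fun _ => -Real.pi)) hf.vadd,
    integrableOn_congr_set_ae (vadd_fundamentalDomain_ae_eq _), ← cube_eq_Icc]
  exact hi

end Periodic

theorem neg_preimage_cube : (fun y : Pt => -y) ⁻¹' cube = cube := by
  ext y
  simp only [cube, Set.mem_preimage, Set.mem_Icc, Pi.le_def, Pi.neg_apply]
  constructor <;> rintro ⟨h1, h2⟩ <;>
    exact ⟨fun i => by have := h2 i; linarith, fun i => by have := h1 i; linarith⟩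

theorem setIntegral_cube_neg (f : Pt → ℂ) : ∫ y in cube, f (-y) = ∫ y in cube, f y := by
  have h := (Measure.measurePreserving_neg (volume : Measure Pt)).setIntegral_preimage_emb
    (MeasurableEquiv.neg Pt).measurableEmbedding f cube
  rwa [neg_preimage_cube] at h

theorem integrableOn_cube_neg {f : Pt → ℂ} (hf : IntegrableOn f cube) :
    IntegrableOn (fun y => f (-y)) cube := by
  have h := (Measure.measurePreserving_neg (volume : Measure Pt)).integrableOn_comp_preimage
    (MeasurableEquiv.neg Pt).measurableEmbedding (f := f) (s := cube)
  rw [neg_preimage_cube] at h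
  exact h.2 hf

theorem TorusPeriodic.setIntegral_sub {f : Pt → ℂ} (hf : TorusPeriodic f) (a : Pt) :
    ∫ y in cube, f (a - y) = ∫ y in cube, f y := by
  rw [← hf.setIntegral_add a, ← setIntegral_cube_neg (fun y => f (a + y))]
  simp_rw [sub_eq_add_neg]

theorem TorusPeriodic.integrableOn_sub {f : Pt → ℂ} (hf : TorusPeriodic f) (a : Pt)
    (hi : IntegrableOn f cube) : IntegrableOn (fun y => f (a - y)) cube := by
  simp_rw [sub_eq_add_neg]
  exact integrableOn_cube_neg (hf.integrableOn_add a hi)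

/-- Convolution with the potential acts on characters as a Fourier multiplier. -/
theorem torusConv_character {V : Pt → ℝ} (hV : TorusPeriodic V) (n : Freq) (x : Pt) :
    torusConv V (character n) x = potentialHat V n * character n x := by
  have hp : TorusPeriodic fun y => (V y : ℂ) * character n (x - y) := fun y k => by
    have h1 := hV y k
    have h2 : character n (x - fun i => y i + 2 * Real.pi * (k i : ℝ)) = character n (x - y) := by
      rw [sub_eq_add_neg, sub_eq_add_neg, character_apply_add, character_apply_add,
        character_apply_neg, character_apply_neg, character_periodic]
    simp only [h1, h2]
  have h := hp.setIntegral_sub x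
  simp only [sub_sub_cancel] at h
  rw [torusConv, torusMean, h, potentialHat, fourierCoef, torusMean, mul_assoc]
  congr 1
  rw [← integral_mul_const]
  refine integral_congr_ae (Eventually.of_forall fun y => ?_)
  simp only
  rw [sub_eq_add_neg, character_apply_add, character_apply_neg]; ring

theorem torusConv_sum {V : Pt → ℝ} (hV : TorusPeriodic V)
    (hi : IntegrableOn (fun x => (V x : ℂ)) cube) {ι : Type*} (s : Finset ι) (c : ι → ℂ)
    (ν : ι → Freq) (x : Pt) :
    torusConv V (fun x => ∑ i ∈ s, c i * character (ν i) x) x =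
      ∑ i ∈ s, c i * potentialHat V (ν i) * character (ν i) x := by
  have hVc : TorusPeriodic fun y => (V y : ℂ) := fun y k => congrArg _ (hV y k)
  have h : ∀ y, (V (x - y) : ℂ) * ∑ i ∈ s, c i * character (ν i) y =
      ∑ i ∈ s, c i * ((V (x - y) : ℂ) * character (ν i) y) := fun y => by
    rw [Finset.mul_sum]; exact Finset.sum_congr rfl fun i _ => by ring
  have hint : ∀ i, IntegrableOn (fun y => (V (x - y) : ℂ) * character (ν i) y) cube := fun i =>
    (hVc.integrableOn_sub x hi).mul_continuousOn (continuous_character _).continuousOn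
      isCompact_cube
  rw [torusConv]
  simp_rw [h]
  rw [torusMean_sum s _ fun i _ => (hint i).const_mul _]
  refine Finset.sum_congr rfl fun i _ => ?_
  rw [torusMean_const_mul, mul_assoc, ← torusConv_character hV, torusConv]

/-! ### Fourier decay of the interaction potential -/

/-- Interpolation between the trivial bound, used when |r - s| is at least the smaller radius, and
the Lipschitz bound 1 - (1+δ)^{-a} ≤ aδ ≤ aδ^κ for the relative increment δ ≤ 1. -/
theorem abs_rpow_neg_sub_le {a κ r s : ℝ} (ha : 0 ≤ a) (hκ : 0 ≤ κ) (hκ1 : κ ≤ 1)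
    (hr : 0 < r) (hs : 0 < s) :
    |r ^ (-a) - s ^ (-a)| ≤ (1 + a) * |r - s| ^ κ * (r ^ (-(a + κ)) + s ^ (-(a + κ))) := by
  wlog hrs : r ≤ s generalizing r s
  · rw [abs_sub_comm, abs_sub_comm r s, add_comm (r ^ (-(a + κ)))]
    exact this hs hr (le_of_not_ge hrs)
  have hle : s ^ (-a) ≤ r ^ (-a) := Real.rpow_le_rpow_of_nonpos hr hrs (by linarith)
  rw [abs_of_nonneg (by linarith), abs_sub_comm, abs_of_nonneg (by linarith)]
  have hs' : 0 ≤ s ^ (-(a + κ)) := by positivity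
  have hr' : 0 < r ^ (-(a + κ)) := by positivity
  have hd : 0 ≤ (s - r) ^ κ := Real.rpow_nonneg (by linarith) _
  suffices h : r ^ (-a) - s ^ (-a) ≤ (1 + a) * (s - r) ^ κ * r ^ (-(a + κ)) by
    refine h.trans ?_
    have : 0 ≤ (1 + a) * (s - r) ^ κ := by positivity
    nlinarith
  have hsplit : r ^ (-(a + κ)) = r ^ (-a) * r ^ (-κ) := by
    rw [← Real.rpow_add hr]; congr 1; ring
  rcases le_total r (s - r) with h | h
  · have h1 : r ^ κ ≤ (s - r) ^ κ := Real.rpow_le_rpow hr.le h hκ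
    have h2 : r ^ (-a) = r ^ κ * r ^ (-(a + κ)) := by
      rw [← Real.rpow_add hr]; congr 1; ring
    have h3 : 0 ≤ s ^ (-a) := by positivity
    calc r ^ (-a) - s ^ (-a) ≤ r ^ κ * r ^ (-(a + κ)) := by linarith
      _ ≤ (s - r) ^ κ * r ^ (-(a + κ)) := by gcongr
      _ ≤ (1 + a) * (s - r) ^ κ * r ^ (-(a + κ)) := by
        have : 0 ≤ (s - r) ^ κ * r ^ (-(a + κ)) := by positivity
        nlinarith
  · set δ := (s - r) / r with hδ
    have hδ0 : 0 ≤ δ := div_nonneg (by linarith) hr.le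
    have hδ1 : δ ≤ 1 := by rw [hδ, div_le_one hr]; exact h
    have hs2 : s = r * (1 + δ) := by rw [hδ]; field_simp; ring
    have h1 : 1 - a * δ ≤ (1 + δ) ^ (-a) := by
      have := one_add_mul_self_le_rpow_one_add (s := δ) (p := -a)
      have h0 := Real.add_one_le_exp (-a * δ)
      have h2 : Real.exp (-a * δ) ≤ (1 + δ) ^ (-a) := by
        rw [Real.rpow_def_of_pos (by linarith)]
        apply Real.exp_le_exp.2
        have := Real.log_le_sub_one_of_pos (show 0 < 1 + δ by linarith)
        nlinarith
      linarith
    have h2 : s ^ (-a) = r ^ (-a) * (1 + δ) ^ (-a) := by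
      rw [hs2, Real.mul_rpow hr.le (by linarith)]
    have h3 : δ ≤ δ ^ κ := by
      rcases hδ0.eq_or_lt with h0 | h0
      · rw [← h0]; exact Real.rpow_nonneg le_rfl _
      · conv_lhs => rw [← Real.rpow_one δ]
        exact Real.rpow_le_rpow_of_exponent_ge h0 hδ1 hκ1
    have h4 : (s - r) ^ κ * r ^ (-κ) = δ ^ κ := by
      rw [hδ, Real.div_rpow (by linarith) hr.le, Real.rpow_neg hr.le, div_eq_mul_inv]
    have h5 : 0 < r ^ (-a) := by positivity
    have h6 : 0 ≤ δ ^ κ := Real.rpow_nonneg hδ0 _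
    rw [h2, hsplit, show (1 + a) * (s - r) ^ κ * (r ^ (-a) * r ^ (-κ)) =
      r ^ (-a) * ((1 + a) * ((s - r) ^ κ * r ^ (-κ))) by ring, h4]
    have : 1 - (1 + δ) ^ (-a) ≤ (1 + a) * δ ^ κ := by nlinarith
    nlinarith

/-- The truncated power `|x|^{-b}`. -/
def singularPower (b : ℝ) (x : Pt) : ℝ := if ‖x‖ ≤ 1 then ‖x‖ ^ (-b) else 0

theorem singularPower_nonneg (b : ℝ) (x : Pt) : 0 ≤ singularPower b x := by
  unfold singularPower; split_ifs <;> positivity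

/-- Polar integration in dimension three gives the density r^{2-b} on (0,1], integrable for b < 3.
-/
theorem integrable_singularPower {b : ℝ} (hb : b < 3) : Integrable (singularPower b) := by
  have h := (integrable_fun_norm_addHaar (volume : Measure Pt)
    (f := fun r : ℝ => if r ≤ 1 then r ^ (-b) else 0)).2 ?_
  · exact h
  have hd : Module.finrank ℝ Pt = 3 := by simp
  rw [hd]
  have h1 : IntegrableOn (fun r : ℝ => r ^ (2 - b)) (Set.Ioc 0 1) := by
    rw [← intervalIntegrable_iff_integrableOn_Ioc_of_le zero_le_one]
    exact intervalIntegral.intervalIntegrable_rpow' (by linarith)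
  have h2 : (fun r : ℝ => r ^ (3 - 1) • (if r ≤ 1 then r ^ (-b) else 0)) =ᵐ[volume.restrict
      (Set.Ioi 0)] (Set.Ioc (0 : ℝ) 1).indicator (fun r : ℝ => r ^ (2 - b)) := by
    filter_upwards [ae_restrict_mem measurableSet_Ioi] with r hr
    have hr : 0 < r := hr
    by_cases h : r ≤ 1
    · rw [Set.indicator_of_mem (show r ∈ Set.Ioc (0:ℝ) 1 from ⟨hr, h⟩), if_pos h, smul_eq_mul,
        ← Real.rpow_natCast, ← Real.rpow_add hr]
      norm_num [sub_eq_add_neg]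
    · rw [Set.indicator_of_notMem (fun h' => h h'.2), if_neg h, smul_zero]
  rw [IntegrableOn, integrable_congr h2, integrable_indicator_iff measurableSet_Ioc]
  exact h1.mono_measure Measure.restrict_le_self

theorem euclid_eq_norm (x : Pt) : euclid x = ‖(WithLp.toLp 2 x : EuclideanSpace ℝ (Fin 3))‖ := by
  simp [euclid, EuclideanSpace.norm_eq]

theorem euclid_nonneg (x : Pt) : 0 ≤ euclid x := Real.sqrt_nonneg _

theorem euclid_sub_le (x y : Pt) : |euclid x - euclid y| ≤ euclid (x - y) := by
  simp only [euclid_eq_norm, WithLp.toLp_sub]; exact abs_norm_sub_norm_le _ _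

theorem norm_le_euclid (x : Pt) : ‖x‖ ≤ euclid x := by
  rw [pi_norm_le_iff_of_nonneg (euclid_nonneg x), euclid_eq_norm]
  intro i
  exact PiLp.norm_apply_le (WithLp.toLp 2 x : EuclideanSpace ℝ (Fin 3)) i

theorem euclid_smul (c : ℝ) (x : Pt) : euclid (c • x) = |c| * euclid x := by
  simp only [euclid_eq_norm, WithLp.toLp_smul, norm_smul, Real.norm_eq_abs]

theorem continuous_euclid : Continuous euclid := by
  unfold euclid; fun_prop

theorem euclid_pos {x : Pt} (hx : x ≠ 0) : 0 < euclid x :=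
  lt_of_lt_of_le (norm_pos_iff.2 hx) (norm_le_euclid x)

theorem notMem_lattice {x : Pt} (hx : x ≠ 0) (hx5 : ‖x‖ < 5) : x ∉ lattice := by
  rintro ⟨k, rfl⟩
  apply hx
  funext i
  by_contra hk
  have h1 : ‖2 * Real.pi * (k i : ℝ)‖ < 5 := lt_of_le_of_lt
    (norm_le_pi_norm (fun i => 2 * Real.pi * (k i : ℝ)) i) hx5
  have h2 : (k i) ≠ 0 := fun h => hk (by simp [h])
  have h3 : (1 : ℝ) ≤ |(k i : ℝ)| := by exact_mod_cast Int.one_le_abs h2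
  rw [Real.norm_eq_abs, abs_mul, abs_of_pos Real.two_pi_pos] at h1
  nlinarith [Real.pi_gt_three]

theorem norm_le_of_mem_cube {x : Pt} (hx : x ∈ cube) : ‖x‖ ≤ Real.pi := by
  rw [pi_norm_le_iff_of_nonneg Real.pi_pos.le]
  exact fun i => abs_le.2 ⟨hx.1 i, hx.2 i⟩

theorem IsInteractionPotential.contDiffOn {β : ℝ} {V : Pt → ℝ} (hV : IsInteractionPotential β V) :
    ContDiffOn ℝ (⊤ : ℕ∞) V {x | x ≠ 0 ∧ ‖x‖ < 5} :=
  hV.smooth.mono fun _ hx => notMem_lattice hx.1 hx.2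

theorem isOpen_punctured : IsOpen {x : Pt | x ≠ 0 ∧ ‖x‖ < 5} :=
  isOpen_ne.inter (isOpen_lt continuous_norm continuous_const)

theorem isCompact_annulus : IsCompact {x : Pt | 1 / 40 ≤ euclid x ∧ ‖x‖ ≤ 4} :=
  (isCompact_closedBall (0 : Pt) 4).of_isClosed_subset
    ((isClosed_le continuous_const continuous_euclid).inter
      (isClosed_le continuous_norm continuous_const))
    fun x hx => by simpa using hx.2

theorem annulus_subset : {x : Pt | 1 / 40 ≤ euclid x ∧ ‖x‖ ≤ 4} ⊆ {x | x ≠ 0 ∧ ‖x‖ < 5} := by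
  rintro x ⟨h1, h2⟩
  refine ⟨?_, by linarith⟩
  rintro rfl
  norm_num [euclid] at h1

/-- The segment from x - h to x stays at distance at least 1/20 - 1/40 from the origin and within
sup norm π + 1/40 < 4, a compact set on which the gradient is bounded. -/
theorem IsInteractionPotential.lipschitz {β : ℝ} {V : Pt → ℝ} (hV : IsInteractionPotential β V) :
    ∃ L, 0 ≤ L ∧ ∀ x ∈ cube, 1 / 20 < euclid x → ∀ h : Pt, euclid h ≤ 1 / 40 →
      |V x - V (x - h)| ≤ L * euclid h := by
  obtain ⟨L, hL⟩ := isCompact_annulus.exists_bound_of_continuousOn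
    ((hV.contDiffOn.continuousOn_fderiv_of_isOpen isOpen_punctured (by simp)).mono annulus_subset)
  refine ⟨max L 0, le_max_right _ _, fun x hx hx1 h hh => ?_⟩
  have hseg : ∀ y ∈ segment ℝ (x - h) x, y ∈ {x : Pt | 1 / 40 ≤ euclid x ∧ ‖x‖ ≤ 4} := by
    intro y hy
    have hxy : ∃ c : ℝ, |c| ≤ 1 ∧ x - y = c • h := by
      obtain ⟨a, b, ha, hb, hab, rfl⟩ := hy
      refine ⟨a, abs_le.2 ⟨by linarith, by linarith⟩, ?_⟩
      obtain rfl : b = 1 - a := by linarith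
      module
    obtain ⟨c, hc, hxy⟩ := hxy
    have h1 : euclid (x - y) ≤ 1 / 40 := by
      rw [hxy, euclid_smul]
      have := euclid_nonneg h
      nlinarith
    constructor
    · have := (abs_le.1 (euclid_sub_le x y)).2
      linarith
    · have h2 := norm_le_euclid (x - y)
      have h3 := norm_le_of_mem_cube hx
      have h4 : ‖y‖ ≤ ‖x‖ + ‖x - y‖ := by
        have := norm_sub_le x (x - y)
        simpa using this
      have := Real.pi_lt_d2
      linarith
  have key := (convex_segment (x - h) x).norm_image_sub_le_of_norm_fderiv_le (𝕜 := ℝ) (f := V)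
    (C := max L 0) (fun y hy =>
      (hV.contDiffOn.differentiableOn (by simp)).differentiableAt
        (isOpen_punctured.mem_nhds (annulus_subset (hseg y hy))))
    (fun y hy => (hL y (hseg y hy)).trans (le_max_left _ _))
    (left_mem_segment ℝ _ _) (right_mem_segment ℝ _ _)
  rw [Real.norm_eq_abs, sub_sub_cancel] at key
  exact key.trans (mul_le_mul_of_nonneg_left (norm_le_euclid h) (le_max_right _ _))

theorem singular_le {b r : ℝ} (hb : 0 ≤ b) {x : Pt} (hx : x ≠ 0) (hr : euclid x ≤ r) (hr1 : r ≤ 1) :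
    euclid x ^ (-b) ≤ singularPower b x := by
  have h := norm_le_euclid x
  rw [singularPower, if_pos (by linarith)]
  exact Real.rpow_le_rpow_of_nonpos (norm_pos_iff.2 hx) h (by linarith)

theorem IsInteractionPotential.abs_apply_le {β : ℝ} (hβ : β ≤ 3) {V : Pt → ℝ}
    (hV : IsInteractionPotential β V) :
    ∃ C, 0 ≤ C ∧ ∀ x ∈ cube, x ≠ 0 → |V x| ≤ C * (singularPower (3 - β) x + 1) := by
  obtain ⟨c, hc, hs⟩ := hV.singular
  obtain ⟨L, hL⟩ := isCompact_annulus.exists_bound_of_continuousOn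
    (hV.contDiffOn.continuousOn.mono annulus_subset)
  refine ⟨max c L, le_max_of_le_left hc.le, fun x hx hx0 => ?_⟩
  have hp := singularPower_nonneg (3 - β) x
  have hm : 0 ≤ max c L := le_max_of_le_left hc.le
  rcases le_total (euclid x) (1 / 10) with h | h
  · rw [hs x (euclid_pos hx0) h, abs_of_nonneg (by have := euclid_nonneg x; positivity)]
    have h1 := singular_le (b := 3 - β) (by linarith) hx0 h (by norm_num)
    calc c * euclid x ^ (-(3 - β)) ≤ max c L * singularPower (3 - β) x := by
          exact mul_le_mul (le_max_left c L) h1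
            (Real.rpow_nonneg (euclid_nonneg x) _) hm
      _ ≤ _ := by nlinarith
  · have h1 := hL x ⟨by linarith, by
      have := norm_le_of_mem_cube hx; have := Real.pi_lt_d2; linarith⟩
    rw [Real.norm_eq_abs] at h1
    have h2 : L ≤ max c L := le_max_right _ _
    nlinarith

theorem IsInteractionPotential.integrableOn {β : ℝ} (hβ : 0 < β) (hβ3 : β ≤ 3) {V : Pt → ℝ}
    (hV : IsInteractionPotential β V) : IntegrableOn V cube := by
  obtain ⟨C, hC, hle⟩ := hV.abs_apply_le hβ3
  have hae : (cube \ {0} : Set Pt) =ᵐ[volume] cube := sdiff_null_ae_eq_self (by simp)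
  have hmeas : MeasurableSet (cube \ {0} : Set Pt) := isCompact_cube.measurableSet.diff (by simp)
  rw [← integrableOn_congr_set_ae hae]
  refine Integrable.mono' (g := fun x => C * (singularPower (3 - β) x + 1)) ?_ ?_ ?_
  · have h1 : IntegrableOn (fun x : Pt => singularPower (3 - β) x + 1) (cube \ {0}) :=
      (integrable_singularPower (by linarith)).integrableOn.add
        (integrableOn_const (by
          rw [measure_congr hae]; exact isCompact_cube.measure_lt_top.ne))
    exact h1.const_mul C
  · refine ContinuousOn.aestronglyMeasurable (hV.contDiffOn.continuousOn.mono ?_) hmeas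
    rintro x ⟨hx, hx0⟩
    exact ⟨hx0, by have := norm_le_of_mem_cube hx; have := Real.pi_lt_d2; linarith⟩
  · filter_upwards [ae_restrict_mem hmeas] with x hx
    exact hle x hx.1 hx.2

/-- A Hölder bound with an integrable weight: near the origin V is an exact power and
`abs_rpow_neg_sub_le` applies; elsewhere V is Lipschitz and |h| ≤ |h|^κ. For κ < β the weight has
exponent 3 - β + κ < 3. -/
theorem IsInteractionPotential.abs_sub_apply_le {β κ : ℝ} (hβ : β ≤ 3) (hκ : 0 ≤ κ) (hκ1 : κ ≤ 1)
    {V : Pt → ℝ} (hV : IsInteractionPotential β V) :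
    ∃ C, 0 ≤ C ∧ ∀ h : Pt, euclid h ≤ 1 / 40 → ∀ x ∈ cube, x ≠ 0 → x ≠ h →
      |V x - V (x - h)| ≤ C * euclid h ^ κ *
        (singularPower (3 - β + κ) x + singularPower (3 - β + κ) (x - h) + 1) := by
  obtain ⟨c, hc, hs⟩ := hV.singular
  obtain ⟨L, hL0, hL⟩ := hV.lipschitz
  have hm : 0 ≤ c * (1 + (3 - β)) := mul_nonneg hc.le (by linarith)
  refine ⟨c * (1 + (3 - β)) + L, by positivity, fun h hh x hx hx0 hxh => ?_⟩
  have hp := singularPower_nonneg (3 - β + κ) x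
  have hp' := singularPower_nonneg (3 - β + κ) (x - h)
  have he := euclid_nonneg h
  have hek : 0 ≤ euclid h ^ κ := Real.rpow_nonneg he _
  have hxh' : x - h ≠ 0 := sub_ne_zero.2 hxh
  rcases le_or_gt (euclid x) (1 / 20) with h1 | h1
  · have h2 : euclid (x - h) ≤ 1 / 10 := by
      have := (_root_.abs_le.1 (euclid_sub_le (x - h) x)).2
      have h3 : euclid (x - h - x) = euclid h := by
        rw [show x - h - x = (-1 : ℝ) • h by module, euclid_smul]; simp
      linarith
    rw [hs x (euclid_pos hx0) (by linarith), hs _ (euclid_pos hxh') h2, ← mul_sub, abs_mul,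
      abs_of_pos hc]
    have h3 := abs_rpow_neg_sub_le (a := 3 - β) (by linarith) hκ hκ1 (euclid_pos hx0)
      (euclid_pos hxh')
    have h4 : |euclid x - euclid (x - h)| ^ κ ≤ euclid h ^ κ := by
      refine Real.rpow_le_rpow (abs_nonneg _) ?_ hκ
      simpa using euclid_sub_le x (x - h)
    have h5 := singular_le (b := 3 - β + κ) (by linarith) hx0 h1 (by norm_num)
    have h6 := singular_le (b := 3 - β + κ) (by linarith) hxh' h2 (by norm_num)
    have h7 : 0 ≤ 3 - β := by linarith
    calc c * |euclid x ^ (-(3 - β)) - euclid (x - h) ^ (-(3 - β))|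
        ≤ c * ((1 + (3 - β)) * euclid h ^ κ *
          (singularPower (3 - β + κ) x + singularPower (3 - β + κ) (x - h))) := by
          refine mul_le_mul_of_nonneg_left (h3.trans ?_) hc.le
          have h8 : 0 ≤ euclid x ^ (-(3 - β + κ)) + euclid (x - h) ^ (-(3 - β + κ)) :=
            add_nonneg (Real.rpow_nonneg (euclid_nonneg _) _)
              (Real.rpow_nonneg (euclid_nonneg _) _)
          gcongr
      _ ≤ _ := by
          have := mul_nonneg hm hek
          have := mul_nonneg hL0 hek
          nlinarith [mul_nonneg (mul_nonneg hL0 hek) (add_nonneg hp hp')]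
  · have h2 := hL x hx h1 h hh
    have h3 : euclid h ≤ euclid h ^ κ := by
      rcases he.eq_or_lt with h0 | h0
      · rw [← h0]; exact Real.rpow_nonneg le_rfl _
      · conv_lhs => rw [← Real.rpow_one (euclid h)]
        exact Real.rpow_le_rpow_of_exponent_ge h0 (by linarith) hκ1
    have h4 : L * euclid h ≤ L * euclid h ^ κ := mul_le_mul_of_nonneg_left h3 hL0
    have := mul_nonneg hm hek
    have := mul_nonneg hL0 hek
    nlinarith [mul_nonneg (mul_nonneg hL0 hek) (add_nonneg hp hp'),
      mul_nonneg (mul_nonneg hm hek) (add_nonneg hp hp')]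

theorem norm_torusMean_le (f : Pt → ℂ) : ‖torusMean f‖ ≤ ∫ x in cube, ‖f x‖ := by
  rw [torusMean, norm_mul, norm_inv, Complex.norm_real, Real.norm_eq_abs,
    abs_of_pos (by positivity)]
  have h1 : (1 : ℝ) ≤ (2 * Real.pi) ^ 3 := one_le_pow₀ (by linarith [Real.pi_gt_three])
  calc ((2 * Real.pi) ^ 3)⁻¹ * ‖∫ x in cube, f x‖ ≤ 1 * ‖∫ x in cube, f x‖ := by
        gcongr; exact inv_le_one_of_one_le₀ h1
    _ ≤ _ := by rw [one_mul]; exact norm_integral_le_integral_norm _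

/-- Fourier decay of the interaction potential. -/
theorem IsInteractionPotential.norm_potentialHat_le {β κ : ℝ} (hκ : 0 < κ) (hκβ : κ < β)
    (hβ : β ≤ 1) {V : Pt → ℝ} (hV : IsInteractionPotential β V) :
    ∃ C, 0 < C ∧ ∀ n, ‖potentialHat V n‖ ≤ C * jap n ^ (-κ) := by
  obtain ⟨C, hC, hle⟩ := hV.abs_sub_apply_le (κ := κ) (by linarith) hκ.le (by linarith)
  have hint := hV.integrableOn (by linarith) (by linarith)
  have hintC : IntegrableOn (fun x => (V x : ℂ)) cube := hint.ofReal
  have hper : TorusPeriodic fun x => (V x : ℂ) := fun x k => congrArg _ (hV.periodic x k)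
  set b := 3 - β + κ with hb
  have hG := integrable_singularPower (b := b) (by linarith)
  set G := ∫ x, singularPower b x with hGd
  have hG0 : 0 ≤ G := integral_nonneg (singularPower_nonneg b)
  set A := ∫ x in cube, |V x| with hA
  have hA0 : 0 ≤ A := integral_nonneg fun x => abs_nonneg _
  set vol := (volume : Measure Pt).real cube with hvol
  have hvol0 : 0 ≤ vol := measureReal_nonneg
  set D := C * Real.pi ^ κ * (2 * G + vol) * 2 ^ κ with hD
  have hπ := Real.pi_pos
  have hD0 : 0 ≤ D := by positivity
  set D' := A * 250 ^ κ with hD'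
  have hD'0 : 0 ≤ D' := by positivity
  refine ⟨D + D' + 1, by positivity, fun n => ?_⟩
  have hj := jap_pos n
  have hjκ : 0 < jap n ^ (-κ) := by positivity
  -- The threshold makes the translation below satisfy |h| = π/|n| ≤ 1/40. The finitely many lower
  -- frequencies have ⟨n⟩ ≤ 250 and are bounded by the L¹ norm of V.
  by_cases hn : freqLen n ≤ 40 * Real.pi
  · have h1 : ‖potentialHat V n‖ ≤ A := by
      refine (norm_torusMean_le _).trans (le_of_eq ?_)
      refine integral_congr_ae (Eventually.of_forall fun x => ?_)
      simp only [norm_mul, norm_character, mul_one, Complex.norm_real, Real.norm_eq_abs]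
    have h2 : jap n ≤ 250 := by
      have := jap_le_one_add n
      have := Real.pi_lt_d2
      linarith
    have h3 : A ≤ D' * jap n ^ (-κ) := by
      rw [hD', mul_assoc, Real.rpow_neg hj.le, ← div_eq_mul_inv]
      have : 1 ≤ (250 : ℝ) ^ κ / jap n ^ κ := by
        rw [one_le_div (by positivity)]
        exact Real.rpow_le_rpow hj.le h2 hκ.le
      nlinarith
    nlinarith
  push Not at hn
  have hlen : 0 < freqLen n := by nlinarith
  -- Half a period in the direction n: the character changes sign under translation by h, so V̂(n)
  -- is half the coefficient of V - V(· - h), whose L¹ norm is O(|h|^κ).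
  set h : Pt := (Real.pi / freqLen n ^ 2) • fun i => (n i : ℝ) with hh
  have heh : euclid h = Real.pi / freqLen n := by
    rw [hh, euclid_smul, abs_of_pos (by positivity)]
    change Real.pi / freqLen n ^ 2 * freqLen n = _
    field_simp
  have heh40 : euclid h ≤ 1 / 40 := by
    rw [heh, div_le_iff₀ hlen]; linarith
  have hchar : character (-n) h = -1 := by
    have h2 : ∑ i, ((-n) i : ℝ) * h i = -Real.pi := by
      have h3 : freqLen n ^ 2 = ∑ i, (n i : ℝ) ^ 2 := by
        rw [freqLen, euclid, Real.sq_sqrt (Finset.sum_nonneg fun i _ => sq_nonneg _)]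
      have h4 : ∑ i, ((-n) i : ℝ) * h i = -(Real.pi / freqLen n ^ 2) * ∑ i, (n i : ℝ) ^ 2 := by
        rw [Finset.mul_sum]
        refine Finset.sum_congr rfl fun i _ => ?_
        simp only [hh, Pi.smul_apply, smul_eq_mul, Pi.neg_apply]; push_cast; ring
      rw [h4, ← h3]; field_simp
    have h3 : ∑ i, (((-n) i : ℤ) : ℝ) * h i = -Real.pi := by simpa using h2
    rw [character, h3, mul_comm]
    push_cast
    rw [neg_mul, Complex.exp_neg, Complex.exp_pi_mul_I]; norm_num
  have hshift : ∫ x in cube, (V (x - h) : ℂ) * character (-n) x =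
      -∫ x in cube, (V x : ℂ) * character (-n) x := by
    have hp2 : TorusPeriodic fun x => (V (x - h) : ℂ) * character (-n) x := fun x k => by
      have e1 : V ((fun i => x i + 2 * Real.pi * (k i : ℝ)) - h) = V (x - h) := by
        rw [← hV.periodic (x - h) k]
        congr 1; funext i; simp only [Pi.sub_apply]; ring
      simp only [e1, character_periodic]
    rw [← hp2.setIntegral_add h, ← integral_neg]
    refine integral_congr_ae (Eventually.of_forall fun x => ?_)
    simp only [add_sub_cancel_left, character_apply_add, hchar]; ring
  have hi1 : IntegrableOn (fun x => (V x : ℂ) * character (-n) x) cube :=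
    hintC.mul_continuousOn (continuous_character _).continuousOn isCompact_cube
  have hi2' : IntegrableOn (fun x => (V (x - h) : ℂ)) cube := by
    have := hper.integrableOn_add (-h) hintC
    refine this.congr (Eventually.of_forall fun x => ?_)
    simp only [neg_add_eq_sub]
  have hi2 : IntegrableOn (fun x => (V (x - h) : ℂ) * character (-n) x) cube :=
    hi2'.mul_continuousOn (continuous_character _).continuousOn isCompact_cube
  have hhalf : potentialHat V n =
      2⁻¹ * torusMean fun x => ((V x - V (x - h) : ℝ) : ℂ) * character (-n) x := by
    have e1 : ∀ x, ((V x - V (x - h) : ℝ) : ℂ) * character (-n) x =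
      (V x : ℂ) * character (-n) x - (V (x - h) : ℂ) * character (-n) x := fun x => by
        push_cast; ring
    simp only [potentialHat, fourierCoef, torusMean]
    simp_rw [e1]
    rw [integral_sub hi1 hi2, hshift]; ring
  have hGi : ∀ a : Pt, IntegrableOn (fun x => singularPower b (x - a)) cube := fun a =>
    (hG.comp_sub_right a).integrableOn
  have hbound : ∫ x in cube, |V x - V (x - h)| ≤ C * euclid h ^ κ * (2 * G + vol) := by
    have hne : ∀ a : Pt, ∀ᵐ x ∂(volume.restrict cube), x ≠ a := fun a =>
      ae_restrict_of_ae (by rw [ae_iff]; simp)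
    calc ∫ x in cube, |V x - V (x - h)|
        ≤ ∫ x in cube, C * euclid h ^ κ * (singularPower b x + singularPower b (x - h) + 1) := by
          refine integral_mono_ae ?_ ?_ ?_
          · have : IntegrableOn (fun x => ((V x : ℂ) - (V (x - h) : ℂ))) cube := hintC.sub hi2'
            refine this.norm.congr (Eventually.of_forall fun x => ?_)
            simp only [← Complex.ofReal_sub, Complex.norm_real, Real.norm_eq_abs]
          · exact ((hG.integrableOn.add (hGi h)).add
              (integrableOn_const isCompact_cube.measure_lt_top.ne)).const_mul _
          · filter_upwards [ae_restrict_mem isCompact_cube.measurableSet, hne 0, hne h]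
              with x h1 h2 h3
            exact hle h heh40 x h1 h2 h3
      _ = C * euclid h ^ κ * ((∫ x in cube, singularPower b x) +
          (∫ x in cube, singularPower b (x - h)) + vol) := by
          have g1 : IntegrableOn (fun x => singularPower b x + singularPower b (x - h)) cube :=
            hG.integrableOn.add (hGi h)
          rw [integral_const_mul, integral_add g1
            (integrableOn_const isCompact_cube.measure_lt_top.ne), integral_add hG.integrableOn
            (hGi h)]
          simp [hvol]
      _ ≤ C * euclid h ^ κ * (2 * G + vol) := by
          have g1 : ∫ x in cube, singularPower b x ≤ G :=
            setIntegral_le_integral hG (Eventually.of_forall (singularPower_nonneg b))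
          have g2 : ∫ x in cube, singularPower b (x - h) ≤ G := by
            rw [hGd, ← integral_sub_right_eq_self (singularPower b) h]
            exact setIntegral_le_integral (hG.comp_sub_right h)
              (Eventually.of_forall fun x => singularPower_nonneg b _)
          have := euclid_nonneg h
          gcongr
          linarith
  have hfin : ‖potentialHat V n‖ ≤ C * euclid h ^ κ * (2 * G + vol) := by
    rw [hhalf, norm_mul]
    have h2 := norm_torusMean_le fun x => ((V x - V (x - h) : ℝ) : ℂ) * character (-n) x
    have h3 : ∫ x in cube, ‖((V x - V (x - h) : ℝ) : ℂ) * character (-n) x‖ =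
        ∫ x in cube, |V x - V (x - h)| := by
      refine integral_congr_ae (Eventually.of_forall fun x => ?_)
      simp only [norm_mul, norm_character, mul_one, Complex.norm_real, Real.norm_eq_abs]
    rw [h3] at h2
    have h4 : ‖(2⁻¹ : ℂ)‖ ≤ 1 := by norm_num
    nlinarith [norm_nonneg (torusMean fun x => ((V x - V (x - h) : ℝ) : ℂ) * character (-n) x)]
  have hlast : euclid h ^ κ ≤ Real.pi ^ κ * 2 ^ κ * jap n ^ (-κ) := by
    rw [heh, Real.div_rpow hπ.le hlen.le, mul_assoc, div_eq_mul_inv]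
    refine mul_le_mul_of_nonneg_left ?_ (by positivity)
    rw [Real.rpow_neg hj.le, ← Real.inv_rpow hlen.le, ← Real.inv_rpow hj.le,
      ← Real.mul_rpow (by norm_num) (by positivity)]
    refine Real.rpow_le_rpow (by positivity) ?_ hκ.le
    have h1 : jap n ≤ 2 * freqLen n := by
      have := jap_le_one_add n; nlinarith [Real.pi_gt_three]
    rw [inv_le_iff_one_le_mul₀ hlen]
    rw [show 2 * (jap n)⁻¹ * freqLen n = 2 * freqLen n / jap n by ring, one_le_div hj]
    exact h1
  calc ‖potentialHat V n‖ ≤ C * euclid h ^ κ * (2 * G + vol) := hfin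
    _ ≤ C * (Real.pi ^ κ * 2 ^ κ * jap n ^ (-κ)) * (2 * G + vol) := by gcongr
    _ = D * jap n ^ (-κ) := by rw [hD]; ring
    _ ≤ _ := by gcongr; linarith

/-! ### Frequency truncations -/

theorem one_le_dyad (k : ℕ) : 1 ≤ dyad k := one_le_pow₀ one_le_two

theorem dyad_pos (k : ℕ) : 0 < dyad k := lt_of_lt_of_le one_pos (one_le_dyad k)

theorem dyad_mono {j k : ℕ} (h : j ≤ k) : dyad j ≤ dyad k := pow_le_pow_right₀ one_le_two h

theorem dyad_succ (k : ℕ) : dyad (k + 1) = 2 * dyad k := by rw [dyad, dyad, pow_succ, mul_comm]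

theorem dyad_add (j k : ℕ) : dyad (j + k) = dyad j * dyad k := by rw [dyad, dyad, dyad, pow_add]

theorem le_dyad (k : ℕ) : (k : ℝ) ≤ dyad k := by
  rw [dyad]; exact_mod_cast Nat.lt_two_pow_self.le

section Cutoff

variable {ρ : ℝ → ℝ}

theorem IsCutoffProfile.nonneg (hρ : IsCutoffProfile ρ) {y : ℝ} (hy : 0 ≤ y) : 0 ≤ ρ y := by
  obtain ⟨R, hR⟩ := hρ.eq_zero
  rw [← hR (max y R) (le_max_right _ _)]
  exact hρ.antitone hy (le_max_of_le_left hy) (le_max_left _ _)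

theorem IsCutoffProfile.le_one (hρ : IsCutoffProfile ρ) {y : ℝ} (hy : 0 ≤ y) : ρ y ≤ 1 := by
  obtain ⟨r, hr, h1⟩ := hρ.eq_one
  rw [← h1 0 le_rfl hr.le]
  exact hρ.antitone (Set.mem_Ici.2 le_rfl) hy hy

theorem freqLen_div_nonneg (N : ℝ) (n : Freq) : 0 ≤ freqLen n / bracket N :=
  div_nonneg (freqLen_nonneg n) (bracket_pos N).le

theorem IsCutoffProfile.trunc_nonneg (hρ : IsCutoffProfile ρ) (N : ℝ) (n : Freq) :
    0 ≤ trunc ρ N n := hρ.nonneg (freqLen_div_nonneg N n)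

theorem IsCutoffProfile.trunc_le_one (hρ : IsCutoffProfile ρ) (N : ℝ) (n : Freq) :
    trunc ρ N n ≤ 1 := hρ.le_one (freqLen_div_nonneg N n)

theorem IsCutoffProfile.abs_trunc_le (hρ : IsCutoffProfile ρ) (N : ℝ) (n : Freq) :
    |trunc ρ N n| ≤ 1 :=
  abs_le.2 ⟨by linarith [hρ.trunc_nonneg N n], hρ.trunc_le_one N n⟩

theorem IsCutoffProfile.abs_lpSymbol_le (hρ : IsCutoffProfile ρ) (k : ℕ) (n : Freq) :
    |lpSymbol ρ k n| ≤ 1 := by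
  cases k with
  | zero => exact hρ.abs_trunc_le _ _
  | succ k =>
    have h1 := hρ.trunc_nonneg (dyad k) n
    have h2 := hρ.trunc_le_one (dyad k) n
    have h3 := hρ.trunc_nonneg (dyad (k + 1)) n
    have h4 := hρ.trunc_le_one (dyad (k + 1)) n
    exact abs_le.2 ⟨by simp only [lpSymbol]; linarith, by simp only [lpSymbol]; linarith⟩

theorem sum_lpSymbol (K : ℕ) (n : Freq) :
    ∑ k ∈ Finset.range (K + 1), lpSymbol ρ k n = trunc ρ (dyad K) n := by
  induction K with
  | zero => simp [lpSymbol]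
  | succ K ih => rw [Finset.sum_range_succ, ih, lpSymbol]; ring

/-- The constant `A` controls the frequency supports of the truncations with profile `ρ`. -/
structure SupportConst (ρ : ℝ → ℝ) (A : ℝ) : Prop where
  one_le : 1 ≤ A
  trunc_support : ∀ K n, trunc ρ (dyad K) n ≠ 0 → jap n ≤ A * dyad K
  trunc_eq_one : ∀ K n, A * jap n ≤ dyad K → trunc ρ (dyad K) n = 1
  lp_support : ∀ k n, lpSymbol ρ k n ≠ 0 → jap n ≤ A * dyad k ∧ dyad k ≤ A * jap n

theorem IsCutoffProfile.exists_supportConst (hρ : IsCutoffProfile ρ) : ∃ A, SupportConst ρ A := by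
  obtain ⟨r, hr, h1⟩ := hρ.eq_one
  obtain ⟨R, hR⟩ := hρ.eq_zero
  -- The term 2|R| covers the supports, as ⟨N⟩ ≤ 2N for dyadic N. The term 2/r forces |n| ≤ r 2^K
  -- when A⟨n⟩ ≤ 2^K; its factor 2 also covers the lower of the two scales in a Littlewood-Paley
  -- symbol.
  set A : ℝ := 1 + 2 * |R| + 2 / r with hA
  have hr2 : 0 < 2 / r := by positivity
  have hA1 : 1 ≤ A := by have := abs_nonneg R; linarith
  have hsupp : ∀ K n, trunc ρ (dyad K) n ≠ 0 → jap n ≤ A * dyad K := by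
    intro K n h
    have h2 : freqLen n / bracket (dyad K) < |R| := by
      by_contra hcon
      push Not at hcon
      exact h (hR _ ((le_abs_self R).trans hcon))
    rw [div_lt_iff₀ (bracket_pos _)] at h2
    have h3 : bracket (dyad K) ≤ 2 * dyad K := by
      have := bracket_le_one_add_abs (dyad K)
      rw [abs_of_pos (dyad_pos K)] at this
      linarith [one_le_dyad K]
    have h4 := jap_le_one_add n
    have h5 := one_le_dyad K
    have h6 : |R| * bracket (dyad K) ≤ |R| * (2 * dyad K) := by gcongr
    have h7 : 0 ≤ 2 / r * dyad K := by positivity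
    rw [hA]; nlinarith
  have hone : ∀ K n, freqLen n ≤ r * dyad K → trunc ρ (dyad K) n = 1 := by
    intro K n h
    refine h1 _ (freqLen_div_nonneg _ _) ?_
    rw [div_le_iff₀ (bracket_pos _)]
    refine h.trans (mul_le_mul_of_nonneg_left ?_ hr.le)
    exact (le_abs_self _).trans (abs_le_bracket _)
  refine ⟨A, hA1, hsupp, fun K n h => hone K n ?_, fun k n h => ?_⟩
  · have h2 := freqLen_le_jap n
    have h3 : 2 / r * jap n ≤ dyad K := le_trans (by
      have := jap_pos n
      gcongr
      have := abs_nonneg R; linarith) h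
    rw [div_mul_eq_mul_div, div_le_iff₀ hr] at h3
    have := jap_pos n
    nlinarith
  · cases k with
    | zero =>
      refine ⟨hsupp 0 n h, ?_⟩
      have := one_le_jap n
      have h0 : dyad 0 = 1 := by simp [dyad]
      rw [h0]; nlinarith
    | succ k =>
      constructor
      · by_cases h2 : trunc ρ (dyad (k + 1)) n = 0
        · have h3 : trunc ρ (dyad k) n ≠ 0 := fun h3 => h (by simp [lpSymbol, h2, h3])
          refine (hsupp k n h3).trans ?_
          gcongr
          exact dyad_mono (Nat.le_succ k)
        · exact hsupp _ n h2
      · by_contra hcon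
        push Not at hcon
        have h2 : freqLen n ≤ r * dyad k := by
          have h3 := freqLen_le_jap n
          have h4 : 2 / r * jap n < 2 * dyad k := by
            rw [← dyad_succ]
            refine lt_of_le_of_lt ?_ hcon
            have := jap_pos n
            gcongr
            have := abs_nonneg R; linarith
          rw [div_mul_eq_mul_div, div_lt_iff₀ hr] at h4
          nlinarith
        have h3 : freqLen n ≤ r * dyad (k + 1) := by
          refine h2.trans ?_
          gcongr
          exact dyad_mono (Nat.le_succ k)
        exact h (by simp [lpSymbol, hone _ _ h2, hone _ _ h3])

end Cutoff

/-! ### Frequency blocks, their supports and coefficients -/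

/-- The frequencies with `⟨n⟩ ≤ B`. -/
def freqBall (B : ℝ) : Finset Freq :=
  (Fintype.piFinset fun _ => Finset.Icc (-(⌈B⌉₊ : ℤ)) ⌈B⌉₊).filter fun n => jap n ≤ B

theorem mem_freqBall {B : ℝ} {n : Freq} : n ∈ freqBall B ↔ jap n ≤ B := by
  rw [freqBall, Finset.mem_filter, and_iff_right_iff_imp]
  intro h
  rw [Fintype.mem_piFinset]
  intro i
  have h1 := (abs_coord_le_freqLen n i).trans ((freqLen_le_jap n).trans (h.trans (Nat.le_ceil B)))
  rw [Finset.mem_Icc, ← abs_le]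
  exact_mod_cast h1

theorem card_freqBall_le {B : ℝ} (hB : 1 ≤ B) : ((freqBall B).card : ℝ) ≤ (5 * B) ^ 3 := by
  have h1 : (freqBall B).card ≤ (2 * ⌈B⌉₊ + 1) ^ 3 := by
    refine (Finset.card_filter_le _ _).trans ?_
    rw [Fintype.card_piFinset_const, Int.card_Icc]
    apply le_of_eq; congr 1; omega
  calc ((freqBall B).card : ℝ) ≤ (2 * (⌈B⌉₊ : ℝ) + 1) ^ 3 := by exact_mod_cast h1
    _ ≤ (5 * B) ^ 3 := by
      have := Nat.ceil_lt_add_one (show 0 ≤ B by linarith)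
      gcongr
      linarith

/-- The frequencies on which a block with scales `2^(k j)` may live. -/
def blockSupp (A : ℝ) (k : Fin 3 → ℕ) : Finset (Fin 3 → Freq) :=
  (Fintype.piFinset fun j => freqBall (A * dyad (k j))).filter
    fun m => ∀ j, dyad (k j) ≤ A * jap (m j)

theorem mem_blockSupp {A : ℝ} {k : Fin 3 → ℕ} {m : Fin 3 → Freq} :
    m ∈ blockSupp A k ↔ ∀ j, jap (m j) ≤ A * dyad (k j) ∧ dyad (k j) ≤ A * jap (m j) := by
  simp only [blockSupp, Finset.mem_filter, Fintype.mem_piFinset, mem_freqBall, forall_and]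

/-- The logarithm of the largest scale. -/
def maxIdx (k : Fin 3 → ℕ) : ℕ := max (k 0) (max (k 1) (k 2))

theorem maxScale_eq (k : Fin 3 → ℕ) : maxScale k = dyad (maxIdx k) := by
  have h : Monotone dyad := fun _ _ h => dyad_mono h
  rw [maxScale, maxIdx, h.map_max, h.map_max]

theorem le_maxIdx (k : Fin 3 → ℕ) (j : Fin 3) : k j ≤ maxIdx k := by
  unfold maxIdx; fin_cases j <;> simp

theorem exists_eq_maxIdx (k : Fin 3 → ℕ) : ∃ j, k j = maxIdx k := by
  unfold maxIdx
  rcases max_choice (k 0) (max (k 1) (k 2)) with h | h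
  · exact ⟨0, h.symm⟩
  · rcases max_choice (k 1) (k 2) with h' | h'
    · exact ⟨1, by rw [h, h']⟩
    · exact ⟨2, by rw [h, h']⟩

theorem one_le_maxScale (k : Fin 3 → ℕ) : 1 ≤ maxScale k := by
  rw [maxScale_eq]; exact one_le_dyad _

theorem card_blockSupp_le {A : ℝ} (hA : 1 ≤ A) (k : Fin 3 → ℕ) :
    ((blockSupp A k).card : ℝ) ≤ (5 * A * maxScale k) ^ 9 := by
  have h1 : (blockSupp A k).card ≤ ∏ j, (freqBall (A * dyad (k j))).card := by
    rw [← Fintype.card_piFinset]; exact Finset.card_filter_le _ _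
  have h2 : ∀ j, ((freqBall (A * dyad (k j))).card : ℝ) ≤ (5 * A * maxScale k) ^ 3 := fun j => by
    have h3 := one_le_dyad (k j)
    refine (card_freqBall_le (by nlinarith)).trans ?_
    have := dyad_pos (k j)
    rw [← mul_assoc, maxScale_eq]
    gcongr
    exact dyad_mono (le_maxIdx k j)
  calc ((blockSupp A k).card : ℝ) ≤ ∏ j, ((freqBall (A * dyad (k j))).card : ℝ) := by
        exact_mod_cast h1
    _ ≤ ∏ _j : Fin 3, (5 * A * maxScale k) ^ 3 :=
        Finset.prod_le_prod (fun _ _ => by positivity) fun j _ => h2 j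
    _ = _ := by simp; ring

/-- The sum `n₁ + n₂ + n₃` of the frequencies. -/
def freqSum (m : Fin 3 → Freq) : Freq := m 0 + m 1 + m 2

/-- The time frequency of a product of three half waves. -/
def phase (ε : Fin 3 → ℤˣ) (m : Fin 3 → Freq) : ℝ := ∑ j, ((ε j : ℤ) : ℝ) * jap (m j)

/-- Deterministic coefficients of a block. -/
def blockCoef (V : Pt → ℝ) (ρ : ℝ → ℝ) (k : Fin 3 → ℕ) (N : ℝ) (m : Fin 3 → Freq) : ℂ :=
  (trunc ρ N (freqSum m) : ℂ) * (∏ j, (trunc ρ N (m j) : ℂ) * (lpSymbol ρ (k j) (m j) : ℂ))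
    * potentialHat V (m 0 + m 1)

theorem freqLen_freqSum_le (m : Fin 3 → Freq) :
    freqLen (freqSum m) ≤ freqLen (m 0) + freqLen (m 1) + freqLen (m 2) :=
  (freqLen_add_le _ _).trans (add_le_add_left (freqLen_add_le _ _) _)

theorem jap_freqSum_le (m : Fin 3 → Freq) :
    jap (freqSum m) ≤ jap (m 0) + jap (m 1) + jap (m 2) + 1 := by
  have := freqLen_freqSum_le m
  have := jap_le_one_add (freqSum m)
  linarith [freqLen_le_jap (m 0), freqLen_le_jap (m 1), freqLen_le_jap (m 2)]

theorem jap_le_prod (m : Fin 3 → Freq) (j : Fin 3) : jap (m j) ≤ ∏ i, jap (m i) := by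
  have h0 := one_le_jap (m 0)
  have h1 := one_le_jap (m 1)
  have h2 := one_le_jap (m 2)
  have h01 : 1 ≤ jap (m 0) * jap (m 1) := by nlinarith
  have h02 : 1 ≤ jap (m 0) * jap (m 2) := by nlinarith
  have h12 : 1 ≤ jap (m 1) * jap (m 2) := by nlinarith
  rw [Fin.prod_univ_three]
  fin_cases j
  · change jap (m 0) ≤ _; nlinarith
  · change jap (m 1) ≤ _; nlinarith
  · change jap (m 2) ≤ _; nlinarith

theorem one_le_prod_jap (m : Fin 3 → Freq) : 1 ≤ ∏ i, jap (m i) :=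
  (one_le_jap (m 0)).trans (jap_le_prod m 0)

theorem abs_units (e : ℤˣ) : |((e : ℤ) : ℝ)| = 1 := by
  rcases Int.units_eq_one_or e with rfl | rfl <;> simp

theorem abs_phase_le (ε : Fin 3 → ℤˣ) (m : Fin 3 → Freq) :
    |phase ε m| ≤ jap (m 0) + jap (m 1) + jap (m 2) := by
  rw [phase, ← Fin.sum_univ_three (fun j => jap (m j))]
  refine (Finset.abs_sum_le_sum_abs _ _).trans (Finset.sum_le_sum fun j _ => ?_)
  rw [abs_mul, abs_units, one_mul, abs_of_pos (jap_pos _)]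

theorem bracket_phase_le (σ : ℝ) (hσ : |σ| = 1) (ε : Fin 3 → ℤˣ) (m : Fin 3 → Freq) :
    bracket (σ * jap (freqSum m) + phase ε m) ≤ 8 * ∏ i, jap (m i) := by
  have h1 := bracket_le_one_add_abs (σ * jap (freqSum m) + phase ε m)
  have h2 := abs_add_le (σ * jap (freqSum m)) (phase ε m)
  rw [abs_mul, hσ, one_mul, abs_of_pos (jap_pos _)] at h2
  linarith [abs_phase_le ε m, jap_freqSum_le m, jap_le_prod m 0, jap_le_prod m 1,
    jap_le_prod m 2, one_le_prod_jap m]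

theorem blockCoef_support {V : Pt → ℝ} {ρ : ℝ → ℝ} {A : ℝ} (hA : SupportConst ρ A)
    {k : Fin 3 → ℕ} {N : ℝ} {m : Fin 3 → Freq} (h : blockCoef V ρ k N m ≠ 0) :
    m ∈ blockSupp A k := by
  rw [mem_blockSupp]
  intro j
  refine hA.lp_support _ _ fun h0 => h ?_
  rw [blockCoef, Finset.prod_eq_zero (Finset.mem_univ j) (by rw [h0]; simp)]
  simp

/-- The index beyond which a block does not depend on the truncation. -/
def stableIdx (A : ℝ) (k : Fin 3 → ℕ) : ℕ := maxIdx k + ⌈4 * A ^ 2⌉₊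

/-- On the block every frequency is at most AM and n₁₂₃ at most 4AM, so 2^K ≥ 4A²M makes all
truncations equal to 1. Adding ⌈4A²⌉ to the index suffices because x ≤ 2^x. -/
theorem trunc_eq_one_of_stable {ρ : ℝ → ℝ} {A : ℝ} (hA : SupportConst ρ A) {k : Fin 3 → ℕ}
    {K : ℕ} (hK : stableIdx A k ≤ K) {m : Fin 3 → Freq} (hm : m ∈ blockSupp A k) :
    trunc ρ (dyad K) (freqSum m) = 1 ∧ ∀ j, trunc ρ (dyad K) (m j) = 1 := by
  have h1A := hA.one_le
  have hD : 4 * A ^ 2 * dyad (maxIdx k) ≤ dyad K := by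
    refine le_trans ?_ (dyad_mono hK)
    rw [stableIdx, dyad_add, mul_comm]
    exact mul_le_mul_of_nonneg_left ((Nat.le_ceil _).trans (le_dyad _)) (dyad_pos _).le
  have hj : ∀ j, jap (m j) ≤ A * dyad (maxIdx k) := fun j =>
    ((mem_blockSupp.1 hm) j).1.trans
      (mul_le_mul_of_nonneg_left (dyad_mono (le_maxIdx k j)) (by linarith))
  have hd := one_le_dyad (maxIdx k)
  have hAd : 1 ≤ A * dyad (maxIdx k) := by nlinarith
  refine ⟨hA.trunc_eq_one _ _ ?_, fun j => hA.trunc_eq_one _ _ ?_⟩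
  · have := jap_freqSum_le m
    have h4 : jap (freqSum m) ≤ 4 * (A * dyad (maxIdx k)) := by linarith [hj 0, hj 1, hj 2]
    calc A * jap (freqSum m) ≤ A * (4 * (A * dyad (maxIdx k))) := by gcongr
      _ = 4 * A ^ 2 * dyad (maxIdx k) := by ring
      _ ≤ _ := hD
  · calc A * jap (m j) ≤ A * (A * dyad (maxIdx k)) := by gcongr; exact hj j
      _ ≤ 4 * A ^ 2 * dyad (maxIdx k) := by nlinarith [mul_nonneg (sq_nonneg A) (dyad_pos (maxIdx k)).le]
      _ ≤ _ := hD

theorem blockCoef_stable {V : Pt → ℝ} {ρ : ℝ → ℝ} {A : ℝ} (hA : SupportConst ρ A)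
    {k : Fin 3 → ℕ} {K : ℕ} (hK : stableIdx A k ≤ K) :
    blockCoef V ρ k (dyad K) = blockCoef V ρ k (dyad (stableIdx A k)) := by
  funext m
  by_cases hm : m ∈ blockSupp A k
  · obtain ⟨h1, h2⟩ := trunc_eq_one_of_stable hA hK hm
    obtain ⟨h3, h4⟩ := trunc_eq_one_of_stable hA le_rfl hm
    simp only [blockCoef, h1, h2, h3, h4]
  · rw [not_imp_comm.1 (blockCoef_support hA) hm, not_imp_comm.1 (blockCoef_support hA) hm]

theorem IsCutoffProfile.norm_blockCoef_le {V : Pt → ℝ} {ρ : ℝ → ℝ} (hρ : IsCutoffProfile ρ)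
    (k : Fin 3 → ℕ) (N : ℝ) (m : Fin 3 → Freq) :
    ‖blockCoef V ρ k N m‖ ≤ ‖potentialHat V (m 0 + m 1)‖ := by
  rw [blockCoef, norm_mul, norm_mul, norm_prod]
  have h1 : ‖(trunc ρ N (freqSum m) : ℂ)‖ ≤ 1 := by
    rw [Complex.norm_real]; exact hρ.abs_trunc_le _ _
  have h2 : ∏ j, ‖(trunc ρ N (m j) : ℂ) * (lpSymbol ρ (k j) (m j) : ℂ)‖ ≤ 1 := by
    refine Finset.prod_le_one (fun _ _ => norm_nonneg _) fun j _ => ?_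
    rw [norm_mul, Complex.norm_real, Complex.norm_real]
    exact mul_le_one₀ (hρ.abs_trunc_le _ _) (norm_nonneg _) (hρ.abs_lpSymbol_le _ _)
  have h3 := mul_le_one₀ h1 (Finset.prod_nonneg fun _ _ => norm_nonneg _) h2
  exact mul_le_of_le_one_left (norm_nonneg _) h3

/-- Raising the modulation exponent from 1 - θ/4 to 1 + θ/4 costs B^{θ/2} ≤ (8Q)^{θ/2}. Half of the
available Q^{-θ} pays for it; the other half becomes decay in the largest scale. -/
theorem block_weight_le {θ A M Q B : ℝ} (hθ : 0 < θ) (hA : 0 < A) (hM : 0 < M) (hQ : M / A ≤ Q)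
    (hB : 0 < B) (hBQ : B ≤ 8 * Q) :
    Q ^ (-θ) * B ^ (-(1 - θ / 4)) ≤
      8 ^ (θ / 2) * A ^ (θ / 2) * M ^ (-(θ / 2)) * B ^ (-(1 + θ / 4)) := by
  have hQ0 : 0 < Q := lt_of_lt_of_le (by positivity) hQ
  have e3 : B ^ (-(1 - θ / 4)) ≤ B ^ (-(1 + θ / 4)) * (8 ^ (θ / 2) * Q ^ (θ / 2)) := by
    have : B ^ (-(1 - θ / 4)) = B ^ (-(1 + θ / 4)) * B ^ (θ / 2) := by
      rw [← Real.rpow_add hB]; congr 1; ring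
    rw [this, ← Real.mul_rpow (by norm_num) hQ0.le]
    gcongr
  have e4 : Q ^ (-θ) * Q ^ (θ / 2) ≤ A ^ (θ / 2) * M ^ (-(θ / 2)) := by
    have h2 : Q ^ (-θ) * Q ^ (θ / 2) = Q ^ (-(θ / 2)) := by
      rw [← Real.rpow_add hQ0]; congr 1; ring
    rw [h2]
    calc Q ^ (-(θ / 2)) ≤ (M / A) ^ (-(θ / 2)) :=
          Real.rpow_le_rpow_of_nonpos (by positivity) hQ (by linarith)
      _ = _ := by
          rw [Real.div_rpow hM.le hA.le, Real.rpow_neg hA.le, div_inv_eq_mul, mul_comm]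
  calc Q ^ (-θ) * B ^ (-(1 - θ / 4))
      ≤ Q ^ (-θ) * (B ^ (-(1 + θ / 4)) * (8 ^ (θ / 2) * Q ^ (θ / 2))) := by gcongr
    _ = 8 ^ (θ / 2) * (Q ^ (-θ) * Q ^ (θ / 2)) * B ^ (-(1 + θ / 4)) := by ring
    _ ≤ 8 ^ (θ / 2) * (A ^ (θ / 2) * M ^ (-(θ / 2))) * B ^ (-(1 + θ / 4)) := by gcongr
    _ = _ := by ring

theorem prod_jap_rpow_neg_two (θ : ℝ) (m : Fin 3 → Freq) :
    ∏ j, jap (m j) ^ (-2 : ℝ) = (∏ j, jap (m j) ^ (-(2 - θ))) * (∏ j, jap (m j)) ^ (-θ) := by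
  rw [← Real.finsetProd_rpow _ _ (fun j _ => (jap_pos _).le), ← Finset.prod_mul_distrib]
  refine Finset.prod_congr rfl fun j _ => ?_
  rw [← Real.rpow_add (jap_pos _)]; congr 1; ring

/-- At the index carrying the largest scale, ⟨m_j⟩ ≥ M/A, and the other factors of the product are
at least 1. -/
theorem maxScale_le_prod_jap {A : ℝ} (hA : 0 < A) {k : Fin 3 → ℕ} {m : Fin 3 → Freq}
    (hm : m ∈ blockSupp A k) : maxScale k / A ≤ ∏ j, jap (m j) := by
  obtain ⟨j, hj⟩ := exists_eq_maxIdx k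
  rw [div_le_iff₀ hA, maxScale_eq, ← hj, mul_comm]
  exact ((mem_blockSupp.1 hm) j).2.trans (mul_le_mul_of_nonneg_left (jap_le_prod m j) hA.le)

/-- The square sum of the coefficients of a block, with decay in the largest scale. -/
theorem block_coef_sum {κ η θ : ℝ} (hκ2 : κ < 1 / 2) (hηκ : η < κ) (hθ : 0 < θ)
    (hθη : 2 * θ < η) {V : Pt → ℝ} {ρ : ℝ → ℝ} (hρ : IsCutoffProfile ρ) {A : ℝ}
    (hA : SupportConst ρ A)
    (hV : ∃ C, 0 < C ∧ ∀ n, ‖potentialHat V n‖ ≤ C * jap n ^ (-κ)) :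
    ∃ C : ℝ, 0 < C ∧ ∀ (k : Fin 3 → ℕ) (N σ : ℝ) (ε : Fin 3 → ℤˣ), |σ| = 1 →
      ∑ m ∈ blockSupp A k, ‖blockCoef V ρ k N m‖ ^ 2 * (∏ j, jap (m j) ^ (-2 : ℝ)) *
        jap (freqSum m) ^ (2 * (κ - η) - 2) *
        bracket (σ * jap (freqSum m) + phase ε m) ^ (-(1 - θ / 4)) ≤
      C * maxScale k ^ (-(θ / 2)) := by
  obtain ⟨CV, hCV, hVle⟩ := hV
  -- The sum is taken with modulation exponent 1 + θ/4 and with each ⟨m_j⟩^{-2} weakened to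
  -- ⟨m_j⟩^{-(2-θ)}; the spare power of the product feeds `block_weight_le`.
  obtain ⟨C₀, hC₀, hsum⟩ := cubic_sum hηκ hκ2 hθ hθη (γ := 1 + θ / 4) (by linarith)
  have hA0 : 0 < A := by linarith [hA.one_le]
  obtain ⟨D, hD⟩ : ∃ D, D = CV ^ 2 * (8 ^ (θ / 2) * A ^ (θ / 2)) := ⟨_, rfl⟩
  have hD0 : 0 < D := by rw [hD]; positivity
  refine ⟨D * (C₀.toReal + 1), by positivity, fun k N σ ε hσ => ?_⟩
  have hM0 : 0 < maxScale k := by linarith [one_le_maxScale k]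
  have hpt : ∀ m ∈ blockSupp A k, ‖blockCoef V ρ k N m‖ ^ 2 * (∏ j, jap (m j) ^ (-2 : ℝ)) *
        jap (freqSum m) ^ (2 * (κ - η) - 2) *
        bracket (σ * jap (freqSum m) + phase ε m) ^ (-(1 - θ / 4)) ≤
      D * maxScale k ^ (-(θ / 2)) * ((∏ j, jap (m j) ^ (-(2 - θ))) *
        jap (m 0 + m 1) ^ (-(2 * κ)) * jap (freqSum m) ^ (2 * (κ - η) - 2) *
        bracket (σ * jap (freqSum m) + phase ε m) ^ (-(1 + θ / 4))) := by
    intro m hm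
    have hw := block_weight_le hθ hA0 hM0 (maxScale_le_prod_jap hA0 hm) (bracket_pos _)
      (bracket_phase_le σ hσ ε m)
    have hB := bracket_pos (σ * jap (freqSum m) + phase ε m)
    generalize bracket (σ * jap (freqSum m) + phase ε m) = B at hw hB ⊢
    have hj12 := jap_pos (m 0 + m 1)
    have hjs := jap_pos (freqSum m)
    have e1 : ‖blockCoef V ρ k N m‖ ^ 2 ≤ CV ^ 2 * jap (m 0 + m 1) ^ (-(2 * κ)) := by
      calc ‖blockCoef V ρ k N m‖ ^ 2 ≤ (CV * jap (m 0 + m 1) ^ (-κ)) ^ 2 := by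
            gcongr; exact (hρ.norm_blockCoef_le k N m).trans (hVle _)
        _ = _ := by
            rw [mul_pow, ← Real.rpow_natCast (jap (m 0 + m 1) ^ (-κ)), ← Real.rpow_mul hj12.le]
            congr 2; push_cast; ring
    have p1 : 0 ≤ ∏ j, jap (m j) ^ (-(2 - θ)) :=
      Finset.prod_nonneg fun j _ => Real.rpow_nonneg (jap_pos _).le _
    have p2 : 0 ≤ jap (m 0 + m 1) ^ (-(2 * κ)) := Real.rpow_nonneg hj12.le _
    have p3 : 0 ≤ jap (freqSum m) ^ (2 * (κ - η) - 2) := Real.rpow_nonneg hjs.le _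
    rw [prod_jap_rpow_neg_two θ]
    generalize ∏ j, jap (m j) ^ (-(2 - θ)) = R at p1 ⊢
    generalize ∏ j, jap (m j) = Q at hw ⊢
    generalize jap (freqSum m) ^ (2 * (κ - η) - 2) = J at p3 ⊢
    generalize jap (m 0 + m 1) ^ (-(2 * κ)) = J' at e1 p2 ⊢
    calc ‖blockCoef V ρ k N m‖ ^ 2 * (R * Q ^ (-θ)) * J * B ^ (-(1 - θ / 4))
        = ‖blockCoef V ρ k N m‖ ^ 2 * R * J * (Q ^ (-θ) * B ^ (-(1 - θ / 4))) := by ring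
      _ ≤ ‖blockCoef V ρ k N m‖ ^ 2 * R * J *
          (8 ^ (θ / 2) * A ^ (θ / 2) * maxScale k ^ (-(θ / 2)) * B ^ (-(1 + θ / 4))) :=
          mul_le_mul_of_nonneg_left hw (by positivity)
      _ ≤ CV ^ 2 * J' * R * J *
          (8 ^ (θ / 2) * A ^ (θ / 2) * maxScale k ^ (-(θ / 2)) * B ^ (-(1 + θ / 4))) := by
          have : 0 ≤ 8 ^ (θ / 2) * A ^ (θ / 2) * maxScale k ^ (-(θ / 2)) * B ^ (-(1 + θ / 4)) := by
            positivity
          gcongr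
      _ = _ := by rw [hD]; ring
  have hFnn : ∀ m : Fin 3 → Freq, 0 ≤ (∏ j, jap (m j) ^ (-(2 - θ))) *
        jap (m 0 + m 1) ^ (-(2 * κ)) * jap (freqSum m) ^ (2 * (κ - η) - 2) *
        bracket (σ * jap (freqSum m) + phase ε m) ^ (-(1 + θ / 4)) := fun m =>
    mul_nonneg (mul_nonneg (mul_nonneg
      (Finset.prod_nonneg fun j _ => Real.rpow_nonneg (jap_pos _).le _)
      (Real.rpow_nonneg (jap_pos _).le _)) (Real.rpow_nonneg (jap_pos _).le _))
      (Real.rpow_nonneg (bracket_pos _).le _)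
  have hS := hsum σ (fun j => ((ε j : ℤ) : ℝ)) hσ (fun j => abs_units _)
  simp only [neg_sub (2 : ℝ) (2 * (κ - η))] at hS
  have hfin := (ENNReal.ofReal_le_iff_le_toReal hC₀.ne).1
    (((ENNReal.ofReal_sum_of_nonneg fun m (_ : m ∈ blockSupp A k) => hFnn m).trans_le
      (ENNReal.sum_le_tsum _)).trans hS)
  refine (Finset.sum_le_sum hpt).trans ?_
  rw [← Finset.mul_sum]
  calc _ ≤ D * maxScale k ^ (-(θ / 2)) * (C₀.toReal + 1) :=
        mul_le_mul_of_nonneg_left (by linarith) (by positivity)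
    _ = _ := by ring

/-! ### Oscillatory sums and their space-time Fourier transforms -/

/-- `e^{i r}`. -/
def osc (r : ℝ) : ℂ := Complex.exp (Complex.I * (r : ℂ))

theorem norm_osc (r : ℝ) : ‖osc r‖ = 1 := by
  rw [osc, mul_comm]; exact Complex.norm_exp_ofReal_mul_I _

theorem osc_add (r s : ℝ) : osc (r + s) = osc r * osc s := by
  rw [osc, osc, osc, ← Complex.exp_add]; push_cast; ring_nf

theorem continuous_osc : Continuous osc := by unfold osc; fun_prop

theorem norm_osc_sub_le (r s : ℝ) : ‖osc r - osc s‖ ≤ |r - s| := by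
  have h : osc r - osc s = osc s * (osc (r - s) - 1) := by
    rw [mul_sub, ← osc_add, mul_one]; ring_nf
  rw [h, norm_mul, norm_osc, one_mul]
  exact Real.norm_exp_I_mul_ofReal_sub_one_le

/-- `∫_0^T e^{i μ t} dt`. -/
def oscInt (T μ : ℝ) : ℂ := ∫ t in (0 : ℝ)..T, osc (μ * t)

theorem continuous_oscInt (T : ℝ) : Continuous (oscInt T) := by
  refine intervalIntegral.continuous_parametric_intervalIntegral_of_continuous' ?_ 0 T
  exact continuous_osc.comp (by fun_prop)

theorem norm_oscInt_le {T : ℝ} (hT : 0 ≤ T) (μ : ℝ) : ‖oscInt T μ‖ ≤ T := by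
  have := intervalIntegral.norm_integral_le_of_norm_le_const (a := 0) (b := T) (C := 1)
    (f := fun t => osc (μ * t)) fun t _ => (norm_osc _).le
  rwa [sub_zero, one_mul, abs_of_nonneg hT] at this

theorem abs_mul_norm_oscInt_le (T μ : ℝ) : |μ| * ‖oscInt T μ‖ ≤ 2 := by
  rcases eq_or_ne μ 0 with rfl | hμ
  · simp
  have hc : Complex.I * (μ : ℂ) ≠ 0 := mul_ne_zero Complex.I_ne_zero (by exact_mod_cast hμ)
  have h1 : ∀ t : ℝ, osc (μ * t) = Complex.exp ((Complex.I * μ) * t) := fun t => by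
    rw [osc]; push_cast; ring_nf
  have h2 : oscInt T μ = (osc (μ * T) - 1) / (Complex.I * μ) := by
    rw [oscInt]
    simp_rw [h1]
    rw [integral_exp_mul_complex hc]
    simp
  rw [h2, norm_div, norm_mul, Complex.norm_I, one_mul, Complex.norm_real, Real.norm_eq_abs,
    mul_div_cancel₀ _ (abs_pos.2 hμ).ne']
  calc ‖osc (μ * T) - 1‖ ≤ ‖osc (μ * T)‖ + ‖(1 : ℂ)‖ := norm_sub_le _ _
    _ = 2 := by rw [norm_osc, norm_one]; norm_num

/-- The trivial bound u ≤ T and the bound 2/|μ| from the explicit primitive, combined. Uniformity in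
u ≤ T later gives uniformity in the cutoff time τ. -/
theorem norm_oscInt_sq_le {T u : ℝ} (hT : 1 ≤ T) (hu : 0 ≤ u) (huT : u ≤ T) (μ : ℝ) :
    ‖oscInt u μ‖ ^ 2 ≤ 5 * T ^ 2 * bracket μ ^ (-2 : ℝ) := by
  have hb := bracket_pos μ
  have h1 := norm_oscInt_le hu μ
  have h2 := abs_mul_norm_oscInt_le u μ
  have h3 := norm_nonneg (oscInt u μ)
  rw [Real.rpow_neg hb.le, Real.rpow_two, bracket_sq, ← div_eq_mul_inv, le_div_iff₀ (by positivity)]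
  have h4 : ‖oscInt u μ‖ ^ 2 ≤ T ^ 2 := by gcongr; linarith
  have h5 : μ ^ 2 * ‖oscInt u μ‖ ^ 2 ≤ 4 := by
    rw [← sq_abs μ, ← mul_pow]
    have : 0 ≤ |μ| * ‖oscInt u μ‖ := by positivity
    nlinarith
  nlinarith

theorem integrable_bracket_rpow {r : ℝ} (hr : 1 < r) : Integrable fun y : ℝ => bracket y ^ (-r) := by
  have h := integrable_rpow_neg_one_add_norm_sq (E := ℝ) (μ := volume) (r := r) (by simpa using hr)
  refine h.congr (Eventually.of_forall fun y => ?_)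
  simp only [bracket, Real.sqrt_eq_rpow, Real.norm_eq_abs, sq_abs]
  rw [← Real.rpow_mul (by positivity)]
  congr 1; ring

theorem continuous_bracket_rpow (r : ℝ) : Continuous fun y : ℝ => bracket y ^ r :=
  continuous_bracket.rpow_const fun y => Or.inl (bracket_pos y).ne'

/-- The weight of the `X^{s,b}`-norm, `b < 0`, applied to the time cutoff of a plane wave. -/
theorem lintegral_weight_oscInt_le {a : ℝ} (ha : 0 ≤ a) (ha1 : a < 1) :
    ∃ C : ℝ, 0 < C ∧ ∀ T J φ : ℝ, 1 ≤ T →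
      ∫⁻ lam : ℝ, ENNReal.ofReal (bracket (|lam| - J) ^ (-a)) * ‖oscInt T (φ - lam)‖ₑ ^ 2 ≤
        ENNReal.ofReal (C * T ^ 2 * (bracket (J + φ) ^ (-a) + bracket (-J + φ) ^ (-a))) := by
  have hint := integrable_bracket_rpow (r := 2 - a) (by linarith)
  set I₀ := ∫ y : ℝ, bracket y ^ (-(2 - a)) with hI
  have hI0 : 0 ≤ I₀ := integral_nonneg fun y => Real.rpow_nonneg (bracket_pos y).le _
  refine ⟨5 * 2 ^ a * (I₀ + 1), by positivity, fun T J φ hT => ?_⟩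
  have hpt : ∀ lam : ℝ, ENNReal.ofReal (bracket (|lam| - J) ^ (-a)) * ‖oscInt T (φ - lam)‖ₑ ^ 2 ≤
      ENNReal.ofReal (5 * T ^ 2 * 2 ^ a * (bracket (J + φ) ^ (-a) + bracket (-J + φ) ^ (-a)) *
        bracket (φ - lam) ^ (-(2 - a))) := by
    intro lam
    rw [← ofReal_norm, ← ENNReal.ofReal_pow (norm_nonneg _),
      ← ENNReal.ofReal_mul (Real.rpow_nonneg (bracket_pos _).le _)]
    apply ENNReal.ofReal_le_ofReal
    have hy := bracket_pos (φ - lam)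
    have h1 := norm_oscInt_sq_le hT (by linarith) le_rfl (φ - lam)
    have p1 : 0 ≤ bracket (lam - J) ^ (-a) := Real.rpow_nonneg (bracket_pos _).le _
    have p2 : 0 ≤ bracket (lam + J) ^ (-a) := Real.rpow_nonneg (bracket_pos _).le _
    -- The weight sees |λ|, hence both branches λ = ±J of the cone; these produce the two
    -- modulations.
    have h2 : bracket (|lam| - J) ^ (-a) ≤ bracket (lam - J) ^ (-a) + bracket (lam + J) ^ (-a) := by
      rcases le_total 0 lam with h | h
      · rw [abs_of_nonneg h]; linarith
      · rw [abs_of_nonpos h, ← bracket_neg (-lam - J), show -(-lam - J) = lam + J by ring]; linarith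
    -- Peetre's inequality moves the weight from λ to φ at the price ⟨φ - λ⟩^a; against the decay ⟨φ
    -- - λ⟩^{-2} the exponent 2 - a > 1 remains, which is integrable.
    have h3 := bracket_rpow_neg_le ha (-J + φ) (lam - φ)
    have h4 := bracket_rpow_neg_le ha (J + φ) (lam - φ)
    rw [← bracket_neg (lam - φ), neg_sub] at h3 h4
    rw [show -J + φ + (lam - φ) = lam - J by ring] at h3
    rw [show J + φ + (lam - φ) = lam + J by ring] at h4
    have h5 : bracket (φ - lam) ^ a * bracket (φ - lam) ^ (-2 : ℝ) =
        bracket (φ - lam) ^ (-(2 - a)) := by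
      rw [← Real.rpow_add hy]; congr 1; ring
    calc bracket (|lam| - J) ^ (-a) * ‖oscInt T (φ - lam)‖ ^ 2
        ≤ (2 ^ a * bracket (-J + φ) ^ (-a) * bracket (φ - lam) ^ a +
          2 ^ a * bracket (J + φ) ^ (-a) * bracket (φ - lam) ^ a) *
          (5 * T ^ 2 * bracket (φ - lam) ^ (-2 : ℝ)) :=
          mul_le_mul (by linarith) h1 (by positivity) (by linarith)
      _ = 5 * T ^ 2 * 2 ^ a * (bracket (J + φ) ^ (-a) + bracket (-J + φ) ^ (-a)) *
          (bracket (φ - lam) ^ a * bracket (φ - lam) ^ (-2 : ℝ)) := by ring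
      _ = _ := by rw [h5]
  have q1 : 0 ≤ bracket (J + φ) ^ (-a) := Real.rpow_nonneg (bracket_pos _).le _
  have q2 : 0 ≤ bracket (-J + φ) ^ (-a) := Real.rpow_nonneg (bracket_pos _).le _
  refine (lintegral_mono hpt).trans ?_
  rw [← ofReal_integral_eq_lintegral_ofReal ((hint.comp_sub_left φ).const_mul _)
    (Eventually.of_forall fun lam => by
      have : 0 ≤ bracket (φ - lam) ^ (-(2 - a)) := Real.rpow_nonneg (bracket_pos _).le _
      positivity), integral_const_mul,
    integral_sub_left_eq_self (fun y => bracket y ^ (-(2 - a))) volume φ, ← hI]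
  apply ENNReal.ofReal_le_ofReal
  have : 0 ≤ 5 * T ^ 2 * 2 ^ a * (bracket (J + φ) ^ (-a) + bracket (-J + φ) ^ (-a)) := by positivity
  nlinarith

/-! ### Fourier inversion in time -/

theorem invFourierTime_eq (ψ : ℝ → ℂ) (lam : ℝ) :
    invFourierTime ψ lam = (((2 * Real.pi : ℝ)) : ℂ)⁻¹ * FourierTransformInv.fourierInv ψ (lam / (2 * Real.pi)) := by
  rw [invFourierTime, Real.fourierInv_eq']
  congr 1
  refine integral_congr_ae (Eventually.of_forall fun t => ?_)
  simp only [smul_eq_mul]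
  rw [mul_comm]
  congr 2
  have h : 2 * Real.pi * inner ℝ t (lam / (2 * Real.pi)) = lam * t := by
    have := Real.pi_pos
    simp only [RCLike.inner_apply, conj_trivial]
    field_simp
  rw [h, mul_comm]

theorem integrable_invFourierTime {ψ : ℝ → ℂ} (hψ : ContDiff ℝ (⊤ : ℕ∞) ψ)
    (hc : HasCompactSupport ψ) : Integrable (invFourierTime ψ) := by
  have h := (FourierTransformInv.fourierInv (hc.toSchwartzMap hψ)).integrable (μ := volume)
  rw [SchwartzMap.fourierInv_coe] at h
  have h2 := ((h.comp_div (R := 2 * Real.pi) Real.two_pi_pos.ne').const_mul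
    (((2 * Real.pi : ℝ)) : ℂ)⁻¹)
  exact h2.congr (Eventually.of_forall fun lam => (invFourierTime_eq ψ lam).symm)

theorem integral_invFourierTime {ψ : ℝ → ℂ} (hψ : ContDiff ℝ (⊤ : ℕ∞) ψ)
    (hc : HasCompactSupport ψ) (t : ℝ) :
    ∫ lam : ℝ, invFourierTime ψ lam * osc (-(lam * t)) = ψ t := by
  set Ψ := hc.toSchwartzMap hψ
  have hinv : FourierTransform.fourier (FourierTransformInv.fourierInv (Ψ : ℝ → ℂ)) t = ψ t := by
    rw [← SchwartzMap.fourierInv_coe, ← SchwartzMap.fourier_coe]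
    simp [Ψ]
  rw [← hinv, Real.fourier_eq']
  have hpi := Real.two_pi_pos
  have h := Measure.integral_comp_div (fun ξ : ℝ =>
    Complex.exp (((-2 * Real.pi * inner ℝ ξ t : ℝ) : ℂ) * Complex.I) •
      FourierTransformInv.fourierInv (Ψ : ℝ → ℂ) ξ) (2 * Real.pi)
  rw [abs_of_pos hpi] at h
  have hpi' : ((2 * Real.pi : ℝ) : ℂ) ≠ 0 := by exact_mod_cast hpi.ne'
  rw [← inv_smul_eq_iff₀ hpi.ne'] at h
  rw [← h, ← integral_smul]
  refine integral_congr_ae (Eventually.of_forall fun lam => ?_)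
  have h2 : -2 * Real.pi * inner ℝ (lam / (2 * Real.pi)) t = -(lam * t) := by
    simp only [RCLike.inner_apply, conj_trivial]
    field_simp
  have h3 : (Ψ : ℝ → ℂ) = ψ := by ext x; simp [Ψ]
  simp only
  rw [h2, h3, invFourierTime_eq, osc, Complex.real_smul, smul_eq_mul, mul_comm Complex.I]
  push_cast; ring

/-- Fourier inversion for the time cutoff of a plane wave. -/
theorem integral_oscInt_mul_invFourierTime {ψ : ℝ → ℂ} (hψ : ContDiff ℝ (⊤ : ℕ∞) ψ)
    (hc : HasCompactSupport ψ) {T : ℝ} (hT : 0 ≤ T) (hs : tsupport ψ ⊆ Set.Ioo 0 T) (φ : ℝ) :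
    ∫ lam : ℝ, oscInt T (φ - lam) * invFourierTime ψ lam = ∫ t : ℝ, ψ t * osc (φ * t) := by
  have hΨ := integrable_invFourierTime hψ hc
  have e1 : ∀ lam, oscInt T (φ - lam) * invFourierTime ψ lam =
      ∫ t in Set.Ioc 0 T, osc (φ * t) * (invFourierTime ψ lam * osc (-(lam * t))) := by
    intro lam
    rw [oscInt, intervalIntegral.integral_of_le hT, ← integral_mul_const]
    refine integral_congr_ae (Eventually.of_forall fun t => ?_)
    simp only
    rw [show (φ - lam) * t = φ * t + -(lam * t) by ring, osc_add]; ring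
  simp_rw [e1]
  -- After exchanging the integrals the inner one is Fourier inversion at time t, and the
  -- restriction to [0,T] is invisible because ψ is supported inside.
  rw [integral_integral_swap]
  · simp_rw [integral_const_mul, integral_invFourierTime hψ hc]
    rw [← integral_indicator measurableSet_Ioc]
    refine integral_congr_ae (Eventually.of_forall fun t => ?_)
    simp only [Set.indicator]
    split_ifs with h
    · rw [mul_comm]
    · rw [image_eq_zero_of_notMem_tsupport (fun h' => h (Set.Ioo_subset_Ioc_self (hs h'))),
        zero_mul]
  · have h1 : Integrable (fun p : ℝ × ℝ => invFourierTime ψ p.1 * 1)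
        (volume.prod (volume.restrict (Set.Ioc 0 T))) :=
      hΨ.mul_prod (integrable_const (1 : ℂ))
    have h2 := h1.bdd_mul (c := 1) (f := fun p : ℝ × ℝ => osc (φ * p.2) * osc (-(p.1 * p.2)))
      (Continuous.aestronglyMeasurable
        ((continuous_osc.comp (by fun_prop)).mul (continuous_osc.comp (by fun_prop))))
      (Eventually.of_forall fun p => by rw [norm_mul, norm_osc, norm_osc, one_mul])
    refine h2.congr (Eventually.of_forall fun p => ?_)
    simp only [Function.uncurry]; ring

/-! ### Oscillatory trigonometric sums -/

section OscSum

variable {ι : Type*} (s : Finset ι) (a : ι → ℂ) (φ : ι → ℝ) (ν : ι → Freq)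

/-- `∑ a_i e^{i φ_i t} e^{i ν_i · x}`. -/
def oscSum (t : ℝ) (x : Pt) : ℂ := ∑ i ∈ s, a i * osc (φ i * t) * character (ν i) x

/-- The space-time Fourier transform of `1_{[0,T]} u` for an oscillatory sum `u`. -/
def oscFourier (T : ℝ) (n : Freq) (lam : ℝ) : ℂ :=
  ∑ i ∈ s, (if ν i = n then a i else 0) * oscInt T (φ i - lam)

theorem fourierCoef_oscSum (t : ℝ) (n : Freq) :
    fourierCoef (oscSum s a φ ν t) n =
      ∑ i ∈ s, (if ν i = n then a i else 0) * osc (φ i * t) := by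
  unfold oscSum
  rw [fourierCoef_sum s (fun i => a i * osc (φ i * t)) ν]
  exact Finset.sum_congr rfl fun i _ => by split_ifs <;> simp

theorem continuous_oscFourier (T : ℝ) (n : Freq) : Continuous (oscFourier s a φ ν T n) := by
  unfold oscFourier
  refine continuous_finsetSum _ fun i _ => continuous_const.mul ?_
  exact (continuous_oscInt T).comp (by fun_prop)

/-- The competitor in the restricted norm is the extension by zero outside [0,T]. A sharp cutoff is
affordable because the regularity exponent b - 1 is negative in the application. -/
theorem extendsFrom_oscSum {T : ℝ} (hT : 0 ≤ T) :
    ExtendsFrom (Set.Icc 0 T) (oscSum s a φ ν) (oscFourier s a φ ν T) := by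
  intro n ψ hψ hc hs
  rw [interior_Icc] at hs
  have hΨ := integrable_invFourierTime hψ hc
  have hψi : ∀ c : ℝ, Integrable fun t => ψ t * osc (c * t) := fun c =>
    (hψ.continuous.mul (continuous_osc.comp (by fun_prop))).integrable_of_hasCompactSupport
      hc.mul_right
  have hΨi : ∀ c : ℝ, Integrable fun lam => oscInt T (c - lam) * invFourierTime ψ lam := fun c =>
    hΨ.bdd_mul (c := T) ((continuous_oscInt T).comp (by fun_prop)).aestronglyMeasurable
      (Eventually.of_forall fun lam => norm_oscInt_le hT _)
  simp_rw [fourierCoef_oscSum, oscFourier, Finset.mul_sum, Finset.sum_mul]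
  have e1 : ∀ t, ∀ i, ψ t * ((if ν i = n then a i else 0) * osc (φ i * t)) =
      (if ν i = n then a i else 0) * (ψ t * osc (φ i * t)) := fun t i => by ring
  simp_rw [e1, mul_assoc]
  rw [integral_finsetSum _ fun i _ => (hψi (φ i)).const_mul _,
    integral_finsetSum _ fun i _ => (hΨi (φ i)).const_mul _]
  refine Finset.sum_congr rfl fun i _ => ?_
  rw [integral_const_mul, integral_const_mul, integral_oscInt_mul_invFourierTime hψ hc hT hs]

theorem xsbRestrict_oscSum_le {T : ℝ} (hT : 0 ≤ T) (r b : ℝ) :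
    xsbRestrict (Set.Icc 0 T) r b (oscSum s a φ ν) ≤ xsbNorm r b (oscFourier s a φ ν T) :=
  iInf_le_of_le _ (iInf_le_of_le (fun n => (continuous_oscFourier s a φ ν T n).measurable)
    (iInf_le _ (extendsFrom_oscSum s a φ ν hT)))

end OscSum

/-! ### Hölder norms of trigonometric sums -/

section TrigHolder

variable {ι : Type*} (s : Finset ι) (ν : ι → Freq)

theorem csPiece_sum (ρ : ℝ → ℝ) (r : ℝ) (c : ι → ℂ) (k : ℕ) :
    csPiece ρ r (fun x => ∑ i ∈ s, c i * character (ν i) x) k =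
      ENNReal.ofReal (dyad k ^ r) *
        ⨆ x, ‖∑ i ∈ s, (lpSymbol ρ k (ν i) : ℂ) * c i * character (ν i) x‖ₑ := by
  simp only [csPiece, multiplier_sum]

theorem enorm_sum_character_le (c : ι → ℂ) (x : Pt) :
    ‖∑ i ∈ s, c i * character (ν i) x‖ₑ ≤ ∑ i ∈ s, ‖c i‖ₑ := by
  refine (enorm_sum_le _ _).trans (Finset.sum_le_sum fun i _ => ?_)
  rw [enorm_mul, ← ofReal_norm (character (ν i) x), norm_character, ENNReal.ofReal_one, mul_one]

/-- A crude bound that serves only the qualitative statements of membership and continuity in time.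
-/
theorem csNorm_sum_le {ρ : ℝ → ℝ} (hρ : IsCutoffProfile ρ) {A : ℝ} (hA : SupportConst ρ A)
    (r : ℝ) (c : ι → ℂ) :
    csNorm ρ r (fun x => ∑ i ∈ s, c i * character (ν i) x) ≤
      ∑ i ∈ s, ENNReal.ofReal ((A * jap (ν i)) ^ |r|) * ‖c i‖ₑ := by
  refine iSup_le fun k => ?_
  rw [csPiece_sum, ENNReal.mul_iSup]
  refine iSup_le fun x => ?_
  refine (mul_le_mul_right (enorm_sum_character_le s ν _ x) _).trans ?_
  rw [Finset.mul_sum]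
  refine Finset.sum_le_sum fun i _ => ?_
  by_cases h : lpSymbol ρ k (ν i) = 0
  · simp [h]
  rw [enorm_mul, ← mul_assoc]
  refine mul_le_mul_left ?_ _
  rw [← ofReal_norm, ← ENNReal.ofReal_mul (Real.rpow_nonneg (dyad_pos k).le _)]
  apply ENNReal.ofReal_le_ofReal
  rw [Complex.norm_real]
  calc dyad k ^ r * ‖lpSymbol ρ k (ν i)‖ ≤ dyad k ^ r * 1 := by
        have := (dyad_pos k).le
        gcongr
        exact hρ.abs_lpSymbol_le _ _
    _ ≤ dyad k ^ |r| := by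
        rw [mul_one]; exact Real.rpow_le_rpow_of_exponent_le (one_le_dyad k) (le_abs_self r)
    _ ≤ _ := Real.rpow_le_rpow (dyad_pos k).le (hA.lp_support _ _ h).2 (abs_nonneg r)

theorem tendsto_csPiece_sum {ρ : ℝ → ℝ} {A : ℝ} (hA : SupportConst ρ A) (r : ℝ) (c : ι → ℂ) :
    Tendsto (csPiece ρ r fun x => ∑ i ∈ s, c i * character (ν i) x) atTop (𝓝 0) := by
  have h1 : Tendsto dyad atTop atTop := tendsto_pow_atTop_atTop_of_one_lt one_lt_two
  have h2 : ∀ᶠ k in atTop, ∀ i ∈ s, A * jap (ν i) < dyad k :=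
    (Filter.eventually_all_finset s).2 fun i _ => h1.eventually_gt_atTop _
  refine tendsto_const_nhds.congr' ?_
  filter_upwards [h2] with k hk
  rw [csPiece_sum]
  have : ∀ x, ∑ i ∈ s, (lpSymbol ρ k (ν i) : ℂ) * c i * character (ν i) x = 0 := fun x => by
    refine Finset.sum_eq_zero fun i hi => ?_
    have : lpSymbol ρ k (ν i) = 0 := by
      by_contra hcon
      exact absurd (hA.lp_support _ _ hcon).2 (not_le.2 (hk i hi))
    simp [this]
  simp [this]

/-- Only finitely many frequencies occur, so the Littlewood-Paley pieces vanish at high scales and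
continuity reduces to that of each coefficient. -/
theorem memCtCs_of_eq_sum {ρ : ℝ → ℝ} (hρ : IsCutoffProfile ρ) (r T : ℝ) {u : ℝ → Pt → ℂ}
    (c : ι → ℝ → ℂ) (hc : ∀ i ∈ s, ContinuousOn (c i) (Set.Icc 0 T))
    (hu : ∀ t ∈ Set.Icc 0 T, ∀ x, u t x = ∑ i ∈ s, c i t * character (ν i) x) :
    MemCtCs ρ r T u := by
  obtain ⟨A, hA⟩ := hρ.exists_supportConst
  have hu' : ∀ t ∈ Set.Icc 0 T, u t = fun x => ∑ i ∈ s, c i t * character (ν i) x :=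
    fun t ht => funext (hu t ht)
  refine ⟨fun t ht => ?_, fun t ht => ?_, fun t₀ ht₀ => ?_⟩
  · rw [hu' t ht]
    refine (csNorm_sum_le s ν hρ hA r _).trans_lt (ENNReal.sum_lt_top.2 fun i _ => ?_)
    exact ENNReal.mul_lt_top ENNReal.ofReal_lt_top enorm_lt_top
  · rw [hu' t ht]; exact tendsto_csPiece_sum s ν hA r _
  · have hlim : Tendsto (fun t => ∑ i ∈ s, ENNReal.ofReal ((A * jap (ν i)) ^ |r|) *
        ‖c i t - c i t₀‖ₑ) (𝓝[Set.Icc 0 T] t₀) (𝓝 0) := by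
      have : (0 : ℝ≥0∞) = ∑ i ∈ s, ENNReal.ofReal ((A * jap (ν i)) ^ |r|) * 0 := by simp
      rw [this]
      refine tendsto_finsetSum _ fun i hi => ENNReal.Tendsto.const_mul ?_ (Or.inr (by simp))
      have h1 : Tendsto (fun t => c i t - c i t₀) (𝓝[Set.Icc 0 T] t₀) (𝓝 (c i t₀ - c i t₀)) :=
        (hc i hi t₀ ht₀).tendsto.sub tendsto_const_nhds
      rw [sub_self] at h1
      have h2 := h1.enorm
      rwa [enorm_zero] at h2
    refine tendsto_of_tendsto_of_tendsto_of_le_of_le' tendsto_const_nhds hlim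
      (Eventually.of_forall fun _ => zero_le) ?_
    filter_upwards [self_mem_nhdsWithin] with t ht
    have : (fun x => u t x - u t₀ x) =
        fun x => ∑ i ∈ s, (c i t - c i t₀) * character (ν i) x := by
      funext x
      rw [hu t ht, hu t₀ ht₀, ← Finset.sum_sub_distrib]
      exact Finset.sum_congr rfl fun i _ => by ring
    rw [this]
    exact csNorm_sum_le s ν hρ hA r _

end TrigHolder

/-! ### Duhamel integrals of oscillatory sums -/

/-- `∫_0^{min(t,τ)} sin((t - t')J)/J e^{i φ t'} dt'`. -/
def duhCoef (τ J φ t : ℝ) : ℂ :=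
  ∫ t' in (0 : ℝ)..(min t τ), ((Real.sin ((t - t') * J) / J : ℝ) : ℂ) * osc (φ * t')

theorem sin_eq_osc (y : ℝ) : (Real.sin y : ℂ) = (osc y - osc (-y)) / (2 * Complex.I) := by
  rw [Complex.ofReal_sin, Complex.sin, osc, osc]
  push_cast
  rw [show Complex.I * (y : ℂ) = y * Complex.I by ring, show Complex.I * -(y : ℂ) = -y * Complex.I by ring]
  field_simp
  rw [Complex.I_sq]; ring

/-- Splitting the sine into exponentials leaves two oscillatory integrals with detunings φ - J and φ
+ J, the same modulations as in the X^{s,b} norm. -/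
theorem duhCoef_eq (τ J φ t : ℝ) :
    duhCoef τ J φ t = (osc (t * J) * oscInt (min t τ) (φ - J) -
      osc (-(t * J)) * oscInt (min t τ) (φ + J)) / (2 * Complex.I * J) := by
  have h : ∀ t', ((Real.sin ((t - t') * J) / J : ℝ) : ℂ) * osc (φ * t') =
      (osc (t * J) * osc ((φ - J) * t') - osc (-(t * J)) * osc ((φ + J) * t')) /
        (2 * Complex.I * J) := fun t' => by
    rw [Complex.ofReal_div, sin_eq_osc, ← osc_add, ← osc_add,
      show t * J + (φ - J) * t' = (t - t') * J + φ * t' by ring,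
      show -(t * J) + (φ + J) * t' = -((t - t') * J) + φ * t' by ring, osc_add, osc_add,
      div_div, div_mul_eq_mul_div, sub_mul]
  have hi : ∀ c : ℝ, IntervalIntegrable (fun t' => osc (c * t')) volume 0 (min t τ) := fun c =>
    (continuous_osc.comp (by fun_prop)).intervalIntegrable _ _
  rw [duhCoef]
  simp_rw [h]
  rw [intervalIntegral.integral_div, intervalIntegral.integral_sub ((hi _).const_mul _)
    ((hi _).const_mul _), intervalIntegral.integral_const_mul, intervalIntegral.integral_const_mul,
    oscInt, oscInt]

theorem norm_two_I_mul {J : ℝ} (hJ : 0 ≤ J) : ‖2 * Complex.I * (J : ℂ)‖ = 2 * J := by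
  rw [norm_mul, norm_mul, Complex.norm_I, Complex.norm_real, Real.norm_eq_abs, abs_of_nonneg hJ]
  simp

theorem norm_duhCoef_sq_le {τ J φ t T : ℝ} (hτ : 0 ≤ τ) (hJ : 0 < J) (ht : 0 ≤ t) (htT : t ≤ T)
    (hT : 1 ≤ T) :
    ‖duhCoef τ J φ t‖ ^ 2 ≤ 5 * T ^ 2 * J ^ (-2 : ℝ) *
      (bracket (J + φ) ^ (-2 : ℝ) + bracket (-J + φ) ^ (-2 : ℝ)) := by
  have hu : 0 ≤ min t τ := le_min ht hτ
  have huT : min t τ ≤ T := (min_le_left _ _).trans htT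
  have h1 := norm_oscInt_sq_le hT hu huT (φ - J)
  have h2 := norm_oscInt_sq_le hT hu huT (φ + J)
  rw [show φ - J = -J + φ by ring] at h1
  rw [add_comm φ J] at h2
  have h3 : ‖osc (t * J) * oscInt (min t τ) (φ - J) - osc (-(t * J)) * oscInt (min t τ) (φ + J)‖ ≤
      ‖oscInt (min t τ) (-J + φ)‖ + ‖oscInt (min t τ) (J + φ)‖ := by
    refine (norm_sub_le _ _).trans (le_of_eq ?_)
    rw [norm_mul, norm_mul, norm_osc, norm_osc, one_mul, one_mul,
      show φ - J = -J + φ by ring, add_comm φ J]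
  rw [duhCoef_eq, norm_div, norm_two_I_mul hJ.le, div_pow, div_le_iff₀ (by positivity),
    Real.rpow_neg hJ.le, Real.rpow_two]
  set X := ‖oscInt (min t τ) (-J + φ)‖
  set Y := ‖oscInt (min t τ) (J + φ)‖
  have h4 : ‖osc (t * J) * oscInt (min t τ) (φ - J) -
      osc (-(t * J)) * oscInt (min t τ) (φ + J)‖ ^ 2 ≤ (X + Y) ^ 2 := by gcongr
  have h5 : (5 * T ^ 2 * (J ^ 2)⁻¹ * (bracket (J + φ) ^ (-2 : ℝ) + bracket (-J + φ) ^ (-2 : ℝ))) *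
      (2 * J) ^ 2 = 4 * (5 * T ^ 2 * bracket (J + φ) ^ (-2 : ℝ) +
        5 * T ^ 2 * bracket (-J + φ) ^ (-2 : ℝ)) := by
    field_simp; ring
  rw [h5]
  nlinarith [sq_nonneg (X - Y)]

theorem norm_oscInt_sub_le (u u' μ : ℝ) : ‖oscInt u μ - oscInt u' μ‖ ≤ |u - u'| := by
  have hi : ∀ a b : ℝ, IntervalIntegrable (fun t => osc (μ * t)) volume a b := fun a b =>
    (continuous_osc.comp (by fun_prop)).intervalIntegrable _ _
  rw [oscInt, oscInt, intervalIntegral.integral_interval_sub_left (hi _ _) (hi _ _)]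
  have := intervalIntegral.norm_integral_le_of_norm_le_const (a := u') (b := u) (C := 1)
    (f := fun t => osc (μ * t)) fun t _ => (norm_osc _).le
  rwa [one_mul] at this

theorem norm_duhCoef_le {τ J φ t T : ℝ} (hτ : 0 ≤ τ) (hJ : 1 ≤ J) (ht : 0 ≤ t) (htT : t ≤ T) :
    ‖duhCoef τ J φ t‖ ≤ T := by
  have hu : 0 ≤ min t τ := le_min ht hτ
  have huT : min t τ ≤ T := (min_le_left _ _).trans htT
  have h := intervalIntegral.norm_integral_le_of_norm_le_const (a := 0) (b := min t τ) (C := 1)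
    (f := fun t' => ((Real.sin ((t - t') * J) / J : ℝ) : ℂ) * osc (φ * t')) fun t' _ => by
      rw [norm_mul, norm_osc, mul_one, Complex.norm_real, Real.norm_eq_abs, abs_div,
        abs_of_pos (by linarith : 0 < J), div_le_one (by linarith)]
      exact (Real.abs_sin_le_one _).trans hJ
  rw [sub_zero, one_mul, abs_of_nonneg hu] at h
  exact h.trans huT

/-- The Lipschitz constant does not grow with J: differentiating e^{itJ} produces J, which the
factor 1/J of the Duhamel kernel cancels. -/
theorem norm_duhCoef_sub_le {τ J φ t t' T : ℝ} (hτ : 0 ≤ τ) (hJ : 1 ≤ J)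
    (ht' : 0 ≤ t') (ht'T : t' ≤ T) :
    ‖duhCoef τ J φ t - duhCoef τ J φ t'‖ ≤ (T + 1) * |t - t'| := by
  have hJ0 : 0 < J := by linarith
  have hu : 0 ≤ min t' τ := le_min ht' hτ
  have huT : min t' τ ≤ T := (min_le_left _ _).trans ht'T
  have hmin : |min t τ - min t' τ| ≤ |t - t'| := abs_inf_sub_inf_le_abs t t' τ
  have key : ∀ (σ : ℝ) (μ : ℝ), |σ| = 1 →
      ‖osc (σ * (t * J)) * oscInt (min t τ) μ - osc (σ * (t' * J)) * oscInt (min t' τ) μ‖ ≤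
        (1 + J * T) * |t - t'| := by
    intro σ μ hσ
    have e : osc (σ * (t * J)) * oscInt (min t τ) μ - osc (σ * (t' * J)) * oscInt (min t' τ) μ =
        osc (σ * (t * J)) * (oscInt (min t τ) μ - oscInt (min t' τ) μ) +
        (osc (σ * (t * J)) - osc (σ * (t' * J))) * oscInt (min t' τ) μ := by ring
    rw [e]
    refine (norm_add_le _ _).trans ?_
    rw [norm_mul, norm_mul, norm_osc, one_mul]
    have h1 := (norm_oscInt_sub_le (min t τ) (min t' τ) μ).trans hmin
    have h2 : ‖osc (σ * (t * J)) - osc (σ * (t' * J))‖ ≤ J * |t - t'| := by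
      refine (norm_osc_sub_le _ _).trans (le_of_eq ?_)
      rw [show σ * (t * J) - σ * (t' * J) = σ * (J * (t - t')) by ring, abs_mul, hσ, one_mul,
        abs_mul, abs_of_pos hJ0]
    have h3 := (norm_oscInt_le hu μ).trans huT
    have h4 : ‖osc (σ * (t * J)) - osc (σ * (t' * J))‖ * ‖oscInt (min t' τ) μ‖ ≤
        J * |t - t'| * T := mul_le_mul h2 h3 (norm_nonneg _) (by positivity)
    linarith
  have k1 := key 1 (φ - J) (by simp)
  have k2 := key (-1) (φ + J) (by simp)
  simp only [one_mul, neg_mul] at k1 k2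
  rw [duhCoef_eq, duhCoef_eq, ← sub_div, norm_div, norm_two_I_mul hJ0.le, div_le_iff₀ (by positivity)]
  have e : osc (t * J) * oscInt (min t τ) (φ - J) - osc (-(t * J)) * oscInt (min t τ) (φ + J) -
      (osc (t' * J) * oscInt (min t' τ) (φ - J) - osc (-(t' * J)) * oscInt (min t' τ) (φ + J)) =
      (osc (t * J) * oscInt (min t τ) (φ - J) - osc (t' * J) * oscInt (min t' τ) (φ - J)) -
      (osc (-(t * J)) * oscInt (min t τ) (φ + J) - osc (-(t' * J)) * oscInt (min t' τ) (φ + J)) := by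
    ring
  rw [e]
  refine (norm_sub_le _ _).trans ((add_le_add k1 k2).trans ?_)
  have := abs_nonneg (t - t')
  have h5 : 0 ≤ (J - 1) * |t - t'| := mul_nonneg (by linarith) this
  nlinarith

theorem continuousOn_duhCoef {τ J φ T : ℝ} (hτ : 0 ≤ τ) (hJ : 1 ≤ J) :
    ContinuousOn (duhCoef τ J φ) (Set.Icc 0 T) := by
  by_cases hT : 0 ≤ T
  · refine LipschitzOnWith.continuousOn (K := (T + 1).toNNReal) ?_
    refine LipschitzOnWith.of_dist_le_mul fun t _ t' ht' => ?_
    rw [dist_eq_norm, Real.dist_eq, Real.coe_toNNReal _ (by linarith)]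
    exact norm_duhCoef_sub_le hτ hJ ht'.1 ht'.2
  · rw [Set.Icc_eq_empty hT]; exact continuousOn_empty _

section Duhamel

variable {ι : Type*} (s : Finset ι) (a : ι → ℂ) (φ : ι → ℝ) (ν : ι → Freq)

theorem multiplier_zero_fun (m : Freq → ℂ) (x : Pt) : multiplier m (fun _ => 0) x = 0 := by
  simp [multiplier, fourierCoef, torusMean]

theorem duhamel_timeCut_oscSum {τ t : ℝ} (hτ : 0 ≤ τ) (ht : 0 ≤ t) (x : Pt) :
    duhamel (timeCut τ (oscSum s a φ ν)) t x =
      ∑ i ∈ s, a i * duhCoef τ (jap (ν i)) (φ i) t * character (ν i) x := by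
  have hpt : ∀ t', multiplier (fun n => ((Real.sin ((t - t') * jap n) / jap n : ℝ) : ℂ))
      (timeCut τ (oscSum s a φ ν) t') x = (Set.Icc 0 τ).indicator (fun t' =>
        ∑ i ∈ s, a i * character (ν i) x *
          (((Real.sin ((t - t') * jap (ν i)) / jap (ν i) : ℝ) : ℂ) * osc (φ i * t'))) t' := by
    intro t'
    by_cases h : t' ∈ Set.Icc 0 τ
    · have : timeCut τ (oscSum s a φ ν) t' =
          fun x => ∑ i ∈ s, (a i * osc (φ i * t')) * character (ν i) x := by
        funext x; rw [timeCut, Set.indicator_of_mem h]; rfl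
      rw [this, multiplier_sum, Set.indicator_of_mem h]
      exact Finset.sum_congr rfl fun i _ => by ring
    · have : timeCut τ (oscSum s a φ ν) t' = fun _ => 0 := by
        funext x; rw [timeCut, Set.indicator_of_notMem h]
      rw [this, multiplier_zero_fun, Set.indicator_of_notMem h]
  rw [duhamel]
  simp_rw [hpt]
  -- The cutoff 1_{[0,τ]} only shortens the time integral to min(t,τ).
  have hset : Set.Ioc 0 t ∩ Set.Icc 0 τ = Set.Ioc 0 (min t τ) := by
    ext y; simp only [Set.mem_inter_iff, Set.mem_Ioc, Set.mem_Icc, le_min_iff]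
    constructor
    · rintro ⟨⟨h1, h2⟩, _, h3⟩; exact ⟨h1, h2, h3⟩
    · rintro ⟨h1, h2, h3⟩; exact ⟨⟨h1, h2⟩, h1.le, h3⟩
  rw [intervalIntegral.integral_of_le ht, setIntegral_indicator measurableSet_Icc, hset,
    ← intervalIntegral.integral_of_le (le_min ht hτ), intervalIntegral.integral_finsetSum]
  · refine Finset.sum_congr rfl fun i _ => ?_
    rw [intervalIntegral.integral_const_mul, duhCoef]; ring
  · intro i _
    refine Continuous.intervalIntegrable ?_ _ _
    refine continuous_const.mul (Continuous.mul ?_ (continuous_osc.comp (by fun_prop)))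
    exact Complex.continuous_ofReal.comp (by fun_prop)

theorem duhamel_timeCut_of_le {F : ℝ → Pt → ℂ} {t T : ℝ} (ht : 0 ≤ t) (htT : t ≤ T) :
    duhamel (timeCut T F) t = duhamel F t := by
  funext x
  rw [duhamel, duhamel]
  refine intervalIntegral.integral_congr fun t' ht' => ?_
  rw [Set.uIcc_of_le ht] at ht'
  have : timeCut T F t' = F t' := by
    funext y
    rw [timeCut, Set.indicator_of_mem (show t' ∈ Set.Icc 0 T from ⟨ht'.1, ht'.2.trans htT⟩)]
  simp only [this]

/-- A cutoff at τ = T is invisible on [0,T], so the bound without cutoff is a special case of the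
bound with one. -/
theorem ctcsNorm_duhamel_eq (ρ : ℝ → ℝ) (r T : ℝ) (F : ℝ → Pt → ℂ) :
    ctcsNorm ρ r T (duhamel F) = ctcsNorm ρ r T (duhamel (timeCut T F)) := by
  unfold ctcsNorm
  exact iSup_congr fun t => iSup_congr fun ht => by rw [duhamel_timeCut_of_le ht.1 ht.2]

theorem memCtCs_duhamel_timeCut_oscSum {ρ : ℝ → ℝ} (hρ : IsCutoffProfile ρ) (r T : ℝ) {τ : ℝ}
    (hτ : 0 ≤ τ) : MemCtCs ρ r T (duhamel (timeCut τ (oscSum s a φ ν))) :=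
  memCtCs_of_eq_sum s ν hρ r T (fun i t => a i * duhCoef τ (jap (ν i)) (φ i) t)
    (fun _ _ => continuousOn_const.mul (continuousOn_duhCoef hτ (one_le_jap _)))
    fun _ ht x => duhamel_timeCut_oscSum s a φ ν hτ ht.1 x

theorem memCtCs_duhamel_oscSum {ρ : ℝ → ℝ} (hρ : IsCutoffProfile ρ) (r T : ℝ) (hT : 0 ≤ T) :
    MemCtCs ρ r T (duhamel (oscSum s a φ ν)) :=
  memCtCs_of_eq_sum s ν hρ r T (fun i t => a i * duhCoef T (jap (ν i)) (φ i) t)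
    (fun _ _ => continuousOn_const.mul (continuousOn_duhCoef hT (one_le_jap _)))
    fun t ht x => by
      rw [← duhamel_timeCut_of_le ht.1 ht.2, duhamel_timeCut_oscSum s a φ ν hT ht.1 x]

end Duhamel

/-! ### The cubic nonlinearity as a sum of blocks -/

/-- The covariance of the linear evolution at fixed time. -/
def pairCov (n k : Freq) : ℂ := if n + k = 0 then ((1 / jap n ^ 2 : ℝ) : ℂ) else 0

/-- The Wick product of three values of a field with covariance `pairCov`. -/
def wickLin (L : Freq → ℂ) (m : Fin 3 → Freq) : ℂ :=
  L (m 0) * L (m 1) * L (m 2) - pairCov (m 0) (m 1) * L (m 2) - pairCov (m 0) (m 2) * L (m 1)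
    - pairCov (m 1) (m 2) * L (m 0)

theorem sum_pairCov {F : Finset Freq} (hF : ∀ n ∈ F, -n ∈ F) {n : Freq} (hn : n ∈ F)
    (h : Freq → ℂ) : ∑ k ∈ F, pairCov n k * h k = ((1 / jap n ^ 2 : ℝ) : ℂ) * h (-n) := by
  rw [Finset.sum_eq_single (-n)]
  · rw [pairCov, if_pos (add_neg_cancel n)]
  · intro k _ hk
    rw [pairCov, if_neg, zero_mul]
    intro h0
    exact hk (by rw [eq_neg_iff_add_eq_zero, add_comm]; exact h0)
  · exact fun h0 => absurd (hF n hn) h0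

theorem sum_piFinset_three {M : Type*} [AddCommMonoid M] (F : Finset Freq)
    (g : (Fin 3 → Freq) → M) :
    ∑ m ∈ Fintype.piFinset (fun _ : Fin 3 => F), g m =
      ∑ k ∈ F, ∑ j ∈ F, ∑ i ∈ F, g ![i, j, k] := by
  classical
  have h := sum_triple_eq F (Fintype.piFinset (fun _ : Fin 3 => F))
    (fun m hm => Fintype.mem_piFinset.1 hm)
    (fun m => if m ∈ Fintype.piFinset (fun _ : Fin 3 => F) then g m else 0)
    (fun m hm => by simp only [if_neg hm])
  rw [Finset.sum_congr rfl fun m hm => (if_pos hm).symm, ← h]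
  refine Finset.sum_congr rfl fun k hk => Finset.sum_congr rfl fun j hj =>
    Finset.sum_congr rfl fun i hi => ?_
  rw [if_pos]
  rw [Fintype.mem_piFinset]
  intro l; fin_cases l <;> simp [hi, hj, hk]

theorem trunc_neg (ρ : ℝ → ℝ) (N : ℝ) (n : Freq) : trunc ρ N (-n) = trunc ρ N n := by
  simp [trunc, freqLen_neg]

theorem trunc_eq_zero {ρ : ℝ → ℝ} {A : ℝ} (hA : SupportConst ρ A) {K : ℕ} {n : Freq}
    (hn : n ∉ freqBall (A * dyad K)) : trunc ρ (dyad K) n = 0 := by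
  by_contra h
  exact hn (mem_freqBall.2 (hA.trunc_support K n h))

theorem neg_mem_freqBall {B : ℝ} {n : Freq} (hn : n ∈ freqBall B) : -n ∈ freqBall B := by
  rw [mem_freqBall] at hn ⊢; rwa [jap_neg]

section Cubic

variable {V : Pt → ℝ} {ρ : ℝ → ℝ}

/-- Expansion of the renormalized nonlinearity applied to a trigonometric polynomial. -/
theorem wickCubic_sum (hV : TorusPeriodic V) (hi : IntegrableOn (fun x => (V x : ℂ)) cube) {A : ℝ}
    (hA : SupportConst ρ A) (K : ℕ) (L : Freq → ℂ) (x : Pt) :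
    wickCubic V ρ (dyad K) (fun x => ∑ n ∈ freqBall (A * dyad K),
      ((trunc ρ (dyad K) n : ℂ) * L n) * character n x) x =
    ∑ m ∈ Fintype.piFinset (fun _ : Fin 3 => freqBall (A * dyad K)),
      ((∏ j, (trunc ρ (dyad K) (m j) : ℂ)) * potentialHat V (m 0 + m 1) * wickLin L m) *
        character (freqSum m) x := by
  set F := freqBall (A * dyad K) with hFd
  have hF : ∀ n ∈ F, -n ∈ F := fun n hn => neg_mem_freqBall hn
  set g : Freq → ℂ := fun n => (trunc ρ (dyad K) n : ℂ) with hg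
  have hgneg : ∀ n, g (-n) = g n := fun n => by simp only [hg, trunc_neg]
  set b : Freq → ℂ := fun n => g n * L n with hb
  set e : Freq → ℂ := fun n => character n x with he
  have hconv : torusConv V (fun y => (∑ n ∈ F, b n * character n y) ^ 2) x =
      ∑ j ∈ F, ∑ i ∈ F, b i * b j * potentialHat V (i + j) * (e i * e j) := by
    have h1 : ∀ y, (∑ n ∈ F, b n * character n y) ^ 2 =
        ∑ p ∈ F ×ˢ F, (b p.2 * b p.1) * character (p.2 + p.1) y := fun y => by
      rw [sq, Finset.sum_mul_sum, Finset.sum_product]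
      refine Finset.sum_congr rfl fun i _ => Finset.sum_congr rfl fun j _ => ?_
      rw [character_add]; ring
    simp_rw [h1]
    rw [torusConv_sum hV hi, Finset.sum_product]
    refine Finset.sum_congr rfl fun i _ => Finset.sum_congr rfl fun j _ => ?_
    rw [character_add]
  have ha : (aConst ρ (dyad K) : ℂ) = ∑ i ∈ F, g i * g i * ((1 / jap i ^ 2 : ℝ) : ℂ) := by
    rw [aConst, tsum_eq_sum (s := F) (fun n hn => by rw [trunc_eq_zero hA hn]; simp)]
    push_cast
    refine Finset.sum_congr rfl fun i _ => ?_
    simp only [hg]; ring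
  have hr : ∀ n, renormSymbol V ρ (dyad K) n =
      ∑ k ∈ F, potentialHat V (n + k) * (g k * g k) * ((1 / jap k ^ 2 : ℝ) : ℂ) := fun n => by
    rw [renormSymbol, tsum_eq_sum (s := F) (fun n hn => by rw [trunc_eq_zero hA hn]; simp)]
    refine Finset.sum_congr rfl fun i _ => ?_
    simp only [hg]; push_cast; ring
  have hmult : multiplier (renormSymbol V ρ (dyad K)) (fun x => ∑ n ∈ F, b n * character n x) x =
      ∑ n ∈ F, ∑ k ∈ F, potentialHat V (n + k) * (g k * g k) * ((1 / jap k ^ 2 : ℝ) : ℂ) *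
        b n * e n := by
    rw [multiplier_sum F b (fun n => n)]
    refine Finset.sum_congr rfl fun n _ => ?_
    rw [hr, Finset.sum_mul, Finset.sum_mul]
  have hright : ∑ m ∈ Fintype.piFinset (fun _ : Fin 3 => F),
      ((∏ j, g (m j)) * potentialHat V (m 0 + m 1) * wickLin L m) * character (freqSum m) x =
      (∑ k ∈ F, ∑ j ∈ F, ∑ i ∈ F, b i * b j * potentialHat V (i + j) * (e i * e j) * (b k * e k)) -
      (∑ k ∈ F, ∑ j ∈ F, ∑ i ∈ F,
        pairCov i j * (g i * g j * potentialHat V (i + j) * (e i * e j)) * (b k * e k)) -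
      (∑ k ∈ F, ∑ j ∈ F, ∑ i ∈ F,
        pairCov i k * (g i * g k * (e i * e k)) * (potentialHat V (i + j) * (b j * e j))) -
      (∑ k ∈ F, ∑ j ∈ F, ∑ i ∈ F,
        pairCov j k * (g j * g k * (e j * e k)) * (potentialHat V (i + j) * (b i * e i))) := by
    rw [sum_piFinset_three]
    simp_rw [← Finset.sum_sub_distrib]
    refine Finset.sum_congr rfl fun k _ => Finset.sum_congr rfl fun j _ =>
      Finset.sum_congr rfl fun i _ => ?_
    have hch : character (freqSum ![i, j, k]) x = e i * e j * e k := by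
      simp only [freqSum, character_add, he]
      rfl
    rw [hch, Fin.prod_univ_three, wickLin]
    simp only [hb, Matrix.cons_val_zero, Matrix.cons_val_one, Matrix.cons_val]
    ring
  have hee : ∀ n, e n * e (-n) = 1 := fun n => by
    simp only [he]; rw [← character_add, add_neg_cancel, character_zero]
  -- Contracting the first two slots forces n₁₂ = 0 and yields a_N V̂(0). Contracting the third slot
  -- with either of the first two yields 𝓜_N in both cases, hence its factor 2.
  have c1 : ∑ k ∈ F, ∑ j ∈ F, ∑ i ∈ F,
      pairCov i j * (g i * g j * potentialHat V (i + j) * (e i * e j)) * (b k * e k) =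
      (aConst ρ (dyad K) : ℂ) * potentialHat V 0 * ∑ n ∈ F, b n * e n := by
    rw [Finset.mul_sum]
    refine Finset.sum_congr rfl fun k _ => ?_
    rw [Finset.sum_comm]
    simp_rw [← Finset.sum_mul]
    congr 1
    rw [ha, Finset.sum_mul]
    refine Finset.sum_congr rfl fun i hi => ?_
    rw [sum_pairCov hF hi (fun j => g i * g j * potentialHat V (i + j) * (e i * e j)), hee, hgneg,
      add_neg_cancel]; ring
  have c2 : ∑ k ∈ F, ∑ j ∈ F, ∑ i ∈ F,
      pairCov i k * (g i * g k * (e i * e k)) * (potentialHat V (i + j) * (b j * e j)) =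
      ∑ n ∈ F, ∑ k ∈ F, potentialHat V (n + k) * (g k * g k) * ((1 / jap k ^ 2 : ℝ) : ℂ) *
        b n * e n := by
    rw [Finset.sum_comm]
    refine Finset.sum_congr rfl fun j _ => ?_
    rw [Finset.sum_comm]
    refine Finset.sum_congr rfl fun i hi => ?_
    rw [← Finset.sum_mul, sum_pairCov hF hi (fun k => g i * g k * (e i * e k)), hee, hgneg,
      add_comm j i]; ring
  have c3 : ∑ k ∈ F, ∑ j ∈ F, ∑ i ∈ F,
      pairCov j k * (g j * g k * (e j * e k)) * (potentialHat V (i + j) * (b i * e i)) =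
      ∑ n ∈ F, ∑ k ∈ F, potentialHat V (n + k) * (g k * g k) * ((1 / jap k ^ 2 : ℝ) : ℂ) *
        b n * e n := by
    rw [Finset.sum_comm, Finset.sum_comm (s := F) (t := F)
      (f := fun n k => potentialHat V (n + k) * (g k * g k) * ((1 / jap k ^ 2 : ℝ) : ℂ) *
        b n * e n)]
    refine Finset.sum_congr rfl fun j hj => ?_
    rw [Finset.sum_comm]
    refine Finset.sum_congr rfl fun i _ => ?_
    rw [← Finset.sum_mul, sum_pairCov hF hj (fun k => g j * g k * (e j * e k)), hee, hgneg]; ring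
  have c0 : ∑ k ∈ F, ∑ j ∈ F, ∑ i ∈ F,
      b i * b j * potentialHat V (i + j) * (e i * e j) * (b k * e k) =
      (∑ j ∈ F, ∑ i ∈ F, b i * b j * potentialHat V (i + j) * (e i * e j)) *
        ∑ n ∈ F, b n * e n := by
    rw [Finset.mul_sum]
    simp_rw [Finset.sum_mul]
  change torusConv V (fun y => (∑ n ∈ F, b n * character n y) ^ 2) x * (∑ n ∈ F, b n * e n) -
    (aConst ρ (dyad K) : ℂ) * potentialHat V 0 * (∑ n ∈ F, b n * e n) -
    2 * multiplier (renormSymbol V ρ (dyad K)) (fun x => ∑ n ∈ F, b n * character n x) x =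
    ∑ m ∈ Fintype.piFinset (fun _ : Fin 3 => F),
      ((∏ j, g (m j)) * potentialHat V (m 0 + m 1) * wickLin L m) * character (freqSum m) x
  rw [hright, c0, c1, c2, c3, hconv, hmult]; ring

variable {Ω : Type*} [MeasurableSpace Ω] {P : Measure Ω} {W : Fin 2 → Freq → Ω → ℂ}

theorem cubic_eq_sum {Ω : Type*} {W : Fin 2 → Freq → Ω → ℂ} (hV : TorusPeriodic V) (hi : IntegrableOn (fun x => (V x : ℂ)) cube) {A : ℝ}
    (hA : SupportConst ρ A) (K : ℕ) (ω : Ω) (t : ℝ) (x : Pt) :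
    cubic V ρ W (dyad K) ω t x =
    ∑ m ∈ Fintype.piFinset (fun _ : Fin 3 => freqBall (A * dyad K)),
      ((trunc ρ (dyad K) (freqSum m) : ℂ) * ((∏ j, (trunc ρ (dyad K) (m j) : ℂ)) *
        potentialHat V (m 0 + m 1) * wickLin (fun n => linCoef W t n ω) m)) *
        character (freqSum m) x := by
  have h1 : truncLin ρ W (dyad K) ω t = fun x => ∑ n ∈ freqBall (A * dyad K),
      ((trunc ρ (dyad K) n : ℂ) * linCoef W t n ω) * character n x := by
    funext y
    exact tsum_eq_sum fun n hn => by rw [trunc_eq_zero hA hn]; simp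
  rw [cubic, h1]
  rw [show wickCubic V ρ (dyad K) _ = _ from funext (wickCubic_sum hV hi hA K _), multiplier_sum]

theorem cos_sin_of_osc (y : ℝ) : osc y = (Real.cos y : ℂ) + Complex.I * (Real.sin y : ℂ) := by
  rw [osc, mul_comm, Complex.exp_mul_I]; push_cast; ring

theorem sum_units {M : Type*} [AddCommMonoid M] (f : ℤˣ → M) : ∑ e, f e = f 1 + f (-1) := by
  rw [show (Finset.univ : Finset ℤˣ) = {1, -1} from rfl, Finset.sum_pair (by decide)]

theorem sum_osc_halfWave {Ω : Type*} {W : Fin 2 → Freq → Ω → ℂ} (t : ℝ) (n : Freq) (ω : Ω) :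
    ∑ e : ℤˣ, osc (((e : ℤ) : ℝ) * jap n * t) * halfWave W e n ω = 2 * linCoef W t n ω := by
  rw [sum_units]
  simp only [halfWave, linCoef, Units.val_one, Units.val_neg, Int.cast_one, Int.cast_neg, one_mul,
    neg_mul, cos_sin_of_osc, Real.cos_neg, Real.sin_neg, mul_comm t]
  push_cast
  linear_combination (-2 * Complex.sin (jap n * t) * W 1 n ω) * Complex.I_mul_I

theorem sum_osc (y : ℝ) : ∑ e : ℤˣ, osc (((e : ℤ) : ℝ) * y) = 2 * (Real.cos y : ℂ) := by
  rw [sum_units]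
  simp only [Units.val_one, Units.val_neg, Int.cast_one, Int.cast_neg, one_mul,
    neg_mul, cos_sin_of_osc, Real.cos_neg, Real.sin_neg]
  push_cast; ring

theorem sum_units_mul_osc (y : ℝ) :
    ∑ e : ℤˣ, ((e : ℤ) : ℂ) * osc (((e : ℤ) : ℝ) * y) = 2 * Complex.I * (Real.sin y : ℂ) := by
  rw [sum_units]
  simp only [Units.val_one, Units.val_neg, Int.cast_one, Int.cast_neg, one_mul,
    neg_mul, cos_sin_of_osc, Real.cos_neg, Real.sin_neg]
  push_cast; ring

/-- The sign factor is 0 for equal signs and 2 for opposite signs: without conjugation only half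
waves of opposite sign correlate. -/
theorem IsGaussianData.halfWave_pair [IsProbabilityMeasure P] (hW : IsGaussianData P W)
    (e e' : ℤˣ) (n k : Freq) : ∫ ω, halfWave W e n ω * halfWave W e' k ω ∂P =
      pairCov n k * (1 - ((e : ℤ) : ℂ) * ((e' : ℤ) : ℂ)) := by
  have hint : ∀ i j, Integrable (fun ω => W i n ω * W j k ω) P := fun i j =>
    (hW.memLp i n).integrable_mul (hW.memLp j k)
  set a : ℂ := ((e : ℤ) : ℂ)
  set a' : ℂ := ((e' : ℤ) : ℂ)
  have e1 : ∀ ω, halfWave W e n ω * halfWave W e' k ω =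
      W 0 n ω * W 0 k ω + (-(a' * Complex.I)) * (W 0 n ω * W 1 k ω) +
        (-(a * Complex.I)) * (W 1 n ω * W 0 k ω) + (-(a * a')) * (W 1 n ω * W 1 k ω) := by
    intro ω
    simp only [halfWave]
    linear_combination (a * a' * W 1 n ω * W 1 k ω) * Complex.I_mul_I
  have i2 := (hint 0 1).const_mul (-(a' * Complex.I))
  have i3 := (hint 1 0).const_mul (-(a * Complex.I))
  have i12 : Integrable (fun ω => W 0 n ω * W 0 k ω +
    (-(a' * Complex.I)) * (W 0 n ω * W 1 k ω)) P := (hint 0 0).add i2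
  have i123 : Integrable (fun ω => W 0 n ω * W 0 k ω +
    (-(a' * Complex.I)) * (W 0 n ω * W 1 k ω) + (-(a * Complex.I)) * (W 1 n ω * W 0 k ω)) P :=
    i12.add i3
  simp_rw [e1]
  rw [integral_add i123 ((hint 1 1).const_mul _), integral_add i12 i3, integral_add (hint 0 0) i2,
    integral_const_mul, integral_const_mul, integral_const_mul, hW.covariance, hW.covariance,
    hW.covariance, hW.covariance, pairCov]
  by_cases h : n + k = 0 <;> simp [h]
  ring

/-- For k = -n the bracket is 4(cos² + sin²): the contraction of the evolved field is independent of
time, which is why time-independent counterterms suffice. -/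
theorem pairCov_mul_cos_sin (t : ℝ) (n k : Freq) :
    pairCov n k * ((2 * (Real.cos (jap n * t) : ℂ)) * (2 * (Real.cos (jap k * t) : ℂ)) -
      (2 * Complex.I * (Real.sin (jap n * t) : ℂ)) * (2 * Complex.I * (Real.sin (jap k * t) : ℂ))) =
      4 * pairCov n k := by
  by_cases h : n + k = 0
  · have hk : k = -n := by rw [eq_neg_iff_add_eq_zero, add_comm]; exact h
    have h1 : (Real.cos (jap n * t) : ℂ) ^ 2 + (Real.sin (jap n * t) : ℂ) ^ 2 = 1 := by
      have := Real.cos_sq_add_sin_sq (jap n * t)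
      exact_mod_cast this
    rw [hk, jap_neg]
    linear_combination (4 * pairCov n (-n)) * h1 -
      (4 * pairCov n (-n) * (Real.sin (jap n * t) : ℂ) ^ 2) * Complex.I_mul_I
  · simp [pairCov, h]

/-- The Wick product of the linear evolution in terms of half waves. -/
theorem IsGaussianData.wickLin_eq [IsProbabilityMeasure P] (hW : IsGaussianData P W) (t : ℝ)
    (m : Fin 3 → Freq) (ω : Ω) :
    wickLin (fun n => linCoef W t n ω) m =
      (1 / 8) * ∑ ε : Fin 3 → ℤˣ, osc (phase ε m * t) * tripleIntegral P W ε m ω := by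
  have hosc : ∀ ε : Fin 3 → ℤˣ, osc (phase ε m * t) =
      ∏ j, osc (((ε j : ℤ) : ℝ) * (jap (m j) * t)) := fun ε => by
    simp only [Fin.prod_univ_three, ← osc_add, phase, Fin.sum_univ_three]
    congr 1; ring
  -- A sum over sign triples of a product of functions of single signs factors into three sums; each
  -- term of the Wick product has this form once 1 - ±± is split in two.
  have hprod : ∀ f : Fin 3 → ℤˣ → ℂ, ∑ ε : Fin 3 → ℤˣ, f 0 (ε 0) * f 1 (ε 1) * f 2 (ε 2) =
      (∑ e, f 0 e) * (∑ e, f 1 e) * ∑ e, f 2 e := fun f => by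
    have := Finset.prod_univ_sum (fun _ : Fin 3 => (Finset.univ : Finset ℤˣ)) f
    rw [Fintype.piFinset_univ, Fin.prod_univ_three] at this
    rw [this]
    exact Finset.sum_congr rfl fun ε _ => by rw [Fin.prod_univ_three]
  set o : Fin 3 → ℤˣ → ℂ := fun j e => osc (((e : ℤ) : ℝ) * (jap (m j) * t)) with ho
  set u : Fin 3 → ℤˣ → ℂ := fun j e => ((e : ℤ) : ℂ) * o j e with hu
  set h : Fin 3 → ℤˣ → ℂ := fun j e => o j e * halfWave W e (m j) ω with hh
  have hS : ∀ j, ∑ e, o j e = 2 * (Real.cos (jap (m j) * t) : ℂ) := fun j => sum_osc _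
  have hD : ∀ j, ∑ e, u j e = 2 * Complex.I * (Real.sin (jap (m j) * t) : ℂ) := fun j =>
    sum_units_mul_osc _
  have hH : ∀ j, ∑ e, h j e = 2 * linCoef W t (m j) ω := fun j => by
    rw [← sum_osc_halfWave]
    exact Finset.sum_congr rfl fun e _ => by simp only [hh, ho, mul_assoc]
  have hterm : ∀ ε : Fin 3 → ℤˣ, osc (phase ε m * t) * tripleIntegral P W ε m ω =
      h 0 (ε 0) * h 1 (ε 1) * h 2 (ε 2)
      - pairCov (m 0) (m 1) * (o 0 (ε 0) * o 1 (ε 1) * h 2 (ε 2) -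
        u 0 (ε 0) * u 1 (ε 1) * h 2 (ε 2))
      - pairCov (m 0) (m 2) * (o 0 (ε 0) * h 1 (ε 1) * o 2 (ε 2) -
        u 0 (ε 0) * h 1 (ε 1) * u 2 (ε 2))
      - pairCov (m 1) (m 2) * (h 0 (ε 0) * o 1 (ε 1) * o 2 (ε 2) -
        h 0 (ε 0) * u 1 (ε 1) * u 2 (ε 2)) := fun ε => by
    rw [hosc, tripleIntegral, wickTriple, hW.halfWave_pair, hW.halfWave_pair, hW.halfWave_pair,
      Fin.prod_univ_three]
    simp only [hh, hu, ho]; ring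
  have p0 := hprod h
  have p1 := hprod ![o 0, o 1, h 2]
  have p1' := hprod ![u 0, u 1, h 2]
  have p2 := hprod ![o 0, h 1, o 2]
  have p2' := hprod ![u 0, h 1, u 2]
  have p3 := hprod ![h 0, o 1, o 2]
  have p3' := hprod ![h 0, u 1, u 2]
  simp only [Matrix.cons_val_zero, Matrix.cons_val_one, Matrix.cons_val] at p1 p1' p2 p2' p3 p3'
  simp_rw [hterm, Finset.sum_sub_distrib, ← Finset.mul_sum, Finset.sum_sub_distrib]
  rw [p0, p1, p1', p2, p2', p3, p3']
  simp only [hS, hD, hH]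
  have q1 := pairCov_mul_cos_sin t (m 0) (m 1)
  have q2 := pairCov_mul_cos_sin t (m 0) (m 2)
  have q3 := pairCov_mul_cos_sin t (m 1) (m 2)
  rw [wickLin]
  linear_combination (linCoef W t (m 2) ω / 4) * q1 + (linCoef W t (m 1) ω / 4) * q2 +
    (linCoef W t (m 0) ω / 4) * q3

theorem prod_exp_eq_osc (ε : Fin 3 → ℤˣ) (t : ℝ) (m : Fin 3 → Freq) :
    ∏ j, Complex.exp (((ε j : ℤ) : ℂ) * Complex.I * ((t * jap (m j) : ℝ) : ℂ)) =
      osc (phase ε m * t) := by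
  rw [← Complex.exp_sum, osc]
  congr 1
  rw [phase, Finset.sum_mul]
  push_cast
  rw [Finset.mul_sum]
  exact Finset.sum_congr rfl fun j _ => by ring

/-- A block is a finite oscillatory sum. -/
theorem cubicBlock_eq_oscSum {A : ℝ} (hA : SupportConst ρ A) (ε : Fin 3 → ℤˣ) (k : Fin 3 → ℕ)
    (N : ℝ) (ω : Ω) :
    cubicBlock V ρ P W ε k N ω = oscSum (blockSupp A k)
      (fun m => blockCoef V ρ k N m * tripleIntegral P W ε m ω) (phase ε) freqSum := by
  funext t x
  have h : ∀ m : Fin 3 → Freq, (trunc ρ N (m 0 + m 1 + m 2) : ℂ)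
      * (∏ j, (trunc ρ N (m j) : ℂ) * (lpSymbol ρ (k j) (m j) : ℂ))
      * potentialHat V (m 0 + m 1) * character (m 0 + m 1 + m 2) x
      * (∏ j, Complex.exp (((ε j : ℤ) : ℂ) * Complex.I * ((t * jap (m j) : ℝ) : ℂ)))
      * tripleIntegral P W ε m ω = blockCoef V ρ k N m * tripleIntegral P W ε m ω *
        osc (phase ε m * t) * character (freqSum m) x := fun m => by
    rw [prod_exp_eq_osc, blockCoef, freqSum]; ring
  rw [cubicBlock]
  simp_rw [h]
  refine tsum_eq_sum fun m hm => ?_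
  rw [not_imp_comm.1 (blockCoef_support hA) hm]; simp

/-- The blocks that contribute to the cubic nonlinearity with truncation `2^K`. -/
def blockIndex (A : ℝ) (K : ℕ) : Finset ((Fin 3 → ℤˣ) × (Fin 3 → ℕ)) :=
  Finset.univ ×ˢ Fintype.piFinset fun _ => Finset.range (K + ⌈A ^ 2⌉₊ + 1)

/-- The symbols χ telescope to a truncation at scale 2^{K+⌈A²⌉}, which equals 1 on the support of
the truncation at scale 2^K. -/
theorem trunc_eq_sum_lp {A : ℝ} (hA : SupportConst ρ A) (K : ℕ) (n : Freq) :
    (trunc ρ (dyad K) n : ℂ) = ∑ k ∈ Finset.range (K + ⌈A ^ 2⌉₊ + 1),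
      (trunc ρ (dyad K) n : ℂ) * (lpSymbol ρ k n : ℂ) := by
  rw [← Finset.mul_sum, ← Complex.ofReal_sum, sum_lpSymbol]
  by_cases h : trunc ρ (dyad K) n = 0
  · simp [h]
  · rw [hA.trunc_eq_one (K + ⌈A ^ 2⌉₊)]
    · simp
    · have h1 := hA.trunc_support K n h
      have h2 := hA.one_le
      calc A * jap n ≤ A * (A * dyad K) := by gcongr
        _ = dyad K * A ^ 2 := by ring
        _ ≤ dyad K * dyad ⌈A ^ 2⌉₊ :=
          mul_le_mul_of_nonneg_left ((Nat.le_ceil _).trans (le_dyad _)) (dyad_pos K).le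
        _ = _ := (dyad_add _ _).symm

/-- The cubic nonlinearity is a finite sum of blocks. -/
theorem IsGaussianData.cubic_eq_sum_block [IsProbabilityMeasure P] (hW : IsGaussianData P W)
    (hV : TorusPeriodic V) (hi : IntegrableOn (fun x => (V x : ℂ)) cube) {A : ℝ}
    (hA : SupportConst ρ A) (K : ℕ) (ω : Ω) :
    cubic V ρ W (dyad K) ω =
      oscSum ((blockIndex A K).sigma fun b => blockSupp A b.2)
        (fun p => (1 / 8) * (blockCoef V ρ p.1.2 (dyad K) p.2 * tripleIntegral P W p.1.1 p.2 ω))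
        (fun p => phase p.1.1 p.2) (fun p => freqSum p.2) := by
  funext t x
  rw [oscSum, Finset.sum_sigma]
  have h1 : ∀ b : (Fin 3 → ℤˣ) × (Fin 3 → ℕ), ∑ m ∈ blockSupp A b.2,
      (1 / 8) * (blockCoef V ρ b.2 (dyad K) m * tripleIntegral P W b.1 m ω) *
        osc (phase b.1 m * t) * character (freqSum m) x =
      ∑ m ∈ Fintype.piFinset (fun _ : Fin 3 => freqBall (A * dyad K)),
      (1 / 8) * (blockCoef V ρ b.2 (dyad K) m * tripleIntegral P W b.1 m ω) *
        osc (phase b.1 m * t) * character (freqSum m) x := by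
    intro b
    -- Both finite index sets contain the support of the summand, so both sums equal the sum over
    -- all triples.
    refine (tsum_eq_sum (L := SummationFilter.unconditional _) ?_).symm.trans (tsum_eq_sum ?_)
    rotate_left
    · intro m hm
      rw [Fintype.mem_piFinset, not_forall] at hm
      obtain ⟨j, hj⟩ := hm
      rw [blockCoef, Finset.prod_eq_zero (Finset.mem_univ j) (by rw [trunc_eq_zero hA hj]; simp)]
      simp
    · intro m hm
      rw [not_imp_comm.1 (blockCoef_support hA) hm]; simp
  rw [Finset.sum_congr rfl fun b _ => h1 b, Finset.sum_comm, cubic_eq_sum hV hi hA]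
  refine Finset.sum_congr rfl fun m _ => ?_
  rw [blockIndex, Finset.sum_product, hW.wickLin_eq]
  have h2 : ∏ j, (trunc ρ (dyad K) (m j) : ℂ) =
      ∑ k ∈ Fintype.piFinset fun _ : Fin 3 => Finset.range (K + ⌈A ^ 2⌉₊ + 1),
        ∏ j, (trunc ρ (dyad K) (m j) : ℂ) * (lpSymbol ρ (k j) (m j) : ℂ) := by
    rw [← Finset.prod_univ_sum (fun _ : Fin 3 => Finset.range (K + ⌈A ^ 2⌉₊ + 1))
      (fun j k => (trunc ρ (dyad K) (m j) : ℂ) * (lpSymbol ρ k (m j) : ℂ))]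
    exact Finset.prod_congr rfl fun j _ => trunc_eq_sum_lp hA K (m j)
  rw [h2]
  simp only [Finset.mul_sum, Finset.sum_mul, blockCoef]
  refine Finset.sum_congr rfl fun ε _ => Finset.sum_congr rfl fun k _ => ?_
  ring

end Cubic

/-! ### The `X^{s,b}`-norm of random oscillatory sums -/

/-- The weight of the `X^{s,b}`-norm. -/
def xsbWeight (r b : ℝ) (p : Freq × ℝ) : ℝ≥0∞ :=
  ENNReal.ofReal (jap p.1 ^ (2 * r) * bracket (|p.2| - jap p.1) ^ (2 * b))

theorem measurable_xsbWeight (r b : ℝ) : Measurable (xsbWeight r b) := by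
  refine measurable_from_prod_countable_right fun n => ENNReal.measurable_ofReal.comp ?_
  have h : Continuous fun lam : ℝ => bracket (|lam| - jap n) ^ (2 * b) :=
    (continuous_bracket_rpow (2 * b)).comp (by fun_prop)
  exact h.measurable.const_mul (jap n ^ (2 * r))

/-- The measure underlying the `X^{s,b}`-norm. -/
def freqMeasure : Measure (Freq × ℝ) := (Measure.count : Measure Freq).prod volume

instance : SFinite freqMeasure := inferInstanceAs (SFinite ((Measure.count : Measure Freq).prod _))

theorem lintegral_freqMeasure {f : Freq × ℝ → ℝ≥0∞} (hf : Measurable f) :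
    ∫⁻ p, f p ∂freqMeasure = ∑' n, ∫⁻ lam : ℝ, f (n, lam) := by
  rw [freqMeasure, lintegral_prod _ hf.aemeasurable, lintegral_count]

theorem xsbNorm_sq (r b : ℝ) {w : Freq → ℝ → ℂ} (hw : ∀ n, Measurable (w n)) :
    xsbNorm r b w ^ 2 = ∫⁻ p, xsbWeight r b p * ‖w p.1 p.2‖ₑ ^ 2 ∂freqMeasure := by
  rw [lintegral_freqMeasure, xsbNorm, ← ENNReal.rpow_natCast, ← ENNReal.rpow_mul]
  · simp [xsbWeight]
  · refine (measurable_xsbWeight r b).mul ?_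
    have : Measurable fun p : Freq × ℝ => w p.1 p.2 := measurable_from_prod_countable_right hw
    fun_prop

theorem ennreal_sqrt_sq (x : ℝ≥0∞) : (x ^ (1 / 2 : ℝ)) ^ 2 = x := by
  rw [← ENNReal.rpow_natCast, ← ENNReal.rpow_mul]; norm_num

/-- Triangle inequality for the `X^{s,b}`-norm. -/
theorem xsbNorm_sum_le {α : Type*} (B : Finset α) (r b : ℝ) {w : α → Freq → ℝ → ℂ}
    (hw : ∀ i n, Measurable (w i n)) :
    xsbNorm r b (fun n lam => ∑ i ∈ B, w i n lam) ≤ ∑ i ∈ B, xsbNorm r b (w i) := by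
  have hm : ∀ i, Measurable fun p : Freq × ℝ => w i p.1 p.2 := fun i =>
    measurable_from_prod_countable_right (hw i)
  have hwt := measurable_xsbWeight r b
  have h := lintegral_rpow_sum_le freqMeasure B
    (F := fun i p => xsbWeight r b p ^ (1 / 2 : ℝ) * ‖w i p.1 p.2‖ₑ)
    (fun i _ => by have := hm i; fun_prop) (g := fun i => xsbNorm r b (w i)) (q := 2) (by norm_num)
    (fun i _ => by
      simp only [ENNReal.rpow_two, mul_pow, ennreal_sqrt_sq]
      rw [xsbNorm_sq r b (hw i)])
  simp only [ENNReal.rpow_two] at h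
  refine (ENNReal.pow_le_pow_left_iff two_ne_zero).1 (le_trans ?_ h)
  rw [xsbNorm_sq r b fun n => Finset.measurable_fun_sum B fun i _ => hw i n]
  refine lintegral_mono fun p => ?_
  simp only
  rw [← Finset.mul_sum, mul_pow, ennreal_sqrt_sq]
  gcongr
  exact enorm_sum_le _ _

section Random

variable {Ω : Type*} [MeasurableSpace Ω] {P : Measure Ω} {W : Fin 2 → Freq → Ω → ℂ}

/-- The space-time Fourier transform of a random oscillatory sum. -/
def randomFourier (P : Measure Ω) (W : Fin 2 → Freq → Ω → ℂ) (ε : Fin 3 → ℤˣ)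
    (s : Finset (Fin 3 → Freq)) (c : (Fin 3 → Freq) → ℂ) (T : ℝ) (ω : Ω) : Freq → ℝ → ℂ :=
  oscFourier s (fun m => c m * tripleIntegral P W ε m ω) (phase ε) freqSum T

theorem randomFourier_apply (ε : Fin 3 → ℤˣ) (s : Finset (Fin 3 → Freq)) (c : (Fin 3 → Freq) → ℂ)
    (T : ℝ) (ω : Ω) (p : Freq × ℝ) : randomFourier P W ε s c T ω p.1 p.2 =
      ∑ m ∈ s, ((if freqSum m = p.1 then c m else 0) * oscInt T (phase ε m - p.2)) *
        tripleIntegral P W ε m ω := by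
  rw [randomFourier, oscFourier]
  exact Finset.sum_congr rfl fun m _ => by split_ifs <;> ring

theorem measurable_randomFourier (hW : IsGaussianData P W) (ε : Fin 3 → ℤˣ)
    (s : Finset (Fin 3 → Freq)) (c : (Fin 3 → Freq) → ℂ) (T : ℝ) :
    Measurable fun z : Ω × (Freq × ℝ) => randomFourier P W ε s c T z.1 z.2.1 z.2.2 := by
  simp_rw [randomFourier_apply]
  refine Finset.measurable_fun_sum s fun m _ => ?_
  refine Measurable.mul (Measurable.mul ?_ ?_) ((measurable_tripleIntegral hW ε m).comp measurable_fst)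
  · have : Measurable fun n : Freq => if freqSum m = n then c m else 0 := measurable_of_countable _
    exact this.comp (measurable_fst.comp measurable_snd)
  · exact (continuous_oscInt T).measurable.comp (by fun_prop)

theorem measurable_xsbNorm_randomFourier (hW : IsGaussianData P W) (ε : Fin 3 → ℤˣ)
    (s : Finset (Fin 3 → Freq)) (c : (Fin 3 → Freq) → ℂ) (T r b : ℝ) :
    Measurable fun ω => xsbNorm r b (randomFourier P W ε s c T ω) ^ 2 := by
  have h1 : ∀ ω, xsbNorm r b (randomFourier P W ε s c T ω) ^ 2 =
      ∫⁻ p, xsbWeight r b p * ‖randomFourier P W ε s c T ω p.1 p.2‖ₑ ^ 2 ∂freqMeasure := fun ω =>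
    xsbNorm_sq r b fun n => (continuous_oscFourier _ _ _ _ T n).measurable
  simp_rw [h1]
  have h2 := measurable_randomFourier hW ε s c T
  have h3 : Measurable fun z : Ω × (Freq × ℝ) => xsbWeight r b z.2 :=
    (measurable_xsbWeight r b).comp measurable_snd
  have h4 : Measurable fun z : Ω × (Freq × ℝ) =>
      xsbWeight r b z.2 * ‖randomFourier P W ε s c T z.1 z.2.1 z.2.2‖ₑ ^ 2 :=
    h3.mul (h2.enorm.pow_const 2)
  exact h4.lintegral_prod_right'

/-- Moments of the `X^{s,b}`-norm of a random oscillatory sum. -/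
theorem IsGaussianData.xsbNorm_moment [IsProbabilityMeasure P] (hW : IsGaussianData P W)
    (ε : Fin 3 → ℤˣ) (s : Finset (Fin 3 → Freq)) (c : (Fin 3 → Freq) → ℂ) (T r b : ℝ) {q : ℝ}
    (hq : 1 ≤ q) :
    ∫⁻ ω, (xsbNorm r b (randomFourier P W ε s c T ω) ^ 2) ^ q ∂P ≤
      (ENNReal.ofReal (2048 * q ^ 3) * ∑ m ∈ s, ‖c m‖ₑ ^ 2 *
        ENNReal.ofReal (∏ j, jap (m j) ^ (-2 : ℝ)) *
        ∫⁻ lam : ℝ, xsbWeight r b (freqSum m, lam) * ‖oscInt T (phase ε m - lam)‖ₑ ^ 2) ^ q := by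
  have hq0 : 0 ≤ q := by linarith
  set g : Freq × ℝ → ℝ≥0∞ := fun p => xsbWeight r b p * (ENNReal.ofReal (2048 * q ^ 3) *
    ∑ m ∈ s, ‖(if freqSum m = p.1 then c m else 0) * oscInt T (phase ε m - p.2)‖ₑ ^ 2 *
      ENNReal.ofReal (∏ j, jap (m j) ^ (-2 : ℝ))) with hg
  have hmeas : ∀ m, Measurable fun p : Freq × ℝ =>
      (if freqSum m = p.1 then c m else 0) * oscInt T (phase ε m - p.2) := fun m => by
    have h1 : Measurable fun n : Freq => if freqSum m = n then c m else 0 := measurable_of_countable _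
    exact (h1.comp measurable_fst).mul ((continuous_oscInt T).measurable.comp (by fun_prop))
  have hgm : Measurable g := by
    refine (measurable_xsbWeight r b).mul (Measurable.const_mul ?_ _)
    exact Finset.measurable_fun_sum s fun m _ => ((hmeas m).enorm.pow_const 2).mul_const _
  have h2 := measurable_randomFourier hW ε s c T
  have h3 : Measurable fun z : Ω × (Freq × ℝ) => xsbWeight r b z.2 :=
    (measurable_xsbWeight r b).comp measurable_snd
  have h4 : Measurable (Function.uncurry fun (ω : Ω) (p : Freq × ℝ) =>
      xsbWeight r b p * ‖randomFourier P W ε s c T ω p.1 p.2‖ₑ ^ 2) :=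
    h3.mul (h2.enorm.pow_const 2)
  -- Minkowski's inequality in L^q of the probability space reduces the norm to the moment bound at
  -- each fixed space-time frequency.
  have key := lintegral_rpow_lintegral_le P freqMeasure h4 hgm hq fun p => by
    simp_rw [ENNReal.mul_rpow_of_nonneg _ _ hq0, hg]
    rw [lintegral_const_mul' _ _ (ENNReal.rpow_ne_top_of_nonneg hq0
      (show xsbWeight r b p ≠ ⊤ from ENNReal.ofReal_ne_top)),
      ENNReal.mul_rpow_of_nonneg _ _ hq0]
    refine mul_le_mul_right ?_ _
    simp_rw [randomFourier_apply]
    exact hW.moment_bound ε s _ hq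
  have h1 : ∀ ω, xsbNorm r b (randomFourier P W ε s c T ω) ^ 2 =
      ∫⁻ p, xsbWeight r b p * ‖randomFourier P W ε s c T ω p.1 p.2‖ₑ ^ 2 ∂freqMeasure := fun ω =>
    xsbNorm_sq r b fun n => (continuous_oscFourier _ _ _ _ T n).measurable
  simp_rw [h1]
  refine key.trans (le_of_eq ?_)
  congr 1
  have h5 : ∀ p, g p = ENNReal.ofReal (2048 * q ^ 3) * ∑ m ∈ s,
      xsbWeight r b p * (‖(if freqSum m = p.1 then c m else 0) * oscInt T (phase ε m - p.2)‖ₑ ^ 2 *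
      ENNReal.ofReal (∏ j, jap (m j) ^ (-2 : ℝ))) := fun p => by
    rw [hg]; simp only; rw [mul_left_comm, Finset.mul_sum]
  have h6 : ∀ m, Measurable fun p : Freq × ℝ => xsbWeight r b p *
      (‖(if freqSum m = p.1 then c m else 0) * oscInt T (phase ε m - p.2)‖ₑ ^ 2 *
      ENNReal.ofReal (∏ j, jap (m j) ^ (-2 : ℝ))) := fun m =>
    (measurable_xsbWeight r b).mul (((hmeas m).enorm.pow_const 2).mul_const _)
  simp_rw [h5]
  rw [lintegral_const_mul' _ _ ENNReal.ofReal_ne_top, lintegral_finsetSum _ fun m _ => h6 m]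
  congr 1
  refine Finset.sum_congr rfl fun m _ => ?_
  rw [lintegral_freqMeasure (h6 m), tsum_eq_single (freqSum m)]
  · rw [← lintegral_const_mul' _ _ (ENNReal.mul_ne_top (by simp) ENNReal.ofReal_ne_top)]
    refine lintegral_congr fun lam => ?_
    rw [if_pos rfl, enorm_mul, mul_pow]; ring
  · intro n hn
    simp [Ne.symm hn]

/-- The weighted energy of a coefficient of a cubic random sum. -/
def coefEnergy (c : (Fin 3 → Freq) → ℂ) (r δ σ : ℝ) (ε : Fin 3 → ℤˣ) (m : Fin 3 → Freq) : ℝ :=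
  ‖c m‖ ^ 2 * (∏ j, jap (m j) ^ (-2 : ℝ)) * jap (freqSum m) ^ r *
    bracket (σ * jap (freqSum m) + phase ε m) ^ (-δ)

theorem prod_jap_rpow_nonneg (m : Fin 3 → Freq) (r : ℝ) : 0 ≤ ∏ j, jap (m j) ^ r :=
  Finset.prod_nonneg fun _ _ => Real.rpow_nonneg (jap_pos _).le _

theorem coefEnergy_nonneg (c : (Fin 3 → Freq) → ℂ) (r δ σ : ℝ) (ε : Fin 3 → ℤˣ)
    (m : Fin 3 → Freq) : 0 ≤ coefEnergy c r δ σ ε m :=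
  mul_nonneg (mul_nonneg (mul_nonneg (sq_nonneg _) (prod_jap_rpow_nonneg m _))
    (Real.rpow_nonneg (jap_pos _).le _)) (Real.rpow_nonneg (bracket_pos _).le _)

/-- A pointwise bound by a weight and two modulation factors sums up to energies. -/
theorem sum_enorm_mul_le_coefEnergy (s : Finset (Fin 3 → Freq)) (c : (Fin 3 → Freq) → ℂ)
    (r δ D B : ℝ) (hD : 0 ≤ D) (ε : Fin 3 → ℤˣ) {f : (Fin 3 → Freq) → ℝ≥0∞}
    (hf : ∀ m ∈ s, ‖c m‖ ≠ 0 → f m ≤ ENNReal.ofReal (D * (jap (freqSum m) ^ r *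
      (bracket (jap (freqSum m) + phase ε m) ^ (-δ) +
        bracket (-jap (freqSum m) + phase ε m) ^ (-δ)))))
    (hB : ∀ σ : ℝ, |σ| = 1 → ∑ m ∈ s, coefEnergy c r δ σ ε m ≤ B) :
    ∑ m ∈ s, ‖c m‖ₑ ^ 2 * ENNReal.ofReal (∏ j, jap (m j) ^ (-2 : ℝ)) * f m ≤
      ENNReal.ofReal (2 * D * B) := by
  have hterm : ∀ m ∈ s, ‖c m‖ₑ ^ 2 * ENNReal.ofReal (∏ j, jap (m j) ^ (-2 : ℝ)) * f m ≤
      ENNReal.ofReal (D * (coefEnergy c r δ 1 ε m + coefEnergy c r δ (-1) ε m)) := by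
    intro m hm
    by_cases hc : ‖c m‖ = 0
    · have : c m = 0 := by simpa using hc
      simp [this]
    refine (mul_le_mul_right (hf m hm hc) _).trans (le_of_eq ?_)
    rw [← ofReal_norm, ← ENNReal.ofReal_pow (norm_nonneg _), ← ENNReal.ofReal_mul (by positivity),
      ← ENNReal.ofReal_mul (mul_nonneg (by positivity) (prod_jap_rpow_nonneg m _))]
    congr 1
    simp only [coefEnergy, one_mul, neg_one_mul]
    ring
  refine (Finset.sum_le_sum hterm).trans ?_
  rw [← ENNReal.ofReal_sum_of_nonneg fun m _ => mul_nonneg hD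
    (add_nonneg (coefEnergy_nonneg ..) (coefEnergy_nonneg ..))]
  apply ENNReal.ofReal_le_ofReal
  rw [← Finset.mul_sum, Finset.sum_add_distrib]
  have h1 := hB 1 (by simp)
  have h2 := hB (-1) (by simp)
  calc _ ≤ D * (B + B) := mul_le_mul_of_nonneg_left (add_le_add h1 h2) hD
    _ = _ := by ring

/-- Moments of the `X^{s,b}`-norm of a block. -/
theorem block_xsb_moment {s₀ δ b : ℝ} (hb : 1 / 2 < b) (hb1 : b < 1) (hδ : δ ≤ 2 - 2 * b) :
    ∃ D : ℝ, 0 < D ∧ ∀ {Ω : Type*} [MeasurableSpace Ω] {P : Measure Ω} [IsProbabilityMeasure P]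
      {W : Fin 2 → Freq → Ω → ℂ}, IsGaussianData P W → ∀ (ε : Fin 3 → ℤˣ)
      (S : Finset (Fin 3 → Freq)) (c : (Fin 3 → Freq) → ℂ) {s T q B : ℝ},
      s ≤ s₀ → 1 ≤ T → 1 ≤ q →
      (∀ σ : ℝ, |σ| = 1 → ∑ m ∈ S, coefEnergy c (2 * s₀ - 2) δ σ ε m ≤ B) →
      ∫⁻ ω, (xsbNorm (s - 1) (b - 1) (randomFourier P W ε S c T ω) ^ 2) ^ q ∂P ≤
        (ENNReal.ofReal (D * q ^ 3 * T ^ 2 * B)) ^ q := by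
  obtain ⟨C₂, hC₂, hosc⟩ := lintegral_weight_oscInt_le (a := 2 - 2 * b) (by linarith) (by linarith)
  refine ⟨2048 * (2 * C₂), by positivity, ?_⟩
  intro Ω _ P _ W hW ε S c s T q B hs hT hq hB
  refine (hW.xsbNorm_moment ε _ _ T _ _ hq).trans (ENNReal.rpow_le_rpow ?_ (by linarith))
  have hsum := sum_enorm_mul_le_coefEnergy S c (2 * s₀ - 2) δ (C₂ * T ^ 2) B (by positivity) ε
    (f := fun m => ∫⁻ lam : ℝ, xsbWeight (s - 1) (b - 1) (freqSum m, lam) *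
      ‖oscInt T (phase ε m - lam)‖ₑ ^ 2) ?_ hB
  · refine (mul_le_mul_right hsum _).trans (le_of_eq ?_)
    rw [← ENNReal.ofReal_mul (by positivity)]
    congr 1; ring
  intro m _ _
  have hj := jap_pos (freqSum m)
  have h1 : ∫⁻ lam : ℝ, xsbWeight (s - 1) (b - 1) (freqSum m, lam) *
      ‖oscInt T (phase ε m - lam)‖ₑ ^ 2 ≤ ENNReal.ofReal (jap (freqSum m) ^ (2 * (s - 1))) *
      ENNReal.ofReal (C₂ * T ^ 2 * (bracket (jap (freqSum m) + phase ε m) ^ (-(2 - 2 * b)) +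
        bracket (-jap (freqSum m) + phase ε m) ^ (-(2 - 2 * b)))) := by
    refine le_trans (le_of_eq ?_) (mul_le_mul_right (hosc T (jap (freqSum m)) (phase ε m) hT) _)
    rw [← lintegral_const_mul' _ _ ENNReal.ofReal_ne_top]
    refine lintegral_congr fun lam => ?_
    rw [xsbWeight, ENNReal.ofReal_mul (Real.rpow_nonneg hj.le _), mul_assoc,
      show 2 * (b - 1) = -(2 - 2 * b) by ring]
  refine h1.trans ?_
  rw [← ENNReal.ofReal_mul (Real.rpow_nonneg hj.le _)]
  apply ENNReal.ofReal_le_ofReal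
  have h2 : jap (freqSum m) ^ (2 * (s - 1)) ≤ jap (freqSum m) ^ (2 * s₀ - 2) :=
    Real.rpow_le_rpow_of_exponent_le (one_le_jap _) (by linarith)
  -- The integral over λ gives the modulation exponent 2 - 2b, slightly below 1; the energies are
  -- stated with a smaller exponent δ, so nothing is lost but room.
  have h3 : ∀ y : ℝ, bracket y ^ (-(2 - 2 * b)) ≤ bracket y ^ (-δ) := fun y =>
    Real.rpow_le_rpow_of_exponent_le (one_le_bracket y) (by linarith)
  have h4 := h3 (jap (freqSum m) + phase ε m)
  have h5 := h3 (-jap (freqSum m) + phase ε m)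
  have p2 : 0 ≤ jap (freqSum m) ^ (2 * s₀ - 2) := Real.rpow_nonneg hj.le _
  have p3 : 0 ≤ bracket (jap (freqSum m) + phase ε m) ^ (-(2 - 2 * b)) :=
    Real.rpow_nonneg (bracket_pos _).le _
  have p4 : 0 ≤ bracket (-jap (freqSum m) + phase ε m) ^ (-(2 - 2 * b)) :=
    Real.rpow_nonneg (bracket_pos _).le _
  rw [mul_left_comm (C₂ * T ^ 2)]
  exact mul_le_mul h2 (mul_le_mul_of_nonneg_left (add_le_add h4 h5) (by positivity))
    (mul_nonneg (by positivity) (add_nonneg p3 p4)) p2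

end Random

/-! ### Discretization of time and space -/

theorem exists_abs_sub_div_le {G : ℕ} (hG : 0 < G) {y : ℝ} (hy : 0 ≤ y) (hy1 : y ≤ 1) :
    ∃ g : Fin (G + 1), |y - g / G| ≤ 1 / G := by
  have hG' : (0 : ℝ) < G := by exact_mod_cast hG
  have h1 := Nat.floor_le (mul_nonneg hy hG'.le)
  have h2 := Nat.lt_floor_add_one (y * G)
  have h3 : ⌊y * G⌋₊ ≤ G := Nat.floor_le_of_le (by nlinarith)
  refine ⟨⟨⌊y * G⌋₊, by omega⟩, ?_⟩
  have e : y - (⌊y * G⌋₊ : ℝ) / G = (y * G - ⌊y * G⌋₊) / G := by field_simp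
  rw [e, abs_div, abs_of_pos hG', abs_of_nonneg (by linarith)]
  gcongr
  linarith

/-- Indices of the space-time grid with `G` steps in every direction. -/
abbrev Grid (G : ℕ) := Fin (G + 1) × (Fin 3 → Fin (G + 1))

/-- Times of the grid. -/
def gridTime (T : ℝ) {G : ℕ} (g : Grid G) : ℝ := T * (g.1 / G)

/-- Points of the grid. -/
def gridPoint {G : ℕ} (g : Grid G) (i : Fin 3) : ℝ := 2 * Real.pi * (g.2 i / G)

theorem gridTime_mem {T : ℝ} (hT : 0 ≤ T) {G : ℕ} (g : Grid G) :
    gridTime T g ∈ Set.Icc 0 T := by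
  have h : ((g.1 : ℕ) : ℝ) / G ≤ 1 := by
    apply div_le_one_of_le₀ _ (by positivity)
    exact_mod_cast Nat.lt_succ_iff.1 g.1.2
  exact ⟨by unfold gridTime; positivity, mul_le_of_le_one_right hT h⟩

/-- Periodicity allows x to be reduced modulo 2π first, so a grid on one period approximates every
point of ℝ³. -/
theorem exists_grid {G : ℕ} (hG : 0 < G) {t T : ℝ} (hT : 0 < T) (ht : t ∈ Set.Icc 0 T) (x : Pt) :
    ∃ (g : Grid G) (k : Freq), |t - gridTime T g| ≤ T / G ∧
      ∀ i, |x i + 2 * Real.pi * (k i : ℝ) - gridPoint g i| ≤ 2 * Real.pi / G := by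
  have hπ := Real.two_pi_pos
  obtain ⟨g₁, hg₁⟩ := exists_abs_sub_div_le hG (y := t / T) (div_nonneg ht.1 hT.le)
    (div_le_one_of_le₀ ht.2 hT.le)
  have h2 := fun i => exists_abs_sub_div_le hG (Int.fract_nonneg (x i / (2 * Real.pi)))
    (Int.fract_lt_one (x i / (2 * Real.pi))).le
  choose g₂ hg₂ using h2
  refine ⟨(g₁, g₂), fun i => -⌊x i / (2 * Real.pi)⌋, ?_, fun i => ?_⟩
  · have e : t - gridTime T (g₁, g₂) = T * (t / T - g₁ / G) := by
      rw [gridTime]; field_simp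
    rw [e, abs_mul, abs_of_pos hT]
    exact (mul_le_mul_of_nonneg_left hg₁ hT.le).trans (le_of_eq (by ring))
  · have e : x i + 2 * Real.pi * ((-⌊x i / (2 * Real.pi)⌋ : ℤ) : ℝ) - gridPoint (g₁, g₂) i =
        2 * Real.pi * (Int.fract (x i / (2 * Real.pi)) - g₂ i / G) := by
      rw [gridPoint, Int.fract]; push_cast; field_simp; ring
    rw [e, abs_mul, abs_of_pos hπ]
    exact (mul_le_mul_of_nonneg_left (hg₂ i) hπ.le).trans (le_of_eq (by ring))

theorem norm_character_sub_le (n : Freq) {x y : Pt} {r : ℝ} (h : ∀ i, |x i - y i| ≤ r) :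
    ‖character n x - character n y‖ ≤ 3 * jap n * r := by
  have hr : 0 ≤ r := (abs_nonneg _).trans (h 0)
  refine (norm_osc_sub_le (∑ i, (n i : ℝ) * x i) (∑ i, (n i : ℝ) * y i)).trans ?_
  rw [← Finset.sum_sub_distrib]
  refine (Finset.abs_sum_le_sum_abs _ _).trans ?_
  have : ∀ i ∈ Finset.univ, |(n i : ℝ) * x i - n i * y i| ≤ jap n * r := fun i _ => by
    rw [← mul_sub, abs_mul]
    exact mul_le_mul ((abs_coord_le_freqLen n i).trans (freqLen_le_jap n)) (h i) (abs_nonneg _)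
      (jap_pos n).le
  refine (Finset.sum_le_card_nsmul _ _ _ this).trans (le_of_eq ?_)
  simp; ring

/-- The discretization error is a Lipschitz constant times Σ‖a_i‖. Cauchy-Schwarz turns its square
into the number of terms times Σ‖a_i‖², so the error is again quadratic in the chaos and the same
moment bound handles it. -/
theorem norm_sum_duhCoef_le_grid {ι : Type*} (S : Finset ι) (a : ι → ℂ) (φ : ι → ℝ)
    (ν : ι → Freq) {J T τ t : ℝ} (hJ1 : 1 ≤ J) (hJ : ∀ i ∈ S, jap (ν i) ≤ J) (hτ : 0 ≤ τ)
    (hT : 1 ≤ T) (ht : t ∈ Set.Icc 0 T) (x : Pt) {G : ℕ} (hG : 0 < G) :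
    ∃ g : Grid G, ‖∑ i ∈ S, a i * duhCoef τ (jap (ν i)) (φ i) t * character (ν i) x‖ ^ 2 ≤
      2 * (‖∑ i ∈ S, a i * duhCoef τ (jap (ν i)) (φ i) (gridTime T g) *
        character (ν i) (gridPoint g)‖ ^ 2 +
        (22 * T ^ 2 * J / G) ^ 2 * S.card * ∑ i ∈ S, ‖a i‖ ^ 2) := by
  have hT0 : 0 < T := by linarith
  have hG' : (0 : ℝ) < G := by exact_mod_cast hG
  obtain ⟨g, k, hg1, hg2⟩ := exists_grid hG hT0 ht x
  refine ⟨g, ?_⟩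
  have htg := gridTime_mem hT0.le g
  have hterm : ∀ i ∈ S, ‖a i * duhCoef τ (jap (ν i)) (φ i) t * character (ν i) x -
      a i * duhCoef τ (jap (ν i)) (φ i) (gridTime T g) * character (ν i) (gridPoint g)‖ ≤
      ‖a i‖ * (22 * T ^ 2 * J / G) := by
    intro i hi
    rw [← character_periodic (ν i) x k]
    set y : Pt := fun i => x i + 2 * Real.pi * (k i : ℝ)
    have e : a i * duhCoef τ (jap (ν i)) (φ i) t * character (ν i) y -
        a i * duhCoef τ (jap (ν i)) (φ i) (gridTime T g) * character (ν i) (gridPoint g) =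
        a i * ((duhCoef τ (jap (ν i)) (φ i) t - duhCoef τ (jap (ν i)) (φ i) (gridTime T g)) *
          character (ν i) y + duhCoef τ (jap (ν i)) (φ i) (gridTime T g) *
          (character (ν i) y - character (ν i) (gridPoint g))) := by ring
    rw [e, norm_mul]
    refine mul_le_mul_of_nonneg_left ((norm_add_le _ _).trans ?_) (norm_nonneg _)
    rw [norm_mul, norm_mul, norm_character, mul_one]
    have h1 := norm_duhCoef_sub_le (φ := φ i) (t := t) hτ (one_le_jap (ν i)) htg.1 htg.2
    have h2 := norm_duhCoef_le (φ := φ i) hτ (one_le_jap (ν i)) htg.1 htg.2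
    have h3 := norm_character_sub_le (ν i) (x := y) (y := gridPoint g) hg2
    have h4 : (T + 1) * |t - gridTime T g| ≤ 2 * T * (T / G) :=
      mul_le_mul (by linarith) hg1 (abs_nonneg _) (by linarith)
    have h5 : 3 * jap (ν i) * (2 * Real.pi / G) ≤ 3 * J * (2 * 3.15 / G) := by
      have := hJ i hi
      have := Real.pi_lt_d2
      gcongr
    have h6 := mul_le_mul h2 (h3.trans h5) (norm_nonneg _) hT0.le
    refine (add_le_add (h1.trans h4) h6).trans ?_
    have e2 : 2 * T * (T / G) + T * (3 * J * (2 * 3.15 / G)) =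
        (2 * T ^ 2 + 18.9 * T * J) / G := by field_simp; ring
    rw [e2]
    gcongr
    nlinarith [mul_nonneg (by nlinarith : 0 ≤ T * T - T) (by linarith : 0 ≤ J),
      mul_nonneg (sq_nonneg T) (by linarith : 0 ≤ J - 1)]
  have hsum : ‖∑ i ∈ S, a i * duhCoef τ (jap (ν i)) (φ i) t * character (ν i) x -
      ∑ i ∈ S, a i * duhCoef τ (jap (ν i)) (φ i) (gridTime T g) *
        character (ν i) (gridPoint g)‖ ≤ (∑ i ∈ S, ‖a i‖) * (22 * T ^ 2 * J / G) := by
    rw [← Finset.sum_sub_distrib, Finset.sum_mul]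
    exact (norm_sum_le _ _).trans (Finset.sum_le_sum hterm)
  have hcs : (∑ i ∈ S, ‖a i‖) ^ 2 ≤ S.card * ∑ i ∈ S, ‖a i‖ ^ 2 := sq_sum_le_card_mul_sum_sq
  set u := ∑ i ∈ S, a i * duhCoef τ (jap (ν i)) (φ i) t * character (ν i) x
  set v := ∑ i ∈ S, a i * duhCoef τ (jap (ν i)) (φ i) (gridTime T g) * character (ν i) (gridPoint g)
  have h1 : ‖u‖ ≤ ‖v‖ + ‖u - v‖ := by
    have := norm_add_le v (u - v); rwa [add_sub_cancel] at this
  have h2 : ‖u - v‖ ^ 2 ≤ (22 * T ^ 2 * J / G) ^ 2 * S.card * ∑ i ∈ S, ‖a i‖ ^ 2 := by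
    calc ‖u - v‖ ^ 2 ≤ ((∑ i ∈ S, ‖a i‖) * (22 * T ^ 2 * J / G)) ^ 2 := by gcongr
      _ = (22 * T ^ 2 * J / G) ^ 2 * (∑ i ∈ S, ‖a i‖) ^ 2 := by ring
      _ ≤ (22 * T ^ 2 * J / G) ^ 2 * (S.card * ∑ i ∈ S, ‖a i‖ ^ 2) := by gcongr
      _ = _ := by ring
  have h3 : ‖u‖ ^ 2 ≤ (‖v‖ + ‖u - v‖) ^ 2 := by gcongr
  nlinarith [sq_nonneg (‖v‖ - ‖u - v‖)]

/-! ### Moments on the grid -/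

theorem lintegral_rpow_add_le {Ω : Type*} [MeasurableSpace Ω] (P : Measure Ω) [SFinite P]
    {f g : Ω → ℝ≥0∞} (hf : Measurable f) (hg : Measurable g) {a b : ℝ≥0∞} {q : ℝ} (hq : 1 ≤ q)
    (hfa : ∫⁻ ω, f ω ^ q ∂P ≤ a ^ q) (hgb : ∫⁻ ω, g ω ^ q ∂P ≤ b ^ q) :
    ∫⁻ ω, (f ω + g ω) ^ q ∂P ≤ (a + b) ^ q := by
  have h := lintegral_rpow_sum_le P Finset.univ (F := fun i : Bool => if i then f else g)
    (g := fun i => if i then a else b) (fun i _ => by cases i <;> simpa) hq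
    (fun i _ => by cases i <;> simpa)
  simpa using h

/-- A family of random variables with a common moment bound has a majorant whose moment is
controlled by the cardinality. -/
theorem exists_majorant {Ω α : Type*} [MeasurableSpace Ω] (P : Measure Ω) (I : Finset α)
    {f : α → Ω → ℝ≥0∞} (hf : ∀ i, Measurable (f i)) {q : ℝ} (hq : 0 < q) {b : ℝ≥0∞}
    (h : ∀ i ∈ I, ∫⁻ ω, f i ω ^ q ∂P ≤ b ^ q) :
    ∃ Y : Ω → ℝ≥0∞, Measurable Y ∧ (∀ i ∈ I, ∀ ω, f i ω ≤ Y ω) ∧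
      ∫⁻ ω, Y ω ^ q ∂P ≤ I.card * b ^ q := by
  refine ⟨fun ω => (∑ i ∈ I, f i ω ^ q) ^ (1 / q), ?_, fun i hi ω => ?_, ?_⟩
  · exact (Finset.measurable_fun_sum I fun i _ => (hf i).pow_const q).pow_const _
  · rw [one_div, ENNReal.le_rpow_inv_iff hq]
    exact Finset.single_le_sum (f := fun i => f i ω ^ q) (fun _ _ => zero_le) hi
  · have e : ∀ ω, ((∑ i ∈ I, f i ω ^ q) ^ (1 / q)) ^ q = ∑ i ∈ I, f i ω ^ q := fun ω => by
      rw [← ENNReal.rpow_mul, one_div_mul_cancel hq.ne', ENNReal.rpow_one]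
    simp_rw [e]
    rw [lintegral_finsetSum _ fun i _ => (hf i).pow_const q]
    refine (Finset.sum_le_card_nsmul _ _ _ h).trans (le_of_eq ?_)
    simp

section Random

variable {Ω : Type*} [MeasurableSpace Ω] {P : Measure Ω} {W : Fin 2 → Freq → Ω → ℂ}

/-- The value on the grid of a Littlewood-Paley piece of the Duhamel integral of a random
oscillatory sum, together with the discretization error. -/
def gridFunctional (P : Measure Ω) (W : Fin 2 → Freq → Ω → ℂ) (ρ : ℝ → ℝ) (ε : Fin 3 → ℤˣ)
    (S : Finset (Fin 3 → Freq)) (c : (Fin 3 → Freq) → ℂ) (s τ T J : ℝ) (j : ℕ) {G : ℕ}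
    (g : Grid G) (ω : Ω) : ℝ≥0∞ :=
  ENNReal.ofReal (dyad j ^ (2 * s)) *
    ‖∑ m ∈ S, ((lpSymbol ρ j (freqSum m) : ℂ) * c m *
      duhCoef τ (jap (freqSum m)) (phase ε m) (gridTime T g) *
      character (freqSum m) (gridPoint g)) * tripleIntegral P W ε m ω‖ₑ ^ 2 +
  ∑ m ∈ S, ENNReal.ofReal (dyad j ^ (2 * s) * ((22 * T ^ 2 * J / G) ^ 2 * S.card)) *
    ‖((lpSymbol ρ j (freqSum m) : ℂ) * c m) * tripleIntegral P W ε m ω‖ₑ ^ 2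

theorem measurable_gridFunctional (hW : IsGaussianData P W) (ρ : ℝ → ℝ) (ε : Fin 3 → ℤˣ)
    (S : Finset (Fin 3 → Freq)) (c : (Fin 3 → Freq) → ℂ) (s τ T J : ℝ) (j : ℕ) {G : ℕ}
    (g : Grid G) : Measurable (gridFunctional P W ρ ε S c s τ T J j g) := by
  have h := measurable_tripleIntegral hW ε
  unfold gridFunctional
  fun_prop

theorem enorm_real_sq (z : ℂ) : ‖z‖ₑ ^ 2 = ENNReal.ofReal (‖z‖ ^ 2) := by
  rw [← ofReal_norm, ENNReal.ofReal_pow (norm_nonneg _)]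

/-- At a grid point the value is a single chaos variable, and ⟨n₁₂₃⟩^{2s} times the Duhamel factor
reproduces the energy. The error has no smoothing, but the fineness of the grid compensates: of the
five powers of J required, two come from the Lipschitz constant, two from the missing ⟨n₁₂₃⟩^{-2},
and one from the missing modulation factor. -/
theorem IsGaussianData.gridFunctional_moment [IsProbabilityMeasure P] (hW : IsGaussianData P W)
    {ρ : ℝ → ℝ} (hρ : IsCutoffProfile ρ) {A : ℝ} (hA : SupportConst ρ A) (ε : Fin 3 → ℤˣ)
    (S : Finset (Fin 3 → Freq)) (c : (Fin 3 → Freq) → ℂ) {s δ τ T J B q : ℝ} (hs : 0 ≤ s)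
    (hδ1 : δ ≤ 1) (hτ : 0 ≤ τ) (hT : 1 ≤ T) (hJ1 : 1 ≤ J)
    (hJ : ∀ m ∈ S, jap (freqSum m) ≤ J ∧ |phase ε m| ≤ J) {G : ℕ} (hG : 0 < G)
    (hSG : S.card * J ^ 5 ≤ (G : ℝ) ^ 2) (hq : 1 ≤ q)
    (hB : ∀ σ : ℝ, |σ| = 1 → ∑ m ∈ S, coefEnergy c (2 * s - 2) δ σ ε m ≤ B) (j : ℕ)
    (g : Grid G) :
    ∫⁻ ω, gridFunctional P W ρ ε S c s τ T J j g ω ^ q ∂P ≤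
      (ENNReal.ofReal (2048 * 3000 * A ^ (2 * s) * q ^ 3 * T ^ 4 * B)) ^ q := by
  have hq0 : 0 ≤ q := by linarith
  have hA1 := hA.one_le
  have hA0 : 0 < A := by linarith
  have hG' : (0 : ℝ) < G := by exact_mod_cast hG
  have hB0 : 0 ≤ B := (Finset.sum_nonneg fun m _ => coefEnergy_nonneg c _ _ _ ε m).trans
    (hB 1 (by simp))
  have hI := measurable_tripleIntegral hW ε
  have hlp : ∀ m, dyad j ^ (2 * s) * ‖(lpSymbol ρ j (freqSum m) : ℂ)‖ ^ 2 ≤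
      A ^ (2 * s) * jap (freqSum m) ^ (2 * s) := by
    intro m
    have hj := (jap_pos (freqSum m)).le
    by_cases h : lpSymbol ρ j (freqSum m) = 0
    · rw [h]; simp; positivity
    rw [← Real.mul_rpow hA0.le hj, Complex.norm_real]
    have h1 : ‖lpSymbol ρ j (freqSum m)‖ ^ 2 ≤ 1 :=
      pow_le_one₀ (norm_nonneg _) (hρ.abs_lpSymbol_le _ _)
    calc _ ≤ dyad j ^ (2 * s) * 1 :=
          mul_le_mul_of_nonneg_left h1 (Real.rpow_nonneg (dyad_pos j).le _)
      _ ≤ _ := by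
          rw [mul_one]
          exact Real.rpow_le_rpow (dyad_pos j).le (hA.lp_support _ _ h).2 (by linarith)
  have hjap : ∀ m, jap (freqSum m) ^ (2 * s) =
      jap (freqSum m) ^ (2 * s - 2) * jap (freqSum m) ^ 2 := fun m => by
    rw [← Real.rpow_natCast, ← Real.rpow_add (jap_pos _)]; norm_num
  have hmain : ∫⁻ ω, (ENNReal.ofReal (dyad j ^ (2 * s)) *
      ‖∑ m ∈ S, ((lpSymbol ρ j (freqSum m) : ℂ) * c m *
        duhCoef τ (jap (freqSum m)) (phase ε m) (gridTime T g) *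
        character (freqSum m) (gridPoint g)) * tripleIntegral P W ε m ω‖ₑ ^ 2) ^ q ∂P ≤
      (ENNReal.ofReal (2048 * q ^ 3) * ENNReal.ofReal (2 * (5 * T ^ 2 * A ^ (2 * s)) * B)) ^ q := by
    simp_rw [ENNReal.mul_rpow_of_nonneg _ _ hq0]
    rw [lintegral_const_mul' _ _ (ENNReal.rpow_ne_top_of_nonneg hq0 ENNReal.ofReal_ne_top)]
    refine (mul_le_mul_right (hW.moment_bound ε S _ hq) _).trans ?_
    rw [← ENNReal.mul_rpow_of_nonneg _ _ hq0, ← ENNReal.mul_rpow_of_nonneg _ _ hq0]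
    refine ENNReal.rpow_le_rpow ?_ hq0
    rw [mul_left_comm]
    refine mul_le_mul_right ?_ _
    refine le_trans (le_of_eq ?_) (sum_enorm_mul_le_coefEnergy S c (2 * s - 2) δ
      (5 * T ^ 2 * A ^ (2 * s)) B (by positivity) ε (f := fun m => ENNReal.ofReal
        (dyad j ^ (2 * s)) * ‖(lpSymbol ρ j (freqSum m) : ℂ) *
          duhCoef τ (jap (freqSum m)) (phase ε m) (gridTime T g) *
          character (freqSum m) (gridPoint g)‖ₑ ^ 2) ?_ hB)
    · rw [Finset.mul_sum]
      refine Finset.sum_congr rfl fun m _ => ?_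
      simp only [enorm_mul]; ring
    intro m _ _
    have hj := jap_pos (freqSum m)
    rw [enorm_real_sq, ← ENNReal.ofReal_mul (Real.rpow_nonneg (dyad_pos j).le _)]
    apply ENNReal.ofReal_le_ofReal
    have htg := gridTime_mem (by linarith : 0 ≤ T) g
    have hd := norm_duhCoef_sq_le (φ := phase ε m) hτ hj htg.1 htg.2 hT
    -- The Duhamel integral supplies modulation exponent 2, of which only δ ≤ 1 is kept so that both
    -- norms share one energy.
    have hb : ∀ y : ℝ, bracket y ^ (-2 : ℝ) ≤ bracket y ^ (-δ) := fun y =>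
      Real.rpow_le_rpow_of_exponent_le (one_le_bracket y) (by linarith)
    rw [norm_mul, norm_mul, norm_character, mul_one, mul_pow, ← mul_assoc]
    have h1 := hlp m
    have h2 := hb (jap (freqSum m) + phase ε m)
    have h3 := hb (-jap (freqSum m) + phase ε m)
    have h4 : 0 ≤ jap (freqSum m) ^ (-2 : ℝ) := Real.rpow_nonneg hj.le _
    have h5 : 5 * T ^ 2 * jap (freqSum m) ^ (-2 : ℝ) *
      (bracket (jap (freqSum m) + phase ε m) ^ (-2 : ℝ) +
        bracket (-jap (freqSum m) + phase ε m) ^ (-2 : ℝ)) ≤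
      5 * T ^ 2 * jap (freqSum m) ^ (-2 : ℝ) * (bracket (jap (freqSum m) + phase ε m) ^ (-δ) +
        bracket (-jap (freqSum m) + phase ε m) ^ (-δ)) :=
      mul_le_mul_of_nonneg_left (add_le_add h2 h3) (by positivity)
    refine (mul_le_mul h1 (hd.trans h5) (sq_nonneg _) (mul_nonneg (by positivity)
      (Real.rpow_nonneg hj.le _))).trans (le_of_eq ?_)
    have e : jap (freqSum m) ^ (2 * s - 2) =
        jap (freqSum m) ^ (2 * s) * jap (freqSum m) ^ (-2 : ℝ) := by
      rw [← Real.rpow_add hj]; congr 1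
    rw [e]; ring
  have herr : ∫⁻ ω, (∑ m ∈ S, ENNReal.ofReal (dyad j ^ (2 * s) *
      ((22 * T ^ 2 * J / G) ^ 2 * S.card)) *
      ‖((lpSymbol ρ j (freqSum m) : ℂ) * c m) * tripleIntegral P W ε m ω‖ₑ ^ 2) ^ q ∂P ≤
      (ENNReal.ofReal (2048 * q ^ 3) *
        ENNReal.ofReal (2 * (726 * T ^ 4 * A ^ (2 * s)) * B)) ^ q := by
    have hd0 : 0 ≤ dyad j ^ (2 * s) := Real.rpow_nonneg (dyad_pos j).le _
    refine (lintegral_rpow_sum_le P S (fun m _ => by have := hI m; fun_prop)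
      (g := fun m => ENNReal.ofReal (2048 * q ^ 3) * (‖c m‖ₑ ^ 2 *
        ENNReal.ofReal (∏ j, jap (m j) ^ (-2 : ℝ)) * (ENNReal.ofReal (dyad j ^ (2 * s) *
      ((22 * T ^ 2 * J / G) ^ 2 * S.card)) * ‖(lpSymbol ρ j (freqSum m) : ℂ)‖ₑ ^ 2)))
      hq fun m _ => ?_).trans ?_
    · simp_rw [ENNReal.mul_rpow_of_nonneg _ _ hq0]
      rw [lintegral_const_mul' _ _ (ENNReal.rpow_ne_top_of_nonneg hq0 ENNReal.ofReal_ne_top)]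
      have h := hW.moment_bound ε {m} (fun m => (lpSymbol ρ j (freqSum m) : ℂ) * c m) hq
      simp only [Finset.sum_singleton] at h
      refine (mul_le_mul_right h _).trans (le_of_eq ?_)
      simp only [← ENNReal.mul_rpow_of_nonneg _ _ hq0]
      congr 1
      rw [enorm_mul]; ring
    refine ENNReal.rpow_le_rpow ?_ hq0
    rw [← Finset.mul_sum]
    refine mul_le_mul_right ?_ _
    refine sum_enorm_mul_le_coefEnergy S c (2 * s - 2) δ
      (726 * T ^ 4 * A ^ (2 * s)) B (by positivity) ε (f := fun m => ENNReal.ofReal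
        (dyad j ^ (2 * s) * ((22 * T ^ 2 * J / G) ^ 2 * S.card)) *
          ‖(lpSymbol ρ j (freqSum m) : ℂ)‖ₑ ^ 2) ?_ hB
    intro m hm _
    obtain ⟨hJm, hφ⟩ := hJ m hm
    have hj := jap_pos (freqSum m)
    rw [enorm_real_sq, ← ENNReal.ofReal_mul (by positivity)]
    apply ENNReal.ofReal_le_ofReal
    -- All modulations are at most 2J and δ ≤ 1, so the factor inserted to form the energy is at
    -- least 1/(3J).
    have hb : ∀ y : ℝ, |y| ≤ 2 * J → 1 / (3 * J) ≤ bracket y ^ (-δ) := fun y hy => by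
      have h1 := one_le_bracket y
      have h2 : bracket y ≤ 3 * J := by linarith [bracket_le_one_add_abs y]
      calc 1 / (3 * J) ≤ 1 / bracket y := by gcongr
        _ = bracket y ^ (-1 : ℝ) := by rw [Real.rpow_neg_one, one_div]
        _ ≤ _ := Real.rpow_le_rpow_of_exponent_le h1 (by linarith)
    have h1 := hb (jap (freqSum m) + phase ε m)
      ((abs_add_le _ _).trans (by rw [abs_of_pos hj]; linarith))
    have h2 := hb (-jap (freqSum m) + phase ε m)
      ((abs_add_le _ _).trans (by rw [abs_neg, abs_of_pos hj]; linarith))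
    have h3 : (22 * T ^ 2 * J / G) ^ 2 * S.card * J ^ 2 ≤
        726 * T ^ 4 * (1 / (3 * J) + 1 / (3 * J)) := by
      have e : (22 * T ^ 2 * J / G) ^ 2 * S.card * J ^ 2 =
        484 * T ^ 4 / J * ((S.card * J ^ 5) / G ^ 2) := by field_simp; ring
      have e2 : 726 * T ^ 4 * (1 / (3 * J) + 1 / (3 * J)) = 484 * T ^ 4 / J * 1 := by
        field_simp; norm_num
      rw [e, e2]
      have : S.card * J ^ 5 / (G : ℝ) ^ 2 ≤ 1 := div_le_one_of_le₀ hSG (by positivity)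
      gcongr
    have hj2 : jap (freqSum m) ^ 2 ≤ J ^ 2 := by gcongr
    have hp := Real.rpow_nonneg hj.le (2 * s - 2)
    calc _ = (dyad j ^ (2 * s) * ‖(lpSymbol ρ j (freqSum m) : ℂ)‖ ^ 2) *
          ((22 * T ^ 2 * J / G) ^ 2 * S.card) := by ring
      _ ≤ (A ^ (2 * s) * jap (freqSum m) ^ (2 * s)) * ((22 * T ^ 2 * J / G) ^ 2 * S.card) :=
          mul_le_mul_of_nonneg_right (hlp m) (by positivity)
      _ = A ^ (2 * s) * jap (freqSum m) ^ (2 * s - 2) *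
          ((22 * T ^ 2 * J / G) ^ 2 * S.card * jap (freqSum m) ^ 2) := by rw [hjap]; ring
      _ ≤ A ^ (2 * s) * jap (freqSum m) ^ (2 * s - 2) *
          (726 * T ^ 4 * (bracket (jap (freqSum m) + phase ε m) ^ (-δ) +
            bracket (-jap (freqSum m) + phase ε m) ^ (-δ))) := by
          refine mul_le_mul_of_nonneg_left ?_ (mul_nonneg (by positivity) hp)
          refine (mul_le_mul_of_nonneg_left hj2 (by positivity)).trans (h3.trans ?_)
          exact mul_le_mul_of_nonneg_left (add_le_add h1 h2) (by positivity)
      _ = _ := by ring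
  have key := lintegral_rpow_add_le P (by fun_prop) (by fun_prop) hq hmain herr
  refine key.trans (ENNReal.rpow_le_rpow ?_ hq0)
  rw [← mul_add, ← ENNReal.ofReal_add (by positivity) (by positivity),
    ← ENNReal.ofReal_mul (by positivity)]
  apply ENNReal.ofReal_le_ofReal
  have hT2 : T ^ 2 ≤ T ^ 4 := pow_le_pow_right₀ hT (by norm_num)
  have hAB : 0 ≤ 2048 * q ^ 3 * (A ^ (2 * s) * B) := by positivity
  have hT4 : 0 ≤ T ^ 4 := by positivity
  calc _ = 2048 * q ^ 3 * (A ^ (2 * s) * B) * (10 * T ^ 2 + 1452 * T ^ 4) := by ring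
    _ ≤ 2048 * q ^ 3 * (A ^ (2 * s) * B) * (3000 * T ^ 4) :=
        mul_le_mul_of_nonneg_left (by linarith) hAB
    _ = _ := by ring

end Random

/-! ### Majorants with controlled moments -/

section Majorant

variable {Ω : Type*} [MeasurableSpace Ω]

/-- `X` has a measurable majorant whose `L^r`-norm is at most `b`. -/
def HasMajorant (P : Measure Ω) (r : ℝ) (X : Ω → ℝ≥0∞) (b : ℝ≥0∞) : Prop :=
  ∃ Z : Ω → ℝ≥0∞, Measurable Z ∧ (∀ ω, X ω ≤ Z ω) ∧ ∫⁻ ω, Z ω ^ r ∂P ≤ b ^ r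

variable {P : Measure Ω} {r : ℝ} {X : Ω → ℝ≥0∞} {b : ℝ≥0∞}

theorem HasMajorant.mono (h : HasMajorant P r X b) (hr : 0 ≤ r) {X' : Ω → ℝ≥0∞} {b' : ℝ≥0∞}
    (hX : ∀ ω, X' ω ≤ X ω) (hb : b ≤ b') : HasMajorant P r X' b' := by
  obtain ⟨Z, hZ, hXZ, hint⟩ := h
  exact ⟨Z, hZ, fun ω => (hX ω).trans (hXZ ω), hint.trans (ENNReal.rpow_le_rpow hb hr)⟩

/-- Monotonicity of L^p norms on a probability space; it lets every p be reached from a larger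
exponent. -/
theorem HasMajorant.lpOmega_le [IsProbabilityMeasure P] (h : HasMajorant P r X b) {p : ℝ}
    (hp : 0 < p) (hpr : p ≤ r) : lpOmega P p X ≤ b := by
  obtain ⟨Z, hZ, hXZ, hint⟩ := h
  have hr : 0 < r := by linarith
  refine (iInf₂_le Z hZ).trans ((iInf_le _ (Eventually.of_forall hXZ)).trans ?_)
  have h1 := rpow_lintegral_le P (f := fun ω => Z ω ^ p) (hZ.pow_const p).aemeasurable (q := r / p)
    ((one_le_div hp).2 hpr)
  simp_rw [← ENNReal.rpow_mul, mul_div_cancel₀ _ hp.ne'] at h1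
  have h2 := ENNReal.rpow_le_rpow (h1.trans hint) (one_div_nonneg.2 hr.le)
  have e : r / p * (1 / r) = 1 / p := by field_simp
  rwa [← ENNReal.rpow_mul, ← ENNReal.rpow_mul, mul_one_div_cancel hr.ne', ENNReal.rpow_one, e] at h2

theorem HasMajorant.tsum [SFinite P] {α : Type*} [Countable α] {Y : α → Ω → ℝ≥0∞}
    {b : α → ℝ≥0∞} (hr : 1 ≤ r) (h : ∀ a, HasMajorant P r (Y a) (b a)) :
    HasMajorant P r (fun ω => ∑' a, Y a ω) (∑' a, b a) := by
  choose Z hZ hYZ hint using h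
  exact ⟨fun ω => ∑' a, Z a ω, Measurable.tsum hZ,
    fun ω => ENNReal.tsum_le_tsum fun a => hYZ a ω, lintegral_rpow_tsum_le P hZ hr hint⟩

theorem HasMajorant.sqrt (h : HasMajorant P r (fun ω => X ω ^ 2) (b ^ 2)) :
    HasMajorant P (2 * r) X b := by
  obtain ⟨Z, hZ, hXZ, hint⟩ := h
  refine ⟨fun ω => Z ω ^ (1 / 2 : ℝ), hZ.pow_const _, fun ω => ?_, ?_⟩
  · rw [one_div, ENNReal.le_rpow_inv_iff (by norm_num), ENNReal.rpow_two]; exact hXZ ω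
  · simp_rw [← ENNReal.rpow_mul]
    rw [ENNReal.rpow_mul, ENNReal.rpow_two]
    refine le_trans (le_of_eq ?_) hint
    exact lintegral_congr fun ω => by congr 1; ring

end Majorant

/-! ### Majorants of the blocks -/

theorem stableIdx_add_one_le (A : ℝ) (k : Fin 3 → ℕ) :
    ((stableIdx A k + 1 : ℕ) : ℝ) ≤ (⌈4 * A ^ 2⌉₊ + 2) * maxScale k := by
  have h1 := one_le_maxScale k
  have h2 := le_dyad (maxIdx k)
  rw [← maxScale_eq] at h2
  rw [stableIdx]
  push_cast
  have : (0 : ℝ) ≤ ⌈4 * A ^ 2⌉₊ := Nat.cast_nonneg _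
  nlinarith

/-- The number of grid steps used for a block. -/
def gridSize (A : ℝ) (k : Fin 3 → ℕ) : ℕ := ⌈(5 * A) ^ 9 * (4 * A) ^ 5⌉₊ * 2 ^ (7 * maxIdx k)

theorem cast_gridSize (A : ℝ) (k : Fin 3 → ℕ) :
    (gridSize A k : ℝ) = ⌈(5 * A) ^ 9 * (4 * A) ^ 5⌉₊ * maxScale k ^ 7 := by
  rw [gridSize, maxScale_eq, dyad, ← pow_mul, mul_comm (maxIdx k)]; push_cast; rfl

theorem gridSize_pos {A : ℝ} (hA : 1 ≤ A) (k : Fin 3 → ℕ) : 0 < gridSize A k :=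
  Nat.mul_pos (Nat.ceil_pos.2 (by positivity)) (by positivity)

/-- The support has O(M⁹) points and J⁵ is O(M⁵), so the square of the grid size must dominate M¹⁴;
this dictates the exponent 7. -/
theorem card_mul_le_gridSize {A : ℝ} (hA : 1 ≤ A) (k : Fin 3 → ℕ) :
    (blockSupp A k).card * (4 * A * maxScale k) ^ 5 ≤ (gridSize A k : ℝ) ^ 2 := by
  have hM := one_le_maxScale k
  have h1 := Nat.le_ceil ((5 * A) ^ 9 * (4 * A) ^ 5)
  have h2 : (1 : ℝ) ≤ ⌈(5 * A) ^ 9 * (4 * A) ^ 5⌉₊ := by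
    exact_mod_cast Nat.ceil_pos.2 (by positivity)
  rw [cast_gridSize]
  calc _ ≤ (5 * A * maxScale k) ^ 9 * (4 * A * maxScale k) ^ 5 := by
        gcongr; exact card_blockSupp_le hA k
    _ = ((5 * A) ^ 9 * (4 * A) ^ 5) * 1 * maxScale k ^ 14 := by ring
    _ ≤ ⌈(5 * A) ^ 9 * (4 * A) ^ 5⌉₊ * ⌈(5 * A) ^ 9 * (4 * A) ^ 5⌉₊ * maxScale k ^ 14 := by
        gcongr
    _ = _ := by ring

/-- The number of random variables that control a block. -/
def blockCount (A : ℝ) (k : Fin 3 → ℕ) : ℕ := (stableIdx A k + 1) ^ 2 * (gridSize A k + 1) ^ 4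

/-- Two index ranges of length O(M) and a four-dimensional grid with O(M⁷) steps give 2 + 4 · 7 =
30. -/
theorem exists_blockCount_le {A : ℝ} (hA : 1 ≤ A) :
    ∃ D : ℝ, 1 ≤ D ∧ ∀ k, (blockCount A k : ℝ) ≤ D * maxScale k ^ 30 := by
  have h2 : (1 : ℝ) ≤ ⌈(5 * A) ^ 9 * (4 * A) ^ 5⌉₊ := by
    exact_mod_cast Nat.ceil_pos.2 (by positivity)
  set c : ℝ := ((⌈(5 * A) ^ 9 * (4 * A) ^ 5⌉₊ : ℕ) : ℝ) with hc
  set d : ℝ := ((⌈4 * A ^ 2⌉₊ : ℕ) : ℝ) with hd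
  have hd0 : 0 ≤ d := Nat.cast_nonneg _
  refine ⟨(d + 2) ^ 2 * (2 * c) ^ 4, ?_, fun k => ?_⟩
  · exact one_le_mul_of_one_le_of_one_le (one_le_pow₀ (by linarith)) (one_le_pow₀ (by linarith))
  have hM := one_le_maxScale k
  have h1 := stableIdx_add_one_le A k
  have h3 : ((gridSize A k + 1 : ℕ) : ℝ) ≤ 2 * c * maxScale k ^ 7 := by
    push_cast
    rw [cast_gridSize]
    have : 1 ≤ c * maxScale k ^ 7 := one_le_mul_of_one_le_of_one_le h2 (one_le_pow₀ hM)
    linarith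
  rw [blockCount]
  push_cast at h1 h3 ⊢
  calc _ ≤ ((d + 2) * maxScale k) ^ 2 * (2 * c * maxScale k ^ 7) ^ 4 := by gcongr
    _ = _ := by ring

theorem le_blockCount (A : ℝ) (k : Fin 3 → ℕ) : stableIdx A k + 1 ≤ blockCount A k := by
  rw [blockCount]
  calc stableIdx A k + 1 ≤ (stableIdx A k + 1) ^ 2 := Nat.le_self_pow two_ne_zero _
    _ ≤ _ := Nat.le_mul_of_pos_right _ (by positivity)

theorem jap_freqSum_le_of_mem {A : ℝ} (hA : 1 ≤ A) {k : Fin 3 → ℕ} {m : Fin 3 → Freq}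
    (hm : m ∈ blockSupp A k) (ε : Fin 3 → ℤˣ) :
    jap (freqSum m) ≤ 4 * A * maxScale k ∧ |phase ε m| ≤ 4 * A * maxScale k := by
  have hM := one_le_maxScale k
  have h : ∀ j, jap (m j) ≤ A * maxScale k := fun j => by
    refine (mem_blockSupp.1 hm j).1.trans ?_
    rw [maxScale_eq]
    have := dyad_mono (le_maxIdx k j)
    gcongr
  have h1 : 1 ≤ A * maxScale k := one_le_mul_of_one_le_of_one_le hA hM
  have := h 0; have := h 1; have := h 2
  have := jap_freqSum_le m
  have := abs_phase_le ε m
  constructor <;> linarith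

/-- Makes the supremum over Littlewood-Paley pieces a finite one on a block. -/
theorem lpSymbol_eq_zero_of_mem {ρ : ℝ → ℝ} {A : ℝ} (hA : SupportConst ρ A) {k : Fin 3 → ℕ}
    {m : Fin 3 → Freq} (hm : m ∈ blockSupp A k) {j : ℕ} (hj : stableIdx A k < j) :
    lpSymbol ρ j (freqSum m) = 0 := by
  by_contra h
  have h1 := (hA.lp_support _ _ h).2
  have h2 := (jap_freqSum_le_of_mem hA.one_le hm 1).1
  have hA1 := hA.one_le
  have hM := one_le_maxScale k
  have h3 : dyad (maxIdx k + (⌈4 * A ^ 2⌉₊ + 1)) ≤ dyad j := dyad_mono (by rw [stableIdx] at hj; omega)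
  rw [dyad_add, ← maxScale_eq] at h3
  have h4 := le_dyad (⌈4 * A ^ 2⌉₊ + 1)
  push_cast at h4
  have h5 := Nat.le_ceil (4 * A ^ 2)
  have h6 : dyad j ≤ maxScale k * (4 * A ^ 2) := h1.trans (by nlinarith)
  nlinarith

theorem csPiece_mono_exponent (ρ : ℝ → ℝ) {s s' : ℝ} (h : s ≤ s') (f : Pt → ℂ) (j : ℕ) :
    csPiece ρ s f j ≤ csPiece ρ s' f j :=
  mul_le_mul_left (ENNReal.ofReal_le_ofReal
    (Real.rpow_le_rpow_of_exponent_le (one_le_dyad j) h)) _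

section Random

variable {Ω : Type*} [MeasurableSpace Ω] {P : Measure Ω} {W : Fin 2 → Freq → Ω → ℂ}

/-- The `X^{s,b}`-norm of a block, for the extension by zero. -/
def blockXsb (P : Measure Ω) (W : Fin 2 → Freq → Ω → ℂ) (V : Pt → ℝ) (ρ : ℝ → ℝ) (A s b T : ℝ)
    (ε : Fin 3 → ℤˣ) (k : Fin 3 → ℕ) (ω : Ω) : ℝ≥0∞ :=
  ⨆ K : ℕ, xsbNorm (s - 1) (b - 1)
    (randomFourier P W ε (blockSupp A k) (blockCoef V ρ k (dyad K)) T ω)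

/-- The Hölder norm of the Duhamel integral of a block. -/
def blockCtcs (P : Measure Ω) (W : Fin 2 → Freq → Ω → ℂ) (V : Pt → ℝ) (ρ : ℝ → ℝ) (s τ T : ℝ)
    (ε : Fin 3 → ℤˣ) (k : Fin 3 → ℕ) (ω : Ω) : ℝ≥0∞ :=
  ⨆ K : ℕ, ctcsNorm ρ s T (duhamel (timeCut τ (cubicBlock V ρ P W ε k (dyad K) ω)))

theorem iSup_sq_le {α : Type*} [Nonempty α] {f : α → ℝ≥0∞} {y : ℝ≥0∞} (h : ∀ a, f a ^ 2 ≤ y) :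
    (⨆ a, f a) ^ 2 ≤ y := by
  rw [← ENNReal.rpow_two, ← ENNReal.le_rpow_inv_iff (by norm_num)]
  refine iSup_le fun a => ?_
  rw [ENNReal.le_rpow_inv_iff (by norm_num), ENNReal.rpow_two]
  exact h a

theorem exists_le_stableIdx {V : Pt → ℝ} {ρ : ℝ → ℝ} {A : ℝ} (hA : SupportConst ρ A)
    (k : Fin 3 → ℕ) (K : ℕ) : ∃ K' ∈ Finset.range (stableIdx A k + 1),
      blockCoef V ρ k (dyad K) = blockCoef V ρ k (dyad K') := by
  rcases le_total (stableIdx A k) K with h | h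
  · exact ⟨stableIdx A k, by simp, blockCoef_stable hA h⟩
  · exact ⟨K, by simp; omega, rfl⟩

/-- The supremum over N is a maximum over K ≤ `stableIdx A k`, so a sum of q-th powers is a
measurable majorant. The count is enlarged to `blockCount A k` to agree with the Hölder case. -/
theorem blockXsb_sq_majorant {s₀ δ b : ℝ} (hb : 1 / 2 < b) (hb1 : b < 1) (hδ : δ ≤ 2 - 2 * b) :
    ∃ D : ℝ, 0 < D ∧ ∀ {Ω : Type*} [MeasurableSpace Ω] {P : Measure Ω} [IsProbabilityMeasure P]
      {W : Fin 2 → Freq → Ω → ℂ}, IsGaussianData P W → ∀ {V : Pt → ℝ} {ρ : ℝ → ℝ} {A : ℝ},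
      SupportConst ρ A → ∀ (ε : Fin 3 → ℤˣ) (k : Fin 3 → ℕ) {s T q B : ℝ},
      s ≤ s₀ → 1 ≤ T → 1 ≤ q →
      (∀ (K : ℕ) (σ : ℝ), |σ| = 1 → ∑ m ∈ blockSupp A k,
        coefEnergy (blockCoef V ρ k (dyad K)) (2 * s₀ - 2) δ σ ε m ≤ B) →
      ∃ Y : Ω → ℝ≥0∞, Measurable Y ∧ (∀ ω, blockXsb P W V ρ A s b T ε k ω ^ 2 ≤ Y ω) ∧
        ∫⁻ ω, Y ω ^ q ∂P ≤ blockCount A k * (ENNReal.ofReal (D * q ^ 3 * T ^ 2 * B)) ^ q := by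
  obtain ⟨D, hD, hmom⟩ := block_xsb_moment (s₀ := s₀) hb hb1 hδ
  refine ⟨D, hD, ?_⟩
  intro Ω _ P _ W hW V ρ A hA ε k s T q B hs hT hq hB
  obtain ⟨Y, hY, hle, hint⟩ := exists_majorant P (Finset.range (stableIdx A k + 1))
    (f := fun K ω => xsbNorm (s - 1) (b - 1) (randomFourier P W ε (blockSupp A k)
      (blockCoef V ρ k (dyad K)) T ω) ^ 2)
    (fun K => measurable_xsbNorm_randomFourier hW ε _ _ T _ _) (by linarith)
    (fun K _ => hmom hW ε _ _ hs hT hq (hB K))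
  refine ⟨Y, hY, fun ω => iSup_sq_le fun K => ?_, hint.trans (mul_le_mul_left ?_ _)⟩
  · obtain ⟨K', hK', e⟩ := exists_le_stableIdx (V := V) hA k K
    rw [e]; exact hle K' hK' ω
  · rw [Finset.card_range]; exact_mod_cast le_blockCount A k

/-- The supremum over truncation, Littlewood-Paley piece, time and point is dominated by twice the
maximum of `gridFunctional` over finitely many indices. -/
theorem IsGaussianData.blockCtcs_sq_majorant [IsProbabilityMeasure P] (hW : IsGaussianData P W)
    {V : Pt → ℝ} {ρ : ℝ → ℝ} (hρ : IsCutoffProfile ρ) {A : ℝ} (hA : SupportConst ρ A)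
    (ε : Fin 3 → ℤˣ) (k : Fin 3 → ℕ) {s s₀ δ τ T B q : ℝ} (hs₀ : 0 ≤ s₀) (hs : s ≤ s₀)
    (hδ1 : δ ≤ 1) (hτ : 0 ≤ τ) (hT : 1 ≤ T) (hq : 1 ≤ q)
    (hB : ∀ (K : ℕ) (σ : ℝ), |σ| = 1 → ∑ m ∈ blockSupp A k,
      coefEnergy (blockCoef V ρ k (dyad K)) (2 * s₀ - 2) δ σ ε m ≤ B) :
    ∃ Y : Ω → ℝ≥0∞, Measurable Y ∧ (∀ ω, blockCtcs P W V ρ s τ T ε k ω ^ 2 ≤ Y ω) ∧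
      ∫⁻ ω, Y ω ^ q ∂P ≤ blockCount A k *
        (ENNReal.ofReal (2 * (2048 * 3000 * A ^ (2 * s₀)) * q ^ 3 * T ^ 4 * B)) ^ q := by
  have hA1 := hA.one_le
  have hM := one_le_maxScale k
  have hJ1 : 1 ≤ 4 * A * maxScale k :=
    one_le_mul_of_one_le_of_one_le (by linarith) hM
  have hG := gridSize_pos hA1 k
  obtain ⟨Y, hY, hle, hint⟩ := exists_majorant P
    ((Finset.range (stableIdx A k + 1) ×ˢ Finset.range (stableIdx A k + 1)) ×ˢ
      (Finset.univ : Finset (Grid (gridSize A k))))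
    (f := fun i => gridFunctional P W ρ ε (blockSupp A k) (blockCoef V ρ k (dyad i.1.1)) s₀ τ T
      (4 * A * maxScale k) i.1.2 i.2)
    (fun i => measurable_gridFunctional hW ..) (by linarith : 0 < q)
    (fun i _ => hW.gridFunctional_moment hρ hA ε (blockSupp A k) _ hs₀ hδ1 hτ hT hJ1
      (fun m hm => jap_freqSum_le_of_mem hA1 hm ε) hG (card_mul_le_gridSize hA1 k) hq
      (hB i.1.1) i.1.2 i.2)
  refine ⟨fun ω => 2 * Y ω, hY.const_mul 2, fun ω => ?_, ?_⟩
  · refine iSup_sq_le fun K => ?_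
    obtain ⟨K', hK', e⟩ := exists_le_stableIdx (V := V) hA k K
    have hcsx : ∀ t ∈ Set.Icc 0 T, ∀ (j : ℕ) (x : Pt), (ENNReal.ofReal (dyad j ^ s₀) *
        ‖∑ m ∈ blockSupp A k, (lpSymbol ρ j (freqSum m) : ℂ) *
          ((blockCoef V ρ k (dyad K) m * tripleIntegral P W ε m ω) *
          duhCoef τ (jap (freqSum m)) (phase ε m) t) * character (freqSum m) x‖ₑ) ^ 2 ≤
        2 * Y ω := by
      intro t ht j x
      -- Pieces beyond the block vanish; the others belong to the finite index set.
      by_cases hj : stableIdx A k < j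
      · rw [Finset.sum_eq_zero fun m hm => by rw [lpSymbol_eq_zero_of_mem hA hm hj]; simp]
        simp
      obtain ⟨g, hg⟩ := norm_sum_duhCoef_le_grid (blockSupp A k)
        (fun m => (lpSymbol ρ j (freqSum m) : ℂ) * blockCoef V ρ k (dyad K') m *
          tripleIntegral P W ε m ω) (phase ε) freqSum hJ1
        (fun m hm => (jap_freqSum_le_of_mem hA1 hm ε).1) hτ hT ht x hG
      refine le_trans ?_ (mul_le_mul_right (hle ((K', j), g)
        (by simp only [Finset.mem_product, hK', Finset.mem_univ, Finset.mem_range, true_and,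
              and_true]; omega) ω) 2)
      have hd0 := Real.rpow_nonneg (dyad_pos j).le (2 * s₀)
      have hd2 : ENNReal.ofReal (dyad j ^ s₀) ^ 2 = ENNReal.ofReal (dyad j ^ (2 * s₀)) := by
        rw [← ENNReal.ofReal_pow (Real.rpow_nonneg (dyad_pos j).le _), ← Real.rpow_natCast,
          ← Real.rpow_mul (dyad_pos j).le]
        congr 2; push_cast; ring
      rw [mul_pow, hd2, enorm_real_sq, gridFunctional, ← Finset.mul_sum, e]
      have e1 : ∀ (t : ℝ) (x : Pt) (m : Fin 3 → Freq), (lpSymbol ρ j (freqSum m) : ℂ) *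
          ((blockCoef V ρ k (dyad K') m * tripleIntegral P W ε m ω) *
          duhCoef τ (jap (freqSum m)) (phase ε m) t) * character (freqSum m) x =
          (lpSymbol ρ j (freqSum m) : ℂ) * blockCoef V ρ k (dyad K') m *
          tripleIntegral P W ε m ω * duhCoef τ (jap (freqSum m)) (phase ε m) t *
          character (freqSum m) x := fun t x m => by ring
      have e2 : ∀ m : Fin 3 → Freq, ((lpSymbol ρ j (freqSum m) : ℂ) *
          blockCoef V ρ k (dyad K') m * duhCoef τ (jap (freqSum m)) (phase ε m) (gridTime T g) *
          character (freqSum m) (gridPoint g)) * tripleIntegral P W ε m ω =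
          (lpSymbol ρ j (freqSum m) : ℂ) * blockCoef V ρ k (dyad K') m *
          tripleIntegral P W ε m ω * duhCoef τ (jap (freqSum m)) (phase ε m) (gridTime T g) *
          character (freqSum m) (gridPoint g) := fun m => by ring
      simp_rw [e1, e2, enorm_real_sq]
      rw [← ENNReal.ofReal_sum_of_nonneg fun _ _ => sq_nonneg _, ← ENNReal.ofReal_mul hd0,
        ← ENNReal.ofReal_mul hd0, ← ENNReal.ofReal_mul (by positivity),
        ← ENNReal.ofReal_add (by positivity) (by positivity),
        show (2 : ℝ≥0∞) = ENNReal.ofReal 2 by simp, ← ENNReal.ofReal_mul (by norm_num)]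
      apply ENNReal.ofReal_le_ofReal
      refine (mul_le_mul_of_nonneg_left hg hd0).trans (le_of_eq ?_)
      ring
    rw [cubicBlock_eq_oscSum hA ε k (dyad K) ω]
    rw [← ENNReal.rpow_two, ← ENNReal.le_rpow_inv_iff (by norm_num)]
    refine iSup₂_le fun t ht => iSup_le fun j => (csPiece_mono_exponent ρ hs _ j).trans ?_
    have e3 := funext (duhamel_timeCut_oscSum (blockSupp A k)
      (fun m => blockCoef V ρ k (dyad K) m * tripleIntegral P W ε m ω) (phase ε) freqSum hτ ht.1)
    rw [e3, csPiece_sum, ENNReal.mul_iSup]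
    refine iSup_le fun x => ?_
    rw [ENNReal.le_rpow_inv_iff (by norm_num), ENNReal.rpow_two]
    exact hcsx t ht j x
  · have hq0 : 0 ≤ q := by linarith
    have e : ENNReal.ofReal (2 * (2048 * 3000 * A ^ (2 * s₀)) * q ^ 3 * T ^ 4 * B) =
        2 * ENNReal.ofReal (2048 * 3000 * A ^ (2 * s₀) * q ^ 3 * T ^ 4 * B) := by
      rw [show (2 : ℝ≥0∞) = ENNReal.ofReal 2 by simp, ← ENNReal.ofReal_mul (by norm_num)]
      congr 1; ring
    simp_rw [e, ENNReal.mul_rpow_of_nonneg _ _ hq0]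
    rw [lintegral_const_mul' _ _ (by finiteness), mul_left_comm]
    refine mul_le_mul_right (hint.trans (le_of_eq ?_)) _
    congr 2
    simp only [Finset.card_product, Finset.card_range, Finset.card_univ, Fintype.card_prod,
      Fintype.card_pi, Fintype.card_fin, Finset.prod_const, blockCount]
    ring

end Random

/-! ### Moment bounds for the blocks -/

/-- A factor M^{30} outside a q-th power is M^{30/q} inside, hence at most M^{θ/4} for q ≥ 120/θ. -/
theorem natCast_mul_ofReal_rpow_le {N : ℕ} {D M θ q x : ℝ} (hD : 1 ≤ D) (hM : 1 ≤ M)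
    (hN : (N : ℝ) ≤ D * M ^ 30) (hq : 1 ≤ q) (hθq : 30 ≤ θ / 4 * q) :
    (N : ℝ≥0∞) * ENNReal.ofReal x ^ q ≤ ENNReal.ofReal (D * M ^ (θ / 4) * x) ^ q := by
  have hq0 : 0 ≤ q := by linarith
  have hDM : 0 ≤ D * M ^ (θ / 4) := by positivity
  rw [ENNReal.ofReal_mul hDM, ENNReal.mul_rpow_of_nonneg _ _ hq0]
  refine mul_le_mul_left ?_ _
  rw [ENNReal.ofReal_rpow_of_nonneg hDM hq0, ← ENNReal.ofReal_natCast]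
  apply ENNReal.ofReal_le_ofReal
  rw [Real.mul_rpow (by linarith) (by positivity), ← Real.rpow_mul (by linarith)]
  refine hN.trans (mul_le_mul ?_ ?_ (by positivity) (by positivity))
  · simpa using Real.rpow_le_rpow_of_exponent_le hD hq
  · rw [← Real.rpow_natCast]
    exact Real.rpow_le_rpow_of_exponent_le hM (by exact_mod_cast hθq)

/-- Budget for the squared norms: the energy gives M^{-θ/2}, the union over `blockCount` variables
loses M^{θ/4}, and the square root of the remaining M^{-θ/4} is M^{-θ/8}. -/
theorem exists_block_majorants {κ η θ : ℝ} (hκ2 : κ < 1 / 2) (hηκ : η < κ) (hθ : 0 < θ)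
    (hθη : 2 * θ < η) {V : Pt → ℝ} {ρ : ℝ → ℝ} (hρ : IsCutoffProfile ρ) {A : ℝ}
    (hA : SupportConst ρ A)
    (hV : ∃ C, 0 < C ∧ ∀ n, ‖potentialHat V n‖ ≤ C * jap n ^ (-κ)) {b : ℝ} (hb : 1 / 2 < b)
    (hbθ : b < 1 / 2 + θ / 8) :
    ∃ C : ℝ, 0 < C ∧ ∀ {Ω : Type*} [MeasurableSpace Ω] {P : Measure Ω} [IsProbabilityMeasure P]
      {W : Fin 2 → Freq → Ω → ℂ}, IsGaussianData P W → ∀ {s T q : ℝ}, s ≤ κ - η → 1 ≤ T →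
      1 ≤ q → 120 / θ ≤ q → ∀ (ε : Fin 3 → ℤˣ) (k : Fin 3 → ℕ),
      HasMajorant P (2 * q) (blockXsb P W V ρ A s b T ε k)
        (ENNReal.ofReal (C * T ^ 2 * q ^ (3 / 2 : ℝ) * maxScale k ^ (-(θ / 8)))) ∧
      ∀ τ, 0 ≤ τ → HasMajorant P (2 * q) (blockCtcs P W V ρ s τ T ε k)
        (ENNReal.ofReal (C * T ^ 2 * q ^ (3 / 2 : ℝ) * maxScale k ^ (-(θ / 8)))) := by
  obtain ⟨C₁, hC₁, hsum⟩ := block_coef_sum hκ2 hηκ hθ hθη hρ hA hV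
  -- The restriction b < 1/2 + θ/8 is exactly what makes δ = 1 - θ/4 smaller than 2 - 2b.
  obtain ⟨D₁, hD₁, hxsb⟩ := blockXsb_sq_majorant (s₀ := κ - η) (δ := 1 - θ / 4) hb (by linarith)
    (by linarith)
  obtain ⟨D, hD, hcount⟩ := exists_blockCount_le hA.one_le
  have hA0 : 0 < A := by linarith [hA.one_le]
  obtain ⟨D₂, hD₂, hD₂e⟩ : ∃ D₂ : ℝ, 0 < D₂ ∧ 2 * (2048 * 3000 * A ^ (2 * (κ - η))) = D₂ :=
    ⟨_, by positivity, rfl⟩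
  have hE : 0 < D * (D₁ + D₂) * C₁ := by positivity
  -- The bound to be reached is squared; adding 1 makes the square of the constant dominate the
  -- constant itself.
  refine ⟨1 + D * (D₁ + D₂) * C₁, by positivity, ?_⟩
  intro Ω _ P _ W hW s T q hs hT hq hθq ε k
  have hM := one_le_maxScale k
  have hM0 : 0 < maxScale k := by linarith
  have hq0 : 0 < q := by linarith
  have hB : ∀ (K : ℕ) (σ : ℝ), |σ| = 1 → ∑ m ∈ blockSupp A k,
      coefEnergy (blockCoef V ρ k (dyad K)) (2 * (κ - η) - 2) (1 - θ / 4) σ ε m ≤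
        C₁ * maxScale k ^ (-(θ / 2)) := fun K σ hσ => hsum k (dyad K) σ ε hσ
  have hθq' : 30 ≤ θ / 4 * q := by
    rw [div_le_iff₀ hθ] at hθq; linarith
  have habs : ∀ D' : ℝ, 0 ≤ D' → D' ≤ D₁ + D₂ →
      (blockCount A k : ℝ≥0∞) * ENNReal.ofReal (D' * q ^ 3 * T ^ 4 *
        (C₁ * maxScale k ^ (-(θ / 2)))) ^ q ≤
      (ENNReal.ofReal ((1 + D * (D₁ + D₂) * C₁) * T ^ 2 * q ^ (3 / 2 : ℝ) *
        maxScale k ^ (-(θ / 8))) ^ 2) ^ q := by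
    intro D' h0 h1
    refine (natCast_mul_ofReal_rpow_le hD hM (hcount k) hq hθq').trans ?_
    refine ENNReal.rpow_le_rpow ?_ hq0.le
    rw [← ENNReal.ofReal_pow (by positivity)]
    apply ENNReal.ofReal_le_ofReal
    have e1 : maxScale k ^ (θ / 4) * maxScale k ^ (-(θ / 2)) = maxScale k ^ (-(θ / 4)) := by
      rw [← Real.rpow_add hM0]; congr 1; ring
    have e2 : (maxScale k ^ (-(θ / 8))) ^ 2 = maxScale k ^ (-(θ / 4)) := by
      rw [← Real.rpow_natCast, ← Real.rpow_mul hM0.le]; congr 1; push_cast; ring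
    have e3 : (q ^ (3 / 2 : ℝ)) ^ 2 = q ^ 3 := by
      rw [← Real.rpow_natCast, ← Real.rpow_mul hq0.le]; norm_num
    have h2 : D * D' * C₁ ≤ (1 + D * (D₁ + D₂) * C₁) ^ 2 := by
      have : D * D' * C₁ ≤ D * (D₁ + D₂) * C₁ := by gcongr
      nlinarith [sq_nonneg (D * (D₁ + D₂) * C₁)]
    calc _ = D * D' * C₁ * (q ^ 3 * T ^ 4 *
          (maxScale k ^ (θ / 4) * maxScale k ^ (-(θ / 2)))) := by ring
      _ ≤ (1 + D * (D₁ + D₂) * C₁) ^ 2 * (q ^ 3 * T ^ 4 * maxScale k ^ (-(θ / 4))) := by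
          rw [e1]; gcongr
      _ = _ := by rw [mul_pow, mul_pow, mul_pow, e2, e3]; ring
  refine ⟨?_, fun τ hτ => ?_⟩
  · obtain ⟨Y, hY, hle, hint⟩ := hxsb hW hA ε k hs hT hq hB
    refine HasMajorant.sqrt ⟨Y, hY, hle, hint.trans (le_trans ?_ (habs D₁ hD₁.le (by linarith)))⟩
    have hT2 : T ^ 2 ≤ T ^ 4 := pow_le_pow_right₀ hT (by norm_num)
    gcongr
  · obtain ⟨Y, hY, hle, hint⟩ := hW.blockCtcs_sq_majorant hρ hA ε k (by linarith) hs
      (by linarith) hτ hT hq hB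
    refine HasMajorant.sqrt ⟨Y, hY, hle, hint.trans ?_⟩
    rw [hD₂e]
    exact habs D₂ hD₂.le (by linarith)

/-! ### Summation over the blocks -/

theorem maxScale_rpow_neg_le {a : ℝ} (ha : 0 ≤ a) (k : Fin 3 → ℕ) :
    maxScale k ^ (-a) ≤ ∏ j, dyad (k j) ^ (-(a / 3)) := by
  have hM := one_le_maxScale k
  have e : maxScale k ^ (-a) = ∏ _j : Fin 3, maxScale k ^ (-(a / 3)) := by
    rw [Finset.prod_const, Finset.card_univ, Fintype.card_fin, ← Real.rpow_natCast,
      ← Real.rpow_mul (by linarith)]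
    congr 1; push_cast; ring
  rw [e]
  refine Finset.prod_le_prod (fun j _ => by positivity) fun j _ => ?_
  refine Real.rpow_le_rpow_of_nonpos (dyad_pos _) ?_ (by linarith)
  rw [maxScale_eq]
  exact dyad_mono (le_maxIdx k j)

theorem tsum_dyad_rpow_lt_top {a : ℝ} (ha : 0 < a) :
    ∑' k : ℕ, ENNReal.ofReal (dyad k ^ (-a)) < ⊤ := by
  have h1 : ∀ k, dyad k ^ (-a) = ((2 : ℝ) ^ (-a)) ^ k := fun k => by
    rw [dyad, ← Real.rpow_natCast, ← Real.rpow_natCast, ← Real.rpow_mul (by norm_num),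
      ← Real.rpow_mul (by norm_num), mul_comm]
  have h2 : Summable fun k : ℕ => ((2 : ℝ) ^ (-a)) ^ k :=
    summable_geometric_of_lt_one (by positivity)
      (Real.rpow_lt_one_of_one_lt_of_neg one_lt_two (by linarith))
  simp_rw [h1]
  rw [← ENNReal.ofReal_tsum_of_nonneg (fun k => by positivity) h2]
  exact ENNReal.ofReal_lt_top

/-- The maximum dominates each scale, so M^{-a} is at most a product of three geometric factors with
exponent a/3, and the sign choices contribute a finite number of copies. -/
theorem exists_tsum_maxScale_le {a : ℝ} (ha : 0 < a) : ∃ C : ℝ, 0 < C ∧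
    ∑' b : (Fin 3 → ℤˣ) × (Fin 3 → ℕ), ENNReal.ofReal (maxScale b.2 ^ (-a)) ≤
      ENNReal.ofReal C := by
  set S := ∑' k : ℕ, ENNReal.ofReal (dyad k ^ (-(a / 3))) with hS
  have hSt : S < ⊤ := tsum_dyad_rpow_lt_top (by positivity)
  have h1 : ∑' k : Fin 3 → ℕ, ENNReal.ofReal (maxScale k ^ (-a)) ≤ S * (S * S) := by
    refine (ENNReal.tsum_le_tsum fun k =>
      ENNReal.ofReal_le_ofReal (maxScale_rpow_neg_le ha.le k)).trans (le_of_eq ?_)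
    rw [tsum_fin_three]
    have h2 : ∀ x : ℕ, 0 ≤ dyad x ^ (-(a / 3)) := fun x => Real.rpow_nonneg (dyad_pos x).le _
    have e : ∀ x y z : ℕ, ENNReal.ofReal (∏ j, dyad (![x, y, z] j) ^ (-(a / 3))) =
        ENNReal.ofReal (dyad x ^ (-(a / 3))) * (ENNReal.ofReal (dyad y ^ (-(a / 3))) *
          ENNReal.ofReal (dyad z ^ (-(a / 3)))) := fun x y z => by
      rw [← ENNReal.ofReal_mul (h2 y), ← ENNReal.ofReal_mul (h2 x)]
      congr 1
      rw [Fin.prod_univ_three]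
      simp [mul_assoc]
    simp_rw [e, ENNReal.tsum_mul_left, ENNReal.tsum_mul_right]
    rfl
  have h3 : ∑' b : (Fin 3 → ℤˣ) × (Fin 3 → ℕ), ENNReal.ofReal (maxScale b.2 ^ (-a)) < ⊤ := by
    rw [ENNReal.tsum_prod']
    simp only [tsum_fintype, Finset.sum_const]
    refine lt_of_le_of_lt (nsmul_le_nsmul_right h1 _) ?_
    rw [nsmul_eq_mul]
    finiteness
  refine ⟨(∑' b : (Fin 3 → ℤˣ) × (Fin 3 → ℕ), ENNReal.ofReal (maxScale b.2 ^ (-a))).toReal + 1,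
    by positivity, ?_⟩
  rw [ENNReal.le_ofReal_iff_toReal_le h3.ne (by positivity)]
  linarith

theorem xsbNorm_mono (r b : ℝ) {w w' : Freq → ℝ → ℂ} (h : ∀ n lam, ‖w n lam‖ₑ ≤ ‖w' n lam‖ₑ) :
    xsbNorm r b w ≤ xsbNorm r b w' := by
  refine ENNReal.rpow_le_rpow (ENNReal.tsum_le_tsum fun n => lintegral_mono fun lam => ?_)
    (by norm_num)
  have := h n lam
  gcongr

section Random

variable {Ω : Type*} [MeasurableSpace Ω] {P : Measure Ω} {W : Fin 2 → Freq → Ω → ℂ}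
  {V : Pt → ℝ} {ρ : ℝ → ℝ}

theorem enorm_eighth_mul_le (z : ℂ) : ‖(1 / 8 : ℂ) * z‖ₑ ≤ ‖z‖ₑ := by
  rw [enorm_mul]
  refine mul_le_of_le_one_left' ?_
  rw [← ofReal_norm]
  refine ENNReal.ofReal_le_one.2 ?_
  norm_num

theorem xsbRestrict_cubicBlock_le {A : ℝ} (hA : SupportConst ρ A) (s b : ℝ) {T : ℝ} (hT : 0 ≤ T)
    (ε : Fin 3 → ℤˣ) (k : Fin 3 → ℕ) (ω : Ω) :
    ⨆ K : ℕ, xsbRestrict (Set.Icc 0 T) (s - 1) (b - 1) (cubicBlock V ρ P W ε k (dyad K) ω) ≤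
      blockXsb P W V ρ A s b T ε k ω :=
  iSup_mono fun K => by
    rw [cubicBlock_eq_oscSum hA]
    exact xsbRestrict_oscSum_le _ _ _ _ hT _ _

/-- Each block term already contains its own supremum over truncations, so the sum over all blocks
bounds every 𝒵_N at once, although the set of contributing blocks grows with N. -/
theorem IsGaussianData.xsbRestrict_cubic_le [IsProbabilityMeasure P] (hW : IsGaussianData P W)
    (hV : TorusPeriodic V) (hi : IntegrableOn (fun x => (V x : ℂ)) cube) {A : ℝ}
    (hA : SupportConst ρ A) (s b : ℝ) {T : ℝ} (hT : 0 ≤ T) (ω : Ω) :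
    ⨆ K : ℕ, xsbRestrict (Set.Icc 0 T) (s - 1) (b - 1) (cubic V ρ W (dyad K) ω) ≤
      ∑' i : (Fin 3 → ℤˣ) × (Fin 3 → ℕ), blockXsb P W V ρ A s b T i.1 i.2 ω := by
  refine iSup_le fun K => ?_
  rw [hW.cubic_eq_sum_block hV hi hA]
  refine (xsbRestrict_oscSum_le _ _ _ _ hT _ _).trans ?_
  have e : oscFourier ((blockIndex A K).sigma fun i => blockSupp A i.2)
      (fun p => (1 / 8) * (blockCoef V ρ p.1.2 (dyad K) p.2 * tripleIntegral P W p.1.1 p.2 ω))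
      (fun p => phase p.1.1 p.2) (fun p => freqSum p.2) T =
      fun n lam => ∑ i ∈ blockIndex A K, (1 / 8) * randomFourier P W i.1 (blockSupp A i.2)
        (blockCoef V ρ i.2 (dyad K)) T ω n lam := by
    funext n lam
    rw [oscFourier, Finset.sum_sigma]
    refine Finset.sum_congr rfl fun i _ => ?_
    rw [randomFourier, oscFourier, Finset.mul_sum]
    exact Finset.sum_congr rfl fun m _ => by split_ifs <;> ring
  rw [e]
  refine (xsbNorm_sum_le (blockIndex A K) _ _ fun i n =>
    ((continuous_oscFourier _ _ _ _ T n).measurable.const_mul _)).trans ?_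
  refine le_trans (Finset.sum_le_sum fun i _ => ?_) (ENNReal.sum_le_tsum (blockIndex A K))
  exact (xsbNorm_mono _ _ fun n lam => enorm_eighth_mul_le _).trans
    (le_iSup (fun K : ℕ => xsbNorm (s - 1) (b - 1)
      (randomFourier P W i.1 (blockSupp A i.2) (blockCoef V ρ i.2 (dyad K)) T ω)) K)

theorem IsGaussianData.ctcsNorm_cubic_le [IsProbabilityMeasure P] (hW : IsGaussianData P W)
    (hV : TorusPeriodic V) (hi : IntegrableOn (fun x => (V x : ℂ)) cube) {A : ℝ}
    (hA : SupportConst ρ A) (s T : ℝ) {τ : ℝ} (hτ : 0 ≤ τ) (ω : Ω) :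
    ⨆ K : ℕ, ctcsNorm ρ s T (duhamel (timeCut τ (cubic V ρ W (dyad K) ω))) ≤
      ∑' i : (Fin 3 → ℤˣ) × (Fin 3 → ℕ), blockCtcs P W V ρ s τ T i.1 i.2 ω := by
  refine iSup_le fun K => iSup₂_le fun t ht => iSup_le fun j => ?_
  rw [hW.cubic_eq_sum_block hV hi hA, funext (duhamel_timeCut_oscSum _ _ _ _ hτ ht.1),
    csPiece_sum, ENNReal.mul_iSup]
  refine iSup_le fun x => ?_
  rw [Finset.sum_sigma]
  refine le_trans ?_ (ENNReal.sum_le_tsum (blockIndex A K))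
  refine (mul_le_mul_right (enorm_sum_le _ _) _).trans ?_
  rw [Finset.mul_sum]
  refine Finset.sum_le_sum fun i _ => ?_
  have h1 : csPiece ρ s (duhamel (timeCut τ (cubicBlock V ρ P W i.1 i.2 (dyad K) ω)) t) j ≤
      blockCtcs P W V ρ s τ T i.1 i.2 ω :=
    le_trans (le_trans (le_iSup _ j) (le_iSup₂ (f := fun t _ => csNorm ρ s
      (duhamel (timeCut τ (cubicBlock V ρ P W i.1 i.2 (dyad K) ω)) t)) t ht))
      (le_iSup (fun K : ℕ => ctcsNorm ρ s T
        (duhamel (timeCut τ (cubicBlock V ρ P W i.1 i.2 (dyad K) ω)))) K)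
  refine le_trans ?_ h1
  rw [cubicBlock_eq_oscSum hA, funext (duhamel_timeCut_oscSum _ _ _ _ hτ ht.1), csPiece_sum]
  refine mul_le_mul_right (le_trans ?_ (le_iSup _ x)) _
  refine le_trans (le_of_eq ?_) (enorm_eighth_mul_le _)
  rw [Finset.mul_sum]
  congr 1
  exact Finset.sum_congr rfl fun m _ => by ring

end Random

end CubicStochastic

end

/-! ### Choice of parameters and conclusion -/

theorem proposition5p1 (β : ℝ) (hβ : 0 < β) (hβ' : β < 1 / 2) (η : ℝ) (hη : 0 < η) :
    ∃ η'₀ : ℝ, 0 < η'₀ ∧ ∀ η' : ℝ, 0 < η' → η' < η'₀ →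
    ∃ b₀ : ℝ, 1 / 2 < b₀ ∧ ∀ bp : ℝ, 1 / 2 < bp → bp < b₀ →
    ∀ (V : Pt → ℝ) (ρ : ℝ → ℝ), IsInteractionPotential β V → IsCutoffProfile ρ →
    ∃ C : ℝ, 0 < C ∧
    ∀ (Ω : Type*) [MeasurableSpace Ω] (P : Measure Ω) [IsProbabilityMeasure P]
      (W : Fin 2 → Freq → Ω → ℂ), IsGaussianData P W →
    ∀ s T p : ℝ, s < β - η → 1 ≤ T → 1 ≤ p →
      -- the cubic nonlinearity and its Duhamel integral
      lpOmega P p (fun ω => ⨆ K : ℕ,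
          xsbRestrict (Set.Icc 0 T) (s - 1) (bp - 1) (cubic V ρ W (dyad K) ω))
        ≤ ENNReal.ofReal (C * T ^ 2 * p ^ (3 / 2 : ℝ)) ∧
      (∀ (K : ℕ) (ω : Ω), MemCtCs ρ s T (duhamel (cubic V ρ W (dyad K) ω))) ∧
      lpOmega P p (fun ω => ⨆ K : ℕ,
          ctcsNorm ρ s T (duhamel (cubic V ρ W (dyad K) ω)))
        ≤ ENNReal.ofReal (C * T ^ 2 * p ^ (3 / 2 : ℝ)) ∧
      -- the Duhamel integral of the nonlinearity restricted to `[0,τ]`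
      (∀ τ : ℝ, 0 ≤ τ →
        (∀ (K : ℕ) (ω : Ω), MemCtCs ρ s T (duhamel (timeCut τ (cubic V ρ W (dyad K) ω)))) ∧
        lpOmega P p (fun ω => ⨆ K : ℕ,
            ctcsNorm ρ s T (duhamel (timeCut τ (cubic V ρ W (dyad K) ω))))
          ≤ ENNReal.ofReal (C * T ^ 2 * p ^ (3 / 2 : ℝ))) ∧
      -- the frequency-localized versions
      (∀ (ε : Fin 3 → ℤˣ) (k : Fin 3 → ℕ),
        lpOmega P p (fun ω => ⨆ K : ℕ,
            xsbRestrict (Set.Icc 0 T) (s - 1) (bp - 1) (cubicBlock V ρ P W ε k (dyad K) ω))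
          ≤ ENNReal.ofReal (C * T ^ 2 * p ^ (3 / 2 : ℝ) * maxScale k ^ (-η')) ∧
        (∀ (K : ℕ) (ω : Ω), MemCtCs ρ s T (duhamel (cubicBlock V ρ P W ε k (dyad K) ω))) ∧
        lpOmega P p (fun ω => ⨆ K : ℕ,
            ctcsNorm ρ s T (duhamel (cubicBlock V ρ P W ε k (dyad K) ω)))
          ≤ ENNReal.ofReal (C * T ^ 2 * p ^ (3 / 2 : ℝ) * maxScale k ^ (-η')) ∧
        (∀ τ : ℝ, 0 ≤ τ →
          (∀ (K : ℕ) (ω : Ω),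
            MemCtCs ρ s T (duhamel (timeCut τ (cubicBlock V ρ P W ε k (dyad K) ω)))) ∧
          lpOmega P p (fun ω => ⨆ K : ℕ,
              ctcsNorm ρ s T (duhamel (timeCut τ (cubicBlock V ρ P W ε k (dyad K) ω))))
            ≤ ENNReal.ofReal (C * T ^ 2 * p ^ (3 / 2 : ℝ) * maxScale k ^ (-η')))) := by
  -- Replacing η by e = min(η, β/2) keeps s < β - η ≤ β - e while ensuring β - e > 0, since the
  -- Hölder estimate is run at a nonnegative reference regularity.
  have he0 : 0 < min η (β / 2) := lt_min hη (by linarith)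
  have he1 : min η (β / 2) ≤ η := min_le_left _ _
  have he2 : min η (β / 2) ≤ β / 2 := min_le_right _ _
  generalize min η (β / 2) = e at he0 he1 he2
  have hθ : 0 < e / 8 := by positivity
  -- With θ = e/8, the decay rate θ/8 of a block is the threshold for η', and 1/2 + θ/8 is the
  -- threshold for b.
  refine ⟨e / 8 / 8, by positivity, fun η' _ hη'2 => ⟨1 / 2 + e / 8 / 8, by linarith, ?_⟩⟩
  intro bp hbp hbp' V ρ hV hρ
  obtain ⟨A, hA⟩ := hρ.exists_supportConst
  have hi : IntegrableOn (fun x => (V x : ℂ)) cube := (hV.integrableOn hβ (by linarith)).ofReal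
  -- Half of e is spent on the Fourier decay of V, which holds only below β; the other half is the
  -- room in the cubic sum. The reference regularity κ - η is then β - e.
  obtain ⟨C, hC, hblock⟩ := exists_block_majorants (κ := β - e / 2) (η := e / 2) (θ := e / 8)
    (by linarith) (by linarith) hθ (by linarith) hρ hA
    (hV.norm_potentialHat_le (by linarith) (by linarith) (by linarith)) hbp hbp'
  obtain ⟨D, hD, htsum⟩ := exists_tsum_maxScale_le (a := e / 8 / 8) (by positivity)
  obtain ⟨q₀, hq₀, hq₀1, hq₀θ⟩ : ∃ q₀ : ℝ, 0 < q₀ ∧ 1 ≤ q₀ ∧ 120 / (e / 8) ≤ q₀ :=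
    ⟨max 1 (120 / (e / 8)), by positivity, le_max_left _ _, le_max_right _ _⟩
  refine ⟨C * q₀ ^ (3 / 2 : ℝ) * (1 + D), by positivity, ?_⟩
  intro Ω _ P _ W hW s T p hs hT hp
  have hT0 : 0 ≤ T := by linarith
  have hp0 : 0 < p := by linarith
  have hmul : q₀ ≤ q₀ * p := le_mul_of_one_le_right hq₀.le hp
  -- The block bounds need q ≥ 120/θ; taking q = q₀p preserves the growth p^{3/2} and puts q₀^{3/2}
  -- into the constant.
  have hblk := hblock hW (s := s) (T := T) (q := q₀ * p) (by linarith) hT (by linarith)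
    (by linarith)
  have hr : p ≤ 2 * (q₀ * p) := by nlinarith
  have hr1 : 1 ≤ 2 * (q₀ * p) := by linarith
  have hr0 : 0 ≤ 2 * (q₀ * p) := by linarith
  have hqp : (q₀ * p) ^ (3 / 2 : ℝ) = q₀ ^ (3 / 2 : ℝ) * p ^ (3 / 2 : ℝ) :=
    Real.mul_rpow hq₀.le hp0.le
  have hbound : ∀ k : Fin 3 → ℕ,
      ENNReal.ofReal (C * T ^ 2 * (q₀ * p) ^ (3 / 2 : ℝ) * maxScale k ^ (-(e / 8 / 8))) ≤
      ENNReal.ofReal (C * q₀ ^ (3 / 2 : ℝ) * (1 + D) * T ^ 2 * p ^ (3 / 2 : ℝ) *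
        maxScale k ^ (-η')) := by
    intro k
    apply ENNReal.ofReal_le_ofReal
    have hM := one_le_maxScale k
    have h1 : maxScale k ^ (-(e / 8 / 8)) ≤ maxScale k ^ (-η') :=
      Real.rpow_le_rpow_of_exponent_le hM (by linarith)
    have h2 : C * q₀ ^ (3 / 2 : ℝ) ≤ C * q₀ ^ (3 / 2 : ℝ) * (1 + D) :=
      le_mul_of_one_le_right (by positivity) (by linarith)
    have h3 : 0 ≤ maxScale k ^ (-(e / 8 / 8)) := by positivity
    calc _ = C * q₀ ^ (3 / 2 : ℝ) * T ^ 2 * p ^ (3 / 2 : ℝ) * maxScale k ^ (-(e / 8 / 8)) := by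
          rw [hqp]; ring
      _ ≤ _ := by gcongr
  have htotal : ∑' i : (Fin 3 → ℤˣ) × (Fin 3 → ℕ), ENNReal.ofReal
      (C * T ^ 2 * (q₀ * p) ^ (3 / 2 : ℝ) * maxScale i.2 ^ (-(e / 8 / 8))) ≤
      ENNReal.ofReal (C * q₀ ^ (3 / 2 : ℝ) * (1 + D) * T ^ 2 * p ^ (3 / 2 : ℝ)) := by
    have h0 : 0 ≤ C * T ^ 2 * (q₀ * p) ^ (3 / 2 : ℝ) := by positivity
    simp_rw [ENNReal.ofReal_mul h0]
    rw [ENNReal.tsum_mul_left]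
    refine (mul_le_mul_right htsum _).trans ?_
    rw [← ENNReal.ofReal_mul h0, hqp]
    apply ENNReal.ofReal_le_ofReal
    have : 0 ≤ C * q₀ ^ (3 / 2 : ℝ) * T ^ 2 * p ^ (3 / 2 : ℝ) := by positivity
    linarith
  have hcut : ∀ τ, 0 ≤ τ → lpOmega P p (fun ω => ⨆ K : ℕ,
      ctcsNorm ρ s T (duhamel (timeCut τ (cubic V ρ W (dyad K) ω)))) ≤
      ENNReal.ofReal (C * q₀ ^ (3 / 2 : ℝ) * (1 + D) * T ^ 2 * p ^ (3 / 2 : ℝ)) := by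
    intro τ hτ
    have h1 := HasMajorant.tsum hr1 fun i : (Fin 3 → ℤˣ) × (Fin 3 → ℕ) => (hblk i.1 i.2).2 τ hτ
    have h2 := h1.mono hr0 (hW.ctcsNorm_cubic_le hV.periodic hi hA s T hτ) htotal
    exact h2.lpOmega_le hp0 hr
  have hcutBlock : ∀ ε k τ, 0 ≤ τ → lpOmega P p (fun ω => ⨆ K : ℕ,
      ctcsNorm ρ s T (duhamel (timeCut τ (cubicBlock V ρ P W ε k (dyad K) ω)))) ≤
      ENNReal.ofReal (C * q₀ ^ (3 / 2 : ℝ) * (1 + D) * T ^ 2 * p ^ (3 / 2 : ℝ) *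
        maxScale k ^ (-η')) := fun ε k τ hτ =>
    (((hblk ε k).2 τ hτ).mono hr0 (fun _ => le_rfl) (hbound k)).lpOmega_le hp0 hr
  refine ⟨?_, fun K ω => ?_, ?_, fun τ hτ => ⟨fun K ω => ?_, hcut τ hτ⟩, fun ε k =>
    ⟨?_, fun K ω => ?_, ?_, fun τ hτ => ⟨fun K ω => ?_, hcutBlock ε k τ hτ⟩⟩⟩
  · have h1 := HasMajorant.tsum hr1 fun i : (Fin 3 → ℤˣ) × (Fin 3 → ℕ) => (hblk i.1 i.2).1
    have h2 := h1.mono hr0 (hW.xsbRestrict_cubic_le hV.periodic hi hA s bp hT0) htotal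
    exact h2.lpOmega_le hp0 hr
  · rw [hW.cubic_eq_sum_block hV.periodic hi hA]
    exact memCtCs_duhamel_oscSum _ _ _ _ hρ s T hT0
  -- The statement without time cutoff is the case τ = T.
  · have h1 := hcut T hT0
    simp only [← ctcsNorm_duhamel_eq] at h1
    exact h1
  · rw [hW.cubic_eq_sum_block hV.periodic hi hA]
    exact memCtCs_duhamel_timeCut_oscSum _ _ _ _ hρ s T hτ
  · exact ((hblk ε k).1.mono hr0 (xsbRestrict_cubicBlock_le hA s bp hT0 ε k)
      (hbound k)).lpOmega_le hp0 hr
  · rw [cubicBlock_eq_oscSum hA]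
    exact memCtCs_duhamel_oscSum _ _ _ _ hρ s T hT0
  · have h1 := hcutBlock ε k T hT0
    simp only [← ctcsNorm_duhamel_eq] at h1
    exact h1
  · rw [cubicBlock_eq_oscSum hA]
    exact memCtCs_duhamel_timeCut_oscSum _ _ _ _ hρ s T hτ
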